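/- **Theorem 6 (Linear convergence of Informed RRT\*).** Let $n\ge 2$. Consider a holonomic minimum-path-length planning problem in $\mathbb R^n$: a state space $X\subseteq\mathbb R^n$, obstacle states $X_{\rm obs}\subseteq X$, free space $X_{\rm free}=\overline{X\setminus X_{\rm obs}}$, a start $x_s$ and a goal $x_g\neq x_s$ in $X_{\rm free}$; the optimal cost $c_{\rm opt}$ is the infimum of the lengths of the rectifiable paths in $X_{\rm free}$ from $x_s$ to $x_g$. Run Informed RRT\* with maximum edge length $\eta\in(0,\infty]$ and rewiring radius $\min\{\eta,r\}$, where $r\in[0,\infty]$ is any measurable function of the current cost and of the numbers of vertices in the tree and in the informed set, starting from a finite tree of collision-free straight edges of length at most $\eta$ that is rooted at $x_s$ and contains $x_g$. Let $c_i$ be the solution cost after $i$ iterations; the sample of the next iteration is, given the past, uniformly distributed on the $L^2$ informed set $\{x\in X_{\rm free}:\|x-x_s\|_2+\|x_g-x\|_2<c_i\}$. The expected convergence rate is the limit of the expected error ratios given the current tree, $$E[r]=\lim_{i\to\infty}\frac{\mathbb E[c_{i+1}\mid \text{tree after } i \text{ iterations}]-c_{\rm opt}}{c_i-c_{\rm opt}},$$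 read as an upper limit where the limit does not exist. 1. Almost surely, if $c_i>c_{\rm opt}$ for all $i$, then $$\frac{n-1}{n+1}\le E[r]\le 1 .$$ 2. The lower bound is attained exactly with an infinite rewiring neighbourhood ($\eta=r=\infty$) in the absence of obstacles and constraints ($X_{\rm obs}=\emptyset$, and $X$ convex with $x_s,x_g$ in its interior, for instance $X=\mathbb R^n$): if the initial solution is not optimal, then almost surely $c_i>c_{\rm opt}$ for all $i$, $c_i\to c_{\rm opt}$, the limit above exists, and $E[r]=\frac{n-1}{n+1}$. Since $0<\frac{n-1}{n+1}<1$, convergence is then linear. -/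

import Mathlib

open MeasureTheory Filter Topology
open scoped ENNReal

noncomputable section

namespace InformedRRT

/-- The ambient space `ℝⁿ` with the Euclidean norm. -/
abbrev Space (n : ℕ) := EuclideanSpace ℝ (Fin n)

/-- A holonomic single-goal planning problem in `ℝⁿ`: a state space, the states in collision with
obstacles, and two distinct permissible states, the start and the goal.  The cost of a path is its
length. -/
structure Problem (n : ℕ) where
  stateSpace : Set (Space n)
  obstacles : Set (Space n)
  obstacles_subset : obstacles ⊆ stateSpace
  start : Space n
  goal : Space n
  start_mem : start ∈ closure (stateSpace \ obstacles)
  goal_mem : goal ∈ closure (stateSpace \ obstacles)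
  start_ne_goal : start ≠ goal

namespace Problem

variable {n : ℕ} (P : Problem n)

/-- The permissible states. -/
def free : Set (Space n) := closure (P.stateSpace \ P.obstacles)

/-- The straight connection between two states is collision-free. -/
def IsFree (a b : Space n) : Prop := segment ℝ a b ⊆ P.free

/-- `ℓ` is the length of a (rectifiable) collision-free path from the start to the goal. -/
def IsPathLength (ℓ : ℝ) : Prop :=
  ∃ γ : ℝ → Space n, ContinuousOn γ (Set.Icc 0 1) ∧ Set.MapsTo γ (Set.Icc 0 1) P.free ∧
    γ 0 = P.start ∧ γ 1 = P.goal ∧ eVariationOn γ (Set.Icc 0 1) ≠ ⊤ ∧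
    ℓ = (eVariationOn γ (Set.Icc 0 1)).toReal

/-- The optimal cost of the planning problem. -/
def optCost : ℝ := sInf {ℓ : ℝ | P.IsPathLength ℓ}

/-- The heuristic cost of a solution constrained to pass through `x`: the length of the
polygonal path from the start through `x` to the goal. -/
def heuristic (x : Space n) : ℝ := ‖x - P.start‖ + ‖P.goal - x‖

/-- The prolate hyperspheroid with the start and the goal as foci and transverse diameter `c`. -/
def hyperspheroid (c : ℝ) : Set (Space n) := {x | P.heuristic x < c}

/-- The `L²` informed set of a current solution cost `c`. -/
def informedSet (c : ℝ) : Set (Space n) := P.free ∩ P.hyperspheroid c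

/-- The uniform distribution on the `L²` informed set. -/
def sampleLaw (c : ℝ) : Measure (Space n) :=
  ProbabilityTheory.cond volume (P.informedSet c)

end Problem

/-- The tuning of the algorithm: the maximum edge length `η` (possibly infinite) and the radius of
the rewiring neighbourhood before it is capped by `η`.  This radius (possibly infinite) may depend
on the number of vertices, the number of vertices in the informed set and the current cost. -/
structure Config where
  η : ℝ≥0∞
  η_pos : 0 < η
  radius : ℕ → ℕ → ℝ → ℝ≥0∞
  radius_measurable : ∀ k l, Measurable (radius k l)

/-- An infinite rewiring neighbourhood. -/
def Config.IsInfinite (cfg : Config) : Prop :=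
  cfg.η = ⊤ ∧ ∀ k l c, cfg.radius k l c = ⊤

/-- A search tree.  Vertices carry natural-number labels below `next`, the root has label `0`, and
the edges are the pairs `(par v, v)` for the vertices `v ≠ 0`. -/
structure Tree (n : ℕ) where
  verts : Finset ℕ
  pos : ℕ → Space n
  par : ℕ → ℕ
  next : ℕ

namespace Tree

variable {n : ℕ} (T : Tree n)

/-- Cost-to-come of a vertex: the length of its tree path from the root.  (With `par 0 = 0`, the
terms beyond the root vanish, and a tree path has fewer than `next` edges.) -/
def costToCome (v : ℕ) : ℝ :=
  ∑ k ∈ Finset.range T.next, ‖T.pos (T.par^[k] v) - T.pos (T.par^[k + 1] v)‖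

/-- The current solution cost: the least cost-to-come of a vertex at the goal. -/
def cost (P : Problem n) : ℝ :=
  sInf (T.costToCome '' {v | v ∈ T.verts ∧ T.pos v = P.goal})

/-- `T` is a finite tree of collision-free edges of length at most `η`, rooted at the start, that
contains a solution. -/
structure Valid (P : Problem n) (cfg : Config) : Prop where
  lt_next : ∀ v ∈ T.verts, v < T.next
  root_mem : 0 ∈ T.verts
  root_pos : T.pos 0 = P.start
  root_par : T.par 0 = 0
  par_mem : ∀ v ∈ T.verts, T.par v ∈ T.verts
  reaches_root : ∀ v ∈ T.verts, ∃ k, T.par^[k] v = 0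
  pos_inj : Set.InjOn T.pos (T.verts : Set ℕ)
  pos_free : ∀ v ∈ T.verts, T.pos v ∈ P.free
  edge_free : ∀ v ∈ T.verts, P.IsFree (T.pos (T.par v)) (T.pos v)
  edge_le : ∀ v ∈ T.verts, edist (T.pos (T.par v)) (T.pos v) ≤ cfg.η
  has_solution : ∃ v ∈ T.verts, T.pos v = P.goal

/-- The vertex nearest to `x` (the least label in case of a tie). -/
def nearest (x : Space n) : ℕ :=
  sInf {v | v ∈ T.verts ∧ ∀ w ∈ T.verts, ‖x - T.pos v‖ ≤ ‖x - T.pos w‖}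

open Classical in
/-- The vertices in the rewiring neighbourhood of `y`. -/
def near (P : Problem n) (cfg : Config) (y : Space n) : Finset ℕ :=
  T.verts.filter fun v =>
    edist (T.pos v) y ≤ min cfg.η (cfg.radius T.verts.card
      (T.verts.filter fun w => T.pos w ∈ P.informedSet (T.cost P)).card (T.cost P))

open Classical in
/-- The parent chosen for the new state `y`, given the nearest vertex `v₀`: a vertex of least
resulting cost-to-come among `v₀` and the neighbours with a collision-free connection to `y`. -/
def bestParent (P : Problem n) (cfg : Config) (v₀ : ℕ) (y : Space n) : ℕ :=
  let candidates := insert v₀ ((T.near P cfg y).filter fun v => P.IsFree (T.pos v) y)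
  sInf {v | v ∈ candidates ∧ ∀ w ∈ candidates,
    T.costToCome v + ‖y - T.pos v‖ ≤ T.costToCome w + ‖y - T.pos w‖}

open Classical in
/-- Add the new state `y` to the tree, with its best parent, and make it the parent of every
neighbour whose cost-to-come this improves through a collision-free connection. -/
def extend (P : Problem n) (cfg : Config) (v₀ : ℕ) (y : Space n) : Tree n :=
  let vmin := T.bestParent P cfg v₀ y
  let gnew := T.costToCome vmin + ‖y - T.pos vmin‖
  let rewired := (T.near P cfg y).filter fun w =>
    gnew + ‖T.pos w - y‖ < T.costToCome w ∧ P.IsFree y (T.pos w)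
  { verts := insert T.next T.verts
    pos := Function.update T.pos T.next y
    par := fun w => if w = T.next then vmin else if w ∈ rewired then T.next else T.par w
    next := T.next + 1 }

open Classical in
/-- Remove all leaves whose heuristic cost exceeds `c`. -/
def pruneLeaves (P : Problem n) (c : ℝ) : Tree n :=
  { T with
    verts := T.verts.filter fun v =>
      ¬ (c < P.heuristic (T.pos v) ∧ ∀ w ∈ T.verts, w ≠ 0 → T.par w ≠ v) }

/-- Remove leaves whose heuristic cost exceeds `c` until there is none.  (Every round that changes
the tree removes a vertex, so that as many rounds as there are vertices suffice.) -/
def prune (P : Problem n) (c : ℝ) : Tree n :=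
  (fun T' : Tree n => T'.pruneLeaves P c)^[T.verts.card] T

end Tree

/-- The point closest to `x` in the closed ball of radius `η` around `v`. -/
def steer {n : ℕ} (η : ℝ≥0∞) (v x : Space n) : Space n :=
  open Classical in
  if edist v x ≤ η then x else v + (η.toReal / ‖x - v‖) • (x - v)

open Classical in
/-- One iteration of Informed RRT*, for the random sample `x`. -/
def step {n : ℕ} (P : Problem n) (cfg : Config) (T : Tree n) (x : Space n) : Tree n :=
  let v₀ := T.nearest x
  let y := steer cfg.η (T.pos v₀) x
  if P.IsFree (T.pos v₀) y then (T.extend P cfg v₀ y).prune P (T.cost P) else T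

/-- The tree after `i` iterations from `T₀` with the samples `x 0, x 1, …`. -/
def treeAt {n : ℕ} (P : Problem n) (cfg : Config) (T₀ : Tree n) (x : ℕ → Space n) : ℕ → Tree n
  | 0 => T₀
  | i + 1 => step P cfg (treeAt P cfg T₀ x i) (x i)

/-- The solution cost after `i` iterations. -/
def costAt {n : ℕ} (P : Problem n) (cfg : Config) (T₀ : Tree n) (x : ℕ → Space n) (i : ℕ) : ℝ :=
  (treeAt P cfg T₀ x i).cost P

/-- The information given by the samples `x 0, …, x (i - 1)`. -/
@[reducible] def past {Ω : Type*} {n : ℕ} (x : ℕ → Ω → Space n) (i : ℕ) : MeasurableSpace Ω :=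
  ⨆ j : {j : ℕ // j < i}, MeasurableSpace.comap (x j) inferInstance

/-- The random samples `x` drive a run of Informed RRT* from the tree `T₀`: given the past, each
sample is uniformly distributed on the `L²` informed set of the current solution cost. -/
structure IsRun {n : ℕ} (P : Problem n) (cfg : Config) (T₀ : Tree n)
    {Ω : Type*} [MeasurableSpace Ω] (μ : Measure Ω) (x : ℕ → Ω → Space n) : Prop where
  measurable : ∀ i, Measurable (x i)
  law : ∀ i, ∀ B : Set (Space n), MeasurableSet B →
    μ[(x i ⁻¹' B).indicator (fun _ => (1 : ℝ)) | past x i] =ᵐ[μ]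
      fun ω => (P.sampleLaw (costAt P cfg T₀ (fun j => x j ω) i) B).toReal

/-- The expected ratio of the next error to the current error, given the current tree: the
expectation is over the next sample. -/
def expectedRatio {n : ℕ} (P : Problem n) (cfg : Config) (T : Tree n) : ℝ :=
  ∫ y, ((step P cfg T y).cost P - P.optCost) / (T.cost P - P.optCost) ∂(P.sampleLaw (T.cost P))

/-- The sequence of expected error ratios of a run. -/
def ratioAt {n : ℕ} (P : Problem n) (cfg : Config) (T₀ : Tree n) (x : ℕ → Space n) (i : ℕ) : ℝ :=
  expectedRatio P cfg (treeAt P cfg T₀ x i)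

/-- The expected convergence rate of a run: the limit of the expected error ratios where it exists,
and their upper limit in general. -/
def expectedRate {n : ℕ} (P : Problem n) (cfg : Config) (T₀ : Tree n) (x : ℕ → Space n) : ℝ :=
  limsup (ratioAt P cfg T₀ x) atTop

/-- The rates that are called linear. -/
def IsLinearRate (r : ℝ) : Prop := 0 < r ∧ r < 1

/-- No obstacles and no constraints: the obstacle set is empty, and the state space is a convex
set with the start and the goal in its interior (for instance the whole of `ℝⁿ`). -/
def Problem.IsUnobstructed {n : ℕ} (P : Problem n) : Prop :=
  P.obstacles = ∅ ∧ Convex ℝ P.stateSpace ∧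
    P.start ∈ interior P.stateSpace ∧ P.goal ∈ interior P.stateSpace

end InformedRRT

end

/-! The cost never increases, so every error ratio lies in [0, 1]. This gives the upper bound.

Let d be the distance from start to goal and h the heuristic cost. Without obstacles and with
infinite neighbourhoods, a sample y of the informed set is joined directly to the start and to the
goal, and the next cost is exactly h(y) (`Tree.Inv.cost_step_eq`). The hyperspheroid of diameter c
has volume proportional to c (c² - d²)^((n-1)/2). As c tends to d, the normalized value (h(y) -
d)/(c - d) of a uniform y therefore acquires the distribution function t^((n-1)/2), whose mean is
(n-1)/(n+1) (`Problem.tendsto_integral_heuristic`). The costs do tend to d, since any fixed level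
above d is beaten with a probability bounded below at every step.

For the lower bound, let ρ < (n-1)/(n+1). It suffices that almost surely the ratios are not all at
most ρ from some time on (`IsRun.ae_not_ratioAt_le`). If they were, the error would decay
exponentially (`IsRun.ae_excess_le`). Three cases exclude this.

(a) The optimal cost is d. Near the optimum steering is inactive, and an improvement cannot beat
h(y). Hence the volume W of the informed set shrinks in one step by a factor that dominates a
uniform variable. Moreover the error e is at least a constant times W^p with p = 2/(n-1). If e were
a multiple of W^p, the mean ratio would be at least 1/(1+p) = (n-1)/(n+1) at once. With obstacles e
is only a monotone function of W. However, W falls too slowly for e to contract by ρ on average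
unless e, as a function of W, drops faster than the power p over long ranges
(`ShrinkingProcess.measure_lt_τ_eq_zero`). Then the potential e^(1/(4p)) W^(-1/4) contracts on
average, although it is bounded below (`ShrinkingProcess.measure_iInter_eq_zero`).

(b) The optimal cost exceeds d and its informed set is null. Almost surely no new edge then has an
endpoint of heuristic cost below the optimum. A new solution has to pass two old vertices outside
the optimal hyperspheroid, which costs a fixed amount more than the optimum
(`IsRun.ae_exists_lt_costAt`).

(c) The informed set of the optimal cost has positive volume. An improvement places the new state in
a band, as wide as the error, between two ellipsoids with tree vertices as foci. There are
polynomially many bands, the vertices are polynomially separated, and the error is exponentially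
small, so that improvements become rare and some ratio exceeds ρ
(`IsRun.ae_not_ratioAt_le_of_volume_ne_zero`). -/

namespace InformedRRT

/-! ### Search trees: extension, pruning and the effect of one iteration on the cost -/

variable {n : ℕ}

/-- The combinatorial part of being a search tree. -/
structure Tree.IsTree (T : Tree n) : Prop where
  lt_next : ∀ v ∈ T.verts, v < T.next
  root_mem : 0 ∈ T.verts
  root_par : T.par 0 = 0
  par_mem : ∀ v ∈ T.verts, T.par v ∈ T.verts
  reaches_root : ∀ v ∈ T.verts, ∃ k, T.par^[k] v = 0

/-- The part of `Tree.Valid` that every iteration preserves, whatever the sample. -/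
structure Tree.Inv (P : Problem n) (cfg : Config) (T : Tree n) : Prop extends T.IsTree where
  root_pos : T.pos 0 = P.start
  edge_free : ∀ v ∈ T.verts, P.IsFree (T.pos (T.par v)) (T.pos v)
  edge_le : ∀ v ∈ T.verts, edist (T.pos (T.par v)) (T.pos v) ≤ cfg.η
  has_solution : ∃ v ∈ T.verts, T.pos v = P.goal

theorem Tree.Valid.inv {P : Problem n} {cfg : Config} {T : Tree n} (h : T.Valid P cfg) :
    T.Inv P cfg :=
  { lt_next := h.lt_next, root_mem := h.root_mem, root_par := h.root_par, par_mem := h.par_mem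
    reaches_root := h.reaches_root, root_pos := h.root_pos, edge_free := h.edge_free
    edge_le := h.edge_le, has_solution := h.has_solution }

namespace Tree.IsTree

variable {T : Tree n} (hT : T.IsTree)
include hT

theorem iterate_mem {v : ℕ} (hv : v ∈ T.verts) (k : ℕ) : T.par^[k] v ∈ T.verts := by
  induction k with
  | zero => simpa
  | succ k ih => rw [Function.iterate_succ_apply']; exact hT.par_mem _ ih

theorem iterate_root (k : ℕ) : T.par^[k] 0 = 0 :=
  Function.iterate_fixed hT.root_par k

theorem iterate_of_le {v k m : ℕ} (h : T.par^[k] v = 0) (hkm : k ≤ m) : T.par^[m] v = 0 := by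
  obtain ⟨j, rfl⟩ := Nat.exists_eq_add_of_le hkm
  rw [add_comm, Function.iterate_add_apply, h, hT.iterate_root]

/-- Pigeonhole: up to the first visit of the root, the vertices of a tree path are distinct, and
their labels lie below `next`. Hence the sum defining `costToCome` covers the whole path. -/
theorem iterate_next {v : ℕ} (hv : v ∈ T.verts) : T.par^[T.next] v = 0 := by
  classical
  have hex := hT.reaches_root v hv
  refine hT.iterate_of_le (Nat.find_spec hex) ?_
  by_contra hlt
  push Not at hlt
  -- A repetition at times i < j would bring the first visit of the root forward by j - i.
  have hinj : Set.InjOn (fun j => T.par^[j] v) (Finset.range (T.next + 1) : Set ℕ) := by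
    have key : ∀ i j, i < j → j ≤ T.next → T.par^[i] v = T.par^[j] v → False := by
      intro i j hij hj he
      have : T.par^[Nat.find hex - (j - i)] v = 0 := by
        have h1 : Nat.find hex - (j - i) = (Nat.find hex - j) + i := by omega
        have h2 : Nat.find hex = (Nat.find hex - j) + j := by omega
        rw [h1, Function.iterate_add_apply, he, ← Function.iterate_add_apply, ← h2]
        exact Nat.find_spec hex
      exact Nat.find_min hex (by omega) this
    intro i hi j hj he
    simp only [Finset.coe_range, Set.mem_Iio] at hi hj
    rcases lt_trichotomy i j with h | h | h
    · exact (key i j h (by omega) he).elim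
    · exact h
    · exact (key j i h (by omega) he.symm).elim
  have := Finset.card_le_card_of_injOn (t := Finset.range T.next) _
    (fun j _ => Finset.mem_coe.2 (Finset.mem_range.2 (hT.lt_next _ (hT.iterate_mem hv j)))) hinj
  simp at this

theorem induct {motive : ℕ → Prop} (root : motive 0)
    (step : ∀ v ∈ T.verts, motive (T.par v) → motive v) : ∀ v ∈ T.verts, motive v := by
  have : ∀ k, ∀ v ∈ T.verts, T.par^[k] v = 0 → motive v := by
    intro k
    induction k with
    | zero => intro v _ h; simp at h; exact h ▸ root
    | succ k ih =>
      intro v hv h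
      exact step v hv (ih _ (hT.par_mem v hv) (by simpa using h))
  intro v hv
  obtain ⟨k, hk⟩ := hT.reaches_root v hv
  exact this k v hv hk

theorem costToCome_root : T.costToCome 0 = 0 := by
  unfold Tree.costToCome
  refine Finset.sum_eq_zero fun k _ => ?_
  rw [hT.iterate_root, hT.iterate_root, sub_self, norm_zero]

theorem costToCome_par {v : ℕ} (hv : v ∈ T.verts) :
    T.costToCome v = ‖T.pos v - T.pos (T.par v)‖ + T.costToCome (T.par v) := by
  unfold Tree.costToCome
  have h1 := Finset.sum_range_succ' (fun k => ‖T.pos (T.par^[k] v) - T.pos (T.par^[k + 1] v)‖) T.next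
  have h2 := Finset.sum_range_succ (fun k => ‖T.pos (T.par^[k] v) - T.pos (T.par^[k + 1] v)‖) T.next
  have h3 : T.par^[T.next + 1] v = 0 := hT.iterate_of_le (hT.iterate_next hv) (Nat.le_succ _)
  rw [hT.iterate_next hv, h3, sub_self, norm_zero, add_zero] at h2
  rw [← h2, h1, add_comm]
  simp [Function.iterate_succ_apply]

end Tree.IsTree

namespace Tree

variable {T : Tree n}

theorem costToCome_nonneg (T : Tree n) (v : ℕ) : 0 ≤ T.costToCome v :=
  Finset.sum_nonneg fun _ _ => norm_nonneg _

theorem IsTree.norm_sub_le (hT : T.IsTree) : ∀ v ∈ T.verts,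
    ‖T.pos v - T.pos 0‖ ≤ T.costToCome v := by
  refine hT.induct (by simp [hT.costToCome_root]) fun v hv ih => ?_
  rw [hT.costToCome_par hv]
  calc ‖T.pos v - T.pos 0‖ ≤ ‖T.pos v - T.pos (T.par v)‖ + ‖T.pos (T.par v) - T.pos 0‖ := by
        simpa using norm_add_le (T.pos v - T.pos (T.par v)) (T.pos (T.par v) - T.pos 0)
    _ ≤ _ := by gcongr

section Cost

variable {P : Problem n}

theorem exists_cost_eq (h : ∃ v ∈ T.verts, T.pos v = P.goal) :
    ∃ v ∈ T.verts, T.pos v = P.goal ∧ T.costToCome v = T.cost P := by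
  classical
  have hfin : (T.costToCome '' {v | v ∈ T.verts ∧ T.pos v = P.goal}).Finite :=
    (T.verts.finite_toSet.subset fun v hv => hv.1).image _
  have hne : (T.costToCome '' {v | v ∈ T.verts ∧ T.pos v = P.goal}).Nonempty := by
    obtain ⟨v, hv, hg⟩ := h
    exact ⟨_, v, ⟨hv, hg⟩, rfl⟩
  obtain ⟨v, hv, he⟩ := hne.csInf_mem hfin
  exact ⟨v, hv.1, hv.2, he⟩

theorem cost_le {v : ℕ} (hv : v ∈ T.verts) (hg : T.pos v = P.goal) :
    T.cost P ≤ T.costToCome v :=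
  csInf_le ⟨0, by rintro _ ⟨w, _, rfl⟩; exact T.costToCome_nonneg w⟩ ⟨v, ⟨hv, hg⟩, rfl⟩

end Cost

section Nearest

theorem nearest_spec (h : T.verts.Nonempty) (x : Space n) :
    T.nearest x ∈ T.verts ∧ ∀ w ∈ T.verts, ‖x - T.pos (T.nearest x)‖ ≤ ‖x - T.pos w‖ := by
  obtain ⟨v, hv, hm⟩ := T.verts.exists_min_image (fun v => ‖x - T.pos v‖) h
  exact Nat.sInf_mem (s := {v | v ∈ T.verts ∧ ∀ w ∈ T.verts, ‖x - T.pos v‖ ≤ ‖x - T.pos w‖})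
    ⟨v, hv, hm⟩

open Classical in
theorem bestParent_spec (P : Problem n) (cfg : Config) (v₀ : ℕ) (y : Space n) :
    T.bestParent P cfg v₀ y ∈ insert v₀ ((T.near P cfg y).filter fun v => P.IsFree (T.pos v) y) ∧
    ∀ w ∈ insert v₀ ((T.near P cfg y).filter fun v => P.IsFree (T.pos v) y),
      T.costToCome (T.bestParent P cfg v₀ y) + ‖y - T.pos (T.bestParent P cfg v₀ y)‖ ≤
        T.costToCome w + ‖y - T.pos w‖ := by
  obtain ⟨v, hv, hm⟩ := (insert v₀ ((T.near P cfg y).filter fun v => P.IsFree (T.pos v) y)).exists_min_image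
    (fun v => T.costToCome v + ‖y - T.pos v‖) (Finset.insert_nonempty _ _)
  exact Nat.sInf_mem (s := {v | v ∈ insert v₀ ((T.near P cfg y).filter fun v => P.IsFree (T.pos v) y) ∧
    ∀ w ∈ insert v₀ ((T.near P cfg y).filter fun v => P.IsFree (T.pos v) y),
    T.costToCome v + ‖y - T.pos v‖ ≤ T.costToCome w + ‖y - T.pos w‖}) ⟨v, hv, hm⟩

theorem near_subset (P : Problem n) (cfg : Config) (y : Space n) : T.near P cfg y ⊆ T.verts :=
  Finset.filter_subset _ _

theorem edist_le_of_mem_near {P : Problem n} {cfg : Config} {y : Space n} {v : ℕ}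
    (h : v ∈ T.near P cfg y) : edist (T.pos v) y ≤ cfg.η :=
  ((Finset.mem_filter.1 h).2).trans (min_le_left _ _)

end Nearest

section Extend

variable {P : Problem n} {cfg : Config} {v₀ : ℕ} {y : Space n}

/-- The cost-to-come of the new state in `Tree.extend`. -/
noncomputable def newCost (T : Tree n) (P : Problem n) (cfg : Config) (v₀ : ℕ) (y : Space n) : ℝ :=
  T.costToCome (T.bestParent P cfg v₀ y) + ‖y - T.pos (T.bestParent P cfg v₀ y)‖

open Classical in
/-- The rewired vertices in `Tree.extend`. -/
noncomputable def rewired (T : Tree n) (P : Problem n) (cfg : Config) (v₀ : ℕ) (y : Space n) :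
    Finset ℕ :=
  (T.near P cfg y).filter fun w =>
    T.newCost P cfg v₀ y + ‖T.pos w - y‖ < T.costToCome w ∧ P.IsFree y (T.pos w)

theorem extend_verts : (T.extend P cfg v₀ y).verts = insert T.next T.verts := rfl
theorem extend_pos : (T.extend P cfg v₀ y).pos = Function.update T.pos T.next y := rfl
theorem extend_next : (T.extend P cfg v₀ y).next = T.next + 1 := rfl

open Classical in
theorem extend_par (w : ℕ) : (T.extend P cfg v₀ y).par w =
    if w = T.next then T.bestParent P cfg v₀ y
    else if w ∈ T.rewired P cfg v₀ y then T.next else T.par w := rfl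

theorem mem_rewired {w : ℕ} : w ∈ T.rewired P cfg v₀ y ↔ w ∈ T.near P cfg y ∧
    T.newCost P cfg v₀ y + ‖T.pos w - y‖ < T.costToCome w ∧ P.IsFree y (T.pos w) := by
  simp [rewired]

theorem bestParent_mem (hv₀ : v₀ ∈ T.verts) : T.bestParent P cfg v₀ y ∈ T.verts := by
  classical
  have := (bestParent_spec (T := T) P cfg v₀ y).1
  rcases Finset.mem_insert.1 this with h | h
  · rwa [h]
  · exact near_subset P cfg y (Finset.mem_filter.1 h).1

theorem bestParent_free (h₀ : P.IsFree (T.pos v₀) y) :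
    P.IsFree (T.pos (T.bestParent P cfg v₀ y)) y := by
  classical
  have := (bestParent_spec (T := T) P cfg v₀ y).1
  rcases Finset.mem_insert.1 this with h | h
  · rwa [h]
  · exact (Finset.mem_filter.1 h).2

theorem bestParent_edist (h₀ : edist (T.pos v₀) y ≤ cfg.η) :
    edist (T.pos (T.bestParent P cfg v₀ y)) y ≤ cfg.η := by
  classical
  have := (bestParent_spec (T := T) P cfg v₀ y).1
  rcases Finset.mem_insert.1 this with h | h
  · rwa [h]
  · exact edist_le_of_mem_near (Finset.mem_filter.1 h).1

variable (hT : T.IsTree) (hv₀ : v₀ ∈ T.verts)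
include hT

theorem IsTree.extend_pos_old {v : ℕ} (hv : v ∈ T.verts) :
    (T.extend P cfg v₀ y).pos v = T.pos v := by
  rw [extend_pos, Function.update_of_ne (hT.lt_next v hv).ne]

omit hT in
theorem extend_pos_new : (T.extend P cfg v₀ y).pos T.next = y := by
  rw [extend_pos, Function.update_self]

theorem IsTree.extend_par_old {v : ℕ} (hv : v ∈ T.verts) (hr : v ∉ T.rewired P cfg v₀ y) :
    (T.extend P cfg v₀ y).par v = T.par v := by
  classical
  rw [extend_par, if_neg (hT.lt_next v hv).ne, if_neg hr]

theorem IsTree.extend_par_rewired {v : ℕ} (hr : v ∈ T.rewired P cfg v₀ y) :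
    (T.extend P cfg v₀ y).par v = T.next := by
  classical
  rw [extend_par, if_neg, if_pos hr]
  exact (hT.lt_next v (near_subset _ _ _ (mem_rewired.1 hr).1)).ne

omit hT in
theorem not_rewired_of_le {v : ℕ} (h : T.costToCome v ≤ T.newCost P cfg v₀ y) :
    v ∉ T.rewired P cfg v₀ y := fun hr => by
  have := (mem_rewired.1 hr).2.1
  linarith [norm_nonneg (T.pos v - y)]

/-- Costs increase along tree paths and only vertices dearer than the new state are rewired. The
path of a cheap vertex, in particular that of the best parent, therefore stays intact, and no cycle
through the new state arises. -/
theorem IsTree.extend_reaches_of_le : ∀ v ∈ T.verts, T.costToCome v ≤ T.newCost P cfg v₀ y →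
    ∃ k, (T.extend P cfg v₀ y).par^[k] v = 0 := by
  refine hT.induct (fun _ => ⟨0, rfl⟩) fun v hv ih hle => ?_
  have h1 := hT.costToCome_par hv
  obtain ⟨k, hk⟩ := ih (by linarith [norm_nonneg (T.pos v - T.pos (T.par v))])
  exact ⟨k + 1, by
    rw [Function.iterate_succ_apply, hT.extend_par_old hv (not_rewired_of_le hle), hk]⟩

omit hT in
theorem bestParent_cost_le : T.costToCome (T.bestParent P cfg v₀ y) ≤ T.newCost P cfg v₀ y := by
  unfold newCost
  linarith [norm_nonneg (y - T.pos (T.bestParent P cfg v₀ y))]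

theorem root_not_rewired : 0 ∉ T.rewired P cfg v₀ y := by
  refine not_rewired_of_le ?_
  rw [hT.costToCome_root]
  exact add_nonneg (T.costToCome_nonneg _) (norm_nonneg _)

include hv₀

theorem IsTree.extend : (T.extend P cfg v₀ y).IsTree := by
  classical
  have hmin := bestParent_mem (P := P) (cfg := cfg) (y := y) hv₀
  have hnew : ∃ k, (T.extend P cfg v₀ y).par^[k] T.next = 0 := by
    obtain ⟨k, hk⟩ := hT.extend_reaches_of_le (P := P) (cfg := cfg) (v₀ := v₀) (y := y) _ hmin
      (bestParent_cost_le)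
    exact ⟨k + 1, by rw [Function.iterate_succ_apply, extend_par, if_pos rfl, hk]⟩
  refine ⟨?_, ?_, ?_, ?_, ?_⟩
  · intro v hv
    rw [extend_next]
    rcases Finset.mem_insert.1 hv with h | h
    · omega
    · exact (hT.lt_next v h).trans (Nat.lt_succ_self _)
  · exact Finset.mem_insert_of_mem hT.root_mem
  · rw [hT.extend_par_old hT.root_mem (root_not_rewired hT), hT.root_par]
  · intro v hv
    rw [extend_par, extend_verts]
    split_ifs with h1 h2
    · exact Finset.mem_insert_of_mem hmin
    · exact Finset.mem_insert_self _ _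
    · exact Finset.mem_insert_of_mem (hT.par_mem _ ((Finset.mem_insert.1 hv).resolve_left h1))
  · intro v hv
    rcases Finset.mem_insert.1 hv with h | h
    · rw [h]; exact hnew
    · revert v
      suffices ∀ v ∈ T.verts, ∃ k, (T.extend P cfg v₀ y).par^[k] v = 0 from fun v _ h => this v h
      refine hT.induct ⟨0, rfl⟩ fun v hv ⟨k, hk⟩ => ?_
      by_cases hr : v ∈ T.rewired P cfg v₀ y
      · obtain ⟨j, hj⟩ := hnew
        exact ⟨j + 1, by rw [Function.iterate_succ_apply, hT.extend_par_rewired hr, hj]⟩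
      · exact ⟨k + 1, by rw [Function.iterate_succ_apply, hT.extend_par_old hv hr, hk]⟩

theorem IsTree.extend_cost_of_le : ∀ v ∈ T.verts, T.costToCome v ≤ T.newCost P cfg v₀ y →
    (T.extend P cfg v₀ y).costToCome v = T.costToCome v := by
  have hE := hT.extend (P := P) (cfg := cfg) (y := y) hv₀
  refine hT.induct (fun _ => by rw [hE.costToCome_root, hT.costToCome_root]) fun v hv ih hle => ?_
  have h1 := hT.costToCome_par hv
  rw [hE.costToCome_par (Finset.mem_insert_of_mem hv),
    hT.extend_par_old hv (not_rewired_of_le hle), hT.extend_pos_old hv,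
    hT.extend_pos_old (hT.par_mem v hv),
    ih (by linarith [norm_nonneg (T.pos v - T.pos (T.par v))]), h1]

theorem IsTree.extend_cost_new : (T.extend P cfg v₀ y).costToCome T.next = T.newCost P cfg v₀ y := by
  classical
  have hE := hT.extend (P := P) (cfg := cfg) (y := y) hv₀
  have hmin := bestParent_mem (P := P) (cfg := cfg) (y := y) hv₀
  rw [hE.costToCome_par (Finset.mem_insert_self _ _), extend_par, if_pos rfl,
    hT.extend_cost_of_le hv₀ _ hmin (bestParent_cost_le), extend_pos_new,
    hT.extend_pos_old hmin, newCost, add_comm]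

theorem IsTree.extend_cost_rewired {w : ℕ} (hr : w ∈ T.rewired P cfg v₀ y) :
    (T.extend P cfg v₀ y).costToCome w = T.newCost P cfg v₀ y + ‖T.pos w - y‖ := by
  have hE := hT.extend (P := P) (cfg := cfg) (y := y) hv₀
  have hw : w ∈ T.verts := near_subset _ _ _ (mem_rewired.1 hr).1
  rw [hE.costToCome_par (Finset.mem_insert_of_mem hw), hT.extend_par_rewired hr,
    hT.extend_cost_new hv₀, hT.extend_pos_old hw, extend_pos_new, add_comm]

/-- Either the path of an old vertex is unchanged, or it now runs through the new state and a
rewired vertex `w`. -/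
theorem IsTree.extend_cost_cases : ∀ v ∈ T.verts,
    (T.extend P cfg v₀ y).costToCome v = T.costToCome v ∨
    ∃ w ∈ T.rewired P cfg v₀ y,
      (T.extend P cfg v₀ y).costToCome v =
        T.costToCome v - T.costToCome w + ‖T.pos w - y‖ + T.newCost P cfg v₀ y ∧
      ‖T.pos v - T.pos w‖ ≤ T.costToCome v - T.costToCome w := by
  have hE := hT.extend (P := P) (cfg := cfg) (y := y) hv₀
  refine hT.induct (Or.inl (by rw [hE.costToCome_root, hT.costToCome_root])) fun v hv ih => ?_
  by_cases hr : v ∈ T.rewired P cfg v₀ y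
  · right
    exact ⟨v, hr, by rw [hT.extend_cost_rewired hv₀ hr]; ring, by simp⟩
  have hpar := hE.costToCome_par (Finset.mem_insert_of_mem hv)
  rw [hT.extend_par_old hv hr, hT.extend_pos_old hv, hT.extend_pos_old (hT.par_mem v hv)] at hpar
  have hpar' := hT.costToCome_par hv
  rcases ih with h | ⟨w, hw, h1, h2⟩
  · left; rw [hpar, hpar', h]
  · right
    refine ⟨w, hw, by rw [hpar, hpar', h1]; ring, ?_⟩
    have := norm_add_le (T.pos v - T.pos (T.par v)) (T.pos (T.par v) - T.pos w)
    rw [sub_add_sub_cancel] at this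
    linarith

theorem IsTree.extend_cost_le : ∀ v ∈ T.verts,
    (T.extend P cfg v₀ y).costToCome v ≤ T.costToCome v := by
  intro v hv
  rcases hT.extend_cost_cases (P := P) (cfg := cfg) (y := y) hv₀ v hv with h | ⟨w, hw, h, _⟩
  · exact h.le
  · have := (mem_rewired.1 hw).2.1
    linarith

omit hT hv₀ in
theorem Inv.extend (hT : T.Inv P cfg) (hv₀ : v₀ ∈ T.verts) (h₀ : P.IsFree (T.pos v₀) y)
    (hd : edist (T.pos v₀) y ≤ cfg.η) : (T.extend P cfg v₀ y).Inv P cfg := by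
  classical
  have hE := hT.toIsTree.extend (P := P) (cfg := cfg) (y := y) hv₀
  have hmin := bestParent_mem (P := P) (cfg := cfg) (y := y) hv₀
  have hcases : ∀ v ∈ (T.extend P cfg v₀ y).verts,
      ((T.extend P cfg v₀ y).pos ((T.extend P cfg v₀ y).par v) =
          T.pos (T.bestParent P cfg v₀ y) ∧ (T.extend P cfg v₀ y).pos v = y) ∨
      (v ∈ T.rewired P cfg v₀ y ∧ (T.extend P cfg v₀ y).pos ((T.extend P cfg v₀ y).par v) = y ∧
        (T.extend P cfg v₀ y).pos v = T.pos v) ∨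
      (v ∈ T.verts ∧ (T.extend P cfg v₀ y).pos ((T.extend P cfg v₀ y).par v) = T.pos (T.par v) ∧
        (T.extend P cfg v₀ y).pos v = T.pos v) := by
    intro v hv
    rcases Finset.mem_insert.1 hv with h | h
    · left
      rw [h, extend_pos_new, extend_par, if_pos rfl, hT.extend_pos_old hmin]
      exact ⟨rfl, rfl⟩
    · right
      by_cases hr : v ∈ T.rewired P cfg v₀ y
      · left
        exact ⟨hr, by rw [hT.extend_par_rewired hr, extend_pos_new],
          hT.extend_pos_old h⟩
      · right
        exact ⟨h, by rw [hT.extend_par_old h hr, hT.extend_pos_old (hT.par_mem v h)],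
          hT.extend_pos_old h⟩
  refine { hE with root_pos := ?_, edge_free := ?_, edge_le := ?_, has_solution := ?_ }
  · rw [hT.extend_pos_old hT.root_mem, hT.root_pos]
  · intro v hv
    rcases hcases v hv with ⟨h1, h2⟩ | ⟨h, h1, h2⟩ | ⟨h, h1, h2⟩ <;> rw [h1, h2]
    · exact bestParent_free h₀
    · exact (mem_rewired.1 h).2.2
    · exact hT.edge_free v h
  · intro v hv
    rcases hcases v hv with ⟨h1, h2⟩ | ⟨h, h1, h2⟩ | ⟨h, h1, h2⟩ <;> rw [h1, h2]
    · exact bestParent_edist hd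
    · rw [edist_comm]; exact edist_le_of_mem_near (mem_rewired.1 h).1
    · exact hT.edge_le v h
  · obtain ⟨v, hv, hg⟩ := hT.has_solution
    exact ⟨v, Finset.mem_insert_of_mem hv, by rw [hT.extend_pos_old hv, hg]⟩

end Extend

section Prune

variable {P : Problem n} {cfg : Config} {c : ℝ}

theorem mem_pruneLeaves {v : ℕ} : v ∈ (T.pruneLeaves P c).verts ↔ v ∈ T.verts ∧
    ¬ (c < P.heuristic (T.pos v) ∧ ∀ w ∈ T.verts, w ≠ 0 → T.par w ≠ v) := by
  classical
  simp [pruneLeaves]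

/-- What pruning does to a tree. -/
structure IsPruned (P : Problem n) (c : ℝ) (T T' : Tree n) : Prop where
  pos_eq : T'.pos = T.pos
  par_eq : T'.par = T.par
  next_eq : T'.next = T.next
  subset : T'.verts ⊆ T.verts
  keep : ∀ v ∈ T.verts, P.heuristic (T.pos v) ≤ c → v ∈ T'.verts
  -- A parent is not a leaf, hence is kept. The root is its own parent, and the leaf test ignores
  -- this loop, so its small heuristic cost is needed to keep it.
  par_mem : (∀ v ∈ T.verts, T.par v ∈ T.verts) → 0 ∈ T.verts → T.par 0 = 0 →
    P.heuristic (T.pos 0) ≤ c → ∀ v ∈ T'.verts, T.par v ∈ T'.verts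

theorem isPruned_pruneLeaves (T : Tree n) : IsPruned P c T (T.pruneLeaves P c) where
  pos_eq := rfl
  par_eq := rfl
  next_eq := rfl
  subset := fun v hv => (mem_pruneLeaves.1 hv).1
  keep := fun v hv h => mem_pruneLeaves.2 ⟨hv, fun h' => h'.1.not_ge h⟩
  par_mem := by
    intro hp h0 hr hc v hv
    have hv' := (mem_pruneLeaves.1 hv).1
    by_cases h : v = 0
    · rw [h, hr]; exact mem_pruneLeaves.2 ⟨h0, fun h' => h'.1.not_ge hc⟩
    · exact mem_pruneLeaves.2 ⟨hp v hv', fun h' => h'.2 v hv' h rfl⟩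

theorem IsPruned.trans {T T' T'' : Tree n} (h : IsPruned P c T T') (h' : IsPruned P c T' T'') :
    IsPruned P c T T'' where
  pos_eq := h'.pos_eq.trans h.pos_eq
  par_eq := h'.par_eq.trans h.par_eq
  next_eq := h'.next_eq.trans h.next_eq
  subset := h'.subset.trans h.subset
  keep := fun v hv hc => h'.keep v (h.keep v hv hc) (by rwa [h.pos_eq])
  par_mem := by
    intro hp h0 hr hc
    have := h'.par_mem (by rw [h.par_eq]; exact h.par_mem hp h0 hr hc) (h.keep 0 h0 hc)
      (by rw [h.par_eq, hr]) (by rwa [h.pos_eq])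
    rwa [h.par_eq] at this

theorem isPruned_prune (T : Tree n) : IsPruned P c T (T.prune P c) := by
  unfold prune
  have : ∀ k, IsPruned P c T ((fun T' : Tree n => T'.pruneLeaves P c)^[k] T) := by
    intro k
    induction k with
    | zero =>
      exact ⟨rfl, rfl, rfl, subset_rfl, fun v hv _ => hv, fun hp _ _ _ => hp⟩
    | succ k ih =>
      rw [Function.iterate_succ_apply']
      exact ih.trans (isPruned_pruneLeaves _)
  exact this _

theorem IsPruned.costToCome {T' : Tree n} (h : IsPruned P c T T') : T'.costToCome = T.costToCome := by
  funext v
  simp [Tree.costToCome, h.pos_eq, h.par_eq, h.next_eq]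

theorem _root_.InformedRRT.Problem.heuristic_goal (P : Problem n) :
    P.heuristic P.goal = ‖P.goal - P.start‖ := by simp [Problem.heuristic]

theorem _root_.InformedRRT.Problem.heuristic_start (P : Problem n) :
    P.heuristic P.start = ‖P.goal - P.start‖ := by simp [Problem.heuristic]

theorem IsPruned.inv {T' : Tree n} (h : IsPruned P c T T') (hT : T.Inv P cfg)
    (hc : ‖P.goal - P.start‖ ≤ c) : T'.Inv P cfg where
  lt_next v hv := by rw [h.next_eq]; exact hT.lt_next v (h.subset hv)
  root_mem := h.keep 0 hT.root_mem (by rw [hT.root_pos, P.heuristic_start]; exact hc)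
  root_par := by rw [h.par_eq, hT.root_par]
  par_mem := by
    rw [h.par_eq]
    exact h.par_mem hT.par_mem hT.root_mem hT.root_par
      (by rw [hT.root_pos, P.heuristic_start]; exact hc)
  reaches_root v hv := by rw [h.par_eq]; exact hT.reaches_root v (h.subset hv)
  root_pos := by rw [h.pos_eq, hT.root_pos]
  edge_free v hv := by rw [h.pos_eq, h.par_eq]; exact hT.edge_free v (h.subset hv)
  edge_le v hv := by rw [h.pos_eq, h.par_eq]; exact hT.edge_le v (h.subset hv)
  has_solution := by
    obtain ⟨v, hv, hg⟩ := hT.has_solution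
    exact ⟨v, h.keep v hv (by rw [hg, P.heuristic_goal]; exact hc), by rw [h.pos_eq, hg]⟩

theorem IsPruned.cost {T' : Tree n} (h : IsPruned P c T T') (hc : ‖P.goal - P.start‖ ≤ c) :
    T'.cost P = T.cost P := by
  unfold Tree.cost
  rw [h.costToCome, h.pos_eq]
  congr 2
  ext v
  constructor
  · exact fun hv => ⟨h.subset hv.1, hv.2⟩
  · exact fun hv => ⟨h.keep v hv.1 (by rw [hv.2, P.heuristic_goal]; exact hc), hv.2⟩

end Prune

section InvCost

variable {P : Problem n} {cfg : Config}

theorem Inv.norm_start_le (hT : T.Inv P cfg) {v : ℕ} (hv : v ∈ T.verts) :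
    ‖T.pos v - P.start‖ ≤ T.costToCome v := by
  rw [← hT.root_pos]; exact hT.norm_sub_le v hv

theorem Inv.dist_le_cost (hT : T.Inv P cfg) : ‖P.goal - P.start‖ ≤ T.cost P := by
  obtain ⟨v, hv, hg, hc⟩ := exists_cost_eq (P := P) hT.has_solution
  rw [← hc, ← hg]; exact hT.norm_start_le hv

end InvCost

end Tree

theorem edist_steer_le (η : ℝ≥0∞) (v x : Space n) : edist v (steer η v x) ≤ η := by
  unfold steer
  split_ifs with h
  · exact h
  · push Not at h
    have hη : η ≠ ⊤ := (h.trans_le le_top).ne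
    have hx : ‖x - v‖ ≠ 0 := by
      intro h0
      rw [norm_eq_zero, sub_eq_zero] at h0
      rw [h0, edist_self] at h
      exact absurd h (by simp)
    rw [edist_dist, dist_eq_norm, sub_add_cancel_left, norm_neg, norm_smul, norm_div, norm_norm,
      div_mul_cancel₀ _ hx, Real.norm_of_nonneg ENNReal.toReal_nonneg, ENNReal.ofReal_toReal hη]

section Step

variable {P : Problem n} {cfg : Config} {T : Tree n}

theorem Tree.Inv.nearest_mem (hT : T.Inv P cfg) (x : Space n) : T.nearest x ∈ T.verts :=
  (Tree.nearest_spec ⟨0, hT.root_mem⟩ x).1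

theorem Tree.Inv.step (hT : T.Inv P cfg) (x : Space n) : (step P cfg T x).Inv P cfg := by
  classical
  unfold InformedRRT.step
  simp only
  split_ifs with h
  · exact (Tree.isPruned_prune _).inv
      (hT.extend (hT.nearest_mem x) h (edist_steer_le _ _ _)) hT.dist_le_cost
  · exact hT

/-- The new state of an iteration. -/
noncomputable def newState (cfg : Config) (T : Tree n) (x : Space n) : Space n :=
  steer cfg.η (T.pos (T.nearest x)) x

theorem cost_step_of_not_free {x : Space n}
    (h : ¬ P.IsFree (T.pos (T.nearest x)) (newState cfg T x)) : step P cfg T x = T := by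
  classical
  exact if_neg h

/-- Pruning leaves the cost unchanged: the goal has heuristic cost d, which is at most the current
cost, so no vertex at the goal is removed. -/
theorem Tree.Inv.cost_step (hT : T.Inv P cfg) {x : Space n}
    (h : P.IsFree (T.pos (T.nearest x)) (newState cfg T x)) :
    (InformedRRT.step P cfg T x).cost P =
      (T.extend P cfg (T.nearest x) (newState cfg T x)).cost P := by
  classical
  have : InformedRRT.step P cfg T x =
    (T.extend P cfg (T.nearest x) (newState cfg T x)).prune P (T.cost P) := if_pos h
  rw [this]
  exact (Tree.isPruned_prune _).cost hT.dist_le_cost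

theorem Tree.Inv.cost_step_le (hT : T.Inv P cfg) (x : Space n) :
    (InformedRRT.step P cfg T x).cost P ≤ T.cost P := by
  by_cases h : P.IsFree (T.pos (T.nearest x)) (newState cfg T x)
  · rw [hT.cost_step h]
    obtain ⟨v, hv, hg, hc⟩ := Tree.exists_cost_eq (P := P) hT.has_solution
    rw [← hc]
    exact (Tree.cost_le (Finset.mem_insert_of_mem hv)
      (by rw [hT.extend_pos_old hv, hg])).trans (hT.extend_cost_le (hT.nearest_mem x) v hv)
  · rw [cost_step_of_not_free h]

/-- The ways in which an iteration can improve the solution. -/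
theorem Tree.Inv.cost_step_lt (hT : T.Inv P cfg) {x : Space n}
    (hlt : (InformedRRT.step P cfg T x).cost P < T.cost P) :
    P.IsFree (T.pos (T.nearest x)) (newState cfg T x) ∧
    ∃ v ∈ T.verts, P.IsFree (T.pos v) (newState cfg T x) ∧
      ((newState cfg T x = P.goal ∧ (InformedRRT.step P cfg T x).cost P =
        T.costToCome v + ‖newState cfg T x - T.pos v‖) ∨
      ∃ γ ∈ T.verts, ∃ w ∈ T.verts, v ≠ w ∧ P.IsFree (newState cfg T x) (T.pos w) ∧
        ‖P.goal - T.pos w‖ ≤ T.costToCome γ - T.costToCome w ∧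
        (InformedRRT.step P cfg T x).cost P = T.costToCome γ - T.costToCome w + T.costToCome v +
          (‖newState cfg T x - T.pos v‖ + ‖newState cfg T x - T.pos w‖)) := by
  by_cases h : P.IsFree (T.pos (T.nearest x)) (newState cfg T x)
  swap
  · rw [cost_step_of_not_free h] at hlt; exact absurd hlt (lt_irrefl _)
  have hx := hT.nearest_mem x
  refine ⟨h, T.bestParent P cfg (T.nearest x) (newState cfg T x), Tree.bestParent_mem hx,
    Tree.bestParent_free h, ?_⟩
  rw [hT.cost_step h] at hlt ⊢
  have hE := hT.extend hx h (edist_steer_le _ _ _)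
  obtain ⟨γ, hγ, hg, hc⟩ := Tree.exists_cost_eq (P := P) hE.has_solution
  rcases Finset.mem_insert.1 hγ with rfl | hγ
  · left
    rw [Tree.extend_pos_new] at hg
    rw [← hc, hT.extend_cost_new hx]
    exact ⟨hg, rfl⟩
  · right
    rw [hT.extend_pos_old hγ] at hg
    have hle := Tree.cost_le hγ hg
    rcases hT.extend_cost_cases hx γ hγ with h1 | ⟨w, hw, h1, h2⟩
    · rw [← hc, h1] at hlt; exact absurd hle (not_le.2 hlt)
    · have hwm : w ∈ T.verts := Tree.near_subset _ _ _ (Tree.mem_rewired.1 hw).1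
      refine ⟨γ, hγ, w, hwm, ?_, (Tree.mem_rewired.1 hw).2.2, by rwa [← hg], ?_⟩
      -- The best parent is cheaper than the new state, hence is not rewired.
      · rintro rfl
        exact Tree.not_rewired_of_le (Tree.bestParent_cost_le) hw
      · rw [← hc, h1, Tree.newCost, norm_sub_rev (newState cfg T x) (T.pos w)]; ring

/-- An improved solution passes through the new state, and the triangle inequality bounds its two
parts by the distances to start and goal. Both the rate without obstacles and the lower bound use
this. -/
theorem Tree.Inv.heuristic_le_cost_step (hT : T.Inv P cfg) {x : Space n}
    (hlt : (InformedRRT.step P cfg T x).cost P < T.cost P) :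
    P.heuristic (newState cfg T x) ≤ (InformedRRT.step P cfg T x).cost P := by
  obtain ⟨_, v, hv, _, h | ⟨γ, hγ, w, hw, _, _, h1, h2⟩⟩ := hT.cost_step_lt hlt
  · have h1 := norm_add_le (newState cfg T x - T.pos v) (T.pos v - P.start)
    rw [sub_add_sub_cancel] at h1
    have h2 := hT.norm_start_le hv
    rw [h.2, Problem.heuristic, h.1, sub_self, norm_zero]
    rw [h.1] at h1
    linarith
  · have h3 := norm_add_le (newState cfg T x - T.pos v) (T.pos v - P.start)
    rw [sub_add_sub_cancel] at h3
    have h4 := hT.norm_start_le hv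
    have h5 := norm_add_le (P.goal - T.pos w) (T.pos w - newState cfg T x)
    rw [sub_add_sub_cancel, norm_sub_rev (T.pos w)] at h5
    rw [h2, Problem.heuristic]
    linarith

end Step

section Run

variable {P : Problem n} {cfg : Config} {T₀ : Tree n}

theorem inv_treeAt (hT : T₀.Inv P cfg) (x : ℕ → Space n) (i : ℕ) :
    (treeAt P cfg T₀ x i).Inv P cfg := by
  induction i with
  | zero => exact hT
  | succ i ih => exact ih.step _

theorem antitone_costAt (hT : T₀.Inv P cfg) (x : ℕ → Space n) : Antitone (costAt P cfg T₀ x) :=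
  antitone_nat_of_succ_le fun i => (inv_treeAt hT x i).cost_step_le (x i)

end Run

end InformedRRT

/-! ### Collision-free paths and the optimal cost -/

namespace InformedRRT

variable {n : ℕ}

namespace Problem

variable (P : Problem n)

/-- There is a collision-free path from `a` to `b` of length at most `L`. -/
def HasPath (a b : Space n) (L : ℝ) : Prop :=
  ∃ γ : ℝ → Space n, ContinuousOn γ (Set.Icc 0 1) ∧ Set.MapsTo γ (Set.Icc 0 1) P.free ∧
    γ 0 = a ∧ γ 1 = b ∧ eVariationOn γ (Set.Icc 0 1) ≤ ENNReal.ofReal L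

variable {P}

theorem IsFree.hasPath {a b : Space n} (h : P.IsFree a b) : P.HasPath a b ‖b - a‖ := by
  refine ⟨AffineMap.lineMap a b, AffineMap.lineMap_continuous.continuousOn, ?_, by simp, by simp, ?_⟩
  · intro t ht
    exact h (by rw [segment_eq_image_lineMap]; exact ⟨t, ht, rfl⟩)
  · have hL : LipschitzOnWith (nndist a b) (AffineMap.lineMap a b : ℝ → Space n) Set.univ :=
      (lipschitzWith_lineMap a b).lipschitzOnWith
    have h1 := hL.comp_eVariationOn_le (g := (id : ℝ → ℝ)) (s := Set.Icc (0 : ℝ) 1)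
      (fun _ _ => Set.mem_univ _)
    have h2 := ((monotone_id.monotoneOn (Set.Icc (0 : ℝ) 1)).eVariationOn_eq
      (a := 0) (b := 1) (by simp) (by simp)).le
    simp only [Set.inter_self, id_eq, sub_zero, ENNReal.ofReal_one] at h2
    refine (h1.trans (mul_le_of_le_one_right' h2)).trans ?_
    rw [← dist_eq_norm, dist_comm, ← ENNReal.ofReal_coe_nnreal, coe_nndist]

theorem HasPath.trans {a b c : Space n} {L M : ℝ} (hL : 0 ≤ L) (hM : 0 ≤ M)
    (h : P.HasPath a b L) (h' : P.HasPath b c M) : P.HasPath a c (L + M) := by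
  obtain ⟨γ, hγ, hγm, hγ0, hγ1, hγL⟩ := h
  obtain ⟨δ, hδ, hδm, hδ0, hδ1, hδL⟩ := h'
  -- A single formula for the concatenation: on either half one of the two summands is constantly b
  -- and cancels, so continuity needs no gluing.
  let φ : ℝ → Space n := fun t => γ (min (2 * t) 1) + δ (max (2 * t - 1) 0) - b
  have m1 : ∀ t ∈ Set.Icc (0 : ℝ) 1, min (2 * t) 1 ∈ Set.Icc (0 : ℝ) 1 := fun t ht =>
    ⟨le_min (by linarith [ht.1]) zero_le_one, min_le_right _ _⟩
  have m2 : ∀ t ∈ Set.Icc (0 : ℝ) 1, max (2 * t - 1) 0 ∈ Set.Icc (0 : ℝ) 1 := fun t ht =>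
    ⟨le_max_right _ _, max_le (by linarith [ht.2]) zero_le_one⟩
  have e1 : Set.EqOn φ (γ ∘ fun t => min (2 * t) 1) (Set.Icc 0 (1 / 2)) := by
    intro t ht
    have : max (2 * t - 1) 0 = 0 := max_eq_right (by linarith [ht.2])
    simp [φ, this, hδ0]
  have e2 : Set.EqOn φ (δ ∘ fun t => max (2 * t - 1) 0) (Set.Icc (1 / 2) 1) := by
    intro t ht
    have : min (2 * t) 1 = 1 := min_eq_right (by linarith [ht.1])
    simp [φ, this, hγ1]
  refine ⟨φ, ?_, ?_, ?_, ?_, ?_⟩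
  · exact ((hγ.comp (by fun_prop) m1).add (hδ.comp (by fun_prop) m2)).sub continuousOn_const
  · intro t ht
    rcases le_total t (1 / 2) with h | h
    · rw [e1 ⟨ht.1, h⟩]; exact hγm (m1 t ht)
    · rw [e2 ⟨h, ht.2⟩]; exact hδm (m2 t ht)
  · rw [e1 ⟨le_rfl, by norm_num⟩]; simp [hγ0]
  · rw [e2 ⟨by norm_num, le_rfl⟩]; norm_num [hδ1]
  · have hadd := eVariationOn.Icc_add_Icc φ (s := Set.univ) (a := (0 : ℝ)) (b := 1 / 2) (c := 1)
      (by norm_num) (by norm_num) (Set.mem_univ _)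
    simp only [Set.univ_inter] at hadd
    rw [← hadd, eVariationOn.congr e1, eVariationOn.congr e2, ENNReal.ofReal_add hL hM]
    refine add_le_add (le_trans (eVariationOn.comp_le_of_monotoneOn γ _ ?_ ?_) hγL)
      (le_trans (eVariationOn.comp_le_of_monotoneOn δ _ ?_ ?_) hδL)
    · intro s _ t _ hst
      exact min_le_min (by linarith) le_rfl
    · exact fun t ht => m1 t ⟨ht.1, by linarith [ht.2]⟩
    · intro s _ t _ hst
      exact max_le_max (by linarith) le_rfl
    · exact fun t ht => m2 t ⟨by linarith [ht.1], ht.2⟩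

theorem bddBelow_isPathLength : BddBelow {ℓ : ℝ | P.IsPathLength ℓ} :=
  ⟨0, by rintro ℓ ⟨γ, _, _, _, _, _, rfl⟩; exact ENNReal.toReal_nonneg⟩

theorem HasPath.exists_isPathLength {L : ℝ} (hL : 0 ≤ L) (h : P.HasPath P.start P.goal L) :
    ∃ ℓ, P.IsPathLength ℓ ∧ ℓ ≤ L := by
  obtain ⟨γ, h1, h2, h3, h4, h5⟩ := h
  exact ⟨_, ⟨γ, h1, h2, h3, h4, (h5.trans_lt ENNReal.ofReal_lt_top).ne, rfl⟩,
    ENNReal.toReal_le_of_le_ofReal hL h5⟩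

theorem HasPath.optCost_le {L : ℝ} (hL : 0 ≤ L) (h : P.HasPath P.start P.goal L) :
    P.optCost ≤ L := by
  obtain ⟨ℓ, h1, h2⟩ := h.exists_isPathLength hL
  exact (csInf_le bddBelow_isPathLength h1).trans h2

theorem IsPathLength.dist_le {ℓ : ℝ} (h : P.IsPathLength ℓ) : ‖P.goal - P.start‖ ≤ ℓ := by
  obtain ⟨γ, _, _, h0, h1, ht, rfl⟩ := h
  have := eVariationOn.edist_le γ (s := Set.Icc (0 : ℝ) 1) (x := 1) (y := 0) (by simp) (by simp)
  rw [h0, h1, edist_dist, dist_eq_norm] at this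
  exact (ENNReal.ofReal_le_iff_le_toReal ht).1 this

end Problem

namespace Tree.Inv

variable {P : Problem n} {cfg : Config} {T : Tree n} (hT : T.Inv P cfg)
include hT

theorem hasPath (hs : P.start ∈ P.free) : ∀ v ∈ T.verts,
    P.HasPath P.start (T.pos v) (T.costToCome v) := by
  refine hT.induct ?_ fun v hv ih => ?_
  · rw [hT.root_pos, hT.costToCome_root]
    have : P.IsFree P.start P.start := by simpa [Problem.IsFree] using hs
    simpa using this.hasPath
  · rw [hT.costToCome_par hv, add_comm]
    exact ih.trans (T.costToCome_nonneg _) (norm_nonneg _) (hT.edge_free v hv).hasPath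

theorem optCost_le_cost : P.optCost ≤ T.cost P := by
  obtain ⟨v, hv, hg, hc⟩ := exists_cost_eq (P := P) hT.has_solution
  rw [← hc]
  have := hT.hasPath P.start_mem v hv
  rw [hg] at this
  exact this.optCost_le (T.costToCome_nonneg _)

/-- The tree supplies a path. Without one, the infimum would have the default value 0 and the bound
would fail. -/
theorem dist_le_optCost : ‖P.goal - P.start‖ ≤ P.optCost := by
  obtain ⟨v, hv, hg, _⟩ := exists_cost_eq (P := P) hT.has_solution
  have := hT.hasPath P.start_mem v hv
  rw [hg] at this
  obtain ⟨ℓ, h1, _⟩ := this.exists_isPathLength (T.costToCome_nonneg _)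
  exact le_csInf ⟨ℓ, h1⟩ fun ℓ h => Problem.IsPathLength.dist_le h

end Tree.Inv

end InformedRRT

/-! ### Measurability of the iteration in the tree and the sample -/

namespace InformedRRT

variable {n : ℕ} {α : Type*} [MeasurableSpace α]

section Auxiliary

theorem measurable_nat_index {β : Type*} [MeasurableSpace β] {N : α → ℕ} (hN : Measurable N)
    {g : ℕ → α → β} (hg : ∀ k, Measurable (g k)) : Measurable fun a => g (N a) a := by
  intro s hs
  have : (fun a => g (N a) a) ⁻¹' s = ⋃ k, N ⁻¹' {k} ∩ g k ⁻¹' s := by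
    ext a; simp
  rw [this]
  exact MeasurableSet.iUnion fun k => (hN (measurableSet_singleton k)).inter (hg k hs)

theorem measurableSet_nat_index {N : α → ℕ} (hN : Measurable N)
    {p : ℕ → α → Prop} (hp : ∀ k, MeasurableSet {a | p k a}) : MeasurableSet {a | p (N a) a} := by
  have : {a | p (N a) a} = ⋃ k, N ⁻¹' {k} ∩ {a | p k a} := by
    ext a; simp
  rw [this]
  exact MeasurableSet.iUnion fun k => (hN (measurableSet_singleton k)).inter (hp k)

theorem measurable_sInf_nat {p : ℕ → α → Prop} (hp : ∀ k, MeasurableSet {a | p k a}) :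
    Measurable fun a => sInf {k | p k a} := by
  refine measurable_of_Iic fun m => ?_
  have : (fun a => sInf {k | p k a}) ⁻¹' Set.Iic m =
      -- The second set accounts for the convention that the infimum of the empty set is 0.
      (⋃ k ∈ Finset.range (m + 1), {a | p k a}) ∪ ⋂ k, {a | p k a}ᶜ := by
    ext a
    simp only [Set.mem_preimage, Set.mem_Iic, Set.mem_union, Set.mem_iUnion, Set.mem_ofPred_eq,
      Set.mem_iInter, Set.mem_compl_iff, Finset.mem_range, exists_prop]
    constructor
    · intro h
      by_cases hne : {k | p k a}.Nonempty
      · exact Or.inl ⟨_, by omega, Nat.sInf_mem hne⟩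
      · exact Or.inr fun k hk => hne ⟨k, hk⟩
    · rintro (⟨k, hk, hp⟩ | h)
      · exact (Nat.sInf_le hp).trans (by omega)
      · rw [show {k | p k a} = ∅ from Set.eq_empty_of_forall_notMem h, Nat.sInf_empty]
        exact Nat.zero_le _
  rw [this]
  exact (Finset.measurableSet_biUnion _ fun k _ => hp k).union
    (MeasurableSet.iInter fun k => (hp k).compl)

theorem measurable_card {F : α → Finset ℕ} (hF : ∀ k, MeasurableSet {a | k ∈ F a}) :
    Measurable fun a => (F a).card := by
  refine measurable_to_countable' fun m => ?_
  have : (fun a => (F a).card) ⁻¹' {m} =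
      ⋃ s ∈ {s : Finset ℕ | s.card = m}, ⋂ k, {a | k ∈ F a ↔ k ∈ s} := by
    ext a
    simp only [Set.mem_preimage, Set.mem_singleton_iff, Set.mem_iUnion, Set.mem_ofPred_eq,
      Set.mem_iInter, exists_prop]
    constructor
    · intro h; exact ⟨F a, h, fun k => Iff.rfl⟩
    · rintro ⟨s, hs, h⟩; rw [Finset.ext h, hs]
  rw [this]
  refine MeasurableSet.biUnion (Set.to_countable _) fun s _ => MeasurableSet.iInter fun k => ?_
  by_cases hk : k ∈ s
  · simpa [hk] using hF k
  · simp only [hk, iff_false]; exact (hF k).compl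

theorem measurableSet_forall_nat {p : ℕ → α → Prop} (hp : ∀ k, MeasurableSet {a | p k a}) :
    MeasurableSet {a | ∀ k, p k a} := by
  rw [Set.ofPred_forall]; exact MeasurableSet.iInter hp

theorem measurableSet_exists_nat {p : ℕ → α → Prop} (hp : ∀ k, MeasurableSet {a | p k a}) :
    MeasurableSet {a | ∃ k, p k a} := by
  rw [Set.ofPred_exists]; exact MeasurableSet.iUnion hp

theorem measurableSet_imp {p q : α → Prop} (hp : MeasurableSet {a | p a})
    (hq : MeasurableSet {a | q a}) : MeasurableSet {a | p a → q a} := by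
  have : {a | p a → q a} = {a | p a}ᶜ ∪ {a | q a} := by
    ext a; simp [imp_iff_not_or]
  rw [this]; exact hp.compl.union hq

end Auxiliary

section Geometry

theorem Problem.isClosed_free (P : Problem n) : IsClosed P.free := isClosed_closure

theorem Problem.isClosed_isFree (P : Problem n) :
    IsClosed {p : Space n × Space n | P.IsFree p.1 p.2} := by
  -- Freeness of a segment is a closed condition for each of its points, and an arbitrary
  -- intersection of closed sets is closed.
  have : {p : Space n × Space n | P.IsFree p.1 p.2} =
      ⋂ t ∈ Set.Icc (0 : ℝ) 1, {p | AffineMap.lineMap p.1 p.2 t ∈ P.free} := by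
    ext p
    simp only [Problem.IsFree, segment_eq_image_lineMap, Set.image_subset_iff, Set.mem_ofPred_eq,
      Set.mem_iInter]
    rfl
  rw [this]
  refine isClosed_biInter fun t _ => P.isClosed_free.preimage ?_
  simp only [AffineMap.lineMap_apply_module]
  fun_prop

theorem Problem.measurableSet_isFree (P : Problem n) {f g : α → Space n} (hf : Measurable f)
    (hg : Measurable g) : MeasurableSet {a | P.IsFree (f a) (g a)} :=
  (hf.prodMk hg) P.isClosed_isFree.measurableSet

theorem Problem.continuous_heuristic (P : Problem n) : Continuous P.heuristic := by
  unfold Problem.heuristic; fun_prop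

theorem Problem.measurableSet_informedSet (P : Problem n) (c : ℝ) :
    MeasurableSet (P.informedSet c) :=
  P.isClosed_free.measurableSet.inter
    (isOpen_lt P.continuous_heuristic continuous_const).measurableSet

theorem measurableSet_mem_informedSet (P : Problem n) {f : α → Space n} {c : α → ℝ}
    (hf : Measurable f) (hc : Measurable c) : MeasurableSet {a | f a ∈ P.informedSet (c a)} :=
  (hf P.isClosed_free.measurableSet).inter
    (measurableSet_lt (P.continuous_heuristic.measurable.comp hf) hc)

theorem measurable_steer (η : ℝ≥0∞) {v x : α → Space n} (hv : Measurable v) (hx : Measurable x) :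
    Measurable fun a => steer η (v a) (x a) := by
  unfold steer
  refine Measurable.ite (measurableSet_le (hv.edist hx) measurable_const) hx ?_
  exact hv.add ((measurable_const.div (hx.sub hv).norm).smul (hx.sub hv))

end Geometry

/-- A tree-valued function is measurable. -/
structure MeasTree (f : α → Tree n) : Prop where
  verts : ∀ k, MeasurableSet {a | k ∈ (f a).verts}
  pos : ∀ k, Measurable fun a => (f a).pos k
  par : ∀ k, Measurable fun a => (f a).par k
  next : Measurable fun a => (f a).next

namespace MeasTree

variable {f : α → Tree n} (hf : MeasTree f) {P : Problem n} {cfg : Config}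
include hf

omit hf in
theorem const (T : Tree n) : MeasTree fun _ : α => T :=
  ⟨fun _ => MeasurableSet.const _, fun _ => measurable_const, fun _ => measurable_const,
    measurable_const⟩

theorem comp {β : Type*} [MeasurableSpace β] {g : β → α} (hg : Measurable g) :
    MeasTree fun b => f (g b) :=
  ⟨fun k => hg (hf.verts k), fun k => (hf.pos k).comp hg, fun k => (hf.par k).comp hg,
    hf.next.comp hg⟩

theorem pos_index {N : α → ℕ} (hN : Measurable N) : Measurable fun a => (f a).pos (N a) :=
  measurable_nat_index hN hf.pos

theorem iterate_par (k v : ℕ) : Measurable fun a => (f a).par^[k] v := by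
  induction k with
  | zero => exact measurable_const
  | succ k ih =>
    simp only [Function.iterate_succ_apply']
    exact measurable_nat_index ih hf.par

theorem costToCome (v : ℕ) : Measurable fun a => (f a).costToCome v := by
  unfold Tree.costToCome
  refine measurable_nat_index (g := fun m a => ∑ k ∈ Finset.range m,
    ‖(f a).pos ((f a).par^[k] v) - (f a).pos ((f a).par^[k + 1] v)‖) hf.next fun m => ?_
  refine Finset.measurable_sum _ fun k _ => ?_
  exact ((hf.pos_index (hf.iterate_par k v)).sub (hf.pos_index (hf.iterate_par (k + 1) v))).norm

theorem cost (P : Problem n) : Measurable fun a => (f a).cost P := by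
  have hS : ∀ v, MeasurableSet {a | v ∈ (f a).verts ∧ (f a).pos v = P.goal} := fun v =>
    (hf.verts v).inter (hf.pos v (measurableSet_singleton _))
  refine measurable_of_Iio fun c => ?_
  have : (fun a => (f a).cost P) ⁻¹' Set.Iio c =
      (⋃ v, {a | v ∈ (f a).verts ∧ (f a).pos v = P.goal} ∩ {a | (f a).costToCome v < c}) ∪
      -- A tree without a vertex at the goal has the default cost 0.
      ((⋂ v, {a | v ∈ (f a).verts ∧ (f a).pos v = P.goal}ᶜ) ∩ {_a | 0 < c}) := by
    ext a
    simp only [Set.mem_preimage, Set.mem_Iio, Set.mem_union, Set.mem_iUnion, Set.mem_inter_iff,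
      Set.mem_ofPred_eq, Set.mem_iInter, Set.mem_compl_iff]
    by_cases hne : ∃ v, v ∈ (f a).verts ∧ (f a).pos v = P.goal
    · have hne' : ((f a).costToCome '' {v | v ∈ (f a).verts ∧ (f a).pos v = P.goal}).Nonempty := by
        obtain ⟨v, hv⟩ := hne; exact ⟨_, v, hv, rfl⟩
      rw [Tree.cost, csInf_lt_iff ⟨0, by
        rintro _ ⟨w, _, rfl⟩; exact (f a).costToCome_nonneg w⟩ hne']
      simp only [Set.mem_image, Set.mem_ofPred_eq, exists_exists_and_eq_and]
      constructor
      · exact fun h => Or.inl h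
      · rintro (h | h)
        · exact h
        · obtain ⟨v, hv⟩ := hne; exact absurd hv (h.1 v)
    · have : {v | v ∈ (f a).verts ∧ (f a).pos v = P.goal} = ∅ :=
        Set.eq_empty_of_forall_notMem fun v hv => hne ⟨v, hv⟩
      rw [Tree.cost, this, Set.image_empty, Real.sInf_empty]
      push Not at hne
      constructor
      · exact fun h => Or.inr ⟨fun v hv => hne v hv.1 hv.2, h⟩
      · rintro (⟨v, hv, _⟩ | h)
        · exact absurd hv.2 (hne v hv.1)
        · exact h.2
  rw [this]
  exact (MeasurableSet.iUnion fun v => (hS v).inter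
    (measurableSet_lt (hf.costToCome v) measurable_const)).union
    ((MeasurableSet.iInter fun v => (hS v).compl).inter (MeasurableSet.const _))

variable {x : α → Space n} (hx : Measurable x)
include hx

theorem nearest : Measurable fun a => (f a).nearest (x a) := by
  unfold Tree.nearest
  refine measurable_sInf_nat fun v => (hf.verts v).inter (measurableSet_forall_nat fun w =>
    measurableSet_imp (hf.verts w) ?_)
  exact measurableSet_le (hx.sub (hf.pos v)).norm (hx.sub (hf.pos w)).norm

theorem near (v : ℕ) : MeasurableSet {a | v ∈ (f a).near P cfg (x a)} := by
  classical
  simp only [Tree.near, Finset.mem_filter]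
  refine (hf.verts v).inter (measurableSet_le ((hf.pos v).edist hx)
    (measurable_const.min ?_))
  have h1 : Measurable fun a => (f a).verts.card := measurable_card hf.verts
  have h2 : Measurable fun a =>
      ((f a).verts.filter fun w => (f a).pos w ∈ P.informedSet ((f a).cost P)).card := by
    refine measurable_card fun k => ?_
    simp only [Finset.mem_filter]
    exact (hf.verts k).inter (measurableSet_mem_informedSet P (hf.pos k) (hf.cost P))
  exact measurable_nat_index (g := fun k a => cfg.radius k
    ((f a).verts.filter fun w => (f a).pos w ∈ P.informedSet ((f a).cost P)).card ((f a).cost P)) h1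
    fun k => measurable_nat_index (g := fun l a => cfg.radius k l ((f a).cost P)) h2
      fun l => (cfg.radius_measurable k l).comp (hf.cost P)

theorem bestParent {v₀ : α → ℕ} (hv₀ : Measurable v₀) :
    Measurable fun a => (f a).bestParent P cfg (v₀ a) (x a) := by
  classical
  have hcand : ∀ v, MeasurableSet {a | v ∈ insert (v₀ a)
      (((f a).near P cfg (x a)).filter fun v => P.IsFree ((f a).pos v) (x a))} := by
    intro v
    simp only [Finset.mem_insert, Finset.mem_filter]
    exact (measurableSet_eq_fun measurable_const hv₀).union
      ((hf.near hx v).inter (P.measurableSet_isFree (hf.pos v) hx))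
  unfold Tree.bestParent
  refine measurable_sInf_nat fun v => (hcand v).inter (measurableSet_forall_nat fun w =>
    measurableSet_imp (hcand w) ?_)
  exact measurableSet_le ((hf.costToCome v).add (hx.sub (hf.pos v)).norm)
    ((hf.costToCome w).add (hx.sub (hf.pos w)).norm)

theorem newCost {v₀ : α → ℕ} (hv₀ : Measurable v₀) :
    Measurable fun a => (f a).newCost P cfg (v₀ a) (x a) := by
  have h := hf.bestParent (P := P) (cfg := cfg) hx hv₀
  unfold Tree.newCost
  exact (measurable_nat_index h hf.costToCome).add (hx.sub (hf.pos_index h)).norm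

theorem rewired {v₀ : α → ℕ} (hv₀ : Measurable v₀) (w : ℕ) :
    MeasurableSet {a | w ∈ (f a).rewired P cfg (v₀ a) (x a)} := by
  simp only [Tree.mem_rewired]
  exact (hf.near hx w).inter ((measurableSet_lt ((hf.newCost hx hv₀).add
    ((hf.pos w).sub hx).norm) (hf.costToCome w)).inter (P.measurableSet_isFree hx (hf.pos w)))

theorem extend {v₀ : α → ℕ} (hv₀ : Measurable v₀) :
    MeasTree fun a => (f a).extend P cfg (v₀ a) (x a) := by
  classical
  refine ⟨fun k => ?_, fun k => ?_, fun k => ?_, ?_⟩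
  · simp only [Tree.extend_verts, Finset.mem_insert]
    exact (measurableSet_eq_fun measurable_const hf.next).union (hf.verts k)
  · simp only [Tree.extend_pos, Function.update_apply]
    exact Measurable.ite (measurableSet_eq_fun measurable_const hf.next) hx (hf.pos k)
  · simp only [Tree.extend_par]
    exact Measurable.ite (measurableSet_eq_fun measurable_const hf.next) (hf.bestParent hx hv₀)
      (Measurable.ite (hf.rewired hx hv₀ k) hf.next (hf.par k))
  · exact hf.next.add_const 1

omit hx in
theorem pruneLeaves {c : α → ℝ} (hc : Measurable c) :
    MeasTree fun a => (f a).pruneLeaves P (c a) := by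
  refine ⟨fun k => ?_, hf.pos, hf.par, hf.next⟩
  simp only [Tree.mem_pruneLeaves]
  refine (hf.verts k).inter (MeasurableSet.compl ((measurableSet_lt hc
    (P.continuous_heuristic.measurable.comp (hf.pos k))).inter ?_))
  exact measurableSet_forall_nat fun w => measurableSet_imp (hf.verts w)
    (measurableSet_imp (MeasurableSet.const _)
      (measurableSet_eq_fun (hf.par w) measurable_const).compl)

omit hx in
theorem prune {c : α → ℝ} (hc : Measurable c) : MeasTree fun a => (f a).prune P (c a) := by
  have h : ∀ k, MeasTree fun a => (fun T' : Tree n => T'.pruneLeaves P (c a))^[k] (f a) := by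
    intro k
    induction k with
    | zero => exact hf
    | succ k ih =>
      simp only [Function.iterate_succ_apply']
      exact ih.pruneLeaves hc
  have hN : Measurable fun a => (f a).verts.card := measurable_card hf.verts
  unfold Tree.prune
  exact ⟨fun v => measurableSet_nat_index hN (p := fun k a =>
      v ∈ ((fun T' : Tree n => T'.pruneLeaves P (c a))^[k] (f a)).verts) fun k => (h k).verts v,
    fun v => measurable_nat_index hN (g := fun k a =>
      ((fun T' : Tree n => T'.pruneLeaves P (c a))^[k] (f a)).pos v) fun k => (h k).pos v,
    fun v => measurable_nat_index hN (g := fun k a =>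
      ((fun T' : Tree n => T'.pruneLeaves P (c a))^[k] (f a)).par v) fun k => (h k).par v,
    measurable_nat_index hN (g := fun k a =>
      ((fun T' : Tree n => T'.pruneLeaves P (c a))^[k] (f a)).next) fun k => (h k).next⟩

theorem newState : Measurable fun a => newState cfg (f a) (x a) :=
  measurable_steer _ (hf.pos_index (hf.nearest hx)) hx

omit hf hx in
theorem ite {p : α → Prop} [DecidablePred p] (hp : MeasurableSet {a | p a}) {f g : α → Tree n}
    (hf : MeasTree f) (hg : MeasTree g) : MeasTree fun a => if p a then f a else g a := by
  have hset : ∀ {q r : α → Prop}, MeasurableSet {a | q a} → MeasurableSet {a | r a} →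
      MeasurableSet {a | if p a then q a else r a} := by
    intro q r hq hr
    have : {a | if p a then q a else r a} = ({a | p a} ∩ {a | q a}) ∪ ({a | p a}ᶜ ∩ {a | r a}) := by
      ext a; by_cases h : p a <;> simp [h]
    rw [this]; exact (hp.inter hq).union (hp.compl.inter hr)
  refine ⟨fun k => ?_, fun k => ?_, fun k => ?_, ?_⟩
  · convert hset (hf.verts k) (hg.verts k) using 3 with a
    split_ifs <;> rfl
  · have h : (fun a => (if p a then f a else g a).pos k) =
        fun a => if p a then (f a).pos k else (g a).pos k := by
      funext a; split_ifs <;> rfl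
    rw [h]; exact Measurable.ite hp (hf.pos k) (hg.pos k)
  · have h : (fun a => (if p a then f a else g a).par k) =
        fun a => if p a then (f a).par k else (g a).par k := by
      funext a; split_ifs <;> rfl
    rw [h]; exact Measurable.ite hp (hf.par k) (hg.par k)
  · have h : (fun a => (if p a then f a else g a).next) =
        fun a => if p a then (f a).next else (g a).next := by
      funext a; split_ifs <;> rfl
    rw [h]; exact Measurable.ite hp hf.next hg.next

theorem step : MeasTree fun a => step P cfg (f a) (x a) := by
  classical
  have hy := hf.newState (cfg := cfg) hx
  have hv := hf.nearest hx
  exact MeasTree.ite (P.measurableSet_isFree (hf.pos_index hv) hy)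
    ((hf.extend hy hv).prune (hf.cost P)) hf

end MeasTree

end InformedRRT

/-! ### The sampling law and integration over the next sample -/

namespace InformedRRT

section Freeze

open ProbabilityTheory

/-- Integrating over a random variable with a given conditional law. -/
theorem lintegral_freeze {Ω Ω' E : Type*} [MeasurableSpace Ω] [MeasurableSpace Ω']
    [MeasurableSpace E] {μ : Measure Ω} [IsFiniteMeasure μ] (K : Kernel Ω' E) [IsFiniteKernel K]
    {ι : Ω → Ω'} (hι : Measurable ι) {X : Ω → E} (hX : Measurable X)
    (h : ∀ A, MeasurableSet A → ∀ B, MeasurableSet B →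
      μ (ι ⁻¹' A ∩ X ⁻¹' B) = ∫⁻ ω in ι ⁻¹' A, K (ι ω) B ∂μ)
    {φ : Ω' × E → ℝ≥0∞} (hφ : Measurable φ) :
    ∫⁻ ω, φ (ι ω, X ω) ∂μ = ∫⁻ ω, ∫⁻ y, φ (ι ω, y) ∂(K (ι ω)) ∂μ := by
  have hpair : Measurable fun ω => (ι ω, X ω) := hι.prodMk hX
  -- The hypothesis identifies the joint law with the composition product on rectangles, and these
  -- determine it.
  have key : μ.map (fun ω => (ι ω, X ω)) = (μ.map ι).compProd K := by
    refine Measure.ext_prod fun {A B} hA hB => ?_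
    rw [Measure.map_apply hpair (hA.prod hB), Measure.compProd_apply_prod hA hB,
      setLIntegral_map hA (K.measurable_coe hB) hι, ← h A hA B hB]
    rfl
  rw [← lintegral_map hφ hpair, key, Measure.lintegral_compProd hφ,
    lintegral_map (Measurable.lintegral_kernel_prod_right' hφ) hι]

end Freeze

variable {n : ℕ}

section SampleLaw

variable (P : Problem n)

theorem Problem.hyperspheroid_subset_ball (c : ℝ) : P.hyperspheroid c ⊆ Metric.ball P.start c := by
  intro x hx
  have : ‖x - P.start‖ + ‖P.goal - x‖ < c := hx
  rw [mem_ball_iff_norm]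
  linarith [norm_nonneg (P.goal - x)]

theorem Problem.volume_hyperspheroid_lt_top (c : ℝ) : volume (P.hyperspheroid c) < ⊤ :=
  (measure_mono (P.hyperspheroid_subset_ball c)).trans_lt measure_ball_lt_top

theorem Problem.volume_informedSet_lt_top (c : ℝ) : volume (P.informedSet c) < ⊤ :=
  (measure_mono Set.inter_subset_right).trans_lt (P.volume_hyperspheroid_lt_top c)

theorem Problem.informedSet_mono : Monotone P.informedSet := fun _ _ h _ hx =>
  ⟨hx.1, lt_of_lt_of_le hx.2 h⟩

theorem Problem.sampleLaw_apply (c : ℝ) (B : Set (Space n)) :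
    P.sampleLaw c B = (volume (P.informedSet c))⁻¹ * volume (P.informedSet c ∩ B) :=
  ProbabilityTheory.cond_apply (P.measurableSet_informedSet c) _ _

theorem Problem.sampleLaw_le_one (c : ℝ) : P.sampleLaw c Set.univ ≤ 1 := by
  rw [P.sampleLaw_apply, Set.inter_univ]
  exact ENNReal.inv_mul_le_one _

/-- The uniform distributions on the informed sets, as a kernel. -/
noncomputable def Problem.sampleKernel : ProbabilityTheory.Kernel ℝ (Space n) where
  toFun := P.sampleLaw
  measurable' := by
    refine Measure.measurable_of_measurable_coe _ fun B hB => ?_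
    simp only [P.sampleLaw_apply]
    -- The informed sets increase with the cost, and monotone functions are measurable.
    have h : ∀ B : Set (Space n), Measurable fun c => volume (P.informedSet c ∩ B) := fun B =>
      Monotone.measurable fun a b hab =>
        measure_mono (Set.inter_subset_inter_left _ (P.informedSet_mono hab))
    have h1 := h Set.univ
    simp only [Set.inter_univ] at h1
    exact h1.inv.mul (h B)

instance : ProbabilityTheory.IsFiniteKernel P.sampleKernel :=
  ⟨⟨1, ENNReal.one_lt_top, fun c => P.sampleLaw_le_one c⟩⟩

instance (c : ℝ) : IsFiniteMeasure (P.sampleLaw c) :=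
  ⟨(P.sampleLaw_le_one c).trans_lt ENNReal.one_lt_top⟩

theorem Problem.isProbabilityMeasure_sampleLaw {c : ℝ} (h : volume (P.informedSet c) ≠ 0) :
    IsProbabilityMeasure (P.sampleLaw c) := by
  refine ⟨?_⟩
  rw [P.sampleLaw_apply, Set.inter_univ, ENNReal.inv_mul_cancel h (P.volume_informedSet_lt_top c).ne]

theorem Problem.sampleLaw_informedSet_compl (c : ℝ) : P.sampleLaw c (P.informedSet c)ᶜ = 0 := by
  simp [P.sampleLaw_apply]

theorem Problem.ae_mem_informedSet (c : ℝ) : ∀ᵐ y ∂(P.sampleLaw c), y ∈ P.informedSet c :=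
  mem_ae_iff.2 (P.sampleLaw_informedSet_compl c)

end SampleLaw

/-- A function of a tree and a state that is measurable along measurable families. -/
def MeasTreeFun.{u} {β : Type*} [MeasurableSpace β] (Ψ : Tree n → Space n → β) : Prop :=
  ∀ (α : Type u) [MeasurableSpace α] (f : α → Tree n) (y : α → Space n), MeasTree f →
    Measurable y → Measurable fun a => Ψ (f a) (y a)

universe u

variable {P : Problem n} {cfg : Config} {T₀ : Tree n} {Ω : Type u} {x : ℕ → Ω → Space n}

theorem MeasTree.mono {α : Type*} {m m' : MeasurableSpace α} (h : m ≤ m') {f : α → Tree n}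
    (hf : @MeasTree n α m f) : @MeasTree n α m' f :=
  @MeasTree.mk n α m' f (fun k => h _ (@MeasTree.verts n α m f hf k))
    (fun k => (@MeasTree.pos n α m f hf k).mono h le_rfl)
    (fun k => (@MeasTree.par n α m f hf k).mono h le_rfl)
    ((@MeasTree.next n α m f hf).mono h le_rfl)

theorem past_mono : Monotone (past x) := by
  intro i j hij
  exact iSup_le fun k => le_iSup_of_le (⟨k.1, k.2.trans_le hij⟩ : {k : ℕ // k < j}) le_rfl

theorem measurable_past {i j : ℕ} (h : j < i) : Measurable[past x i] (x j) := by
  have : MeasurableSpace.comap (x j) inferInstance ≤ past x i :=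
    le_iSup_of_le (⟨j, h⟩ : {j : ℕ // j < i}) le_rfl
  exact (comap_measurable (x j)).mono this le_rfl

theorem measTree_treeAt (i : ℕ) : @MeasTree n Ω (past x i)
    (fun ω => treeAt P cfg T₀ (fun j => x j ω) i) := by
  induction i with
  | zero => exact @MeasTree.const n Ω (past x 0) T₀
  | succ i ih =>
    have h : @MeasTree n Ω (past x (i + 1)) (fun ω => treeAt P cfg T₀ (fun j => x j ω) i) :=
      MeasTree.mono (past_mono (Nat.le_succ i)) ih
    exact @MeasTree.step n Ω (past x (i + 1)) _ h P cfg _ (measurable_past (Nat.lt_succ_self i))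

theorem measTree_treeAt_of_le {i j : ℕ} (hij : i ≤ j) : @MeasTree n Ω (past x j)
    (fun ω => treeAt P cfg T₀ (fun j => x j ω) i) :=
  MeasTree.mono (past_mono hij) (measTree_treeAt i)

theorem measurable_costAt {i j : ℕ} (hij : i ≤ j) : Measurable[past x j]
    (fun ω => costAt P cfg T₀ (fun j => x j ω) i) :=
  @MeasTree.cost n Ω (past x j) _ (measTree_treeAt_of_le hij) P

/-- The kernel of the sampling law, over the past. -/
noncomputable def pastKernel (P : Problem n) (cfg : Config) (T₀ : Tree n) (x : ℕ → Ω → Space n)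
    (i : ℕ) : @ProbabilityTheory.Kernel Ω (Space n) (past x i) _ :=
  letI := past x i
  P.sampleKernel.comap (fun ω => costAt P cfg T₀ (fun j => x j ω) i) (measurable_costAt (le_refl i))

theorem isFiniteKernel_pastKernel (i : ℕ) :
    @ProbabilityTheory.IsFiniteKernel Ω (Space n) (past x i) _ (pastKernel P cfg T₀ x i) := by
  let _ := past x i
  unfold pastKernel
  infer_instance

theorem measurable_treeFun {β : Type*} [MeasurableSpace β] {Ψ : Tree n → Space n → β}
    (hΨ : MeasTreeFun.{u} Ψ) (i : ℕ) :
    Measurable[(past x i).prod inferInstance] fun p : Ω × Space n =>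
      Ψ (treeAt P cfg T₀ (fun j => x j p.1) i) p.2 := by
  let _ := past x i
  exact hΨ (Ω × Space n) _ _ ((measTree_treeAt i).comp measurable_fst) measurable_snd

theorem measurable_lintegral_sampleLaw {Ψ : Tree n → Space n → ℝ≥0∞} (hΨ : MeasTreeFun.{u} Ψ)
    (i : ℕ) :
    Measurable[past x i] fun ω => ∫⁻ y, Ψ (treeAt P cfg T₀ (fun j => x j ω) i) y
      ∂(P.sampleLaw (costAt P cfg T₀ (fun j => x j ω) i)) := by
  have hφ := measurable_treeFun (P := P) (cfg := cfg) (T₀ := T₀) (x := x) hΨ i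
  have hK := isFiniteKernel_pastKernel (P := P) (cfg := cfg) (T₀ := T₀) (x := x) i
  let _ := past x i
  exact Measurable.lintegral_kernel_prod_right' (κ := pastKernel P cfg T₀ x i) hφ

/-- The lift moves the state space into the universe over which `MeasTreeFun` quantifies. -/
theorem MeasTreeFun.measurable_right {β : Type*} [MeasurableSpace β] {Ψ : Tree n → Space n → β}
    (hΨ : MeasTreeFun.{u} Ψ) (T : Tree n) : Measurable (Ψ T) :=
  (hΨ (ULift.{u} (Space n)) (fun _ => T) ULift.down (MeasTree.const _) measurable_down).comp
    measurable_up

variable [m0 : MeasurableSpace Ω] {μ : Measure Ω}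

namespace IsRun

theorem past_le (hx : IsRun P cfg T₀ μ x) (i : ℕ) : past x i ≤ m0 :=
  iSup_le fun j => (hx.measurable j).comap_le

theorem measTree (hx : IsRun P cfg T₀ μ x) (i : ℕ) :
    MeasTree fun ω => treeAt P cfg T₀ (fun j => x j ω) i :=
  MeasTree.mono (hx.past_le i) (measTree_treeAt i)

variable [IsProbabilityMeasure μ] (hx : IsRun P cfg T₀ μ x)
include hx

/-- The real-valued conditional expectation of the law, integrated over an event of the past, in the
form needed by `lintegral_freeze`. -/
theorem measure_inter (i : ℕ) {A : Set Ω} (hA : MeasurableSet[past x i] A) {B : Set (Space n)}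
    (hB : MeasurableSet B) : μ (A ∩ x i ⁻¹' B) =
      ∫⁻ ω in A, P.sampleLaw (costAt P cfg T₀ (fun j => x j ω) i) B ∂μ := by
  have hm := hx.past_le i
  have hBx : MeasurableSet (x i ⁻¹' B) := hx.measurable i hB
  have hK : Measurable fun ω => P.sampleLaw (costAt P cfg T₀ (fun j => x j ω) i) B :=
    (P.sampleKernel.measurable_coe hB).comp ((measurable_costAt (P := P) (cfg := cfg)
      (T₀ := T₀) (x := x) (le_refl i)).mono hm le_rfl)
  have hle : ∀ ω, P.sampleLaw (costAt P cfg T₀ (fun j => x j ω) i) B ≤ 1 := fun ω =>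
    (measure_mono (Set.subset_univ _)).trans (P.sampleLaw_le_one _)
  have hint : Integrable ((x i ⁻¹' B).indicator fun _ => (1 : ℝ)) μ :=
    (integrable_const 1).indicator hBx
  have h1 := setIntegral_condExp hm hint hA
  rw [setIntegral_congr_ae (hm A hA) ((hx.law i B hB).mono fun ω h _ => h),
    setIntegral_indicator hBx, setIntegral_const, smul_eq_mul, mul_one,
    integral_toReal hK.aemeasurable (ae_of_all _ fun ω => (hle ω).trans_lt ENNReal.one_lt_top)] at h1
  rw [measureReal_def] at h1
  refine ((ENNReal.toReal_eq_toReal_iff' ?_ (measure_ne_top _ _)).1 h1).symm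
  refine ((lintegral_mono hle).trans_lt ?_).ne
  simp

theorem lintegral_eq (i : ℕ) {φ : Ω × Space n → ℝ≥0∞}
    (hφ : Measurable[(past x i).prod inferInstance] φ) :
    ∫⁻ ω, φ (ω, x i ω) ∂μ =
      ∫⁻ ω, ∫⁻ y, φ (ω, y) ∂(P.sampleLaw (costAt P cfg T₀ (fun j => x j ω) i)) ∂μ :=
  @lintegral_freeze Ω Ω (Space n) m0 (past x i) _ μ _ (pastKernel P cfg T₀ x i)
    (isFiniteKernel_pastKernel i) id (measurable_id'' (hx.past_le i)) (x i) (hx.measurable i)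
    (fun _ hA _ hB => hx.measure_inter i hA hB) φ hφ

theorem lintegral_mul_tree (i : ℕ) {g : Ω → ℝ≥0∞} (hg : Measurable[past x i] g)
    {Ψ : Tree n → Space n → ℝ≥0∞} (hΨ : MeasTreeFun.{u} Ψ) :
    ∫⁻ ω, g ω * Ψ (treeAt P cfg T₀ (fun j => x j ω) i) (x i ω) ∂μ =
      ∫⁻ ω, g ω * ∫⁻ y, Ψ (treeAt P cfg T₀ (fun j => x j ω) i) y
        ∂(P.sampleLaw (costAt P cfg T₀ (fun j => x j ω) i)) ∂μ := by
  have hφ : Measurable[(past x i).prod inferInstance] fun p : Ω × Space n =>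
      g p.1 * Ψ (treeAt P cfg T₀ (fun j => x j p.1) i) p.2 := by
    have hΨ' := measurable_treeFun (P := P) (cfg := cfg) (T₀ := T₀) (x := x) hΨ i
    let _ := past x i
    exact (hg.comp measurable_fst).mul hΨ'
  rw [hx.lintegral_eq i hφ]
  refine lintegral_congr fun ω => ?_
  exact lintegral_const_mul (g ω) (hΨ.measurable_right (treeAt P cfg T₀ (fun j => x j ω) i))

/-- An event for the current tree and the next sample that is negligible for every sampling law
almost surely does not occur. -/
theorem ae_not_mem {p : Tree n → Space n → Prop} (hp : MeasTreeFun.{u} p)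
    (h0 : ∀ i ω, P.sampleLaw (costAt P cfg T₀ (fun j => x j ω) i)
      {y | p (treeAt P cfg T₀ (fun j => x j ω) i) y} = 0) :
    ∀ᵐ ω ∂μ, ∀ i, ¬ p (treeAt P cfg T₀ (fun j => x j ω) i) (x i ω) := by
  classical
  refine ae_all_iff.2 fun i => ?_
  have hΨ : MeasTreeFun.{u} (fun T y => if p T y then (1 : ℝ≥0∞) else 0) := fun α _ f y hf hy =>
    Measurable.ite (measurableSet_setOfPred.2 (hp α f y hf hy)) measurable_const measurable_const
  have h := hx.lintegral_mul_tree i (g := fun _ => 1) measurable_const hΨ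
  simp only [one_mul] at h
  have hz : ∀ ω, ∫⁻ y, (if p (treeAt P cfg T₀ (fun j => x j ω) i) y then (1 : ℝ≥0∞) else 0)
      ∂(P.sampleLaw (costAt P cfg T₀ (fun j => x j ω) i)) = 0 := by
    intro ω
    rw [lintegral_eq_zero_iff']
    · refine mem_ae_iff.2 ?_
      convert h0 i ω using 2
      ext y; simp
    · exact (hΨ.measurable_right _).aemeasurable
  simp only [hz, lintegral_zero] at h
  rw [lintegral_eq_zero_iff'] at h
  · filter_upwards [h] with ω hω hp
    simp [hp] at hω
  · exact (hΨ Ω _ _ (hx.measTree i) (hx.measurable i)).aemeasurable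

/-- Conditioning on a null set yields the zero measure, whereas the law of the next sample has total
mass 1. -/
theorem ae_volume_informedSet_ne_zero :
    ∀ᵐ ω ∂μ, ∀ i, volume (P.informedSet (costAt P cfg T₀ (fun j => x j ω) i)) ≠ 0 := by
  refine ae_all_iff.2 fun i => ?_
  have h := hx.law i Set.univ MeasurableSet.univ
  have h1 : μ[(x i ⁻¹' Set.univ).indicator (fun _ => (1 : ℝ)) | past x i] = fun _ => (1 : ℝ) := by
    rw [Set.preimage_univ, Set.indicator_univ]
    exact condExp_const (hx.past_le i) 1
  rw [h1] at h
  filter_upwards [h] with ω hω h0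
  rw [P.sampleLaw_apply, Set.inter_univ, h0] at hω
  simp at hω

theorem ae_isProbabilityMeasure : ∀ᵐ ω ∂μ, ∀ i,
    IsProbabilityMeasure (P.sampleLaw (costAt P cfg T₀ (fun j => x j ω) i)) := by
  filter_upwards [hx.ae_volume_informedSet_ne_zero] with ω hω i
  exact P.isProbabilityMeasure_sampleLaw (hω i)

end IsRun

end InformedRRT

/-! ### Volume of the prolate hyperspheroid -/

namespace InformedRRT

variable {n : ℕ}

namespace Problem

variable (P : Problem n)

/-- The distance between the foci. -/
noncomputable def focal : ℝ := ‖P.goal - P.start‖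

theorem focal_pos : 0 < P.focal := norm_pos_iff.2 (sub_ne_zero.2 P.start_ne_goal.symm)

theorem focal_le_heuristic (x : Space n) : P.focal ≤ P.heuristic x := by
  have := norm_add_le (x - P.start) (P.goal - x)
  rwa [show x - P.start + (P.goal - x) = P.goal - P.start by abel] at this

include P in
theorem dim_ne_zero : n ≠ 0 := by
  rintro rfl
  exact P.start_ne_goal (Subsingleton.elim _ _)

/-- The semi-minor axis of the hyperspheroid of transverse diameter `c`. -/
noncomputable def semiMinor (c : ℝ) : ℝ := √(c ^ 2 - P.focal ^ 2) / 2

variable {c : ℝ}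

theorem semiMinor_sq (hc : P.focal < c) : 4 * P.semiMinor c ^ 2 = c ^ 2 - P.focal ^ 2 := by
  have : 0 ≤ c ^ 2 - P.focal ^ 2 := by nlinarith [P.focal_pos]
  rw [semiMinor, div_pow, Real.sq_sqrt this]; ring

theorem semiMinor_pos (hc : P.focal < c) : 0 < P.semiMinor c := by
  have : 0 < c ^ 2 - P.focal ^ 2 := by nlinarith [P.focal_pos]
  rw [semiMinor]; positivity

/-- The unit vector from the start to the goal. -/
noncomputable def axis : Space n := P.focal⁻¹ • (P.goal - P.start)

theorem norm_axis : ‖P.axis‖ = 1 := by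
  rw [axis, norm_smul, norm_inv, Real.norm_of_nonneg P.focal_pos.le]
  exact inv_mul_cancel₀ P.focal_pos.ne'

theorem focal_smul_axis : P.focal • P.axis = P.goal - P.start := by
  rw [axis, smul_smul, mul_inv_cancel₀ P.focal_pos.ne', one_smul]

/-- The linear map that takes the unit ball to the centred hyperspheroid. -/
noncomputable def spheroidMap (c : ℝ) : Space n →ₗ[ℝ] Space n :=
  P.semiMinor c • LinearMap.transvection (innerₛₗ ℝ P.axis)
    ((c / (2 * P.semiMinor c) - 1) • P.axis)

theorem spheroidMap_apply (hc : P.focal < c) (w : Space n) :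
    P.spheroidMap c w =
      P.semiMinor c • w + ((c / 2 - P.semiMinor c) * inner ℝ P.axis w) • P.axis := by
  have hb := (P.semiMinor_pos hc).ne'
  simp only [spheroidMap, LinearMap.smul_apply, LinearMap.transvection.apply, innerₛₗ_apply_apply,
    smul_add, smul_smul]
  congr 2
  field_simp

theorem det_spheroidMap (hc : P.focal < c) :
    LinearMap.det (P.spheroidMap c) = P.semiMinor c ^ (n - 1) * (c / 2) := by
  have hb := (P.semiMinor_pos hc).ne'
  rw [spheroidMap, LinearMap.det_smul, LinearMap.transvection.det, finrank_euclideanSpace_fin]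
  simp only [innerₛₗ_apply_apply, inner_smul_right, real_inner_self_eq_norm_sq, P.norm_axis]
  obtain ⟨k, rfl⟩ := Nat.exists_eq_succ_of_ne_zero P.dim_ne_zero
  simp only [Nat.succ_eq_add_one, Nat.add_sub_cancel, pow_succ]
  field_simp
  ring

/-- The quadric equation of the spheroid with the square roots cleared. The second factor on the
left is positive because the difference of the focal distances is at most d < c, so the sign of c -
h is that of 1 - ‖w‖. -/
theorem heuristic_spheroidMap (hc : P.focal < c) (w : Space n) :
    (c ^ 2 - P.heuristic (midpoint ℝ P.start P.goal + P.spheroidMap c w) ^ 2) *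
      (c ^ 2 - (‖midpoint ℝ P.start P.goal + P.spheroidMap c w - P.start‖ -
        ‖P.goal - (midpoint ℝ P.start P.goal + P.spheroidMap c w)‖) ^ 2) =
      4 * P.semiMinor c ^ 2 * c ^ 2 * (1 - ‖w‖ ^ 2) := by
  set z := P.spheroidMap c w with hz
  have hu : ‖P.axis‖ = 1 := P.norm_axis
  have e1 : midpoint ℝ P.start P.goal + z - P.start = z + (P.focal / 2) • P.axis := by
    rw [midpoint_eq_smul_add, div_eq_inv_mul, mul_smul, P.focal_smul_axis, invOf_eq_inv, smul_sub,
      smul_add, show P.start = (2 : ℝ)⁻¹ • P.start + (2 : ℝ)⁻¹ • P.start by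
        rw [← add_smul]; norm_num]
    simp only [smul_smul, ← add_smul]
    module
  have e2 : P.goal - (midpoint ℝ P.start P.goal + z) = -(z - (P.focal / 2) • P.axis) := by
    rw [midpoint_eq_smul_add, div_eq_inv_mul, mul_smul, P.focal_smul_axis, invOf_eq_inv]
    module
  have h1 : ‖z + (P.focal / 2) • P.axis‖ ^ 2 =
      ‖z‖ ^ 2 + P.focal * inner ℝ P.axis z + P.focal ^ 2 / 4 := by
    rw [norm_add_sq_real, inner_smul_right, norm_smul, hu, real_inner_comm, mul_one,
      Real.norm_eq_abs, sq_abs]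
    ring
  have h2 : ‖z - (P.focal / 2) • P.axis‖ ^ 2 =
      ‖z‖ ^ 2 - P.focal * inner ℝ P.axis z + P.focal ^ 2 / 4 := by
    rw [norm_sub_sq_real, inner_smul_right, norm_smul, hu, real_inner_comm, mul_one,
      Real.norm_eq_abs, sq_abs]
    ring
  have h3 : inner ℝ P.axis z = c / 2 * inner ℝ P.axis w := by
    rw [hz, P.spheroidMap_apply hc, inner_add_right, inner_smul_right, inner_smul_right,
      real_inner_self_eq_norm_sq, hu]
    ring
  have h4 : ‖z‖ ^ 2 = P.semiMinor c ^ 2 * ‖w‖ ^ 2 +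
      (c ^ 2 / 4 - P.semiMinor c ^ 2) * inner ℝ P.axis w ^ 2 := by
    rw [hz, P.spheroidMap_apply hc, norm_add_sq_real, norm_smul, norm_smul, inner_smul_left,
      inner_smul_right, hu, real_inner_comm]
    simp only [Real.norm_eq_abs, mul_pow, sq_abs, conj_trivial, one_pow]
    ring
  have h5 := P.semiMinor_sq hc
  rw [heuristic, e1, e2, norm_neg]
  set A := ‖z + (P.focal / 2) • P.axis‖
  set B := ‖z - (P.focal / 2) • P.axis‖
  rw [h3] at h1 h2
  have h6 : (c ^ 2 - (A + B) ^ 2) * (c ^ 2 - (A - B) ^ 2) =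
      c ^ 4 - 2 * c ^ 2 * (A ^ 2 + B ^ 2) + (A ^ 2 - B ^ 2) ^ 2 := by ring
  rw [h6, h1, h2, h4]
  have h7 : P.focal ^ 2 = c ^ 2 - 4 * P.semiMinor c ^ 2 := by linarith
  linear_combination ((-c ^ 2) + 4 * (c / 2 * inner ℝ P.axis w) ^ 2) * h7

theorem heuristic_spheroidMap_lt_iff (hc : P.focal < c) (w : Space n) :
    P.heuristic (midpoint ℝ P.start P.goal + P.spheroidMap c w) < c ↔ ‖w‖ < 1 := by
  have h := P.heuristic_spheroidMap hc w
  set p := midpoint ℝ P.start P.goal + P.spheroidMap c w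
  have hb := P.semiMinor_pos hc
  have hd := P.focal_pos
  have hh := hd.trans_le (P.focal_le_heuristic p)
  have hpos : 0 < c ^ 2 - (‖p - P.start‖ - ‖P.goal - p‖) ^ 2 := by
    have h1 : |‖p - P.start‖ - ‖P.goal - p‖| ≤ P.focal := by
      have := abs_norm_sub_norm_le (p - P.start) (p - P.goal)
      rwa [norm_sub_rev p P.goal, sub_sub_sub_cancel_left] at this
    have h2 := sq_le_sq' (abs_le.1 h1).1 (abs_le.1 h1).2
    nlinarith
  have hk : 0 < 4 * P.semiMinor c ^ 2 * c ^ 2 := by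
    have : 0 < c := hd.trans hc
    positivity
  constructor
  · intro hlt
    have h1 : 0 < 4 * P.semiMinor c ^ 2 * c ^ 2 * (1 - ‖w‖ ^ 2) := by
      rw [← h]; exact mul_pos (by nlinarith) hpos
    have := pos_of_mul_pos_right h1 hk.le
    nlinarith [norm_nonneg w]
  · intro hlt
    have h1 : 0 < 4 * P.semiMinor c ^ 2 * c ^ 2 * (1 - ‖w‖ ^ 2) :=
      mul_pos hk (by nlinarith [norm_nonneg w])
    rw [← h] at h1
    have := pos_of_mul_pos_left h1 hpos.le
    nlinarith

theorem hyperspheroid_eq_image (hc : P.focal < c) : P.hyperspheroid c =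
    (fun z => midpoint ℝ P.start P.goal + z) '' (P.spheroidMap c '' Metric.ball 0 1) := by
  have hdet : LinearMap.det (P.spheroidMap c) ≠ 0 := by
    have := P.semiMinor_pos hc
    have : 0 < c := P.focal_pos.trans hc
    rw [P.det_spheroidMap hc]; positivity
  ext p
  simp only [Set.mem_image, Metric.mem_ball, dist_zero_right, exists_exists_and_eq_and]
  constructor
  · intro hp
    have hs : P.spheroidMap c ((LinearMap.equivOfDetNeZero _ hdet).symm
        (p - midpoint ℝ P.start P.goal)) = p - midpoint ℝ P.start P.goal :=
      (LinearMap.equivOfDetNeZero _ hdet).apply_symm_apply _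
    refine ⟨(LinearMap.equivOfDetNeZero _ hdet).symm (p - midpoint ℝ P.start P.goal), ?_, ?_⟩
    · rw [← P.heuristic_spheroidMap_lt_iff hc, hs]
      simpa [hyperspheroid] using hp
    · rw [hs]; abel
  · rintro ⟨w, hw, rfl⟩
    exact (P.heuristic_spheroidMap_lt_iff hc w).2 hw

/-- The volume of a prolate hyperspheroid. -/
theorem volume_hyperspheroid (hc : P.focal < c) : volume (P.hyperspheroid c) =
    ENNReal.ofReal (P.semiMinor c ^ (n - 1) * (c / 2)) * volume (Metric.ball (0 : Space n) 1) := by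
  have := P.semiMinor_pos hc
  have : 0 < c := P.focal_pos.trans hc
  rw [P.hyperspheroid_eq_image hc, Set.image_add_left, measure_preimage_add,
    Measure.addHaar_image_linearMap, P.det_spheroidMap hc, abs_of_nonneg (by positivity)]

theorem hyperspheroid_eq_empty (hc : c ≤ P.focal) : P.hyperspheroid c = ∅ :=
  Set.eq_empty_of_forall_notMem fun x hx => absurd (P.focal_le_heuristic x)
    (not_le.2 (lt_of_lt_of_le hx hc))

/-- The volume of the hyperspheroid, as a real function. -/
noncomputable def spheroidVolume (c : ℝ) : ℝ :=
  P.semiMinor c ^ (n - 1) * (c / 2) * volume.real (Metric.ball (0 : Space n) 1)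

theorem continuous_spheroidVolume : Continuous P.spheroidVolume := by
  unfold spheroidVolume semiMinor
  fun_prop

theorem volume_real_hyperspheroid (hc : P.focal < c) :
    volume.real (P.hyperspheroid c) = P.spheroidVolume c := by
  have := P.semiMinor_pos hc
  have : 0 < c := P.focal_pos.trans hc
  rw [measureReal_def, P.volume_hyperspheroid hc, ENNReal.toReal_mul,
    ENNReal.toReal_ofReal (by positivity)]
  rfl

theorem spheroidVolume_pos (hc : P.focal < c) : 0 < P.spheroidVolume c := by
  have := P.semiMinor_pos hc
  have : 0 < c := P.focal_pos.trans hc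
  have : 0 < volume.real (Metric.ball (0 : Space n) 1) :=
    ENNReal.toReal_pos (Metric.measure_ball_pos _ _ one_pos).ne' measure_ball_lt_top.ne
  unfold spheroidVolume
  positivity

/-- The level set lies between the hyperspheroids of diameters c and c' > c, and their volumes
depend continuously on the diameter. -/
theorem volume_heuristic_eq (hc : P.focal < c) : volume {x | P.heuristic x = c} = 0 := by
  have hle : ∀ c' > c, volume {x | P.heuristic x = c} ≤
      ENNReal.ofReal (P.spheroidVolume c' - P.spheroidVolume c) := by
    intro c' hc'
    have hsub : {x | P.heuristic x = c} ⊆ P.hyperspheroid c' \ P.hyperspheroid c := by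
      intro x hx
      have hx : P.heuristic x = c := hx
      exact ⟨show P.heuristic x < c' by linarith, show ¬ P.heuristic x < c by linarith⟩
    refine (measure_mono hsub).trans ?_
    have hms : MeasurableSet (P.hyperspheroid c) :=
      measurableSet_lt P.continuous_heuristic.measurable measurable_const
    have hmono : P.hyperspheroid c ⊆ P.hyperspheroid c' :=
      fun x (hx : P.heuristic x < c) => show P.heuristic x < c' by linarith
    rw [measure_sdiff hmono hms.nullMeasurableSet
      (P.volume_hyperspheroid_lt_top c).ne, ← P.volume_real_hyperspheroid hc,
      ← P.volume_real_hyperspheroid (hc.trans hc'), measureReal_def, measureReal_def,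
      ENNReal.ofReal_sub _ ENNReal.toReal_nonneg,
      ENNReal.ofReal_toReal (P.volume_hyperspheroid_lt_top _).ne,
      ENNReal.ofReal_toReal (P.volume_hyperspheroid_lt_top _).ne]
  have hlim : Tendsto (fun c' => ENNReal.ofReal (P.spheroidVolume c' - P.spheroidVolume c))
      (𝓝[>] c) (𝓝 0) := by
    have : Tendsto (fun c' => P.spheroidVolume c' - P.spheroidVolume c) (𝓝[>] c) (𝓝 0) := by
      have h := (P.continuous_spheroidVolume.tendsto c).sub_const (P.spheroidVolume c)
      rw [sub_self] at h
      exact h.mono_left nhdsWithin_le_nhds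
    simpa using ENNReal.tendsto_ofReal this
  exact le_antisymm (ge_of_tendsto hlim (eventually_nhdsWithin_of_forall hle)) zero_le

end Problem

end InformedRRT

/-! ### Error ratios and the mean heuristic cost of a thin hyperspheroid -/

namespace InformedRRT

variable {n : ℕ} {P : Problem n} {cfg : Config} {T T₀ : Tree n}

section Ratio

theorem measTreeFun_cost_step : MeasTreeFun.{u} fun (T : Tree n) y => (step P cfg T y).cost P :=
  fun _ _ _ _ hf hy => (hf.step hy).cost P

theorem measurable_cost_step (T : Tree n) : Measurable fun y => (step P cfg T y).cost P :=
  MeasTreeFun.measurable_right.{0} measTreeFun_cost_step T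

theorem Tree.Inv.ratio_mem_Icc (hT : T.Inv P cfg) (y : Space n) :
    ((InformedRRT.step P cfg T y).cost P - P.optCost) / (T.cost P - P.optCost) ∈
      Set.Icc (0 : ℝ) 1 := by
  have h1 := (hT.step y).optCost_le_cost
  have h2 := hT.cost_step_le y
  exact ⟨div_nonneg (by linarith) (by linarith), div_le_one_of_le₀ (by linarith) (by linarith)⟩

theorem Tree.Inv.integrable_ratio (hT : T.Inv P cfg) :
    Integrable (fun y => ((InformedRRT.step P cfg T y).cost P - P.optCost) /
      (T.cost P - P.optCost)) (P.sampleLaw (T.cost P)) := by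
  refine Integrable.of_bound (((measurable_cost_step T).sub_const _).div_const _).aestronglyMeasurable
    1 (ae_of_all _ fun y => ?_)
  rw [Real.norm_of_nonneg (hT.ratio_mem_Icc y).1]
  exact (hT.ratio_mem_Icc y).2

theorem Tree.Inv.expectedRatio_nonneg (hT : T.Inv P cfg) : 0 ≤ expectedRatio P cfg T :=
  integral_nonneg fun y => (hT.ratio_mem_Icc y).1

theorem Tree.Inv.expectedRatio_le_one (hT : T.Inv P cfg) : expectedRatio P cfg T ≤ 1 := by
  have h : expectedRatio P cfg T ≤ ∫ _, (1 : ℝ) ∂(P.sampleLaw (T.cost P)) :=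
    integral_mono hT.integrable_ratio (integrable_const _) fun y => (hT.ratio_mem_Icc y).2
  refine h.trans ?_
  rw [integral_const, smul_eq_mul, mul_one]
  exact ENNReal.toReal_le_of_le_ofReal zero_le_one (by simpa using P.sampleLaw_le_one _)

theorem isBoundedUnder_ratioAt (hT : T₀.Inv P cfg) (x : ℕ → Space n) :
    IsBoundedUnder (· ≤ ·) atTop (ratioAt P cfg T₀ x) :=
  isBoundedUnder_of ⟨1, fun i => (inv_treeAt hT x i).expectedRatio_le_one⟩

theorem isCoboundedUnder_ratioAt (hT : T₀.Inv P cfg) (x : ℕ → Space n) :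
    IsCoboundedUnder (· ≤ ·) atTop (ratioAt P cfg T₀ x) :=
  IsBoundedUnder.isCoboundedUnder_le
    (isBoundedUnder_of ⟨0, fun i => (inv_treeAt hT x i).expectedRatio_nonneg⟩)

theorem expectedRate_le_one (hT : T₀.Inv P cfg) (x : ℕ → Space n) : expectedRate P cfg T₀ x ≤ 1 :=
  limsup_le_of_le (isCoboundedUnder_ratioAt hT x)
    (Eventually.of_forall fun i => (inv_treeAt hT x i).expectedRatio_le_one)

end Ratio

namespace Problem

theorem sampleLaw_absolutelyContinuous (c : ℝ) : P.sampleLaw c ≪ volume :=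
  ProbabilityTheory.cond_absolutelyContinuous

/-- The semi-minor axis vanishes at c = d. In dimension one its exponent n - 1 would be 0, so n ≥ 2
is essential here. -/
theorem volume_heuristic_le_focal (hn : 2 ≤ n) : volume {x | P.heuristic x ≤ P.focal} = 0 := by
  have hle : ∀ c' > P.focal, volume {x | P.heuristic x ≤ P.focal} ≤
      ENNReal.ofReal (P.spheroidVolume c') := by
    intro c' hc'
    rw [← P.volume_real_hyperspheroid hc', measureReal_def,
      ENNReal.ofReal_toReal (P.volume_hyperspheroid_lt_top _).ne]
    exact measure_mono fun x (hx : P.heuristic x ≤ P.focal) => lt_of_le_of_lt hx hc'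
  have h0 : P.spheroidVolume P.focal = 0 := by
    simp [spheroidVolume, semiMinor, show n - 1 ≠ 0 by omega]
  have hlim : Tendsto (fun c' => ENNReal.ofReal (P.spheroidVolume c')) (𝓝[>] P.focal) (𝓝 0) := by
    have h := (P.continuous_spheroidVolume.tendsto P.focal)
    rw [h0] at h
    simpa using ENNReal.tendsto_ofReal (h.mono_left nhdsWithin_le_nhds)
  exact le_antisymm (ge_of_tendsto hlim (eventually_nhdsWithin_of_forall hle)) zero_le

theorem mem_segment_of_heuristic_eq {x : Space n} (h : P.heuristic x = P.focal) :
    x ∈ segment ℝ P.start P.goal := by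
  rw [mem_segment_iff_wbtw, ← dist_add_dist_eq_iff]
  rw [heuristic, focal] at h
  rw [dist_eq_norm, dist_eq_norm, dist_eq_norm, norm_sub_rev P.start,
    norm_sub_rev x P.goal, norm_sub_rev P.start P.goal, h]

theorem isCompact_heuristic_le (c : ℝ) : IsCompact {x | P.heuristic x ≤ c} := by
  refine Metric.isCompact_of_isClosed_isBounded
    (isClosed_le P.continuous_heuristic continuous_const) ?_
  exact Metric.isBounded_ball.subset fun x hx =>
    P.hyperspheroid_subset_ball (c + 1) (lt_of_le_of_lt hx (lt_add_one c))

/-- Thin hyperspheroids are close to the segment between their foci. -/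
theorem exists_hyperspheroid_subset {U : Set (Space n)} (hU : IsOpen U)
    (h : segment ℝ P.start P.goal ⊆ U) : ∃ c > P.focal, P.hyperspheroid c ⊆ U := by
  have hK : IsCompact ({x | P.heuristic x ≤ P.focal + 1} \ U) :=
    (P.isCompact_heuristic_le _).diff hU
  rcases ({x | P.heuristic x ≤ P.focal + 1} \ U).eq_empty_or_nonempty with he | hne
  · refine ⟨P.focal + 1, lt_add_one _, fun x hx => ?_⟩
    by_contra hxU
    exact Set.notMem_empty x (he ▸ ⟨(le_of_lt hx : P.heuristic x ≤ P.focal + 1), hxU⟩)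
  -- The least heuristic cost outside U, attained by compactness, serves as the diameter. It exceeds
  -- d because only the points of the segment have heuristic cost d.
  · obtain ⟨z, hz, hmin⟩ := hK.exists_isMinOn hne P.continuous_heuristic.continuousOn
    refine ⟨P.heuristic z, ?_, fun x hx => ?_⟩
    · refine lt_of_le_of_ne (P.focal_le_heuristic z) fun he => ?_
      exact hz.2 (h (P.mem_segment_of_heuristic_eq he.symm))
    · by_contra hxU
      have hz1 : P.heuristic z ≤ P.focal + 1 := hz.1
      have hx : P.heuristic x < P.heuristic z := hx
      exact absurd (hmin (show x ∈ _ from ⟨show P.heuristic x ≤ P.focal + 1 by linarith, hxU⟩))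
        (not_le.2 hx)

/-- The mean of the normalized heuristic over a hyperspheroid, as a function of its transverse
diameter. -/
theorem integral_heuristic {c : ℝ} (hc : P.focal < c)
    (hsub : P.hyperspheroid c ⊆ P.free) :
    ∫ y, (P.heuristic y - P.focal) / (c - P.focal) ∂(P.sampleLaw c) =
      ∫ t in Set.Ioc (0 : ℝ) 1,
        (1 - P.spheroidVolume (P.focal + t * (c - P.focal)) / P.spheroidVolume c) := by
  have hinf : P.informedSet c = P.hyperspheroid c := Set.inter_eq_right.2 hsub
  have hcd : 0 < c - P.focal := sub_pos.2 hc
  have hmem : ∀ᵐ y ∂(P.sampleLaw c), P.heuristic y < c :=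
    (P.ae_mem_informedSet c).mono fun y hy => hy.2
  have hV := P.spheroidVolume_pos hc
  have hpm : IsProbabilityMeasure (P.sampleLaw c) := by
    refine P.isProbabilityMeasure_sampleLaw ?_
    rw [hinf]
    intro h0
    have := P.volume_real_hyperspheroid hc
    rw [measureReal_def, h0, ENNReal.toReal_zero] at this
    exact hV.ne this
  have hmeas : Measurable fun y => (P.heuristic y - P.focal) / (c - P.focal) :=
    ((P.continuous_heuristic.measurable.sub_const _).div_const _)
  have hnn : ∀ y, 0 ≤ (P.heuristic y - P.focal) / (c - P.focal) := fun y =>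
    div_nonneg (sub_nonneg.2 (P.focal_le_heuristic y)) hcd.le
  have hle : ∀ᵐ y ∂(P.sampleLaw c), (P.heuristic y - P.focal) / (c - P.focal) ≤ 1 := by
    filter_upwards [hmem] with y hy
    exact div_le_one_of_le₀ (by linarith) hcd.le
  have hint : Integrable (fun y => (P.heuristic y - P.focal) / (c - P.focal)) (P.sampleLaw c) := by
    refine Integrable.of_bound hmeas.aestronglyMeasurable 1 ?_
    filter_upwards [hle] with y hy
    rwa [Real.norm_of_nonneg (hnn y)]
  -- Layer-cake formula: the normalized heuristic is at least t exactly outside the hyperspheroid of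
  -- diameter d + t (c - d).
  rw [hint.integral_eq_integral_Ioc_meas_le (ae_of_all _ hnn) hle]
  refine setIntegral_congr_fun measurableSet_Ioc fun t ht => ?_
  have hset : {a | t ≤ (P.heuristic a - P.focal) / (c - P.focal)} =
      (P.hyperspheroid (P.focal + t * (c - P.focal)))ᶜ := by
    ext y
    simp only [Set.mem_ofPred_eq, hyperspheroid, Set.mem_compl_iff, not_lt, le_div_iff₀ hcd]
    constructor <;> intro h <;> linarith
  have hms : MeasurableSet (P.hyperspheroid (P.focal + t * (c - P.focal))) :=
    measurableSet_lt P.continuous_heuristic.measurable measurable_const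
  have h1 : P.focal < P.focal + t * (c - P.focal) := by nlinarith [ht.1]
  have h2 : P.focal + t * (c - P.focal) ≤ c := by nlinarith [ht.2]
  have h3 : P.hyperspheroid c ∩ P.hyperspheroid (P.focal + t * (c - P.focal)) =
      P.hyperspheroid (P.focal + t * (c - P.focal)) :=
    Set.inter_eq_right.2 fun y hy => lt_of_lt_of_le hy h2
  simp only [hset]
  rw [prob_compl_eq_one_sub hms |> fun h => show (P.sampleLaw c).real _ = _ by
    rw [measureReal_def, h, ENNReal.toReal_sub_of_le prob_le_one ENNReal.one_ne_top]]
  rw [P.sampleLaw_apply, hinf, h3, ENNReal.toReal_mul, ENNReal.toReal_inv, ← measureReal_def,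
    ← measureReal_def, P.volume_real_hyperspheroid hc, P.volume_real_hyperspheroid h1]
  simp [div_eq_inv_mul]

/-- With δ = c - d, the squared semi-minor axes have the quotient tδ(2d + tδ) / (δ(c + d)). The
factor δ cancels, and the rest tends to t, while the quotient of the major axes tends to 1. -/
theorem tendsto_spheroidVolume_ratio (t : ℝ) :
    Tendsto (fun c => P.spheroidVolume (P.focal + t * (c - P.focal)) / P.spheroidVolume c)
      (𝓝[>] P.focal) (𝓝 (√t ^ (n - 1))) := by
  have hd := P.focal_pos
  have hb : 0 < volume.real (Metric.ball (0 : Space n) 1) :=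
    ENNReal.toReal_pos (Metric.measure_ball_pos _ _ one_pos).ne' measure_ball_lt_top.ne
  have heq : ∀ᶠ c in 𝓝[>] P.focal,
      (√(t * ((2 * P.focal + t * (c - P.focal)) / (c + P.focal)))) ^ (n - 1) *
        ((P.focal + t * (c - P.focal)) / c) =
      P.spheroidVolume (P.focal + t * (c - P.focal)) / P.spheroidVolume c := by
    filter_upwards [self_mem_nhdsWithin] with c hc
    have hc : P.focal < c := hc
    have hc0 : 0 < c := hd.trans hc
    have h1 : 0 < c ^ 2 - P.focal ^ 2 := by nlinarith
    have h2 : t * ((2 * P.focal + t * (c - P.focal)) / (c + P.focal)) =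
        ((P.focal + t * (c - P.focal)) ^ 2 - P.focal ^ 2) / (c ^ 2 - P.focal ^ 2) := by
      have : c - P.focal ≠ 0 := (sub_pos.2 hc).ne'
      rw [show c ^ 2 - P.focal ^ 2 = (c - P.focal) * (c + P.focal) by ring]
      field_simp
      ring
    have h3 : 0 < √(c ^ 2 - P.focal ^ 2) := Real.sqrt_pos.2 h1
    rw [h2, Real.sqrt_div' _ h1.le]
    simp only [spheroidVolume, semiMinor, div_pow]
    field_simp
  refine Tendsto.congr' heq ?_
  have hcont : ContinuousAt (fun c => (√(t * ((2 * P.focal + t * (c - P.focal)) / (c + P.focal)))) ^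
      (n - 1) * ((P.focal + t * (c - P.focal)) / c)) P.focal := by
    have h1 : P.focal + P.focal ≠ 0 := by positivity
    have h2 : P.focal ≠ 0 := hd.ne'
    have e1 : ContinuousAt (fun c => (2 * P.focal + t * (c - P.focal)) / (c + P.focal)) P.focal :=
      ContinuousAt.div (by fun_prop) (by fun_prop) h1
    have e2 : ContinuousAt (fun c => (P.focal + t * (c - P.focal)) / c) P.focal :=
      ContinuousAt.div (by fun_prop) (by fun_prop) h2
    exact (((e1.const_mul t).sqrt).pow _).mul e2
  have hval := hcont.tendsto
  have h2 : P.focal ≠ 0 := hd.ne'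
  have h3 : (2 * P.focal + t * (P.focal - P.focal)) / (P.focal + P.focal) = 1 := by
    rw [sub_self, mul_zero, add_zero, ← two_mul]; exact div_self (by positivity)
  rw [h3, sub_self, mul_zero, add_zero, div_self h2, mul_one, mul_one] at hval
  exact hval.mono_left nhdsWithin_le_nhds

theorem integral_sqrt_pow (hn : 1 ≤ n) :
    ∫ t in Set.Ioc (0 : ℝ) 1, (1 - √t ^ (n - 1)) = ((n : ℝ) - 1) / ((n : ℝ) + 1) := by
  have h1 : ∀ t ∈ Set.Ioc (0 : ℝ) 1, 1 - √t ^ (n - 1) = 1 - t ^ (((n : ℝ) - 1) / 2) := by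
    intro t ht
    rw [Real.sqrt_eq_rpow, ← Real.rpow_natCast, ← Real.rpow_mul ht.1.le, Nat.cast_sub hn]
    congr 2; push_cast; ring
  have hn' : (1 : ℝ) ≤ n := by exact_mod_cast hn
  rw [setIntegral_congr_fun measurableSet_Ioc h1, ← intervalIntegral.integral_of_le zero_le_one,
    intervalIntegral.integral_sub (by simp) (intervalIntegral.intervalIntegrable_rpow' (by linarith)),
    integral_rpow (Or.inl (by linarith))]
  have h2 : (n : ℝ) + 1 ≠ 0 := by linarith
  rw [Real.zero_rpow (by linarith), Real.one_rpow, intervalIntegral.integral_const,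
    show ((n : ℝ) - 1) / 2 + 1 = (n + 1) / 2 by ring, smul_eq_mul]
  field_simp
  ring

theorem tendsto_integral_heuristic (hn : 2 ≤ n)
    (h : segment ℝ P.start P.goal ⊆ interior P.free) :
    Tendsto (fun c => ∫ y, (P.heuristic y - P.focal) / (c - P.focal) ∂(P.sampleLaw c))
      (𝓝[>] P.focal) (𝓝 (((n : ℝ) - 1) / ((n : ℝ) + 1))) := by
  obtain ⟨c₁, hc₁, hsub⟩ := P.exists_hyperspheroid_subset isOpen_interior h
  have hev : ∀ᶠ c in 𝓝[>] P.focal, c ∈ Set.Ioo P.focal c₁ := Ioo_mem_nhdsGT hc₁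
  have heq : ∀ᶠ c in 𝓝[>] P.focal, ∫ t in Set.Ioc (0 : ℝ) 1,
        (1 - P.spheroidVolume (P.focal + t * (c - P.focal)) / P.spheroidVolume c) =
      ∫ y, (P.heuristic y - P.focal) / (c - P.focal) ∂(P.sampleLaw c) := by
    filter_upwards [hev] with c hc
    exact (P.integral_heuristic hc.1 fun x hx =>
      interior_subset (hsub (lt_trans hx hc.2))).symm
  refine Tendsto.congr' heq ?_
  rw [← integral_sqrt_pow (n := n) (by omega)]
  refine tendsto_integral_filter_of_dominated_convergence (fun _ => 1) ?_ ?_ (by simp) ?_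
  · refine Eventually.of_forall fun c => Measurable.aestronglyMeasurable ?_
    have := P.continuous_spheroidVolume.measurable
    fun_prop
  · filter_upwards [hev] with c hc
    refine (ae_restrict_iff' measurableSet_Ioc).2 (ae_of_all _ fun t ht => ?_)
    have hcd : 0 < c - P.focal := sub_pos.2 hc.1
    have h1 : P.focal < P.focal + t * (c - P.focal) := by nlinarith [ht.1]
    have h2 : P.focal + t * (c - P.focal) ≤ c := by nlinarith [ht.2]
    have h3 := P.spheroidVolume_pos hc.1
    have h4 := P.spheroidVolume_pos h1
    have h5 : P.spheroidVolume (P.focal + t * (c - P.focal)) ≤ P.spheroidVolume c := by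
      rw [← P.volume_real_hyperspheroid hc.1, ← P.volume_real_hyperspheroid h1]
      exact measureReal_mono (fun y hy => lt_of_lt_of_le hy h2) (P.volume_hyperspheroid_lt_top c).ne
    have h6 := div_le_one_of_le₀ h5 h3.le
    have h7 := div_pos h4 h3
    rw [Real.norm_of_nonneg (by linarith)]
    linarith
  · refine (ae_restrict_iff' measurableSet_Ioc).2 (ae_of_all _ fun t _ => ?_)
    exact (P.tendsto_spheroidVolume_ratio t).const_sub 1

end Problem

end InformedRRT

/-! ### The exact rate without obstacles -/

namespace InformedRRT

variable {n : ℕ} {P : Problem n} {cfg : Config} {T T₀ : Tree n}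

theorem Tree.Inv.pos_mem_free (hT : T.Inv P cfg) {v : ℕ} (hv : v ∈ T.verts) : T.pos v ∈ P.free :=
  hT.edge_free v hv (right_mem_segment ℝ _ _)

namespace Problem.IsUnobstructed

variable (hP : P.IsUnobstructed)
include hP

theorem free_eq : P.free = closure P.stateSpace := by
  rw [Problem.free, hP.1, Set.sdiff_empty]

theorem isFree {a b : Space n} (ha : a ∈ P.free) (hb : b ∈ P.free) : P.IsFree a b := by
  rw [hP.free_eq] at ha hb
  rw [Problem.IsFree, hP.free_eq]
  exact hP.2.1.closure.segment_subset ha hb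

theorem segment_subset : segment ℝ P.start P.goal ⊆ interior P.free := by
  rw [hP.free_eq]
  exact (hP.2.1.interior.segment_subset hP.2.2.1 hP.2.2.2).trans (interior_mono subset_closure)

theorem optCost_eq (hT : T.Inv P cfg) : P.optCost = P.focal := by
  refine le_antisymm ?_ hT.dist_le_optCost
  exact (hP.isFree P.start_mem P.goal_mem).hasPath.optCost_le (norm_nonneg _)

end Problem.IsUnobstructed

theorem steer_top (v x : Space n) : steer ⊤ v x = x := if_pos le_top

/-- With an infinite rewiring neighbourhood and no obstacles, a sample in the informed set becomes
the only interior vertex of the new solution. -/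
theorem Tree.Inv.cost_step_eq (hT : T.Inv P cfg) (hP : P.IsUnobstructed) (hcfg : cfg.IsInfinite)
    {y : Space n} (hy : y ∈ P.informedSet (T.cost P)) :
    (InformedRRT.step P cfg T y).cost P = P.heuristic y := by
  classical
  have hnew : newState cfg T y = y := by rw [newState, hcfg.1, steer_top]
  have hmem := hT.nearest_mem y
  have hfree : ∀ v ∈ T.verts, P.IsFree (T.pos v) y := fun v hv =>
    hP.isFree (hT.pos_mem_free hv) hy.1
  have hnear : ∀ v ∈ T.verts, v ∈ T.near P cfg y := fun v hv =>
    Finset.mem_filter.2 ⟨hv, by simp [hcfg.1, hcfg.2]⟩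
  have h0 : P.IsFree (T.pos (T.nearest y)) (newState cfg T y) := by
    rw [hnew]; exact hfree _ hmem
  -- The root is among the candidates for the parent, so the new state is reached at its straight
  -- distance from the start. This is cheap enough for the goal vertex to be rewired. The reverse
  -- inequality is the triangle inequality.
  have hnc : T.newCost P cfg (T.nearest y) y ≤ ‖y - P.start‖ := by
    have := (Tree.bestParent_spec (T := T) P cfg (T.nearest y) y).2 0
      (Finset.mem_insert_of_mem (Finset.mem_filter.2 ⟨hnear 0 hT.root_mem, hfree 0 hT.root_mem⟩))
    rwa [hT.costToCome_root, zero_add, hT.root_pos] at this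
  obtain ⟨γ, hγ, hg, hc⟩ := Tree.exists_cost_eq (P := P) hT.has_solution
  have hlt : T.newCost P cfg (T.nearest y) y + ‖T.pos γ - y‖ < T.costToCome γ := by
    have : ‖y - P.start‖ + ‖P.goal - y‖ < T.cost P := hy.2
    rw [hg, hc]; linarith
  have hrew : γ ∈ T.rewired P cfg (T.nearest y) y :=
    Tree.mem_rewired.2 ⟨hnear γ hγ, hlt, by rw [hg]; exact hP.isFree hy.1 P.goal_mem⟩
  have hle : (InformedRRT.step P cfg T y).cost P ≤ P.heuristic y := by
    rw [hT.cost_step h0, hnew]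
    refine (Tree.cost_le (v := γ) (Finset.mem_insert_of_mem hγ)
      (by rw [hT.extend_pos_old hγ, hg])).trans ?_
    rw [hT.extend_cost_rewired hmem hrew, hg, Problem.heuristic]
    linarith
  refine le_antisymm hle ?_
  have := hT.heuristic_le_cost_step (x := y) (lt_of_le_of_lt hle hy.2)
  rwa [hnew] at this

theorem costAt_le_cost (hT : T₀.Inv P cfg) (x : ℕ → Space n) (i : ℕ) :
    (treeAt P cfg T₀ x i).cost P ≤ T₀.cost P := by
  have h := antitone_costAt hT x (Nat.zero_le i)
  rwa [costAt, costAt, treeAt] at h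

section Run

universe u

variable {Ω : Type u} [MeasurableSpace Ω] {μ : Measure Ω} [IsProbabilityMeasure μ]
  {x : ℕ → Ω → Space n}

variable (hx : IsRun P cfg T₀ μ x)
include hx

/-- Almost surely, every sample lies in the informed set, off the segment from start to goal. -/
theorem IsRun.ae_mem_informedSet (hn : 2 ≤ n) : ∀ᵐ ω ∂μ, ∀ i,
    x i ω ∈ P.informedSet (costAt P cfg T₀ (fun j => x j ω) i) ∧ P.focal < P.heuristic (x i ω) := by
  have h := hx.ae_not_mem
    (p := fun T y => ¬ (y ∈ P.informedSet (T.cost P) ∧ P.focal < P.heuristic y)) ?_ ?_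
  · filter_upwards [h] with ω hω i
    exact not_not.1 (hω i)
  · intro α _ f y hf hy
    exact (measurableSet_setOfPred.1 ((measurableSet_mem_informedSet P hy (hf.cost P)).inter
      (measurableSet_lt measurable_const (P.continuous_heuristic.measurable.comp hy)))).not
  · intro i ω
    refine measure_mono_null (t := (P.informedSet (costAt P cfg T₀ (fun j => x j ω) i))ᶜ ∪
      {y | P.heuristic y ≤ P.focal}) (fun y hy => ?_) (measure_union_null
        (P.sampleLaw_informedSet_compl _)
        (P.sampleLaw_absolutelyContinuous _ (P.volume_heuristic_le_focal hn)))
    by_contra hcon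
    simp only [Set.mem_union, Set.mem_compl_iff, Set.mem_ofPred_eq, not_or, not_not, not_le] at hcon
    exact hy hcon

variable (hT₀ : T₀.Inv P cfg) (hP : P.IsUnobstructed) (hcfg : cfg.IsInfinite)
include hT₀ hP hcfg

/-- Each new cost is the heuristic cost of a sample, and samples almost surely miss the segment from
start to goal. -/
theorem IsRun.ae_focal_lt_costAt (hn : 2 ≤ n) (hc : P.focal < T₀.cost P) :
    ∀ᵐ ω ∂μ, ∀ i, P.focal < costAt P cfg T₀ (fun j => x j ω) i := by
  filter_upwards [hx.ae_mem_informedSet hn] with ω hω i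
  cases i with
  | zero => exact hc
  | succ i =>
    have := (inv_treeAt hT₀ (fun j => x j ω) i).cost_step_eq hP hcfg (hω i).1
    exact lt_of_lt_of_eq (hω i).2 this.symm

omit hT₀ hx [IsProbabilityMeasure μ] in
open Classical in
/-- Sampling improves the solution beyond any level with a fixed positive probability. -/
theorem Tree.Inv.lintegral_cost_step_level (hT : T.Inv P cfg)
    (hvol : volume (P.informedSet (T.cost P)) ≠ 0) {c L : ℝ} (hc : T.cost P ≤ c) :
    ∫⁻ y, (if L ≤ (InformedRRT.step P cfg T y).cost P then 1 else 0) ∂(P.sampleLaw (T.cost P)) ≤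
      (1 - (volume (P.informedSet c))⁻¹ * volume (P.informedSet L)) *
        if L ≤ T.cost P then 1 else 0 := by
  have := P.isProbabilityMeasure_sampleLaw hvol
  have hmeas : MeasurableSet (P.informedSet L) := P.measurableSet_informedSet _
  split_ifs with hcε
  · rw [mul_one]
    calc _ ≤ ∫⁻ y, (P.informedSet L)ᶜ.indicator 1 y ∂(P.sampleLaw (T.cost P)) := by
          refine lintegral_mono_ae ?_
          filter_upwards [P.ae_mem_informedSet (T.cost P)] with y hy
          split_ifs with h1
          · rw [hT.cost_step_eq hP hcfg hy] at h1
            have : y ∈ (P.informedSet L)ᶜ := fun h3 => absurd h3.2 (not_lt.2 h1)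
            rw [Set.indicator_of_mem this, Pi.one_apply]
          · exact zero_le
      _ = 1 - P.sampleLaw (T.cost P) (P.informedSet L) := by
          rw [lintegral_indicator_one hmeas.compl, prob_compl_eq_one_sub hmeas]
      _ ≤ _ := by
          refine tsub_le_tsub_left ?_ _
          rw [P.sampleLaw_apply, Set.inter_eq_right.2 (P.informedSet_mono hcε)]
          exact mul_le_mul_left (ENNReal.inv_le_inv.2 (measure_mono (P.informedSet_mono hc))) _
  · have : ∀ y, ¬ L ≤ (InformedRRT.step P cfg T y).cost P :=
      fun y h => hcε (h.trans (hT.cost_step_le y))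
    simp only [if_neg (this _), lintegral_zero, zero_le]

/-- The informed set only shrinks, so a sample below the level L is always at least as likely as
under the uniform law on the first informed set. -/
theorem IsRun.measure_le_costAt_succ {L : ℝ} (i : ℕ) :
    μ {ω | L ≤ costAt P cfg T₀ (fun j => x j ω) (i + 1)} ≤
      (1 - (volume (P.informedSet (T₀.cost P)))⁻¹ * volume (P.informedSet L)) *
        μ {ω | L ≤ costAt P cfg T₀ (fun j => x j ω) i} := by
  classical
  have hΨ : MeasTreeFun.{u} fun T y =>
      if L ≤ (step P cfg T y).cost P then (1 : ℝ≥0∞) else 0 := fun α _ f y hf hy =>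
    Measurable.ite (measurableSet_le measurable_const ((hf.step hy).cost P)) measurable_const
      measurable_const
  have hms : ∀ i, MeasurableSet {ω | L ≤ costAt P cfg T₀ (fun j => x j ω) i} := fun i =>
    measurableSet_le measurable_const ((hx.measTree i).cost P)
  have h := hx.lintegral_mul_tree i (g := fun _ => 1) measurable_const hΨ
  simp only [one_mul] at h
  have h1 : ∀ i, μ {ω | L ≤ costAt P cfg T₀ (fun j => x j ω) i} =
      ∫⁻ ω, (if L ≤ costAt P cfg T₀ (fun j => x j ω) i then 1 else 0) ∂μ := by
    intro i
    rw [← lintegral_indicator_one (hms i)]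
    rfl
  have h2 : ∫⁻ ω, (if L ≤ costAt P cfg T₀ (fun j => x j ω) (i + 1) then (1 : ℝ≥0∞) else 0) ∂μ =
      ∫⁻ ω, (if L ≤ (step P cfg (treeAt P cfg T₀ (fun j => x j ω) i) (x i ω)).cost P
        then (1 : ℝ≥0∞) else 0) ∂μ := rfl
  rw [h1, h1, h2, h, ← lintegral_const_mul]
  · refine lintegral_mono_ae ?_
    filter_upwards [hx.ae_volume_informedSet_ne_zero] with ω hω
    exact (inv_treeAt hT₀ (fun j => x j ω) i).lintegral_cost_step_level hP hcfg (hω i) (costAt_le_cost hT₀ _ i)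
  · exact Measurable.ite (hms i) measurable_const measurable_const

theorem IsRun.ae_tendsto_costAt : ∀ᵐ ω ∂μ,
    Tendsto (costAt P cfg T₀ (fun j => x j ω)) atTop (𝓝 P.focal) := by
  -- The free space contains a neighbourhood of the segment, hence a whole thin hyperspheroid.
  have hpos : ∀ ε : ℝ, 0 < ε → volume (P.informedSet (P.focal + ε)) ≠ 0 := by
    intro ε hε h0
    obtain ⟨c₁, hc₁, hsub⟩ := P.exists_hyperspheroid_subset isOpen_interior hP.segment_subset
    have hc : P.focal < min c₁ (P.focal + ε) := lt_min hc₁ (by linarith)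
    have h1 : P.hyperspheroid (min c₁ (P.focal + ε)) ⊆ P.informedSet (P.focal + ε) := fun y hy =>
      ⟨interior_subset (hsub (lt_of_lt_of_le (show P.heuristic y < _ from hy) (min_le_left _ _))),
        lt_of_lt_of_le (show P.heuristic y < _ from hy) (min_le_right _ _)⟩
    have h2 := P.volume_real_hyperspheroid hc
    rw [measureReal_def, measure_mono_null h1 h0, ENNReal.toReal_zero] at h2
    exact (P.spheroidVolume_pos hc).ne h2
  have key : ∀ ε : ℝ, 0 < ε → ∀ᵐ ω ∂μ, ∃ i, costAt P cfg T₀ (fun j => x j ω) i < P.focal + ε := by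
    intro ε hε
    set q : ℝ≥0∞ := 1 - (volume (P.informedSet (T₀.cost P)))⁻¹ *
      volume (P.informedSet (P.focal + ε)) with hq
    have hq1 : q < 1 := by
      refine ENNReal.sub_lt_self ENNReal.one_ne_top one_ne_zero ?_
      exact mul_ne_zero (ENNReal.inv_ne_zero.2 (P.volume_informedSet_lt_top _).ne) (hpos ε hε)
    have hpow : ∀ i, μ {ω | P.focal + ε ≤ costAt P cfg T₀ (fun j => x j ω) i} ≤ q ^ i := by
      intro i
      induction i with
      | zero => simpa using prob_le_one
      | succ i ih =>
        refine (hx.measure_le_costAt_succ hT₀ hP hcfg i).trans ?_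
        rw [pow_succ']
        gcongr
    have h0 : μ {ω | ∀ i, P.focal + ε ≤ costAt P cfg T₀ (fun j => x j ω) i} = 0 := by
      refine le_antisymm (ge_of_tendsto' (ENNReal.tendsto_pow_atTop_nhds_zero_of_lt_one hq1)
        fun i => (measure_mono fun ω hω => ?_).trans (hpow i)) zero_le
      exact hω i
    refine mem_ae_iff.2 (measure_mono_null (fun ω hω => ?_) h0)
    exact fun i => not_lt.1 fun hcon => hω ⟨i, hcon⟩
  have hall : ∀ᵐ ω ∂μ, ∀ k : ℕ, ∃ i,
      costAt P cfg T₀ (fun j => x j ω) i < P.focal + 1 / ((k : ℝ) + 1) :=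
    ae_all_iff.2 fun k => key _ (by positivity)
  filter_upwards [hall] with ω hω
  rw [Metric.tendsto_atTop]
  intro ε hε
  obtain ⟨k, hk⟩ := exists_nat_one_div_lt hε
  obtain ⟨i, hi⟩ := hω k
  refine ⟨i, fun j hj => ?_⟩
  have h1 := antitone_costAt hT₀ (fun j => x j ω) hj
  have h2 : P.focal ≤ costAt P cfg T₀ (fun j => x j ω) j :=
    (inv_treeAt hT₀ (fun j => x j ω) j).dist_le_cost
  rw [Real.dist_eq, abs_of_nonneg (by linarith)]
  linarith

omit hT₀ hx in
theorem Tree.Inv.expectedRatio_eq (hT : T.Inv P cfg) : expectedRatio P cfg T =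
    ∫ y, (P.heuristic y - P.focal) / (T.cost P - P.focal) ∂(P.sampleLaw (T.cost P)) := by
  rw [expectedRatio, hP.optCost_eq hT]
  refine integral_congr_ae ?_
  filter_upwards [P.ae_mem_informedSet (T.cost P)] with y hy
  rw [hT.cost_step_eq hP hcfg hy]

/-- The exact rate of convergence without obstacles. -/
theorem IsRun.ae_rate_of_isUnobstructed (hn : 2 ≤ n) (hc : P.optCost < T₀.cost P) :
    ∀ᵐ ω ∂μ, (∀ i, P.optCost < costAt P cfg T₀ (fun j => x j ω) i) ∧
      Tendsto (costAt P cfg T₀ (fun j => x j ω)) atTop (𝓝 P.optCost) ∧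
      Tendsto (ratioAt P cfg T₀ (fun j => x j ω)) atTop (𝓝 (((n : ℝ) - 1) / ((n : ℝ) + 1))) ∧
      expectedRate P cfg T₀ (fun j => x j ω) = ((n : ℝ) - 1) / ((n : ℝ) + 1) := by
  rw [hP.optCost_eq hT₀] at hc ⊢
  filter_upwards [hx.ae_focal_lt_costAt hT₀ hP hcfg hn hc, hx.ae_tendsto_costAt hT₀ hP hcfg]
    with ω h1 h2
  have h3 : Tendsto (ratioAt P cfg T₀ (fun j => x j ω)) atTop
      (𝓝 (((n : ℝ) - 1) / ((n : ℝ) + 1))) := by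
    have h4 : Tendsto (costAt P cfg T₀ (fun j => x j ω)) atTop (𝓝[>] P.focal) :=
      tendsto_nhdsWithin_iff.2 ⟨h2, Eventually.of_forall h1⟩
    refine ((P.tendsto_integral_heuristic hn hP.segment_subset).comp h4).congr fun i => ?_
    exact ((inv_treeAt hT₀ (fun j => x j ω) i).expectedRatio_eq hP hcfg).symm
  exact ⟨h1, h2, h3, h3.limsup_eq⟩

end Run

end InformedRRT

/-! ### Exponential decay of the error under small ratios -/

namespace InformedRRT

variable {n : ℕ} {P : Problem n} {cfg : Config} {T T₀ : Tree n}

/-- The error of the current solution. -/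
noncomputable def Tree.excess (P : Problem n) (T : Tree n) : ℝ≥0∞ :=
  ENNReal.ofReal (T.cost P - P.optCost)

theorem Tree.excess_ne_top : T.excess P ≠ ⊤ := ENNReal.ofReal_ne_top

theorem Tree.Inv.excess_step_le (hT : T.Inv P cfg) (y : Space n) :
    (InformedRRT.step P cfg T y).excess P ≤ T.excess P :=
  ENNReal.ofReal_le_ofReal (sub_le_sub_right (hT.cost_step_le y) _)

theorem excess_treeAt_antitone (hT : T₀.Inv P cfg) (x : ℕ → Space n) :
    Antitone fun i => (treeAt P cfg T₀ x i).excess P :=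
  antitone_nat_of_succ_le fun i => (inv_treeAt hT x i).excess_step_le (x i)

theorem excess_treeAt_le (hT : T₀.Inv P cfg) (x : ℕ → Space n) (i : ℕ) :
    (treeAt P cfg T₀ x i).excess P ≤ T₀.excess P :=
  ENNReal.ofReal_le_ofReal (sub_le_sub_right (costAt_le_cost hT x i) _)

theorem measTreeFun_excess_step :
    MeasTreeFun.{u} fun (T : Tree n) y => (step P cfg T y).excess P :=
  fun _ _ _ _ hf hy => (((hf.step hy).cost P).sub_const _).ennreal_ofReal

theorem Tree.Inv.lintegral_excess_step (hT : T.Inv P cfg) :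
    ∫⁻ y, (InformedRRT.step P cfg T y).excess P ∂(P.sampleLaw (T.cost P)) =
      ENNReal.ofReal (expectedRatio P cfg T) * T.excess P := by
  rw [expectedRatio, ofReal_integral_eq_lintegral_ofReal hT.integrable_ratio
    (ae_of_all _ fun y => (hT.ratio_mem_Icc y).1), ← lintegral_mul_const]
  · refine lintegral_congr fun y => ?_
    rw [Tree.excess, Tree.excess, ← ENNReal.ofReal_mul (hT.ratio_mem_Icc y).1]
    -- At zero error the ratio is a division by zero, but then the next error vanishes as well.
    rcases hT.optCost_le_cost.eq_or_lt with h | h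
    · have h1 := hT.cost_step_le y
      rw [← h, sub_self, mul_zero, ENNReal.ofReal_zero, ENNReal.ofReal_eq_zero]
      linarith
    · rw [div_mul_cancel₀ _ (sub_pos.2 h).ne']
  · exact (((measurable_cost_step T).sub_const _).div_const _).ennreal_ofReal

section Run

universe u

variable {Ω : Type u} {x : ℕ → Ω → Space n}

theorem measurable_excess {i j : ℕ} (hij : i ≤ j) : Measurable[past x j]
    fun ω => (treeAt P cfg T₀ (fun j => x j ω) i).excess P :=
  ((measurable_costAt hij).sub_const _).ennreal_ofReal

theorem measurable_ratioAt (hT₀ : T₀.Inv P cfg) {i j : ℕ} (hij : i ≤ j) : Measurable[past x j]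
    fun ω => ratioAt P cfg T₀ (fun j => x j ω) i := by
  have h1 : MeasTreeFun.{u} fun (T : Tree n) y =>
      ENNReal.ofReal (((step P cfg T y).cost P - P.optCost) / (T.cost P - P.optCost)) :=
    fun _ _ _ _ hf hy => ((((hf.step hy).cost P).sub_const _).div
      ((hf.cost P).sub_const _)).ennreal_ofReal
  have h2 := (measurable_lintegral_sampleLaw (P := P) (cfg := cfg) (T₀ := T₀) (x := x) h1 i).mono
    (past_mono hij) le_rfl
  have h3 := h2.ennreal_toReal
  convert h3 using 1
  funext ω
  have hT := inv_treeAt hT₀ (fun j => x j ω) i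
  exact (integral_eq_lintegral_of_nonneg_ae (ae_of_all _ fun y => (hT.ratio_mem_Icc y).1)
    hT.integrable_ratio.aestronglyMeasurable)

theorem measurableSet_ratioAt_le (hT₀ : T₀.Inv P cfg) (ρ : ℝ) {i j : ℕ} (hij : i ≤ j) :
    MeasurableSet[past x j] {ω | ratioAt P cfg T₀ (fun j => x j ω) i ≤ ρ} :=
  measurable_ratioAt hT₀ hij measurableSet_Iic

variable [MeasurableSpace Ω] {μ : Measure Ω} [IsProbabilityMeasure μ]
  (hx : IsRun P cfg T₀ μ x) (hT₀ : T₀.Inv P cfg)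
include hx hT₀

/-- Where the expected ratio is small, the error contracts on average. -/
theorem IsRun.lintegral_excess_succ_le {ρ : ℝ} {i : ℕ} {g : Ω → ℝ≥0∞}
    (hg : Measurable[past x i] g)
    (hgρ : ∀ ω, ρ < ratioAt P cfg T₀ (fun j => x j ω) i → g ω = 0) :
    ∫⁻ ω, g ω * (treeAt P cfg T₀ (fun j => x j ω) (i + 1)).excess P ∂μ ≤
      ENNReal.ofReal ρ * ∫⁻ ω, g ω * (treeAt P cfg T₀ (fun j => x j ω) i).excess P ∂μ := by
  have h := hx.lintegral_mul_tree i hg (measTreeFun_excess_step (P := P) (cfg := cfg))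
  have h1 : ∫⁻ ω, g ω * (treeAt P cfg T₀ (fun j => x j ω) (i + 1)).excess P ∂μ =
    ∫⁻ ω, g ω * (step P cfg (treeAt P cfg T₀ (fun j => x j ω) i) (x i ω)).excess P ∂μ := rfl
  have h5 := lintegral_const_mul (μ := μ) (ENNReal.ofReal ρ)
    (f := fun ω => g ω * (treeAt P cfg T₀ (fun j => x j ω) i).excess P)
    ((hg.mono (hx.past_le i) le_rfl).mul ((measurable_excess le_rfl).mono (hx.past_le i) le_rfl))
  rw [h1, h, ← h5]
  refine lintegral_mono fun ω => ?_
  have hT := inv_treeAt hT₀ (fun j => x j ω) i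
  have h2 : ∫⁻ y, (step P cfg (treeAt P cfg T₀ (fun j => x j ω) i) y).excess P
      ∂(P.sampleLaw (costAt P cfg T₀ (fun j => x j ω) i)) = _ := hT.lintegral_excess_step
  rw [h2, mul_left_comm]
  by_cases hr : ρ < ratioAt P cfg T₀ (fun j => x j ω) i
  · simp [hgρ ω hr]
  · exact mul_le_mul_left (ENNReal.ofReal_le_ofReal (not_lt.1 hr)) _

open Classical in
/-- If the expected ratios are bounded away from one, the error vanishes exponentially fast. -/
theorem IsRun.ae_excess_le {ρ ρ' : ℝ} (hρ : 0 ≤ ρ) (hρ' : ρ < ρ') (I : ℕ) :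
    ∀ᵐ ω ∂μ, (∀ i ≥ I, ratioAt P cfg T₀ (fun j => x j ω) i ≤ ρ) →
      ∃ C : ℝ≥0∞, C ≠ ⊤ ∧ ∀ i, (treeAt P cfg T₀ (fun j => x j ω) (I + i)).excess P ≤
        C * ENNReal.ofReal ρ' ^ i := by
  -- `g i` marks the runs whose ratios at the times I, …, I + i - 1 are at most ρ. It is determined
  -- before the sample I + i is drawn, and `g (i + 1)` requires a small ratio at time I + i, so the
  -- integral of `g i * e i` contracts by ρ in every step.
  set g : ℕ → Ω → ℝ≥0∞ := fun i ω =>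
    if ∀ k, I ≤ k → k < I + i → ratioAt P cfg T₀ (fun j => x j ω) k ≤ ρ then 1 else 0 with hg
  set e : ℕ → Ω → ℝ≥0∞ := fun i ω => (treeAt P cfg T₀ (fun j => x j ω) (I + i)).excess P with he
  have hset : ∀ i, MeasurableSet[past x (I + i)]
      {ω | ∀ k, I ≤ k → k < I + i → ratioAt P cfg T₀ (fun j => x j ω) k ≤ ρ} := by
    intro i
    simp only [Set.ofPred_forall]
    refine MeasurableSet.iInter fun k => MeasurableSet.iInter fun _ => MeasurableSet.iInter fun hk => ?_
    exact measurableSet_ratioAt_le hT₀ ρ hk.le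
  have hgm : ∀ i, Measurable[past x (I + i)] (g i) := fun i =>
    Measurable.ite (hset i) measurable_const measurable_const
  have hem : ∀ i, Measurable (e i) := fun i =>
    (measurable_excess le_rfl).mono (hx.past_le (I + i)) le_rfl
  have hgm' : ∀ i, Measurable (g i) := fun i => (hgm i).mono (hx.past_le _) le_rfl
  have hstep : ∀ i, ∫⁻ ω, g (i + 1) ω * e (i + 1) ω ∂μ ≤
      ENNReal.ofReal ρ * ∫⁻ ω, g i ω * e i ω ∂μ := by
    intro i
    set R : Set Ω := {ω | ratioAt P cfg T₀ (fun j => x j ω) (I + i) ≤ ρ}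
    have hR : MeasurableSet[past x (I + i)] R :=
      measurableSet_ratioAt_le hT₀ ρ le_rfl
    have h := hx.lintegral_excess_succ_le hT₀ (ρ := ρ) (i := I + i) (g := R.indicator (g i))
      ((hgm i).indicator hR) fun ω hω => Set.indicator_of_notMem (show ω ∉ R from not_le.2 hω) _
    refine (lintegral_mono fun ω => ?_).trans (h.trans (mul_le_mul_right (lintegral_mono fun ω => ?_) _))
    · refine mul_le_mul_left ?_ _
      simp only [hg]
      split_ifs with h1
      · rw [Set.indicator_of_mem (show ω ∈ R from h1 (I + i) (by omega) (by omega)),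
          if_pos fun k h2 h3 => h1 k h2 (by omega)]
      · exact zero_le
    · exact mul_le_mul_left (Set.indicator_le_self _ _ _) _
  have hpow : ∀ i, ∫⁻ ω, g i ω * e i ω ∂μ ≤ ENNReal.ofReal ρ ^ i * T₀.excess P := by
    intro i
    induction i with
    | zero =>
      calc ∫⁻ ω, g 0 ω * e 0 ω ∂μ ≤ ∫⁻ _, T₀.excess P ∂μ := lintegral_mono fun ω => by
            have h1 : g 0 ω ≤ 1 := by simp only [hg]; split_ifs <;> simp
            have h2 : e 0 ω ≤ T₀.excess P :=
              excess_treeAt_le hT₀ (fun j => x j ω) _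
            simpa using mul_le_mul' h1 h2
        _ = ENNReal.ofReal ρ ^ 0 * T₀.excess P := by simp
    | succ i ih =>
      refine (hstep i).trans ?_
      rw [pow_succ', mul_assoc]
      exact mul_le_mul_right ih _
  have hρ'0 : 0 < ρ' := hρ.trans_lt hρ'
  have hr0 : ENNReal.ofReal ρ' ≠ 0 := by simpa using hρ'0
  -- Weighted by ρ'^(-i), the terms form a series with finite integral. Its value at ω is the
  -- constant C, since each term is at most the sum.
  have hsum : ∫⁻ ω, ∑' i, (ENNReal.ofReal ρ' ^ i)⁻¹ * (g i ω * e i ω) ∂μ ≠ ⊤ := by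
    have hm : ∀ i, AEMeasurable (fun ω => (ENNReal.ofReal ρ' ^ i)⁻¹ * (g i ω * e i ω)) μ :=
      fun i => (((hgm' i).mul (hem i)).const_mul _).aemeasurable
    rw [lintegral_tsum hm]
    have hq : ENNReal.ofReal ρ / ENNReal.ofReal ρ' < 1 :=
      (ENNReal.div_lt_iff (Or.inl hr0) (Or.inl ENNReal.ofReal_ne_top)).2
        (by rw [one_mul]; exact (ENNReal.ofReal_lt_ofReal_iff hρ'0).2 hρ')
    have hle : ∀ i, ∫⁻ ω, (ENNReal.ofReal ρ' ^ i)⁻¹ * (g i ω * e i ω) ∂μ ≤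
        (ENNReal.ofReal ρ / ENNReal.ofReal ρ') ^ i * T₀.excess P := by
      intro i
      have hge : Measurable fun ω => g i ω * e i ω := (hgm' i).mul (hem i)
      rw [lintegral_const_mul _ hge, div_eq_mul_inv, mul_pow, ENNReal.inv_pow,
        mul_comm (_ ^ i) (_ ^ i), mul_assoc]
      exact mul_le_mul_right (hpow i) _
    refine ((ENNReal.tsum_le_tsum hle).trans_lt ?_).ne
    rw [ENNReal.tsum_mul_right, ENNReal.tsum_geometric]
    refine ENNReal.mul_lt_top ?_ Tree.excess_ne_top.lt_top
    exact ENNReal.inv_lt_top.2 (tsub_pos_of_lt hq)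
  have hfin := ae_lt_top (Measurable.tsum fun i => ((hgm' i).mul (hem i)).const_mul _)
    hsum
  filter_upwards [hfin] with ω hω hr
  refine ⟨_, hω.ne, fun i => ?_⟩
  have h1 := ENNReal.le_tsum (f := fun i => (ENNReal.ofReal ρ' ^ i)⁻¹ * (g i ω * e i ω)) i
  have h2 : g i ω = 1 := if_pos fun k hk _ => hr k hk
  rw [h2, one_mul] at h1
  have h3 : ENNReal.ofReal ρ' ^ i ≠ 0 := pow_ne_zero _ hr0
  have h4 : ENNReal.ofReal ρ' ^ i ≠ ⊤ := ENNReal.pow_ne_top ENNReal.ofReal_ne_top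
  calc e i ω = (ENNReal.ofReal ρ' ^ i)⁻¹ * e i ω * ENNReal.ofReal ρ' ^ i := by
        rw [mul_right_comm, ENNReal.inv_mul_cancel h3 h4, one_mul]
    _ ≤ _ := mul_le_mul_left h1 _

end Run

end InformedRRT

/-! ### Real estimates behind the potential argument -/

namespace InformedRRT

section RealEstimates

/-- The factor by which the potential `E ^ s * W ^ (-1/4)` changes when `E` and `W` decrease. -/
theorem potential_le {p x₀ x₁ E E' W W' : ℝ} (hp : 0 < p) (hx₀ : 0 < x₀) (hx : x₀ ≤ x₁)
    (hE' : 0 < E') (hW' : 0 < W') (hE : E' ≤ E) (hW : W' ≤ W)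
    (h : ∀ x : ℚ, x₀ ≤ x → (x : ℝ) ≤ x₁ → W' < x * W → E' ≤ 4⁻¹ * (x : ℝ) ^ p * E) :
    E' ^ (1 / (4 * p)) * W' ^ (-(1 / 4) : ℝ) ≤
      ((1 / 2) ^ (1 / (4 * p)) + x₁ ^ (-(1 / 4) : ℝ) * (if 4⁻¹ * x₁ ^ p * E < E' then 1 else 0) +
        x₀ ^ (1 / 4 : ℝ) * (W' ^ (-(1 / 2) : ℝ) * W ^ (1 / 2 : ℝ))) *
      (E ^ (1 / (4 * p)) * W ^ (-(1 / 4) : ℝ)) := by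
  have hE0 : 0 < E := hE'.trans_le hE
  have hW0 : 0 < W := hW'.trans_le hW
  have hx₁ : 0 < x₁ := hx₀.trans_le hx
  obtain ⟨Z, rfl⟩ : ∃ Z, E' = Z * E := ⟨E' / E, by field_simp⟩
  obtain ⟨X, rfl⟩ : ∃ X, W' = X * W := ⟨W' / W, by field_simp⟩
  have hZ0 : 0 < Z := pos_of_mul_pos_left hE' hE0.le
  have hX0 : 0 < X := pos_of_mul_pos_left hW' hW0.le
  have hZ1 : Z ≤ 1 := le_of_mul_le_mul_right (by linarith) hE0
  -- This exponent turns a power x^p into x^(1/4), so that the potential is constant when E is a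
  -- multiple of W^p.
  set s : ℝ := 1 / (4 * p) with hs
  have hs0 : 0 < s := by positivity
  have hps : p * s = 1 / 4 := by rw [hs]; field_simp
  have hZs : Z ^ s ≤ 1 := Real.rpow_le_one hZ0.le hZ1 hs0.le
  have hWW : (X * W) ^ (-(1 / 2) : ℝ) * W ^ (1 / 2 : ℝ) = X ^ (-(1 / 2) : ℝ) := by
    rw [Real.mul_rpow hX0.le hW0.le, mul_assoc, ← Real.rpow_add hW0]; norm_num
  rw [hWW, Real.mul_rpow hZ0.le hE0.le, Real.mul_rpow hX0.le hW0.le]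
  have key : Z ^ s * X ^ (-(1 / 4) : ℝ) ≤ (1 / 2) ^ s +
      x₁ ^ (-(1 / 4) : ℝ) * (if 4⁻¹ * x₁ ^ p * E < Z * E then 1 else 0) +
      x₀ ^ (1 / 4 : ℝ) * X ^ (-(1 / 2) : ℝ) := by
    have hpow : ∀ {a : ℝ}, 0 < a → (a ^ p) ^ s = a ^ (1 / 4 : ℝ) := fun {a} ha => by
      rw [← Real.rpow_mul ha.le, hps]
    have h1 : 0 ≤ (1 / 2 : ℝ) ^ s := by positivity
    have h2 : 0 ≤ x₁ ^ (-(1 / 4) : ℝ) * (if 4⁻¹ * x₁ ^ p * E < Z * E then (1 : ℝ) else 0) := by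
      split_ifs <;> positivity
    have h3 : 0 ≤ x₀ ^ (1 / 4 : ℝ) * X ^ (-(1 / 2) : ℝ) := by positivity
    -- Three regimes of the factor X of W. If X is at least x₁, either E has dropped by x₁^p / 4 or
    -- the indicator pays. If X is below x₀, the moment of order -1/2 pays, with the small factor
    -- x₀^(1/4). In between, the hypothesis makes E drop by more than X^p.
    rcases le_or_gt x₁ X with hX | hX
    · have hXm : X ^ (-(1 / 4) : ℝ) ≤ x₁ ^ (-(1 / 4) : ℝ) :=
        Real.rpow_le_rpow_of_nonpos hx₁ hX (by norm_num)
      split_ifs at h2 ⊢ with hc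
      · have : Z ^ s * X ^ (-(1 / 4) : ℝ) ≤ 1 * x₁ ^ (-(1 / 4) : ℝ) := by gcongr
        linarith
      · have hZ : Z ≤ 1 / 2 * x₁ ^ p := by
          have := le_of_mul_le_mul_right (not_lt.1 hc) hE0
          have : 0 < x₁ ^ p := by positivity
          linarith
        have : Z ^ s * X ^ (-(1 / 4) : ℝ) ≤ (1 / 2 * x₁ ^ p) ^ s * x₁ ^ (-(1 / 4) : ℝ) := by gcongr
        rw [Real.mul_rpow (by norm_num) (by positivity), hpow hx₁, mul_assoc,
          ← Real.rpow_add hx₁, add_neg_cancel, Real.rpow_zero, mul_one] at this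
        linarith
    · rcases lt_or_ge X x₀ with hX' | hX'
      · have : Z ^ s * X ^ (-(1 / 4) : ℝ) ≤ 1 * (x₀ ^ (1 / 4 : ℝ) * X ^ (-(1 / 2) : ℝ)) := by
          have h4 : X ^ (-(1 / 4) : ℝ) = X ^ (1 / 4 : ℝ) * X ^ (-(1 / 2) : ℝ) := by
            rw [← Real.rpow_add hX0]; norm_num
          rw [h4]
          gcongr
        linarith
      -- A rational x above X within the factor 2^(1/p) loses a factor 2 in x^p, so that 1/4 becomes
      -- 1/2. Rational values suffice because the hypothesis will be available only off countably
      -- many null sets.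
      · have h21 : 1 < (2 : ℝ) ^ (1 / p) := Real.one_lt_rpow one_lt_two (by positivity)
        obtain ⟨x, hx1, hx2⟩ := exists_rat_btwn (show X < min x₁ ((2 : ℝ) ^ (1 / p) * X) from
          lt_min hX (by nlinarith))
        have hle := h x (by linarith) (hx2.le.trans (min_le_left _ _)) (by nlinarith)
        have hle := le_of_mul_le_mul_right hle hE0
        have hxp : (x : ℝ) ^ p ≤ 2 * X ^ p := by
          have h5 : (x : ℝ) ^ p ≤ ((2 : ℝ) ^ (1 / p) * X) ^ p :=
            Real.rpow_le_rpow (hX0.le.trans hx1.le) (hx2.le.trans (min_le_right _ _)) hp.le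
          rwa [Real.mul_rpow (by positivity) hX0.le, ← Real.rpow_mul (by norm_num),
            one_div_mul_cancel hp.ne', Real.rpow_one] at h5
        have hZ : Z ≤ 1 / 2 * X ^ p := by linarith
        have : Z ^ s * X ^ (-(1 / 4) : ℝ) ≤ (1 / 2 * X ^ p) ^ s * X ^ (-(1 / 4) : ℝ) := by gcongr
        rw [Real.mul_rpow (by norm_num) (by positivity), hpow hX0, mul_assoc,
          ← Real.rpow_add hX0, add_neg_cancel, Real.rpow_zero, mul_one] at this
        linarith
  calc Z ^ s * E ^ s * (X ^ (-(1 / 4) : ℝ) * W ^ (-(1 / 4) : ℝ))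
      = Z ^ s * X ^ (-(1 / 4) : ℝ) * (E ^ s * W ^ (-(1 / 4) : ℝ)) := by ring
    _ ≤ _ := by gcongr

theorem exists_exponent {p ρ : ℝ} (hρ : 0 < ρ) (h : (1 + p) * ρ < 1) :
    ∃ θ, p < θ ∧ (1 + θ) * ρ < 1 := by
  refine ⟨p + (1 - (1 + p) * ρ) / (2 * ρ), ?_, ?_⟩
  · have : 0 < (1 - (1 + p) * ρ) / (2 * ρ) := by apply div_pos <;> linarith
    linarith
  · have : (1 - (1 + p) * ρ) / (2 * ρ) * ρ = (1 - (1 + p) * ρ) / 2 := by field_simp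
    nlinarith

/-- As θ > p, the power x^(-p) is negligible against x^(-θ) for small x. -/
theorem exists_ratio_bound {p θ ρ : ℝ} (hp : 0 < p) (hθ : p < θ)
    (h : (1 + θ) * ρ < 1) : ∃ x₁, 0 < x₁ ∧ x₁ < 1 ∧ ∀ x, 0 < x → x ≤ x₁ →
      4 * x ^ (-p) * (1 + θ) / (1 - (1 + θ) * ρ) ≤ x ^ (-θ) / 4 := by
  set A : ℝ := (1 - (1 + θ) * ρ) / (16 * (1 + θ)) with hA
  have hθ0 : 0 < 1 + θ := by linarith
  have hβ : 0 < 1 - (1 + θ) * ρ := by linarith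
  have hA0 : 0 < A := by positivity
  refine ⟨min (1 / 2) (A ^ (1 / (θ - p))), by positivity,
    (min_le_left _ _).trans_lt (by norm_num), fun x hx hx1 => ?_⟩
  have h1 : x ^ (θ - p) ≤ A := by
    have h2 : x ^ (θ - p) ≤ (A ^ (1 / (θ - p))) ^ (θ - p) :=
      Real.rpow_le_rpow hx.le (hx1.trans (min_le_right _ _)) (by linarith)
    rwa [← Real.rpow_mul hA0.le, one_div_mul_cancel (by linarith), Real.rpow_one] at h2
  have h3 : x ^ (-p) = x ^ (θ - p) * x ^ (-θ) := by rw [← Real.rpow_add hx]; ring_nf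
  have h4 : 0 < x ^ (-θ) := by positivity
  rw [div_le_iff₀ hβ, h3]
  have h5 : A * (16 * (1 + θ)) = 1 - (1 + θ) * ρ := by rw [hA]; field_simp
  rw [← h5]
  have : 4 * (x ^ (θ - p) * x ^ (-θ)) * (1 + θ) ≤ 4 * (A * x ^ (-θ)) * (1 + θ) := by gcongr
  linarith

/-- The terms with ρ^k form a geometric series of ratio (1 + θ)ρ < 1, bounded through
`exists_ratio_bound`. The horizon K makes the last such term small uniformly for x ≥ x₀, and only
then κ is chosen so small that the finitely many terms with κ do no harm. -/
theorem exists_horizon {p θ ρ x₀ x₁ : ℝ} (hp : 0 < p) (hθ : p < θ) (hρ : 0 < ρ)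
    (h : (1 + θ) * ρ < 1) (hx₀ : 0 < x₀) (hx₁ : x₁ < 1)
    (hr : ∀ x, 0 < x → x ≤ x₁ →
      4 * x ^ (-p) * (1 + θ) / (1 - (1 + θ) * ρ) ≤ x ^ (-θ) / 4) :
    ∃ K : ℕ, ∃ κ₀ : ℝ, 0 < κ₀ ∧ ∀ κ, 0 ≤ κ → κ ≤ κ₀ → ∀ x, x₀ ≤ x → x ≤ x₁ →
      (∑ k ∈ Finset.range K, (1 + θ) ^ (k + 1) * (κ + 4 * x ^ (-p) * ρ ^ k)) +
        (1 + θ) ^ K * x ^ (-θ) * (κ + 4 * x ^ (-p) * ρ ^ K) < x ^ (-θ) := by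
  set z := 1 + θ with hz
  have hz0 : 0 < z := by linarith
  have hβ0 : 0 < z * ρ := by positivity
  have hlim := (tendsto_pow_atTop_nhds_zero_of_lt_one hβ0.le h).const_mul (4 * x₀ ^ (-p))
  rw [mul_zero] at hlim
  obtain ⟨K, hK⟩ := (hlim.eventually (gt_mem_nhds (show (0 : ℝ) < 1 / 4 by norm_num))).exists
  set B : ℝ := (∑ k ∈ Finset.range K, z ^ (k + 1)) + z ^ K with hB
  have hB0 : 0 < B := by
    have : 0 ≤ ∑ k ∈ Finset.range K, z ^ (k + 1) := Finset.sum_nonneg fun k _ => by positivity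
    positivity
  refine ⟨K, 1 / (8 * B), by positivity, fun κ hκ hκ0 x hxx hx1 => ?_⟩
  have hx : 0 < x := hx₀.trans_le hxx
  have hκB : κ * B ≤ 1 / 8 := by
    have : κ * B ≤ 1 / (8 * B) * B := by gcongr
    rwa [show 1 / (8 * B) * B = 1 / 8 by field_simp] at this
  have hxθ : 1 ≤ x ^ (-θ) :=
    Real.one_le_rpow_of_pos_of_le_one_of_nonpos hx (by linarith) (by linarith)
  have h1 : (∑ k ∈ Finset.range K, z ^ (k + 1) * (κ + 4 * x ^ (-p) * ρ ^ k)) =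
      κ * (∑ k ∈ Finset.range K, z ^ (k + 1)) +
        4 * x ^ (-p) * z * ∑ k ∈ Finset.range K, (z * ρ) ^ k := by
    rw [Finset.mul_sum, Finset.mul_sum, ← Finset.sum_add_distrib]
    refine Finset.sum_congr rfl fun k _ => ?_
    rw [mul_pow]; ring
  have h2 : ∑ k ∈ Finset.range K, (z * ρ) ^ k ≤ 1 / (1 - z * ρ) := by
    rw [one_div, ← tsum_geometric_of_lt_one hβ0.le h]
    exact (summable_geometric_of_lt_one hβ0.le h).sum_le_tsum _ fun k _ => by positivity
  have h3 : 4 * x ^ (-p) * z * ∑ k ∈ Finset.range K, (z * ρ) ^ k ≤ x ^ (-θ) / 4 := by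
    refine le_trans ?_ (hr x hx hx1)
    rw [div_eq_mul_one_div (4 * x ^ (-p) * z)]
    gcongr
  have h4 : 4 * x ^ (-p) * (z * ρ) ^ K ≤ 1 / 4 := by
    have : x ^ (-p) ≤ x₀ ^ (-p) := Real.rpow_le_rpow_of_nonpos hx₀ hxx (by linarith)
    refine le_trans ?_ hK.le
    gcongr
  have h5 : z ^ K * x ^ (-θ) * (κ + 4 * x ^ (-p) * ρ ^ K) =
      x ^ (-θ) * (κ * z ^ K) + x ^ (-θ) * (4 * x ^ (-p) * (z * ρ) ^ K) := by
    rw [mul_pow]; ring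
  rw [h1, h5]
  have h6 : κ * (∑ k ∈ Finset.range K, z ^ (k + 1)) ≤ 1 / 8 := by
    refine le_trans ?_ hκB
    have : 0 ≤ z ^ K := by positivity
    gcongr
    linarith
  have h7 : κ * z ^ K ≤ 1 / 8 := by
    refine le_trans ?_ hκB
    have : 0 ≤ ∑ k ∈ Finset.range K, z ^ (k + 1) := Finset.sum_nonneg fun k _ => by positivity
    gcongr
    linarith
  have h8 : x ^ (-θ) * (κ * z ^ K) ≤ x ^ (-θ) * (1 / 8) := by gcongr
  have h9 : x ^ (-θ) * (4 * x ^ (-p) * (z * ρ) ^ K) ≤ x ^ (-θ) * (1 / 4) := by gcongr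
  linarith

end RealEstimates

end InformedRRT

/-! ### Shrinking processes cannot contract too fast -/

namespace InformedRRT

/-- A pair of shrinking nonnegative processes, `w` losing at most a uniform factor in each step, and
`e`, a monotone transform of `w` bounded below by a power of `w`, contracting on average by the
factor `ρ` on the events `R i`. -/
structure ShrinkingProcess {Ω : Type*} {m0 : MeasurableSpace Ω} (μ : Measure Ω)
    (ℱ : Filtration ℕ m0) (p ρ : ℝ) (c : ℝ≥0∞) (e w : ℕ → Ω → ℝ≥0∞) (τ : ℝ≥0∞ → ℝ≥0∞)
    (R : ℕ → Set Ω) : Prop where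
  measurable_e : ∀ i, Measurable[ℱ i] (e i)
  measurable_w : ∀ i, Measurable[ℱ i] (w i)
  measurable_τ : Measurable τ
  measurableSet_R : ∀ i, MeasurableSet[ℱ i] (R i)
  antitone_e : ∀ ω, Antitone fun i => e i ω
  antitone_w : ∀ ω, Antitone fun i => w i ω
  e_ne_top : ∀ i ω, e i ω ≠ ⊤
  w_ne_top : ∀ i ω, w i ω ≠ ⊤
  w_ne_zero : ∀ᵐ ω ∂μ, ∀ i, w i ω ≠ 0
  c_ne_zero : c ≠ 0
  c_ne_top : c ≠ ⊤
  lower : ∀ᵐ ω ∂μ, ∀ i, c * w i ω ^ p ≤ e i ω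
  -- The error need not be a function of the volume where the volume is constant in the cost. These
  -- two inequalities say e = τ(w) as far as is needed.
  τ_le : ∀ i ω v, v ≤ w i ω → τ v ≤ e i ω
  le_τ : ∀ i ω v, w i ω < v → e i ω ≤ τ v
  -- Conditional moment bounds for the factor w (i + 1) / w i, with the constants of a uniform
  -- variable U: the mean of U^θ is 1/(1 + θ), that of U^(-1/2) is 2.
  growth : ∀ θ : ℝ, 0 ≤ θ → ∀ i S g, MeasurableSet[ℱ i] S → Measurable[ℱ i] g →
    ∫⁻ ω in S, g ω * w i ω ^ θ ∂μ ≤ ENNReal.ofReal (1 + θ) * ∫⁻ ω in S, g ω * w (i + 1) ω ^ θ ∂μ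
  decay : ∀ i S g, MeasurableSet[ℱ i] S → Measurable[ℱ i] g →
    ∫⁻ ω in S, g ω * w (i + 1) ω ^ (-(1 / 2) : ℝ) ∂μ ≤
      2 * ∫⁻ ω in S, g ω * w i ω ^ (-(1 / 2) : ℝ) ∂μ
  contract : ∀ i S g, MeasurableSet[ℱ i] S → S ⊆ R i → Measurable[ℱ i] g →
    ∫⁻ ω in S, g ω * e (i + 1) ω ∂μ ≤ ENNReal.ofReal ρ * ∫⁻ ω in S, g ω * e i ω ∂μ

namespace ShrinkingProcess

variable {Ω : Type*} {m0 : MeasurableSpace Ω} {μ : Measure Ω} [IsFiniteMeasure μ]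
  {ℱ : Filtration ℕ m0} {p ρ : ℝ} {c : ℝ≥0∞} {e w : ℕ → Ω → ℝ≥0∞} {τ : ℝ≥0∞ → ℝ≥0∞}
  {R : ℕ → Set Ω}

/-- The conditional probability of all the events `R i` is at least `1 - κ`. -/
def safe (μ : Measure Ω) (ℱ : Filtration ℕ m0) (R : ℕ → Set Ω) (κ : ℝ) (j : ℕ) : Set Ω :=
  {ω | 1 - κ ≤ (μ[(⋂ i, R i).indicator (fun _ => (1 : ℝ)) | ℱ j]) ω}

omit [IsFiniteMeasure μ] in
theorem measurableSet_safe (κ : ℝ) (j : ℕ) : MeasurableSet[ℱ j] (safe μ ℱ R κ j) :=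
  (stronglyMeasurable_condExp (m := ℱ j) (μ := μ)).measurable measurableSet_Ici

variable (h : ShrinkingProcess μ ℱ p ρ c e w τ R)
include h

omit [IsFiniteMeasure μ] in
theorem measurableSet_iInter : MeasurableSet (⋂ i, R i) :=
  MeasurableSet.iInter fun i => ℱ.le i _ (h.measurableSet_R i)

theorem measure_diff_le {κ : ℝ} (hκ : 0 ≤ κ) {j : ℕ} {S : Set Ω} (hS : MeasurableSet[ℱ j] S)
    (hsafe : S ⊆ safe μ ℱ R κ j) : μ (S ∩ (⋂ i, R i)ᶜ) ≤ ENNReal.ofReal κ * μ S := by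
  have hG := h.measurableSet_iInter
  have hS' := ℱ.le j _ hS
  have h1 := setIntegral_condExp (ℱ.le j) ((integrable_const (1 : ℝ)).indicator hG) hS (μ := μ)
  have h2 : (1 - κ) * μ.real S ≤ μ.real (S ∩ ⋂ i, R i) := by
    have h3 : ∫ ω in S, (1 - κ) ∂μ ≤
        ∫ ω in S, (μ[(⋂ i, R i).indicator (fun _ => (1 : ℝ)) | ℱ j]) ω ∂μ :=
      setIntegral_mono_on (integrable_const _).integrableOn integrable_condExp.integrableOn hS'
        fun ω hω => hsafe hω
    rw [h1, setIntegral_indicator hG] at h3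
    simpa [mul_comm] using h3
  have h4 : μ.real (S ∩ (⋂ i, R i)ᶜ) ≤ κ * μ.real S := by
    have h5 := measureReal_inter_add_sdiff (μ := μ) (s := S) hG
    rw [Set.sdiff_eq] at h5
    linarith
  rw [← ENNReal.ofReal_toReal (measure_ne_top μ (S ∩ (⋂ i, R i)ᶜ)),
    ← ENNReal.ofReal_toReal (measure_ne_top μ S), ← ENNReal.ofReal_mul hκ]
  exact ENNReal.ofReal_le_ofReal h4

/-- The measure bound holds for all events of time j inside S, so it is a comparison of two measures
on the σ-algebra of time j. Integrals of functions measurable at that time inherit it. -/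
theorem setLIntegral_compl_le {κ : ℝ} (hκ : 0 ≤ κ) {j : ℕ} {S : Set Ω} (hS : MeasurableSet[ℱ j] S)
    (hsafe : S ⊆ safe μ ℱ R κ j) {g : Ω → ℝ≥0∞} (hg : Measurable[ℱ j] g) :
    ∫⁻ ω in S ∩ (⋂ i, R i)ᶜ, g ω ∂μ ≤ ENNReal.ofReal κ * ∫⁻ ω in S, g ω ∂μ := by
  have hle : (μ.restrict (S ∩ (⋂ i, R i)ᶜ)).trim (ℱ.le j) ≤
      ENNReal.ofReal κ • (μ.restrict S).trim (ℱ.le j) := by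
    refine Measure.le_iff.2 fun A hA => ?_
    rw [trim_measurableSet_eq _ hA, Measure.smul_apply, trim_measurableSet_eq _ hA,
      Measure.restrict_apply (ℱ.le j _ hA), Measure.restrict_apply (ℱ.le j _ hA), smul_eq_mul,
      ← Set.inter_assoc]
    exact h.measure_diff_le hκ (hA.inter hS) (Set.inter_subset_right.trans hsafe)
  rw [← lintegral_trim (ℱ.le j) hg, ← lintegral_trim (ℱ.le j) hg, ← smul_eq_mul,
    ← lintegral_smul_measure]
  exact lintegral_mono' hle le_rfl

omit [IsFiniteMeasure μ] in
-- Contraction can be iterated because membership in `R (j + k)` is already known at time j + k,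
-- before the next step.
theorem setLIntegral_window_le {j : ℕ} {S : Set Ω} (hS : MeasurableSet[ℱ j] S) {g : Ω → ℝ≥0∞}
    (hg : Measurable[ℱ j] g) (k : ℕ) :
    ∫⁻ ω in S ∩ ⋂ m ∈ Finset.range k, R (j + m), g ω * e (j + k) ω ∂μ ≤
      ENNReal.ofReal ρ ^ k * ∫⁻ ω in S, g ω * e j ω ∂μ := by
  have hset : ∀ k, MeasurableSet[ℱ (j + k)] (S ∩ ⋂ m ∈ Finset.range (k + 1), R (j + m)) := by
    intro k
    refine MeasurableSet.inter (ℱ.mono (Nat.le_add_right j k) _ hS) ?_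
    refine MeasurableSet.biInter (Finset.countable_toSet _) fun m hm => ?_
    exact ℱ.mono (by have := Finset.mem_range.1 hm; omega) _ (h.measurableSet_R (j + m))
  induction k with
  | zero => simp
  | succ k ih =>
    have h1 := h.contract (j + k) (S ∩ ⋂ m ∈ Finset.range (k + 1), R (j + m)) g (hset k)
      (fun ω hω => Set.mem_iInter₂.1 hω.2 k (by simp)) (hg.mono (ℱ.mono (Nat.le_add_right j k)) le_rfl)
    refine h1.trans ?_
    rw [pow_succ', mul_assoc]
    refine mul_le_mul_right (le_trans (lintegral_mono_set ?_) ih) _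
    refine Set.inter_subset_inter_right _ fun ω hω => ?_
    simp only [Set.mem_iInter, Finset.mem_range] at hω ⊢
    exact fun m hm => hω m (by omega)

omit [IsFiniteMeasure μ] in
theorem ae_e_ne_zero : ∀ᵐ ω ∂μ, ∀ i, e i ω ≠ 0 := by
  filter_upwards [h.w_ne_zero, h.lower] with ω hω hlow i h0
  have := hlow i
  rw [h0, nonpos_iff_eq_zero, mul_eq_zero, ENNReal.rpow_eq_zero_iff] at this
  rcases this with h1 | ⟨h1, _⟩ | ⟨h1, _⟩
  · exact h.c_ne_zero h1
  · exact hω i h1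
  · exact h.w_ne_top i ω h1

/-- Outside the intersection of the `R i` the safety of S pays κ. Inside it, Markov's inequality
with the weight g / e j applies to the error contracted by ρ^k. -/
theorem setLIntegral_markov (hρ : 0 ≤ ρ) {κ : ℝ} (hκ : 0 ≤ κ) {j : ℕ} {S : Set Ω}
    (hS : MeasurableSet[ℱ j] S) (hsafe : S ⊆ safe μ ℱ R κ j) {g : Ω → ℝ≥0∞}
    (hg : Measurable[ℱ j] g) {t : ℝ} (ht : 0 < t) (k : ℕ) :
    ∫⁻ ω in S ∩ {ω | ENNReal.ofReal t * e j ω ≤ e (j + k) ω}, g ω ∂μ ≤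
      ENNReal.ofReal (κ + t⁻¹ * ρ ^ k) * ∫⁻ ω in S, g ω ∂μ := by
  set D := {ω | ENNReal.ofReal t * e j ω ≤ e (j + k) ω} with hD
  have hem : ∀ i, Measurable (e i) := fun i => (h.measurable_e i).mono (ℱ.le i) le_rfl
  have hDm : MeasurableSet D := measurableSet_le ((hem j).const_mul _) (hem _)
  have hG := h.measurableSet_iInter
  have hS' := ℱ.le j _ hS
  have ht0 : ENNReal.ofReal t ≠ 0 := by simpa using ht
  have hsub : S ∩ D ⊆ (S ∩ (⋂ i, R i)ᶜ) ∪ ((S ∩ ⋂ i, R i) ∩ D) := by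
    intro ω hω
    by_cases hωG : ω ∈ ⋂ i, R i
    · exact Or.inr ⟨⟨hω.1, hωG⟩, hω.2⟩
    · exact Or.inl ⟨hω.1, hωG⟩
  refine (lintegral_mono_set hsub).trans ((lintegral_union_le _ _ _).trans ?_)
  rw [ENNReal.ofReal_add hκ (by positivity), add_mul]
  refine add_le_add (h.setLIntegral_compl_le hκ hS hsafe hg) ?_
  have h1 : ∫⁻ ω in (S ∩ ⋂ i, R i) ∩ D, g ω ∂μ ≤
      ∫⁻ ω in S ∩ ⋂ m ∈ Finset.range k, R (j + m),
        (ENNReal.ofReal t⁻¹ * (g ω * (e j ω)⁻¹)) * e (j + k) ω ∂μ := by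
    refine (setLIntegral_mono_ae' ((hS'.inter hG).inter hDm) ?_).trans (lintegral_mono_set ?_)
    · filter_upwards [h.ae_e_ne_zero] with ω hω hm
      have h2 : ENNReal.ofReal t * e j ω ≤ e (j + k) ω := hm.2
      calc g ω = ENNReal.ofReal t⁻¹ * (g ω * (e j ω)⁻¹) * (ENNReal.ofReal t * e j ω) := by
            have h3 : ENNReal.ofReal t⁻¹ * ENNReal.ofReal t = 1 := by
              rw [← ENNReal.ofReal_mul (by positivity), inv_mul_cancel₀ ht.ne', ENNReal.ofReal_one]
            have h4 := ENNReal.inv_mul_cancel (hω j) (h.e_ne_top j ω)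
            calc g ω = g ω * (ENNReal.ofReal t⁻¹ * ENNReal.ofReal t) * ((e j ω)⁻¹ * e j ω) := by
                  rw [h3, h4, mul_one, mul_one]
              _ = _ := by ring
        _ ≤ _ := by gcongr
    · rintro ω ⟨⟨h2, h3⟩, _⟩
      exact ⟨h2, Set.mem_iInter₂.2 fun m _ => Set.mem_iInter.1 h3 _⟩
  refine h1.trans ((h.setLIntegral_window_le hS (g := fun ω => ENNReal.ofReal t⁻¹ *
    (g ω * (e j ω)⁻¹)) ((hg.mul (h.measurable_e j).inv).const_mul _) k).trans ?_)
  rw [ENNReal.ofReal_mul (by positivity), ENNReal.ofReal_pow hρ,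
    mul_comm (ENNReal.ofReal t⁻¹), mul_assoc]
  refine mul_le_mul_right ?_ _
  rw [← lintegral_const_mul' _ _ ENNReal.ofReal_ne_top]
  refine lintegral_mono fun ω => ?_
  calc ENNReal.ofReal t⁻¹ * (g ω * (e j ω)⁻¹) * e j ω
      = ENNReal.ofReal t⁻¹ * g ω * (e j ω * (e j ω)⁻¹) := by ring
    _ ≤ ENNReal.ofReal t⁻¹ * g ω * 1 := by gcongr; exact ENNReal.mul_inv_le_one _
    _ = _ := mul_one _

end ShrinkingProcess

end InformedRRT

namespace InformedRRT

namespace ShrinkingProcess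

variable {Ω : Type*} {m0 : MeasurableSpace Ω} {μ : Measure Ω} [IsFiniteMeasure μ]
  {ℱ : Filtration ℕ m0} {p ρ : ℝ} {c : ℝ≥0∞} {e w : ℕ → Ω → ℝ≥0∞} {τ : ℝ≥0∞ → ℝ≥0∞}
  {R : ℕ → Set Ω} (h : ShrinkingProcess μ ℱ p ρ c e w τ R)
include h

/-- Where all the events are likely to occur, the transform `τ` decreases by more than the power
`p` of the factor. -/
theorem measure_lt_τ_eq_zero (hρ : 0 ≤ ρ) {θ κ x : ℝ} (hθ : 0 ≤ θ) (hκ : 0 ≤ κ) (hx : 0 < x)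
    (hx1 : x ≤ 1) {K : ℕ}
    (hK : (∑ k ∈ Finset.range K, (1 + θ) ^ (k + 1) * (κ + 4 * x ^ (-p) * ρ ^ k)) +
        (1 + θ) ^ K * x ^ (-θ) * (κ + 4 * x ^ (-p) * ρ ^ K) < x ^ (-θ)) (j : ℕ) :
    μ (safe μ ℱ R κ j ∩
      {ω | ENNReal.ofReal (4⁻¹ * x ^ p) * e j ω < τ (ENNReal.ofReal x * w j ω)}) = 0 := by
  set A := safe μ ℱ R κ j ∩
      {ω | ENNReal.ofReal (4⁻¹ * x ^ p) * e j ω < τ (ENNReal.ofReal x * w j ω)} with hAdef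
  have hA : MeasurableSet[ℱ j] A := (measurableSet_safe κ j).inter
    (measurableSet_lt ((h.measurable_e j).const_mul _)
      (h.measurable_τ.comp ((h.measurable_w j).const_mul _)))
  have hA' := ℱ.le j _ hA
  -- While w has not fallen below the level x w j, e stays above τ of that level, which on A exceeds
  -- x^p e j / 4. By contraction and Markov, such long waits are unlikely.
  set D : ℕ → Set Ω := fun k => A ∩ {ω | ENNReal.ofReal x * w j ω ≤ w (j + k) ω} with hD
  have hDm : ∀ k, MeasurableSet[ℱ (j + k)] (D k) := fun k =>
    (ℱ.mono (Nat.le_add_right j k) _ hA).inter (measurableSet_le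
      (((h.measurable_w j).mono (ℱ.mono (Nat.le_add_right j k)) le_rfl).const_mul _)
      (h.measurable_w (j + k)))
  set z := ENNReal.ofReal (1 + θ) with hz
  set v : Ω → ℝ≥0∞ := fun ω => ((ENNReal.ofReal x * w j ω) ^ θ)⁻¹ with hv
  have hvm : Measurable[ℱ j] v := (((h.measurable_w j).const_mul _).pow_const _).inv
  set b : ℕ → ℝ≥0∞ := fun k => ∫⁻ ω in D k, v ω * w (j + k) ω ^ θ ∂μ with hb
  have hx0 : ENNReal.ofReal x ≠ 0 := by simpa using hx
  have hrec : ∀ k, b k ≤ z * (μ (D k) + b (k + 1)) := by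
    intro k
    refine (h.growth θ hθ (j + k) (D k) v (hDm k)
      (hvm.mono (ℱ.mono (Nat.le_add_right j k)) le_rfl)).trans (mul_le_mul_right ?_ _)
    have hsub : D k ⊆ (D k \ D (k + 1)) ∪ D (k + 1) := fun ω hω => by
      by_cases h1 : ω ∈ D (k + 1)
      · exact Or.inr h1
      · exact Or.inl ⟨hω, h1⟩
    refine (lintegral_mono_set hsub).trans ((lintegral_union_le _ _ _).trans ?_)
    refine add_le_add_left ?_ _
    have hm : MeasurableSet (D k \ D (k + 1)) := (ℱ.le _ _ (hDm k)).diff (ℱ.le _ _ (hDm (k + 1)))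
    calc ∫⁻ ω in D k \ D (k + 1), v ω * w (j + k + 1) ω ^ θ ∂μ
        ≤ ∫⁻ _ in D k \ D (k + 1), 1 ∂μ := by
          refine setLIntegral_mono' hm fun ω hω => ?_
          have hlt : w (j + k + 1) ω < ENNReal.ofReal x * w j ω :=
            not_le.1 fun hle => hω.2 ⟨hω.1.1, hle⟩
          calc v ω * w (j + k + 1) ω ^ θ ≤ v ω * (ENNReal.ofReal x * w j ω) ^ θ := by gcongr
            _ ≤ 1 := ENNReal.inv_mul_le_one _
      _ = μ (D k \ D (k + 1)) := by rw [setLIntegral_one]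
      _ ≤ μ (D k) := measure_mono Set.sdiff_subset
  have hsum : ∀ K, b 0 ≤ (∑ k ∈ Finset.range K, z ^ (k + 1) * μ (D k)) + z ^ K * b K := by
    intro K
    induction K with
    | zero => simp
    | succ K ih =>
      refine ih.trans ?_
      rw [Finset.sum_range_succ, add_assoc]
      refine add_le_add_right ?_ _
      calc z ^ K * b K ≤ z ^ K * (z * (μ (D K) + b (K + 1))) := by gcongr; exact hrec K
        _ = _ := by ring
  have hvx : ∀ᵐ ω ∂μ, v ω * w j ω ^ θ = ENNReal.ofReal (x ^ (-θ)) := by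
    filter_upwards [h.w_ne_zero] with ω hω
    rw [hv, ← ENNReal.ofReal_rpow_of_pos hx, ENNReal.rpow_neg]
    simp only
    rw [ENNReal.mul_rpow_of_nonneg _ _ hθ, ENNReal.mul_inv (Or.inr (by
      simp [ENNReal.rpow_eq_top_iff, hω j, h.w_ne_top j ω])) (Or.inr (by
      simp [ENNReal.rpow_eq_zero_iff, hω j, h.w_ne_top j ω])), mul_assoc, ENNReal.inv_mul_cancel,
      mul_one]
    · simp [ENNReal.rpow_eq_zero_iff, hω j, h.w_ne_top j ω]
    · simp [ENNReal.rpow_eq_top_iff, hω j, h.w_ne_top j ω]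
  have hb0 : ENNReal.ofReal (x ^ (-θ)) * μ A ≤ b 0 := by
    have h1 : A ⊆ D 0 := fun ω hω => ⟨hω, by
      have : ENNReal.ofReal x ≤ 1 := ENNReal.ofReal_le_one.2 hx1
      exact (mul_le_mul_left this _).trans_eq (one_mul _)⟩
    calc ENNReal.ofReal (x ^ (-θ)) * μ A = ∫⁻ _ in A, ENNReal.ofReal (x ^ (-θ)) ∂μ := by
          rw [setLIntegral_const]
      _ = ∫⁻ ω in A, v ω * w j ω ^ θ ∂μ :=
          lintegral_congr_ae (ae_restrict_of_ae (hvx.mono fun ω hω => hω.symm))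
      _ ≤ b 0 := lintegral_mono_set h1
  have hbK : b K ≤ ENNReal.ofReal (x ^ (-θ)) * μ (D K) := by
    rw [← setLIntegral_const]
    refine lintegral_mono_ae (ae_restrict_of_ae (hvx.mono fun ω hω => ?_))
    rw [← hω]
    gcongr
    exact h.antitone_w ω (Nat.le_add_right j K)
  have hDle : ∀ k, μ (D k) ≤ ENNReal.ofReal (κ + 4 * x ^ (-p) * ρ ^ k) * μ A := by
    intro k
    have h1 := h.setLIntegral_markov hρ hκ hA Set.inter_subset_left (g := fun _ => 1)
      measurable_const (t := 4⁻¹ * x ^ p) (by positivity) k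
    rw [setLIntegral_one, setLIntegral_one, mul_inv, inv_inv, ← Real.rpow_neg hx.le] at h1
    refine (measure_mono ?_).trans h1
    rintro ω ⟨h2, h3⟩
    exact ⟨h2, h2.2.le.trans (h.τ_le _ _ _ h3)⟩
  have hκk : ∀ k, 0 ≤ κ + 4 * x ^ (-p) * ρ ^ k := fun k => by positivity
  have hfinal : ENNReal.ofReal (x ^ (-θ)) * μ A ≤ ENNReal.ofReal
      ((∑ k ∈ Finset.range K, (1 + θ) ^ (k + 1) * (κ + 4 * x ^ (-p) * ρ ^ k)) +
        (1 + θ) ^ K * x ^ (-θ) * (κ + 4 * x ^ (-p) * ρ ^ K)) * μ A := by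
    refine (hb0.trans (hsum K)).trans ?_
    have hs : ∀ k ∈ Finset.range K, 0 ≤ (1 + θ) ^ (k + 1) * (κ + 4 * x ^ (-p) * ρ ^ k) := fun k _ =>
      mul_nonneg (by positivity) (hκk k)
    rw [ENNReal.ofReal_add (Finset.sum_nonneg hs)
        (mul_nonneg (by positivity) (hκk K)), ENNReal.ofReal_sum_of_nonneg hs, add_mul,
      Finset.sum_mul]
    refine add_le_add (Finset.sum_le_sum fun k _ => ?_) ?_
    · rw [ENNReal.ofReal_mul (by positivity), ENNReal.ofReal_pow (by positivity), mul_assoc]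
      exact mul_le_mul_right (hDle k) _
    · rw [ENNReal.ofReal_mul (by positivity), ENNReal.ofReal_mul (by positivity),
        ENNReal.ofReal_pow (by positivity), mul_assoc, mul_assoc]
      refine mul_le_mul_right (hbK.trans ?_) _
      exact mul_le_mul_right (hDle K) _
  -- If A had positive measure, the first passage would have to start from b 0 ≥ x^(-θ) μ(A), more
  -- than the bound allows.
  by_contra h0
  have hxθ : 0 < x ^ (-θ) := by positivity
  exact absurd hfinal (not_le.2 (ENNReal.mul_lt_mul_left h0 (measure_ne_top _ _)
    ((ENNReal.ofReal_lt_ofReal_iff hxθ).2 hK)))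

end ShrinkingProcess

end InformedRRT

namespace InformedRRT

/-- `potential_le` for extended reals, with the three contributions separated so that each can be
integrated. The strict inequality in the indicator is relaxed to match `setLIntegral_markov`. -/
theorem ennreal_potential_le {p x₀ x₁ : ℝ} {E E' W W' : ℝ≥0∞} (hp : 0 < p) (hx₀ : 0 < x₀)
    (hx : x₀ ≤ x₁) (hE' : E' ≠ 0) (hW' : W' ≠ 0) (hEt : E ≠ ⊤) (hWt : W ≠ ⊤) (hE : E' ≤ E)
    (hW : W' ≤ W)
    (h : ∀ x : ℚ, x₀ ≤ x → (x : ℝ) ≤ x₁ → W' < ENNReal.ofReal x * W →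
      E' ≤ ENNReal.ofReal (4⁻¹ * (x : ℝ) ^ p) * E) :
    E' ^ (1 / (4 * p)) * W' ^ (-(1 / 4) : ℝ) ≤
      ENNReal.ofReal ((1 / 2) ^ (1 / (4 * p))) * (E ^ (1 / (4 * p)) * W ^ (-(1 / 4) : ℝ)) +
      ENNReal.ofReal (x₁ ^ (-(1 / 4) : ℝ)) * (if ENNReal.ofReal (4⁻¹ * x₁ ^ p) * E ≤ E' then
        E ^ (1 / (4 * p)) * W ^ (-(1 / 4) : ℝ) else 0) +
      ENNReal.ofReal (x₀ ^ (1 / 4 : ℝ)) *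
        ((E ^ (1 / (4 * p)) * W ^ (1 / 4 : ℝ)) * W' ^ (-(1 / 2) : ℝ)) := by
  lift E to NNReal using hEt
  lift W to NNReal using hWt
  lift E' to NNReal using (hE.trans_lt ENNReal.coe_lt_top).ne
  lift W' to NNReal using (hW.trans_lt ENNReal.coe_lt_top).ne
  have hx₁ : 0 < x₁ := hx₀.trans_le hx
  have hE0 : (0 : ℝ) < E' := by
    have : (0 : NNReal) < E' := pos_iff_ne_zero.2 fun h0 => hE' (by simp [h0])
    exact_mod_cast this
  have hW0 : (0 : ℝ) < W' := by
    have : (0 : NNReal) < W' := pos_iff_ne_zero.2 fun h0 => hW' (by simp [h0])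
    exact_mod_cast this
  have hEle : (E' : ℝ) ≤ E := by exact_mod_cast hE
  have hWle : (W' : ℝ) ≤ W := by exact_mod_cast hW
  have hE1 : (0 : ℝ) < E := hE0.trans_le hEle
  have hW1 : (0 : ℝ) < W := hW0.trans_le hWle
  have hcoe : ∀ a : NNReal, (a : ℝ≥0∞) = ENNReal.ofReal a := fun a => by simp
  simp only [hcoe] at h ⊢
  have key := potential_le hp hx₀ hx hE0 hW0 hEle hWle fun x h1 h2 h3 => by
    have hx0 : (0 : ℝ) < x := hx₀.trans_le h1
    have h4 := h x h1 h2 (by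
      rw [← ENNReal.ofReal_mul hx0.le]
      exact (ENNReal.ofReal_lt_ofReal_iff (by positivity)).2 h3)
    rw [← ENNReal.ofReal_mul (by positivity)] at h4
    exact (ENNReal.ofReal_le_ofReal_iff (by positivity)).1 h4
  have hs : (if 4⁻¹ * x₁ ^ p * (E : ℝ) < E' then (1 : ℝ) else 0) ≤
      if 4⁻¹ * x₁ ^ p * (E : ℝ) ≤ E' then (1 : ℝ) else 0 := by
    split_ifs <;> linarith
  have key2 := ENNReal.ofReal_le_ofReal (key.trans (mul_le_mul_of_nonneg_right (add_le_add_left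
    (add_le_add_right (mul_le_mul_of_nonneg_left hs (by positivity)) _) _) (by positivity)))
  have hiff : ENNReal.ofReal (4⁻¹ * x₁ ^ p) * ENNReal.ofReal E ≤ ENNReal.ofReal E' ↔
      4⁻¹ * x₁ ^ p * (E : ℝ) ≤ E' := by
    rw [← ENNReal.ofReal_mul (by positivity)]
    exact ENNReal.ofReal_le_ofReal_iff hE0.le
  have hWW : (W : ℝ) ^ (1 / 2 : ℝ) * (W : ℝ) ^ (-(1 / 4) : ℝ) = (W : ℝ) ^ (1 / 4 : ℝ) := by
    rw [← Real.rpow_add hW1]; norm_num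
  simp only [ENNReal.ofReal_rpow_of_pos hE0, ENNReal.ofReal_rpow_of_pos hW0,
    ENNReal.ofReal_rpow_of_pos hE1, ENNReal.ofReal_rpow_of_pos hW1, hiff]
  refine (le_of_eq_of_le ?_ key2).trans_eq ?_
  · rw [ENNReal.ofReal_mul (by positivity)]
  · rw [show ∀ a b d : ℝ, (a + b + d * (((W' : ℝ) ^ (-(1 / 2) : ℝ)) * (W : ℝ) ^ (1 / 2 : ℝ))) *
        ((E : ℝ) ^ (1 / (4 * p)) * (W : ℝ) ^ (-(1 / 4) : ℝ)) =
        a * ((E : ℝ) ^ (1 / (4 * p)) * (W : ℝ) ^ (-(1 / 4) : ℝ)) +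
        b * ((E : ℝ) ^ (1 / (4 * p)) * (W : ℝ) ^ (-(1 / 4) : ℝ)) +
        d * (((E : ℝ) ^ (1 / (4 * p)) * (W : ℝ) ^ (1 / 4 : ℝ)) * (W' : ℝ) ^ (-(1 / 2) : ℝ)) from
        fun a b d => by rw [← hWW]; ring]
    split_ifs
    · rw [ENNReal.ofReal_add (by positivity) (by positivity),
        ENNReal.ofReal_add (by positivity) (by positivity), mul_one]
      rw [ENNReal.ofReal_mul (by positivity),
        ENNReal.ofReal_mul (p := x₁ ^ (-(1 / 4) : ℝ)) (by positivity),
        ENNReal.ofReal_mul (p := x₀ ^ (1 / 4 : ℝ)) (by positivity),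
        ENNReal.ofReal_mul (q := (W' : ℝ) ^ (-(1 / 2) : ℝ)) (by positivity),
        ENNReal.ofReal_mul (p := (E : ℝ) ^ (1 / (4 * p))) (by positivity),
        ENNReal.ofReal_mul (p := (E : ℝ) ^ (1 / (4 * p))) (by positivity)]
    · rw [ENNReal.ofReal_add (by positivity) (by positivity),
        ENNReal.ofReal_add (by positivity) (by positivity), mul_zero, zero_mul, mul_zero,
        ENNReal.ofReal_zero]
      rw [ENNReal.ofReal_mul (by positivity),
        ENNReal.ofReal_mul (p := x₀ ^ (1 / 4 : ℝ)) (by positivity),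
        ENNReal.ofReal_mul (q := (W' : ℝ) ^ (-(1 / 2) : ℝ)) (by positivity),
        ENNReal.ofReal_mul (p := (E : ℝ) ^ (1 / (4 * p))) (by positivity),
        ENNReal.ofReal_mul (p := (E : ℝ) ^ (1 / (4 * p))) (by positivity)]

namespace ShrinkingProcess

variable {Ω : Type*} {m0 : MeasurableSpace Ω} {μ : Measure Ω} [IsFiniteMeasure μ]
  {ℱ : Filtration ℕ m0} {p ρ : ℝ} {c : ℝ≥0∞} {e w : ℕ → Ω → ℝ≥0∞} {τ : ℝ≥0∞ → ℝ≥0∞}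
  {R : ℕ → Set Ω}

/-- The potential, which contracts on average where all the events are likely to occur. -/
noncomputable def potential (p : ℝ) (e w : ℕ → Ω → ℝ≥0∞) (j : ℕ) (ω : Ω) : ℝ≥0∞ :=
  e j ω ^ (1 / (4 * p)) * w j ω ^ (-(1 / 4) : ℝ)

variable (h : ShrinkingProcess μ ℱ p ρ c e w τ R)
include h

omit [IsFiniteMeasure μ] in
theorem measurable_potential (j : ℕ) : Measurable[ℱ j] (potential p e w j) :=
  ((h.measurable_e j).pow_const _).mul ((h.measurable_w j).pow_const _)

omit [IsFiniteMeasure μ] in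
theorem setLIntegral_decay {j : ℕ} {S : Set Ω} (hS : MeasurableSet[ℱ j] S) {g : Ω → ℝ≥0∞}
    (hg : Measurable[ℱ j] g) (k : ℕ) :
    ∫⁻ ω in S, g ω * w (j + k) ω ^ (-(1 / 2) : ℝ) ∂μ ≤
      2 ^ k * ∫⁻ ω in S, g ω * w j ω ^ (-(1 / 2) : ℝ) ∂μ := by
  induction k with
  | zero => simp
  | succ k ih =>
    refine (h.decay (j + k) S g (ℱ.mono (Nat.le_add_right j k) _ hS)
      (hg.mono (ℱ.mono (Nat.le_add_right j k)) le_rfl)).trans ?_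
    rw [pow_succ', mul_assoc]
    exact mul_le_mul_right ih _

/-- Of the three contributions in `ennreal_potential_le`, the first is deterministic, the second is
the rare event of `setLIntegral_markov`, and the third at most doubles in each of the J steps by
`decay`. -/
theorem setLIntegral_potential_le (hp : 0 < p) (hρ : 0 ≤ ρ) {κ x₀ x₁ : ℝ} (hκ : 0 ≤ κ)
    (hx₀ : 0 < x₀) (hx : x₀ ≤ x₁) {j : ℕ} (J : ℕ)
    (hnull : ∀ x : ℚ, x₀ ≤ x → (x : ℝ) ≤ x₁ → μ (safe μ ℱ R κ j ∩
      {ω | ENNReal.ofReal (4⁻¹ * (x : ℝ) ^ p) * e j ω < τ (ENNReal.ofReal x * w j ω)}) = 0)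
    {S : Set Ω} (hS : MeasurableSet[ℱ j] S) (hsafe : S ⊆ safe μ ℱ R κ j) :
    ∫⁻ ω in S, potential p e w (j + J) ω ∂μ ≤ ENNReal.ofReal ((1 / 2) ^ (1 / (4 * p)) +
      x₁ ^ (-(1 / 4) : ℝ) * (κ + (4⁻¹ * x₁ ^ p)⁻¹ * ρ ^ J) + x₀ ^ (1 / 4 : ℝ) * 2 ^ J) *
      ∫⁻ ω in S, potential p e w j ω ∂μ := by
  have hx₁ : 0 < x₁ := hx₀.trans_le hx
  have hS' := ℱ.le j _ hS
  have hem : ∀ i, Measurable (e i) := fun i => (h.measurable_e i).mono (ℱ.le i) le_rfl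
  have hwm : ∀ i, Measurable (w i) := fun i => (h.measurable_w i).mono (ℱ.le i) le_rfl
  have hum : Measurable (potential p e w j) := (h.measurable_potential j).mono (ℱ.le j) le_rfl
  set D : Set Ω := {ω | ENNReal.ofReal (4⁻¹ * x₁ ^ p) * e j ω ≤ e (j + J) ω} with hD
  have hDm : MeasurableSet D := measurableSet_le ((hem j).const_mul _) (hem _)
  set g : Ω → ℝ≥0∞ := fun ω => e j ω ^ (1 / (4 * p)) * w j ω ^ (1 / 4 : ℝ) with hg
  have hgm : Measurable[ℱ j] g := ((h.measurable_e j).pow_const _).mul ((h.measurable_w j).pow_const _)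
  have hae : ∀ᵐ ω ∂μ, ω ∈ S → ∀ x : ℚ, x₀ ≤ x → (x : ℝ) ≤ x₁ →
      τ (ENNReal.ofReal x * w j ω) ≤ ENNReal.ofReal (4⁻¹ * (x : ℝ) ^ p) * e j ω := by
    have : ∀ᵐ ω ∂μ, ∀ x : ℚ, ω ∈ S → x₀ ≤ x → (x : ℝ) ≤ x₁ →
        τ (ENNReal.ofReal x * w j ω) ≤ ENNReal.ofReal (4⁻¹ * (x : ℝ) ^ p) * e j ω := by
      refine ae_all_iff.2 fun x => ?_
      by_cases h1 : x₀ ≤ x ∧ (x : ℝ) ≤ x₁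
      · filter_upwards [measure_eq_zero_iff_ae_notMem.1 (hnull x h1.1 h1.2)] with ω hω hS _ _
        by_contra hcon
        exact hω ⟨hsafe hS, not_le.1 hcon⟩
      · exact ae_of_all _ fun ω _ h2 h3 => absurd ⟨h2, h3⟩ h1
    filter_upwards [this] with ω hω hS x using hω x hS
  have hpt : ∀ᵐ ω ∂μ, ω ∈ S → potential p e w (j + J) ω ≤
      ENNReal.ofReal ((1 / 2) ^ (1 / (4 * p))) * potential p e w j ω +
      ENNReal.ofReal (x₁ ^ (-(1 / 4) : ℝ)) * D.indicator (potential p e w j) ω +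
      ENNReal.ofReal (x₀ ^ (1 / 4 : ℝ)) * (g ω * w (j + J) ω ^ (-(1 / 2) : ℝ)) := by
    filter_upwards [hae, h.w_ne_zero, h.ae_e_ne_zero] with ω hω hw0 he0 hωS
    have := ennreal_potential_le hp hx₀ hx (he0 (j + J)) (hw0 (j + J)) (h.e_ne_top j ω)
      (h.w_ne_top j ω) (h.antitone_e ω (Nat.le_add_right j J))
      (h.antitone_w ω (Nat.le_add_right j J)) fun x h1 h2 h3 =>
        (h.le_τ _ _ _ h3).trans (hω hωS x h1 h2)
    refine this.trans_eq ?_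
    congr 3
    classical
    rw [Set.indicator_apply]
    exact if_congr Iff.rfl rfl rfl
  have h2 : ∫⁻ ω in S, D.indicator (potential p e w j) ω ∂μ ≤
      ENNReal.ofReal (κ + (4⁻¹ * x₁ ^ p)⁻¹ * ρ ^ J) * ∫⁻ ω in S, potential p e w j ω ∂μ := by
    rw [setLIntegral_indicator hDm, Set.inter_comm]
    exact h.setLIntegral_markov hρ hκ hS hsafe (h.measurable_potential j) (by positivity) J
  have h3 : ∫⁻ ω in S, g ω * w (j + J) ω ^ (-(1 / 2) : ℝ) ∂μ ≤
      2 ^ J * ∫⁻ ω in S, potential p e w j ω ∂μ := by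
    -- The exponents 1/4 - 1/2 = -1/4 restore the potential at time j.
    refine (h.setLIntegral_decay hS hgm J).trans (mul_le_mul_right (le_of_eq ?_) _)
    refine lintegral_congr_ae (ae_restrict_of_ae (h.w_ne_zero.mono fun ω hω => ?_))
    simp only [hg, potential]
    rw [mul_assoc, ← ENNReal.rpow_add _ _ (hω j) (h.w_ne_top j ω)]
    norm_num
  calc _ ≤ ∫⁻ ω in S, (ENNReal.ofReal ((1 / 2) ^ (1 / (4 * p))) * potential p e w j ω +
      ENNReal.ofReal (x₁ ^ (-(1 / 4) : ℝ)) * D.indicator (potential p e w j) ω +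
      ENNReal.ofReal (x₀ ^ (1 / 4 : ℝ)) * (g ω * w (j + J) ω ^ (-(1 / 2) : ℝ))) ∂μ :=
        setLIntegral_mono_ae' hS' hpt
    _ = ENNReal.ofReal ((1 / 2) ^ (1 / (4 * p))) * ∫⁻ ω in S, potential p e w j ω ∂μ +
      ENNReal.ofReal (x₁ ^ (-(1 / 4) : ℝ)) * ∫⁻ ω in S, D.indicator (potential p e w j) ω ∂μ +
      ENNReal.ofReal (x₀ ^ (1 / 4 : ℝ)) * ∫⁻ ω in S, g ω * w (j + J) ω ^ (-(1 / 2) : ℝ) ∂μ := by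
        have hm1 : Measurable fun ω =>
            ENNReal.ofReal ((1 / 2) ^ (1 / (4 * p))) * potential p e w j ω := hum.const_mul _
        have hm2 : Measurable fun ω => ENNReal.ofReal (x₁ ^ (-(1 / 4) : ℝ)) *
            D.indicator (potential p e w j) ω := (hum.indicator hDm).const_mul _
        have hm12 : Measurable fun ω =>
            ENNReal.ofReal ((1 / 2) ^ (1 / (4 * p))) * potential p e w j ω +
            ENNReal.ofReal (x₁ ^ (-(1 / 4) : ℝ)) * D.indicator (potential p e w j) ω := hm1.add hm2
        rw [lintegral_add_left hm12, lintegral_add_left hm1, lintegral_const_mul' _ _ ENNReal.ofReal_ne_top,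
          lintegral_const_mul' _ _ ENNReal.ofReal_ne_top,
          lintegral_const_mul' _ _ ENNReal.ofReal_ne_top]
    _ ≤ _ := by
        rw [ENNReal.ofReal_add (by positivity) (by positivity),
          ENNReal.ofReal_add (by positivity) (by positivity),
          ENNReal.ofReal_mul (p := x₁ ^ (-(1 / 4) : ℝ)) (by positivity),
          ENNReal.ofReal_mul (p := x₀ ^ (1 / 4 : ℝ)) (by positivity),
          ENNReal.ofReal_pow zero_le_two, ENNReal.ofReal_ofNat, add_mul, add_mul,
          mul_assoc (ENNReal.ofReal (x₁ ^ (-(1 / 4) : ℝ))),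
          mul_assoc (ENNReal.ofReal (x₀ ^ (1 / 4 : ℝ)))]
        gcongr

omit [IsFiniteMeasure μ] in
-- The exponents are matched so that the lower bound e ≥ c w^p cancels w.
theorem le_potential (hp : 0 < p) : ∀ᵐ ω ∂μ, ∀ j, c ^ (1 / (4 * p)) ≤ potential p e w j ω := by
  filter_upwards [h.w_ne_zero, h.lower] with ω hω hlow j
  have hs : 0 ≤ 1 / (4 * p) := by positivity
  have h1 := ENNReal.rpow_le_rpow (hlow j) hs
  rw [ENNReal.mul_rpow_of_nonneg _ _ hs, ← ENNReal.rpow_mul,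
    show p * (1 / (4 * p)) = 1 / 4 by field_simp] at h1
  calc c ^ (1 / (4 * p)) = c ^ (1 / (4 * p)) * w j ω ^ (1 / 4 : ℝ) * w j ω ^ (-(1 / 4) : ℝ) := by
        rw [mul_assoc, ← ENNReal.rpow_add _ _ (hω j) (h.w_ne_top j ω), add_neg_cancel,
          ENNReal.rpow_zero, mul_one]
    _ ≤ _ := by unfold potential; gcongr

/-- The order of the choices matters: θ and x₁ from p and ρ, then a block length J that makes the
Markov term small, then x₀ small against 2^J, then the horizon K, and last κ. Together the error
terms stay below the gap δ = 1 - (1/2)^(1/(4p)). -/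
theorem exists_constants (hp : 0 < p) (hρ : 0 < ρ) (hpρ : (1 + p) * ρ < 1) :
    ∃ (J : ℕ) (κ q : ℝ), 0 < κ ∧ κ < 1 ∧ q < 1 ∧ 0 ≤ q ∧ ∀ j S, MeasurableSet[ℱ j] S →
      S ⊆ safe μ ℱ R κ j → ∫⁻ ω in S, potential p e w (j + J) ω ∂μ ≤
        ENNReal.ofReal q * ∫⁻ ω in S, potential p e w j ω ∂μ := by
  obtain ⟨θ, hθ, hθρ⟩ := exists_exponent hρ hpρ
  obtain ⟨x₁, hx₁, hx₁', hr⟩ := exists_ratio_bound hp hθ hθρ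
  have hρ1 : ρ < 1 := by nlinarith
  set δ : ℝ := 1 - (1 / 2) ^ (1 / (4 * p)) with hδ
  have hδ0 : 0 < δ := sub_pos.2 (Real.rpow_lt_one (by norm_num) (by norm_num) (by positivity))
  have hX : 0 < x₁ ^ (-(1 / 4) : ℝ) := by positivity
  obtain ⟨J, hJ⟩ : ∃ J : ℕ, x₁ ^ (-(1 / 4) : ℝ) * ((4⁻¹ * x₁ ^ p)⁻¹ * ρ ^ J) < δ / 4 := by
    have hlim := ((tendsto_pow_atTop_nhds_zero_of_lt_one hρ.le hρ1).const_mul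
      (4⁻¹ * x₁ ^ p)⁻¹).const_mul (x₁ ^ (-(1 / 4) : ℝ))
    rw [mul_zero, mul_zero] at hlim
    exact (hlim.eventually (gt_mem_nhds (by positivity))).exists
  set x₀ : ℝ := min x₁ ((δ / 8 / 2 ^ J) ^ (4 : ℝ)) with hx₀def
  have hx₀ : 0 < x₀ := by positivity
  have hx₀J : x₀ ^ (1 / 4 : ℝ) * 2 ^ J ≤ δ / 8 := by
    have h1 : x₀ ^ (1 / 4 : ℝ) ≤ ((δ / 8 / 2 ^ J) ^ (4 : ℝ)) ^ (1 / 4 : ℝ) :=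
      Real.rpow_le_rpow hx₀.le (min_le_right _ _) (by norm_num)
    rw [← Real.rpow_mul (by positivity), show (4 : ℝ) * (1 / 4) = 1 by norm_num, Real.rpow_one] at h1
    rwa [le_div_iff₀ (by positivity)] at h1
  obtain ⟨K, κ₀, hκ₀, hK⟩ := exists_horizon hp hθ hρ hθρ hx₀ hx₁' hr
  set κ : ℝ := min (min κ₀ (1 / 2)) (δ / 4 / x₁ ^ (-(1 / 4) : ℝ)) with hκdef
  have hκ : 0 < κ := by positivity
  have hκX : x₁ ^ (-(1 / 4) : ℝ) * κ ≤ δ / 4 := by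
    have h1 : κ ≤ δ / 4 / x₁ ^ (-(1 / 4) : ℝ) := min_le_right _ _
    rwa [le_div_iff₀ hX, mul_comm] at h1
  refine ⟨J, κ, _, hκ, ?_, ?_, ?_, fun j S hS hsafe => h.setLIntegral_potential_le hp hρ.le hκ.le hx₀
    (min_le_left _ _) J (fun x hx1 hx2 => ?_) hS hsafe⟩
  · have : κ ≤ 1 / 2 := (min_le_left _ _).trans (min_le_right _ _)
    linarith
  · rw [mul_add]; linarith
  · positivity
  · exact h.measure_lt_τ_eq_zero hρ.le (by linarith) hκ.le (hx₀.trans_le hx1) (hx2.trans hx₁'.le)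
      (hK κ hκ.le ((min_le_left _ _).trans (min_le_left _ _)) x hx1 hx2) j

/-- Almost surely, one of the events `R i` does not occur. -/
theorem measure_iInter_eq_zero (hp : 0 < p) (hρ : 0 < ρ) (hpρ : (1 + p) * ρ < 1) :
    μ (⋂ i, R i) = 0 := by
  obtain ⟨J, κ, q, hκ, hκ1, hq1, hq0, hcon⟩ := h.exists_constants hp hρ hpρ
  have hG := h.measurableSet_iInter
  set s := 1 / (4 * p) with hs
  have hs0 : 0 < s := by positivity
  -- On `B j N m` the potential starts below N and contracts over m blocks of length J. As it is
  -- bounded below, the intersection over m is null.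
  set B : ℕ → ℕ → ℕ → Set Ω := fun j N m =>
    {ω | potential p e w j ω ≤ N} ∩ ⋂ l ∈ Finset.range (m + 1), safe μ ℱ R κ (j + l * J) with hB
  have hBm : ∀ j N m, MeasurableSet[ℱ (j + m * J)] (B j N m) := by
    intro j N m
    refine MeasurableSet.inter (ℱ.mono (Nat.le_add_right _ _) _
      (h.measurable_potential j measurableSet_Iic)) ?_
    refine MeasurableSet.biInter (Finset.countable_toSet _) fun l hl => ?_
    have hl : l ≤ m := Nat.lt_succ_iff.1 (Finset.mem_range.1 hl)
    exact ℱ.mono (Nat.add_le_add_left (Nat.mul_le_mul_right J hl) _) _ (measurableSet_safe κ _)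
  have hBsafe : ∀ j N m, B j N m ⊆ safe μ ℱ R κ (j + m * J) := fun j N m ω hω =>
    Set.mem_iInter₂.1 hω.2 m (by simp)
  have hBanti : ∀ j N m, B j N (m + 1) ⊆ B j N m := fun j N m ω hω =>
    ⟨hω.1, Set.mem_iInter₂.2 fun l hl => Set.mem_iInter₂.1 hω.2 l
      (by simp only [Finset.mem_range] at hl ⊢; omega)⟩
  have hdecay : ∀ j N m, ∫⁻ ω in B j N m, potential p e w (j + m * J) ω ∂μ ≤
      ENNReal.ofReal q ^ m * (N * μ Set.univ) := by
    intro j N m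
    induction m with
    | zero =>
      rw [pow_zero, one_mul, zero_mul, add_zero]
      calc _ ≤ ∫⁻ ω in B j N 0, N ∂μ :=
            setLIntegral_mono' (ℱ.le _ _ (hBm j N 0)) fun ω hω => hω.1
        _ = N * μ (B j N 0) := setLIntegral_const _ _
        _ ≤ _ := by gcongr; exact Set.subset_univ _
    | succ m ih =>
      refine (lintegral_mono_set (hBanti j N m)).trans ?_
      rw [show j + (m + 1) * J = j + m * J + J by ring, pow_succ', mul_assoc]
      exact (hcon _ _ (hBm j N m) (hBsafe j N m)).trans (mul_le_mul_right ih _)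
  have hnull : ∀ j N, μ (⋂ m, B j N m) = 0 := by
    intro j N
    have hle : ∀ m, c ^ s * μ (⋂ m, B j N m) ≤ ENNReal.ofReal q ^ m * (N * μ Set.univ) := by
      intro m
      refine le_trans ?_ (hdecay j N m)
      calc c ^ s * μ (⋂ m, B j N m) ≤ c ^ s * μ (B j N m) := by
            gcongr; exact Set.iInter_subset _ m
        _ = ∫⁻ ω in B j N m, c ^ s ∂μ := (setLIntegral_const _ _).symm
        _ ≤ _ := lintegral_mono_ae (ae_restrict_of_ae ((h.le_potential hp).mono fun ω hω => hω _))
    have hlim : Tendsto (fun m => ENNReal.ofReal q ^ m * (N * μ Set.univ)) atTop (𝓝 0) := by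
      have h1 := ENNReal.Tendsto.mul_const (ENNReal.tendsto_pow_atTop_nhds_zero_of_lt_one
        (ENNReal.ofReal_lt_one.2 hq1)) (b := (N : ℝ≥0∞) * μ Set.univ)
        (Or.inr (ENNReal.mul_ne_top (by simp) (measure_ne_top _ _)))
      rwa [zero_mul] at h1
    have h0 := le_antisymm (ge_of_tendsto' hlim hle) zero_le
    rcases mul_eq_zero.1 h0 with h1 | h1
    · rw [ENNReal.rpow_eq_zero_iff] at h1
      rcases h1 with ⟨h2, _⟩ | ⟨h2, _⟩
      · exact absurd h2 h.c_ne_zero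
      · exact absurd h2 h.c_ne_top
    · exact h1
  -- By Lévy's upward theorem, the conditional probability of the intersection tends to 1 on it, so
  -- a run in it is safe from some time on and lies in one of the null sets.
  have hlevy := tendsto_ae_condExp (μ := μ) (ℱ := ℱ) ((⋂ i, R i).indicator fun _ => (1 : ℝ))
  have hlim : μ[(⋂ i, R i).indicator (fun _ => (1 : ℝ)) | ⨆ n, ℱ n] =
      (⋂ i, R i).indicator fun _ => (1 : ℝ) := by
    refine condExp_of_stronglyMeasurable (iSup_le ℱ.le) ?_ ((integrable_const 1).indicator hG)
    refine (@stronglyMeasurable_const _ _ (⨆ n, ℱ n) _ 1).indicator ?_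
    exact MeasurableSet.iInter fun i => le_iSup (fun n => (ℱ n : MeasurableSpace Ω)) i _
      (h.measurableSet_R i)
  rw [hlim] at hlevy
  have hall : ∀ᵐ ω ∂μ, ω ∉ ⋂ i, R i := by
    filter_upwards [hlevy, h.w_ne_zero, measure_eq_zero_iff_ae_notMem.1
      (measure_iUnion_null fun j => measure_iUnion_null fun N => hnull j N)] with ω h1 h2 h3 hωG
    rw [Set.indicator_of_mem hωG] at h1
    obtain ⟨j, hj⟩ := (h1.eventually (lt_mem_nhds (show 1 - κ < 1 by linarith))).exists_forall_of_atTop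
    have hut : potential p e w j ω ≠ ⊤ := by
      refine ENNReal.mul_ne_top (ENNReal.rpow_ne_top_of_nonneg hs0.le (h.e_ne_top j ω)) ?_
      simp [ENNReal.rpow_eq_top_iff, h2 j]
    obtain ⟨N, hN⟩ := ENNReal.exists_nat_gt hut
    refine h3 (Set.mem_iUnion.2 ⟨j, Set.mem_iUnion.2 ⟨N, Set.mem_iInter.2 fun m => ⟨hN.le, ?_⟩⟩⟩)
    exact Set.mem_iInter₂.2 fun l _ => (hj _ (Nat.le_add_right _ _)).le
  exact measure_eq_zero_iff_ae_notMem.2 hall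

end ShrinkingProcess

end InformedRRT

/-! ### Moments of variables that dominate a uniform one -/

namespace InformedRRT

section Uniform

variable {E : Type*} [MeasurableSpace E] {κ : Measure E} [IsProbabilityMeasure κ] {Y : E → ℝ}

/-- A random variable that dominates a uniform one has larger moments. -/
theorem one_le_mul_lintegral_rpow (hY : Measurable Y) (hY0 : ∀ y, 0 ≤ Y y)
    (h : ∀ s : ℝ, 0 ≤ s → s < 1 → κ {y | Y y ≤ s} ≤ ENNReal.ofReal s) {θ : ℝ} (hθ : 0 < θ) :
    1 ≤ ENNReal.ofReal (1 + θ) * ∫⁻ y, ENNReal.ofReal (Y y ^ θ) ∂κ := by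
  rw [lintegral_eq_lintegral_meas_le κ (ae_of_all _ fun y => Real.rpow_nonneg (hY0 y) θ)
    (hY.pow_const θ).aemeasurable]
  -- The layer-cake formula for a uniform variable U, where U^θ > t has probability 1 - t^(1/θ).
  have h1 : ENNReal.ofReal (1 / (1 + θ)) = ∫⁻ t in Set.Ioo (0 : ℝ) 1,
      ENNReal.ofReal (1 - t ^ (1 / θ)) := by
    rw [← ofReal_integral_eq_lintegral_ofReal]
    · congr 1
      rw [← integral_Ioc_eq_integral_Ioo, ← intervalIntegral.integral_of_le zero_le_one,
        intervalIntegral.integral_sub (by simp) (intervalIntegral.intervalIntegrable_rpow'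
          (by have : 0 < 1 / θ := by positivity
              linarith)), integral_rpow (Or.inl (by
          have : 0 < 1 / θ := by positivity
          linarith)), intervalIntegral.integral_const, Real.one_rpow, Real.zero_rpow (by positivity)]
      simp only [smul_eq_mul]
      field_simp
      ring
    · have h2 : IntervalIntegrable (fun t : ℝ => 1 - t ^ (1 / θ)) volume 0 1 :=
        IntervalIntegrable.sub (by simp) (intervalIntegral.intervalIntegrable_rpow' (by
          have : 0 < 1 / θ := by positivity
          linarith))
      exact ((intervalIntegrable_iff_integrableOn_Ioo_of_le zero_le_one).1 h2)
    · refine (ae_restrict_iff' measurableSet_Ioo).2 (ae_of_all _ fun t ht => ?_)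
      exact sub_nonneg.2 (Real.rpow_le_one ht.1.le ht.2.le (by positivity))
  have h2 : ∫⁻ t in Set.Ioo (0 : ℝ) 1, ENNReal.ofReal (1 - t ^ (1 / θ)) ≤
      ∫⁻ t in Set.Ioi (0 : ℝ), κ {a | t ≤ Y a ^ θ} := by
    refine le_trans ?_ (lintegral_mono_set (Set.Ioo_subset_Ioi_self : Set.Ioo (0 : ℝ) 1 ⊆ Set.Ioi 0))
    refine setLIntegral_mono' measurableSet_Ioo fun t ht => ?_
    have hs1 : t ^ (1 / θ) < 1 := Real.rpow_lt_one ht.1.le ht.2 (by positivity)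
    have hs0 : 0 ≤ t ^ (1 / θ) := Real.rpow_nonneg ht.1.le _
    have h3 : {y | Y y ≤ t ^ (1 / θ)}ᶜ ⊆ {a | t ≤ Y a ^ θ} := by
      intro y hy
      have hy : t ^ (1 / θ) < Y y := not_le.1 hy
      have := Real.rpow_le_rpow hs0 hy.le hθ.le
      rwa [← Real.rpow_mul ht.1.le, one_div_mul_cancel hθ.ne', Real.rpow_one] at this
    refine le_trans ?_ (measure_mono h3)
    rw [prob_compl_eq_one_sub (measurableSet_le hY measurable_const), ENNReal.ofReal_sub _ hs0,
      ENNReal.ofReal_one]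
    exact tsub_le_tsub_left (h _ hs0 hs1) _
  have h3 : ENNReal.ofReal (1 + θ) * ENNReal.ofReal (1 / (1 + θ)) = 1 := by
    rw [← ENNReal.ofReal_mul (by positivity), mul_one_div_cancel (by positivity), ENNReal.ofReal_one]
  rw [← h3]
  exact mul_le_mul_right (h1.trans_le h2) _

/-- In the layer-cake formula, the levels below 1 contribute at most 1, and a level t > 1
contributes at most t^(-2), whose integral over (1, ∞) is 1. -/
theorem lintegral_rpow_neg_half_le (hY : Measurable Y) (hY0 : ∀ y, 0 ≤ Y y)
    (h : ∀ s : ℝ, 0 ≤ s → s < 1 → κ {y | Y y ≤ s} ≤ ENNReal.ofReal s) :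
    ∫⁻ y, ENNReal.ofReal (Y y ^ (-(1 / 2) : ℝ)) ∂κ ≤ 2 := by
  rw [lintegral_eq_lintegral_meas_le κ (ae_of_all _ fun y => Real.rpow_nonneg (hY0 y) _)
    (hY.pow_const _).aemeasurable, ← Set.Ioc_union_Ioi_eq_Ioi zero_le_one]
  refine (lintegral_union_le _ _ _).trans ?_
  refine (add_le_add (b := 1) (d := 1) ?_ ?_).trans_eq one_add_one_eq_two
  · calc _ ≤ ∫⁻ _ in Set.Ioc (0 : ℝ) 1, 1 := lintegral_mono fun t => prob_le_one
      _ = 1 := by simp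
  · have h1 : ∫⁻ t in Set.Ioi (1 : ℝ), ENNReal.ofReal (t ^ (-2 : ℝ)) = 1 := by
      rw [← ofReal_integral_eq_lintegral_ofReal (integrableOn_Ioi_rpow_of_lt (by norm_num) one_pos),
        integral_Ioi_rpow_of_lt (by norm_num) one_pos]
      · norm_num
      · refine (ae_restrict_iff' measurableSet_Ioi).2 (ae_of_all _ fun t ht => ?_)
        exact Real.rpow_nonneg (zero_le_one.trans (le_of_lt ht)) _
    rw [← h1]
    refine setLIntegral_mono' measurableSet_Ioi fun t ht => ?_
    have ht : 1 < t := ht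
    have ht0 : 0 < t := one_pos.trans ht
    refine (measure_mono ?_).trans (h (t ^ (-2 : ℝ)) (Real.rpow_nonneg ht0.le _)
      (Real.rpow_lt_one_of_one_lt_of_neg ht (by norm_num)))
    intro y hy
    have hy : t ≤ Y y ^ (-(1 / 2) : ℝ) := hy
    have hY1 : 0 < Y y := by
      refine lt_of_le_of_ne (hY0 y) fun h0 => ?_
      rw [← h0, Real.zero_rpow (by norm_num)] at hy
      linarith
    have h2 := Real.rpow_le_rpow_of_nonpos ht0 hy (show (-2 : ℝ) ≤ 0 by norm_num)
    rwa [← Real.rpow_mul hY1.le, show (-(1 / 2) : ℝ) * -2 = 1 by norm_num, Real.rpow_one] at h2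

theorem rpow_le_mul_lintegral {X : E → ℝ≥0∞} {W : ℝ≥0∞} (hX : Measurable X) (hW0 : W ≠ 0)
    (hWt : W ≠ ⊤) (hXt : ∀ y, X y ≠ ⊤)
    (h : ∀ s : ℝ, 0 ≤ s → s < 1 → κ {y | X y ≤ ENNReal.ofReal s * W} ≤ ENNReal.ofReal s) {θ : ℝ}
    (hθ : 0 ≤ θ) : W ^ θ ≤ ENNReal.ofReal (1 + θ) * ∫⁻ y, X y ^ θ ∂κ := by
  rcases hθ.eq_or_lt with rfl | hθ
  · simp
  have hY : ∀ y, ENNReal.ofReal ((X y / W).toReal) = X y / W := fun y =>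
    ENNReal.ofReal_toReal (ENNReal.div_ne_top (hXt y) hW0)
  have h1 := one_le_mul_lintegral_rpow (κ := κ) (Y := fun y => (X y / W).toReal)
    (hX.div_const W).ennreal_toReal (fun y => ENNReal.toReal_nonneg) (fun s hs hs1 => by
      refine (measure_mono fun y hy => ?_).trans (h s hs hs1)
      have hy : (X y / W).toReal ≤ s := hy
      have := ENNReal.ofReal_le_ofReal hy
      rw [hY] at this
      exact (ENNReal.div_le_iff hW0 hWt).1 this) hθ
  have h2 : ∀ y, X y ^ θ = W ^ θ * ENNReal.ofReal ((X y / W).toReal ^ θ) := by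
    intro y
    rw [← ENNReal.ofReal_rpow_of_nonneg ENNReal.toReal_nonneg hθ.le, hY,
      ← ENNReal.mul_rpow_of_nonneg _ _ hθ.le, ENNReal.mul_div_cancel hW0 hWt]
  simp only [h2]
  rw [lintegral_const_mul' _ _ (ENNReal.rpow_ne_top_of_nonneg hθ.le hWt), mul_left_comm]
  exact le_mul_of_one_le_right zero_le h1

theorem lintegral_rpow_neg_half_le' {X : E → ℝ≥0∞} {W : ℝ≥0∞} (hX : Measurable X) (hW0 : W ≠ 0)
    (hWt : W ≠ ⊤) (hXt : ∀ y, X y ≠ ⊤)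
    (h : ∀ s : ℝ, 0 ≤ s → s < 1 → κ {y | X y ≤ ENNReal.ofReal s * W} ≤ ENNReal.ofReal s) :
    ∫⁻ y, X y ^ (-(1 / 2) : ℝ) ∂κ ≤ 2 * W ^ (-(1 / 2) : ℝ) := by
  have hY : ∀ y, ENNReal.ofReal ((X y / W).toReal) = X y / W := fun y =>
    ENNReal.ofReal_toReal (ENNReal.div_ne_top (hXt y) hW0)
  -- The value 0 has to be excluded: its power of exponent -1/2 is infinite for extended reals but 0
  -- for reals.
  have h0 : κ {y | (X y / W).toReal ≤ 0} ≤ 0 := by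
    refine (measure_mono fun y hy => ?_).trans ((h 0 le_rfl one_pos).trans_eq (by simp))
    have hy : (X y / W).toReal ≤ 0 := hy
    have := ENNReal.ofReal_le_ofReal hy
    rw [hY] at this
    exact (ENNReal.div_le_iff hW0 hWt).1 this
  have h1 := lintegral_rpow_neg_half_le (κ := κ) (Y := fun y => (X y / W).toReal)
    (hX.div_const W).ennreal_toReal (fun y => ENNReal.toReal_nonneg) (fun s hs hs1 => by
      refine (measure_mono fun y hy => ?_).trans (h s hs hs1)
      have hy : (X y / W).toReal ≤ s := hy
      have := ENNReal.ofReal_le_ofReal hy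
      rw [hY] at this
      exact (ENNReal.div_le_iff hW0 hWt).1 this)
  have h2 : ∀ᵐ y ∂κ, X y ^ (-(1 / 2) : ℝ) =
      W ^ (-(1 / 2) : ℝ) * ENNReal.ofReal ((X y / W).toReal ^ (-(1 / 2) : ℝ)) := by
    filter_upwards [measure_eq_zero_iff_ae_notMem.1 (le_antisymm h0 zero_le)] with y hy
    have hy : 0 < (X y / W).toReal := not_le.1 hy
    have hX0 : X y ≠ 0 := fun h3 => by simp [h3] at hy
    rw [← ENNReal.ofReal_rpow_of_pos hy, hY, ← ENNReal.mul_rpow_of_ne_top hWt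
      (ENNReal.div_ne_top (hXt y) hW0), ENNReal.mul_div_cancel hW0 hWt]
  rw [lintegral_congr_ae h2, lintegral_const_mul' _ _ (by simp [ENNReal.rpow_eq_top_iff, hW0]),
    mul_comm]
  exact mul_le_mul_left h1 _

end Uniform

end InformedRRT

/-! ### Uniform shrinkage of the informed set and inactivity of steering near the optimum -/

namespace InformedRRT

variable {n : ℕ} {P : Problem n} {cfg : Config} {T : Tree n}

/-- The volume of the informed set of the heuristic cost of a uniform sample dominates a uniform
random variable. -/
theorem Problem.volume_informedSet_heuristic_le (P : Problem n) (hn : 2 ≤ n) {D : Set (Space n)}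
    {a : ℝ≥0∞} {c : ℝ} (hD : ∀ y ∈ D, y ∈ P.informedSet c ∧ volume (P.informedSet (P.heuristic y)) ≤ a) :
    volume D ≤ a := by
  rcases D.eq_empty_or_nonempty with rfl | hne
  · simp
  have hbdd : BddAbove (P.heuristic '' D) := ⟨c, by rintro _ ⟨y, hy, rfl⟩; exact le_of_lt (hD y hy).1.2⟩
  -- D lies in the informed set of t up to the null level set h = t. That informed set is the
  -- increasing union of informed sets of heuristic costs attained in D, each of volume at most a.
  set t := sSup (P.heuristic '' D) with ht
  obtain ⟨u, hu, hut, hmem⟩ := exists_seq_tendsto_sSup (hne.image P.heuristic) hbdd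
  have h1 : P.informedSet t ⊆ ⋃ k, P.informedSet (u k) := by
    intro y hy
    obtain ⟨k, hk⟩ := (hut.eventually (lt_mem_nhds (show P.heuristic y < t from hy.2))).exists
    exact Set.mem_iUnion.2 ⟨k, hy.1, hk⟩
  have h2 : volume (P.informedSet t) ≤ a := by
    refine (measure_mono h1).trans ?_
    rw [Monotone.measure_iUnion fun i j hij => P.informedSet_mono (hu hij)]
    refine iSup_le fun k => ?_
    obtain ⟨y, hy, hyk⟩ := hmem k
    rw [← hyk]
    exact (hD y hy).2
  have h3 : volume {y | P.heuristic y = t} = 0 := by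
    rcases lt_or_ge P.focal t with h | h
    · exact P.volume_heuristic_eq h
    · exact measure_mono_null (fun y (hy : P.heuristic y = t) => hy.trans_le h)
        (P.volume_heuristic_le_focal hn)
  have h4 : D ⊆ P.informedSet t ∪ {y | P.heuristic y = t} := by
    intro y hy
    rcases (le_csSup hbdd (Set.mem_image_of_mem _ hy)).eq_or_lt with h | h
    · exact Or.inr h
    · exact Or.inl ⟨(hD y hy).1.1, h⟩
  refine (measure_mono h4).trans ((measure_union_le _ _).trans ?_)
  rw [h3, add_zero]
  exact h2

/-- Where steering is inactive, an iteration shrinks the volume of the informed set by at most a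
uniform factor. -/
theorem Tree.Inv.sampleLaw_volume_le (hT : T.Inv P cfg) (hn : 2 ≤ n)
    (hnew : ∀ y ∈ P.informedSet (T.cost P), newState cfg T y = y)
    (hW : volume (P.informedSet (T.cost P)) ≠ 0) {s : ℝ} (hs1 : s < 1) :
    P.sampleLaw (T.cost P) {y | volume (P.informedSet ((InformedRRT.step P cfg T y).cost P)) ≤
      ENNReal.ofReal s * volume (P.informedSet (T.cost P))} ≤ ENNReal.ofReal s := by
  set W := volume (P.informedSet (T.cost P)) with hWdef
  have hWt : W ≠ ⊤ := (P.volume_informedSet_lt_top _).ne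
  have h1 : volume (P.informedSet (T.cost P) ∩ {y | volume (P.informedSet ((InformedRRT.step P cfg T y).cost P)) ≤
      ENNReal.ofReal s * W}) ≤ ENNReal.ofReal s * W := by
    refine P.volume_informedSet_heuristic_le hn (c := T.cost P) fun y hy => ⟨hy.1, ?_⟩
    have hy2 : volume (P.informedSet ((InformedRRT.step P cfg T y).cost P)) ≤ ENNReal.ofReal s * W := hy.2
    -- As s < 1, the volume can have shrunk this much only through an improvement, and then the new
    -- cost is at least the heuristic cost of y.
    have hlt : (InformedRRT.step P cfg T y).cost P < T.cost P := by
      refine lt_of_le_of_ne (hT.cost_step_le y) fun h => ?_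
      rw [h, ← hWdef] at hy2
      have : ENNReal.ofReal s * W < 1 * W :=
        ENNReal.mul_lt_mul_left hW hWt (by rw [← ENNReal.ofReal_one]; exact (ENNReal.ofReal_lt_ofReal_iff one_pos).2 hs1)
      rw [one_mul] at this
      exact absurd hy2 (not_le.2 this)
    have := hT.heuristic_le_cost_step hlt
    rw [hnew y hy.1] at this
    exact (measure_mono (P.informedSet_mono this)).trans hy2
  rw [P.sampleLaw_apply, ← hWdef]
  calc W⁻¹ * _ ≤ W⁻¹ * (ENNReal.ofReal s * W) := mul_le_mul_right h1 _
    _ = ENNReal.ofReal s := by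
      rw [mul_left_comm, ENNReal.inv_mul_cancel hW hWt, mul_one]

namespace Problem

variable (P)

/-- The coordinate along the segment from the start to the goal. -/
noncomputable def along (p : Space n) : ℝ := inner ℝ P.axis (p - P.start)

/-- The component perpendicular to the segment from the start to the goal. -/
noncomputable def across (p : Space n) : Space n := p - P.start - P.along p • P.axis

theorem along_sub_along (p q : Space n) : P.along p - P.along q = inner ℝ P.axis (p - q) := by
  rw [along, along, ← inner_sub_right, sub_sub_sub_cancel_right]

theorem abs_along_sub_along_le (p q : Space n) : |P.along p - P.along q| ≤ ‖p - q‖ := by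
  rw [along_sub_along]
  have := abs_real_inner_le_norm P.axis (p - q)
  rwa [P.norm_axis, one_mul] at this

theorem along_start : P.along P.start = 0 := by simp [along]

theorem along_goal : P.along P.goal = P.focal := by
  rw [along, ← P.focal_smul_axis, inner_smul_right, real_inner_self_eq_norm_sq, P.norm_axis]; ring

theorem inner_axis_across (p : Space n) : inner ℝ P.axis (P.across p) = 0 := by
  rw [across, inner_sub_right, inner_smul_right, real_inner_self_eq_norm_sq, P.norm_axis, along]
  ring

theorem norm_sub_sq_eq (p q : Space n) :
    ‖p - q‖ ^ 2 = (P.along p - P.along q) ^ 2 + ‖P.across p - P.across q‖ ^ 2 := by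
  have h : p - q = (P.along p - P.along q) • P.axis + (P.across p - P.across q) := by
    simp only [across]; module
  have h0 : inner ℝ P.axis (P.across p - P.across q) = 0 := by
    rw [inner_sub_right, P.inner_axis_across, P.inner_axis_across, sub_zero]
  rw [h, norm_add_sq_real, inner_smul_left, h0, norm_smul, P.norm_axis, mul_one, Real.norm_eq_abs,
    sq_abs]
  simp

theorem across_start : P.across P.start = 0 := by simp [across, along_start]

variable {P}

/-- The distance to the start exceeds its projection by at most e, because the distance to the goal
is at least its own projection. The square of the perpendicular part is the product of the
difference and the sum of that distance and its projection. -/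
theorem along_bounds {p : Space n} {e : ℝ} (h : P.heuristic p ≤ P.focal + e) :
    -e ≤ P.along p ∧ P.along p ≤ P.focal + e ∧ ‖P.across p‖ ^ 2 ≤ 2 * e * (P.focal + e) := by
  have h1 := (abs_le.1 (P.abs_along_sub_along_le p P.start)).2
  have h2 := (abs_le.1 (P.abs_along_sub_along_le P.goal p)).2
  have h3 := P.norm_sub_sq_eq p P.start
  rw [P.along_start, sub_zero] at h1
  rw [P.along_goal] at h2
  rw [P.along_start, P.across_start, sub_zero, sub_zero] at h3
  have h4 := norm_nonneg (p - P.start)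
  have h5 := norm_nonneg (P.goal - p)
  rw [heuristic] at h
  refine ⟨by linarith, by linarith, ?_⟩
  have h6 : 0 ≤ ‖p - P.start‖ - P.along p := by linarith
  have h7 : ‖p - P.start‖ - P.along p ≤ e := by linarith
  rw [show ‖P.across p‖ ^ 2 = (‖p - P.start‖ - P.along p) * (‖p - P.start‖ + P.along p) by
    linear_combination -h3]
  have h8 : 0 ≤ ‖p - P.start‖ + P.along p := by
    have := (abs_le.1 (P.abs_along_sub_along_le p P.start)).1
    rw [P.along_start] at this
    linarith
  calc _ ≤ e * (‖p - P.start‖ + P.along p) := mul_le_mul_of_nonneg_right h7 h8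
    _ ≤ e * (2 * (P.focal + e)) := mul_le_mul_of_nonneg_left (by linarith) (h6.trans h7)
    _ = _ := by ring

/-- By the parallelogram law the perpendicular parts differ in square by at most 8e(d + e) ≤ r²/2,
and the projections by at most r²/4. -/
theorem norm_sub_le_of_heuristic_le {p q : Space n} {e r : ℝ} (hr : 0 ≤ r)
    (hp : P.heuristic p ≤ P.focal + e) (hq : P.heuristic q ≤ P.focal + e)
    (h : |P.along p - P.along q| ≤ r / 2) (he : 16 * e * (P.focal + e) ≤ r ^ 2) : ‖p - q‖ ≤ r := by
  have h1 := (along_bounds hp).2.2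
  have h2 := (along_bounds hq).2.2
  have h3 := parallelogram_law_with_norm ℝ (P.across p) (P.across q)
  have h4 : (P.along p - P.along q) ^ 2 ≤ (r / 2) ^ 2 := sq_le_sq' (abs_le.1 h).1 (abs_le.1 h).2
  refine abs_le_of_sq_le_sq' ?_ hr |>.2
  rw [P.norm_sub_sq_eq]
  nlinarith [mul_self_nonneg ‖P.across p + P.across q‖]

end Problem

/-- A sequence with small steps passes close to every intermediate value. -/
theorem exists_abs_sub_le {f : ℕ → ℝ} {r t : ℝ} {K : ℕ} (hf : ∀ k, |f k - f (k + 1)| ≤ r)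
    (h0 : t ≤ f 0) (hK : f K ≤ t) : ∃ k, |f k - t| ≤ r / 2 := by
  classical
  have hex : ∃ k, f k ≤ t := ⟨K, hK⟩
  have hr : 0 ≤ r := (abs_nonneg _).trans (hf 0)
  rcases hk : Nat.find hex with _ | k
  · have h1 := Nat.find_spec hex
    rw [hk] at h1
    exact ⟨0, by rw [le_antisymm h1 h0, sub_self, abs_zero]; positivity⟩
  · have h1 := Nat.find_spec hex
    rw [hk] at h1
    have h2 : t < f k := not_le.1 (Nat.find_min hex (by omega))
    have h3 := (abs_le.1 (hf k)).2
    rcases le_total (f k - t) (r / 2) with h4 | h4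
    · exact ⟨k, by rw [abs_of_pos (by linarith)]; exact h4⟩
    · exact ⟨k + 1, by rw [abs_of_nonpos (by linarith)]; linarith⟩

theorem Tree.Inv.costToCome_add_le (hT : T.Inv P cfg) {v : ℕ} (hv : v ∈ T.verts) (k : ℕ) :
    T.costToCome (T.par^[k] v) + ‖T.pos v - T.pos (T.par^[k] v)‖ ≤ T.costToCome v := by
  induction k with
  | zero => simp
  | succ k ih =>
    have h1 := hT.costToCome_par (hT.iterate_mem hv k)
    rw [Function.iterate_succ_apply']
    have h2 := norm_sub_le_norm_sub_add_norm_sub (T.pos v) (T.pos (T.par^[k] v))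
      (T.pos (T.par (T.par^[k] v)))
    linarith

theorem Tree.Inv.heuristic_solution_le (hT : T.Inv P cfg) {γ : ℕ} (hγ : γ ∈ T.verts)
    (hg : T.pos γ = P.goal) (k : ℕ) : P.heuristic (T.pos (T.par^[k] γ)) ≤ T.costToCome γ := by
  have h1 := hT.costToCome_add_le hγ k
  rw [hg] at h1
  exact (add_le_add (hT.norm_start_le (hT.iterate_mem hγ k)) le_rfl).trans h1

/-- Near optimality, the vertices of the solution are so dense that no sample is steered. -/
theorem Tree.Inv.newState_eq (hT : T.Inv P cfg) {e : ℝ}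
    (hη : cfg.η ≠ ⊤ → 2 * e ≤ cfg.η.toReal ∧ 16 * e * (P.focal + e) ≤ cfg.η.toReal ^ 2)
    (hc : T.cost P ≤ P.focal + e) {y : Space n} (hy : P.heuristic y ≤ P.focal + e) :
    newState cfg T y = y := by
  by_cases htop : cfg.η = ⊤
  · rw [newState, htop, steer_top]
  obtain ⟨h1, h2⟩ := hη htop
  set r := cfg.η.toReal with hr
  have hr0 : 0 ≤ r := ENNReal.toReal_nonneg
  obtain ⟨γ, hγ, hg, hcost⟩ := Tree.exists_cost_eq (P := P) hT.has_solution
  have hdist : ∀ {a b : Space n}, edist a b ≤ cfg.η ↔ ‖a - b‖ ≤ r := by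
    intro a b
    rw [edist_dist, dist_eq_norm, hr, ENNReal.ofReal_le_iff_le_toReal htop]
  have hheur : ∀ k, P.heuristic (T.pos (T.par^[k] γ)) ≤ P.focal + e := fun k =>
    (hT.heuristic_solution_le hγ hg k).trans (hcost.le.trans hc)
  -- Projected to the axis, the solution runs from the goal to the start in steps of length at most
  -- η, so some vertex projects within η/2 of the sample. A sample projecting beyond a focus
  -- overshoots it by at most e ≤ η/2.
  have hex : ∃ k, |P.along (T.pos (T.par^[k] γ)) - P.along y| ≤ r / 2 := by
    obtain ⟨hy1, hy2, -⟩ := Problem.along_bounds hy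
    have hroot : P.along (T.pos (T.par^[T.next] γ)) = 0 := by
      rw [hT.iterate_next hγ, hT.root_pos, P.along_start]
    have hgoal : P.along (T.pos (T.par^[0] γ)) = P.focal := by
      rw [Function.iterate_zero, id, hg, P.along_goal]
    rcases le_total (P.along y) 0 with h | h
    · exact ⟨T.next, by rw [hroot, zero_sub, abs_neg, abs_of_nonpos h]; linarith⟩
    rcases le_total P.focal (P.along y) with h' | h'
    · exact ⟨0, by rw [hgoal, abs_of_nonpos (by linarith)]; linarith⟩
    refine exists_abs_sub_le (f := fun k => P.along (T.pos (T.par^[k] γ))) (K := T.next)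
      (fun k => ?_) (hgoal ▸ h') (hroot ▸ h)
    refine (P.abs_along_sub_along_le _ _).trans ?_
    rw [Function.iterate_succ_apply', norm_sub_rev]
    exact hdist.1 (hT.edge_le _ (hT.iterate_mem hγ k))
  obtain ⟨k, hk⟩ := hex
  rw [abs_sub_comm] at hk
  have h3 := P.norm_sub_le_of_heuristic_le hr0 hy (hheur k) hk h2
  have h4 := (Tree.nearest_spec ⟨0, hT.root_mem⟩ y).2 _ (hT.iterate_mem hγ k)
  rw [newState, steer, if_pos]
  rw [hdist, norm_sub_rev]
  exact h4.trans h3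

end InformedRRT

/-! ### Lower bound when the optimal solution is straight -/

namespace InformedRRT

variable {n : ℕ} {P : Problem n} {cfg : Config} {T : Tree n}

/-- The volume of a thin informed set bounds its cost from below. -/
theorem Problem.exists_mul_volume_rpow_le (P : Problem n) (hn : 2 ≤ n) :
    ∃ C : ℝ≥0∞, C ≠ 0 ∧ C ≠ ⊤ ∧ ∀ e : ℝ, 0 ≤ e → e ≤ 1 →
      C * volume (P.informedSet (P.focal + e)) ^ (2 / ((n : ℝ) - 1)) ≤ ENNReal.ofReal e := by
  have hn' : (0 : ℝ) < (n : ℝ) - 1 := by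
    have : (2 : ℝ) ≤ n := by exact_mod_cast hn
    linarith
  set p : ℝ := 2 / ((n : ℝ) - 1) with hp
  have hp0 : 0 < p := by positivity
  have hd := P.focal_pos
  set B : ℝ := volume.real (Metric.ball (0 : Space n) 1)
  have hB : 0 < B := ENNReal.toReal_pos (Metric.measure_ball_pos _ _ one_pos).ne' measure_ball_lt_top.ne
  -- From (d + e)² - d² ≤ (2d + 1)e for e ≤ 1, the volume is at most K e^((n-1)/2), and the power
  -- 2/(n-1) makes this linear in e.
  set K : ℝ := (√(2 * P.focal + 1) / 2) ^ (n - 1) * ((P.focal + 1) / 2) * B with hK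
  have hK0 : 0 < K := by positivity
  refine ⟨ENNReal.ofReal (K ^ (-p)), by simpa using (by positivity), ENNReal.ofReal_ne_top,
    fun e he0 he1 => ?_⟩
  rcases he0.eq_or_lt with rfl | he
  · rw [add_zero, Problem.informedSet, P.hyperspheroid_eq_empty le_rfl, Set.inter_empty,
      measure_empty, ENNReal.zero_rpow_of_pos hp0, mul_zero]
    exact zero_le
  have h1 : P.spheroidVolume (P.focal + e) ≤ K * √e ^ (n - 1) := by
    have h2 : P.semiMinor (P.focal + e) ≤ √(2 * P.focal + 1) / 2 * √e := by
      rw [Problem.semiMinor, div_mul_eq_mul_div, ← Real.sqrt_mul (by positivity)]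
      gcongr
      nlinarith
    calc P.spheroidVolume (P.focal + e) ≤
        (√(2 * P.focal + 1) / 2 * √e) ^ (n - 1) * ((P.focal + 1) / 2) * B := by
          unfold Problem.spheroidVolume
          gcongr
          exact (P.semiMinor_pos (by linarith)).le
      _ = K * √e ^ (n - 1) := by rw [hK, mul_pow]; ring
  have h2 : volume (P.informedSet (P.focal + e)) ≤ ENNReal.ofReal (K * √e ^ (n - 1)) := by
    refine (measure_mono Set.inter_subset_right).trans ?_
    rw [← ENNReal.ofReal_toReal (P.volume_hyperspheroid_lt_top _).ne]
    refine ENNReal.ofReal_le_ofReal (le_trans (le_of_eq ?_) h1)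
    exact P.volume_real_hyperspheroid (by linarith)
  have h3 : (K * √e ^ (n - 1)) ^ p = K ^ p * e := by
    rw [Real.mul_rpow hK0.le (by positivity), Real.sqrt_eq_rpow, ← Real.rpow_natCast,
      ← Real.rpow_mul he.le, ← Real.rpow_mul he.le, Nat.cast_sub (by omega), hp]
    congr 1
    rw [show 1 / 2 * ((n : ℝ) - (1 : ℕ)) * (2 / ((n : ℝ) - 1)) = 1 by push_cast; field_simp,
      Real.rpow_one]
  calc _ ≤ ENNReal.ofReal (K ^ (-p)) * ENNReal.ofReal (K * √e ^ (n - 1)) ^ p :=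
        mul_le_mul_right (ENNReal.rpow_le_rpow h2 hp0.le) _
    _ = ENNReal.ofReal e := by
      rw [ENNReal.ofReal_rpow_of_nonneg (by positivity) hp0.le, h3,
        ← ENNReal.ofReal_mul (by positivity), ← mul_assoc, ← Real.rpow_add hK0, neg_add_cancel,
        Real.rpow_zero, one_mul]

theorem Config.exists_threshold (cfg : Config) {d : ℝ} (hd : 0 < d) : ∃ t : ℝ, 0 < t ∧ t ≤ 1 ∧
    (cfg.η ≠ ⊤ → 2 * t ≤ cfg.η.toReal ∧ 16 * t * (d + t) ≤ cfg.η.toReal ^ 2) := by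
  by_cases h : cfg.η = ⊤
  · exact ⟨1, one_pos, le_rfl, fun h' => absurd h h'⟩
  have hr : 0 < cfg.η.toReal := ENNReal.toReal_pos cfg.η_pos.ne' h
  set r := cfg.η.toReal
  refine ⟨min 1 (min (r / 2) (r ^ 2 / (16 * (d + 1)))), by positivity, min_le_left _ _, fun _ => ?_⟩
  set t := min 1 (min (r / 2) (r ^ 2 / (16 * (d + 1)))) with ht
  have h1 : t ≤ 1 := min_le_left _ _
  have h2 : t ≤ r / 2 := (min_le_right _ _).trans (min_le_left _ _)
  have h3 : t ≤ r ^ 2 / (16 * (d + 1)) := (min_le_right _ _).trans (min_le_right _ _)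
  have h0 : 0 < t := by positivity
  rw [le_div_iff₀ (by positivity)] at h3
  exact ⟨by linarith, by nlinarith⟩

universe u

variable {T₀ : Tree n} {Ω : Type u} {x : ℕ → Ω → Space n}

theorem Problem.measurable_volume_informedSet (P : Problem n) :
    Measurable fun c => volume (P.informedSet c) :=
  Monotone.measurable fun _ _ h => measure_mono (P.informedSet_mono h)

variable [m0 : MeasurableSpace Ω] {μ : Measure Ω} [IsProbabilityMeasure μ]

theorem IsRun.setLIntegral_mul_tree (hx : IsRun P cfg T₀ μ x) (i : ℕ) {S : Set Ω}
    (hS : MeasurableSet[past x i] S) {g : Ω → ℝ≥0∞} (hg : Measurable[past x i] g)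
    {Ψ : Tree n → Space n → ℝ≥0∞} (hΨ : MeasTreeFun.{u} Ψ) :
    ∫⁻ ω in S, g ω * Ψ (treeAt P cfg T₀ (fun j => x j ω) i) (x i ω) ∂μ =
      ∫⁻ ω in S, g ω * ∫⁻ y, Ψ (treeAt P cfg T₀ (fun j => x j ω) i) y
        ∂(P.sampleLaw (costAt P cfg T₀ (fun j => x j ω) i)) ∂μ := by
  have h := hx.lintegral_mul_tree i (hg.indicator hS) hΨ
  have hS' := hx.past_le i _ hS
  rw [← lintegral_indicator hS', ← lintegral_indicator hS']
  refine (lintegral_congr fun ω => ?_).trans (h.trans (lintegral_congr fun ω => ?_)) <;>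
  · by_cases hω : ω ∈ S <;> simp [hω]

variable (P) in
/-- The least increase of the cost that yields an informed set of the given volume. -/
noncomputable def Problem.excessOfVolume (v : ℝ≥0∞) : ℝ≥0∞ :=
  sInf {t | v ≤ volume (P.informedSet (P.focal + t.toReal))}

variable (hx : IsRun P cfg T₀ μ x) (hT₀ : T₀.Inv P cfg)
include hx hT₀

/-- Restriction to the runs within t of the optimum at time I switches off steering from then on, as
costs only decrease. The volume of the informed set then shrinks by factors dominating a uniform
variable. -/
theorem IsRun.shrinkingProcess (hn : 2 ≤ n) (hd : P.optCost = P.focal) {t : ℝ}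
    (ht1 : t ≤ 1)
    (hη : cfg.η ≠ ⊤ → 2 * t ≤ cfg.η.toReal ∧ 16 * t * (P.focal + t) ≤ cfg.η.toReal ^ 2)
    {C : ℝ≥0∞} (hC0 : C ≠ 0) (hCt : C ≠ ⊤)
    (hC : ∀ e : ℝ, 0 ≤ e → e ≤ 1 →
      C * volume (P.informedSet (P.focal + e)) ^ (2 / ((n : ℝ) - 1)) ≤ ENNReal.ofReal e)
    (ρ : ℝ) (I : ℕ) :
    ShrinkingProcess (μ.restrict {ω | costAt P cfg T₀ (fun j => x j ω) I ≤ P.focal + t})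
      ⟨fun i => past x (I + i), fun _ _ h => past_mono (Nat.add_le_add_left h I),
        fun i => hx.past_le (I + i)⟩
      (2 / ((n : ℝ) - 1)) ρ C
      (fun i ω => (treeAt P cfg T₀ (fun j => x j ω) (I + i)).excess P)
      (fun i ω => volume (P.informedSet (costAt P cfg T₀ (fun j => x j ω) (I + i))))
      P.excessOfVolume (fun i => {ω | ratioAt P cfg T₀ (fun j => x j ω) (I + i) ≤ ρ}) := by
  set A : Set Ω := {ω | costAt P cfg T₀ (fun j => x j ω) I ≤ P.focal + t} with hA
  have hAm : ∀ i, MeasurableSet[past x (I + i)] A := fun i =>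
    measurable_costAt (P := P) (cfg := cfg) (T₀ := T₀) (Nat.le_add_right I i) measurableSet_Iic
  have hAm' : MeasurableSet A := hx.past_le _ _ (hAm 0)
  have hvol : ∀ᵐ ω ∂μ.restrict A, ∀ i,
      volume (P.informedSet (costAt P cfg T₀ (fun j => x j ω) (I + i))) ≠ 0 :=
    ae_restrict_of_ae (hx.ae_volume_informedSet_ne_zero.mono fun ω h i => h _)
  have hcost : ∀ ω i, P.focal ≤ costAt P cfg T₀ (fun j => x j ω) i := fun ω i =>
    hd ▸ (inv_treeAt hT₀ (fun j => x j ω) i).optCost_le_cost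
  have hexc : ∀ ω i, (treeAt P cfg T₀ (fun j => x j ω) i).excess P =
      ENNReal.ofReal (costAt P cfg T₀ (fun j => x j ω) i - P.focal) := fun ω i => by
    rw [Tree.excess, hd]; rfl
  have hcA : ∀ ω ∈ A, ∀ i, costAt P cfg T₀ (fun j => x j ω) (I + i) ≤ P.focal + t := fun ω hω i =>
    (antitone_costAt hT₀ (fun j => x j ω) (Nat.le_add_right I i)).trans hω
  have hlaw : ∀ ω ∈ A, ∀ i, volume (P.informedSet (costAt P cfg T₀ (fun j => x j ω) (I + i))) ≠ 0 →
      ∀ s : ℝ, 0 ≤ s → s < 1 → P.sampleLaw (costAt P cfg T₀ (fun j => x j ω) (I + i))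
        {y | volume (P.informedSet ((step P cfg (treeAt P cfg T₀ (fun j => x j ω) (I + i)) y).cost P)) ≤
          ENNReal.ofReal s * volume (P.informedSet (costAt P cfg T₀ (fun j => x j ω) (I + i)))} ≤
        ENNReal.ofReal s := by
    intro ω hω i hW s _ hs1
    have hT := inv_treeAt hT₀ (fun j => x j ω) (I + i)
    refine hT.sampleLaw_volume_le hn (fun y hy => ?_) hW hs1
    exact hT.newState_eq hη (hcA ω hω i) ((le_of_lt hy.2).trans (hcA ω hω i))
  have hmeas : ∀ θ : ℝ, MeasTreeFun.{u} fun (T : Tree n) y =>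
      volume (P.informedSet ((step P cfg T y).cost P)) ^ θ := fun θ _ _ f y hf hy =>
    (P.measurable_volume_informedSet.comp ((hf.step hy).cost P)).pow_const θ
  have hmeasT : ∀ T : Tree n, Measurable fun y => volume (P.informedSet ((step P cfg T y).cost P)) :=
    fun T => P.measurable_volume_informedSet.comp (measurable_cost_step T)
  refine
    { measurable_e := fun i => measurable_excess le_rfl
      measurable_w := fun i => P.measurable_volume_informedSet.comp (measurable_costAt le_rfl)
      measurable_τ := ?_
      measurableSet_R := fun i => measurableSet_ratioAt_le hT₀ ρ le_rfl
      antitone_e := fun ω i j hij =>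
        excess_treeAt_antitone hT₀ (fun j => x j ω) (Nat.add_le_add_left hij I)
      antitone_w := fun ω i j hij => measure_mono (P.informedSet_mono
        (antitone_costAt hT₀ (fun j => x j ω) (Nat.add_le_add_left hij I)))
      e_ne_top := fun i ω => Tree.excess_ne_top
      w_ne_top := fun i ω => (P.volume_informedSet_lt_top _).ne
      w_ne_zero := hvol
      c_ne_zero := hC0
      c_ne_top := hCt
      lower := ?_
      τ_le := ?_
      le_τ := ?_
      growth := ?_
      decay := ?_
      contract := ?_ }
  · exact Monotone.measurable fun v v' h => sInf_le_sInf fun t ht => h.trans ht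
  · refine (ae_restrict_iff' hAm').2 (ae_of_all _ fun ω hω i => ?_)
    have h1 := hC (costAt P cfg T₀ (fun j => x j ω) (I + i) - P.focal)
      (sub_nonneg.2 (hcost ω _)) (by linarith [hcA ω hω i])
    rwa [add_sub_cancel, ← hexc] at h1
  · intro i ω v hv
    refine sInf_le ?_
    rwa [Set.mem_ofPred_eq, hexc, ENNReal.toReal_ofReal (sub_nonneg.2 (hcost ω _)), add_sub_cancel]
  · intro i ω v hv
    refine le_sInf fun t ht => ?_
    rcases eq_or_ne t ⊤ with rfl | htt
    · exact le_top
    have h1 : costAt P cfg T₀ (fun j => x j ω) (I + i) < P.focal + t.toReal := by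
      by_contra h
      exact absurd (hv.trans_le ht) (not_lt.2 (measure_mono (P.informedSet_mono (not_lt.1 h))))
    rw [hexc]
    exact ENNReal.ofReal_le_of_le_toReal (by linarith)
  · intro θ hθ i S g hS hg
    have hSA : MeasurableSet[past x (I + i)] (S ∩ A) := hS.inter (hAm i)
    rw [Measure.restrict_restrict (hx.past_le _ _ hS)]
    have h1 := hx.setLIntegral_mul_tree (I + i) hSA hg (hmeas θ)
    refine le_trans ?_ (mul_le_mul_right (le_of_eq h1.symm) _)
    rw [← lintegral_const_mul' _ _ ENNReal.ofReal_ne_top]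
    refine lintegral_mono_ae ((ae_restrict_iff' (hx.past_le _ _ hSA)).2 ?_)
    filter_upwards [hx.ae_volume_informedSet_ne_zero] with ω hω hωS
    have := P.isProbabilityMeasure_sampleLaw (hω (I + i))
    rw [mul_left_comm]
    exact mul_le_mul_right (rpow_le_mul_lintegral (hmeasT _) (hω _)
      (P.volume_informedSet_lt_top _).ne (fun y => (P.volume_informedSet_lt_top _).ne)
      (hlaw ω hωS.2 i (hω _)) hθ) _
  · intro i S g hS hg
    have hSA : MeasurableSet[past x (I + i)] (S ∩ A) := hS.inter (hAm i)
    rw [Measure.restrict_restrict (hx.past_le _ _ hS)]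
    have h1 := hx.setLIntegral_mul_tree (I + i) hSA hg (hmeas (-(1 / 2)))
    refine (le_of_eq h1).trans ?_
    rw [← lintegral_const_mul' _ _ ENNReal.ofNat_ne_top]
    refine lintegral_mono_ae ((ae_restrict_iff' (hx.past_le _ _ hSA)).2 ?_)
    filter_upwards [hx.ae_volume_informedSet_ne_zero] with ω hω hωS
    have := P.isProbabilityMeasure_sampleLaw (hω (I + i))
    rw [mul_left_comm]
    exact mul_le_mul_right (lintegral_rpow_neg_half_le' (hmeasT _) (hω _)
      (P.volume_informedSet_lt_top _).ne (fun y => (P.volume_informedSet_lt_top _).ne)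
      (hlaw ω hωS.2 i (hω _))) _
  · intro i S g hS hSR hg
    have hSA : MeasurableSet[past x (I + i)] (S ∩ A) := hS.inter (hAm i)
    have hSA' := hx.past_le _ _ hSA
    rw [Measure.restrict_restrict (hx.past_le _ _ hS)]
    have h1 := hx.lintegral_excess_succ_le hT₀ (ρ := ρ) (i := I + i) (g := (S ∩ A).indicator g)
      (hg.indicator hSA) fun ω hω => Set.indicator_of_notMem
        (fun h => absurd (hSR h.1) (not_le.2 hω)) _
    rw [← lintegral_indicator hSA', ← lintegral_indicator hSA']
    refine (le_of_eq (lintegral_congr fun ω => ?_)).trans (h1.trans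
      (le_of_eq (congrArg _ (lintegral_congr fun ω => ?_)))) <;>
    · by_cases hω : ω ∈ S ∩ A <;> simp [hω, add_assoc]

/-- Ratios bounded away from 1 force convergence to the optimum, through exponential decay of the
error. -/
theorem IsRun.ae_exists_costAt_lt {ρ : ℝ} (hρ : 0 ≤ ρ) (hρ1 : ρ < 1) (I : ℕ) :
    ∀ᵐ ω ∂μ, (∀ i, I ≤ i → ratioAt P cfg T₀ (fun j => x j ω) i ≤ ρ) →
      ∀ g > P.optCost, ∃ i ≥ I, costAt P cfg T₀ (fun j => x j ω) i < g := by
  obtain ⟨ρ₁, hρ₁, hρ₁1⟩ := exists_between hρ1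
  filter_upwards [hx.ae_excess_le hT₀ hρ hρ₁ I] with ω h2 hr g hg
  obtain ⟨K, hK, hKi⟩ := h2 hr
  have h3 : Tendsto (fun i => K * ENNReal.ofReal ρ₁ ^ i) atTop (𝓝 (K * 0)) :=
    ENNReal.Tendsto.const_mul (ENNReal.tendsto_pow_atTop_nhds_zero_of_lt_one
      (by rw [← ENNReal.ofReal_one]; exact (ENNReal.ofReal_lt_ofReal_iff one_pos).2 hρ₁1)) (Or.inr hK)
  rw [mul_zero] at h3
  obtain ⟨i, hi⟩ := (h3.eventually (gt_mem_nhds (ENNReal.ofReal_pos.2 (sub_pos.2 hg)))).exists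
  refine ⟨I + i, Nat.le_add_right _ _, ?_⟩
  have h4 := (hKi i).trans_lt hi
  rw [Tree.excess, ENNReal.ofReal_lt_ofReal_iff (sub_pos.2 hg)] at h4
  have h5 : (treeAt P cfg T₀ (fun j => x j ω) (I + i)).cost P =
    costAt P cfg T₀ (fun j => x j ω) (I + i) := rfl
  linarith

/-- No run of a problem whose optimal solution is straight contracts too fast. -/
theorem IsRun.ae_not_ratioAt_le_of_optCost_eq_focal (hn : 2 ≤ n) (hd : P.optCost = P.focal)
    {ρ : ℝ} (hρ : 0 < ρ) (hρ' : ρ < ((n : ℝ) - 1) / ((n : ℝ) + 1)) (I : ℕ) :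
    ∀ᵐ ω ∂μ, ¬ ∀ i, I ≤ i → ratioAt P cfg T₀ (fun j => x j ω) i ≤ ρ := by
  have hn' : (2 : ℝ) ≤ n := by exact_mod_cast hn
  obtain ⟨t, ht, ht1, hη⟩ := cfg.exists_threshold P.focal_pos
  obtain ⟨C, hC0, hCt, hC⟩ := P.exists_mul_volume_rpow_le hn
  -- With p = 2/(n-1) one has 1 + p = (n+1)/(n-1): here the bound (n-1)/(n+1) enters.
  have hρn : (1 + 2 / ((n : ℝ) - 1)) * ρ < 1 := by
    rw [lt_div_iff₀ (by linarith)] at hρ'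
    rw [show 1 + 2 / ((n : ℝ) - 1) = ((n : ℝ) + 1) / ((n : ℝ) - 1) by
      field_simp [show (n : ℝ) - 1 ≠ 0 by linarith]; ring, div_mul_eq_mul_div, div_lt_one (by linarith)]
    linarith
  have hρ1 : ρ < 1 := hρ'.trans (by rw [div_lt_one (by linarith)]; linarith)
  -- The time at which a run comes within t of the optimum is random, so all deterministic starting
  -- times J are treated.
  have h0 : ∀ J, ∀ᵐ ω ∂μ, costAt P cfg T₀ (fun j => x j ω) J ≤ P.focal + t →
      ¬ ∀ i, ratioAt P cfg T₀ (fun j => x j ω) (J + i) ≤ ρ := by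
    intro J
    have h1 := (hx.shrinkingProcess hT₀ hn hd ht1 hη hC0 hCt hC ρ J).measure_iInter_eq_zero
      (by apply div_pos <;> linarith) hρ hρn
    have h2 : MeasurableSet {ω | costAt P cfg T₀ (fun j => x j ω) J ≤ P.focal + t} :=
      hx.past_le _ _ (measurable_costAt (P := P) (cfg := cfg) (T₀ := T₀) (le_refl J) measurableSet_Iic)
    have h3 := (ae_restrict_iff' h2).1 (measure_eq_zero_iff_ae_notMem.1 h1)
    filter_upwards [h3] with ω hω hc hr
    exact hω hc (Set.mem_iInter.2 hr)
  filter_upwards [ae_all_iff.2 h0, hx.ae_exists_costAt_lt hT₀ hρ.le hρ1 I] with ω h1 h2 hr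
  obtain ⟨i, hi, hlt⟩ := h2 hr (P.focal + t) (by rw [hd]; linarith)
  exact h1 i hlt.le fun j => hr _ (by omega)

end InformedRRT

/-! ### Connections into a null informed set have probability zero -/

namespace InformedRRT

variable {n : ℕ}

theorem exists_unit_orthogonal (hn : 2 ≤ n) (a : Space n) :
    ∃ m : Space n, ‖m‖ = 1 ∧ inner ℝ a m = 0 := by
  have h1 : (Submodule.span ℝ {a})ᗮ ≠ ⊥ := by
    intro h
    have h2 := Submodule.finrank_add_finrank_orthogonal (Submodule.span ℝ {a})
    rw [h, finrank_bot, add_zero, finrank_euclideanSpace, Fintype.card_fin] at h2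
    have := finrank_span_le_card (R := ℝ) ({a} : Set (Space n))
    simp at this
    omega
  obtain ⟨m, hm, hm0⟩ := Submodule.exists_mem_ne_zero_of_ne_bot h1
  refine ⟨‖m‖⁻¹ • m, norm_smul_inv_norm hm0, ?_⟩
  rw [inner_smul_right, Submodule.mem_orthogonal_singleton_iff_inner_right.1 hm, mul_zero]

theorem volume_homothety_preimage_eq_zero {N : Set (Space n)} (hN : volume N = 0) (v : Space n)
    {l : ℝ} (hl : l ≠ 0) : volume {x | v + l • (x - v) ∈ N} = 0 := by
  refine measure_mono_null (t := AffineMap.homothety v l⁻¹ '' N) (fun x hx => ⟨_, hx, ?_⟩) ?_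
  · simp [AffineMap.homothety_apply, smul_smul, inv_mul_cancel₀ hl]
  · rw [Measure.addHaar_image_homothety, hN, mul_zero]

/-- An open set of scalars contains a rational one, so countably many homothetic copies of N cover
the set. -/
theorem volume_rays_eq_zero {N : Set (Space n)} (hN : volume N = 0) (v : Space n) :
    volume {x | ∃ U : Set ℝ, IsOpen U ∧ U.Nonempty ∧ ∀ l ∈ U, l ≠ 0 ∧ v + l • (x - v) ∈ N} = 0 := by
  refine measure_mono_null (t := ⋃ q : {q : ℚ // (q : ℝ) ≠ 0}, {x | v + (q : ℝ) • (x - v) ∈ N}) ?_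
    (measure_iUnion_null fun q => volume_homothety_preimage_eq_zero hN v q.2)
  rintro x ⟨U, hU, hne, h⟩
  obtain ⟨q, hq⟩ := Rat.denseRange_cast.exists_mem_open hU hne
  exact Set.mem_iUnion.2 ⟨⟨q, (h _ hq).1⟩, (h _ hq).2⟩

/-- Take a unit vector m orthogonal to a. On the half of the cone where ⟨m, x - v⟩ ≥ 0, a shift by a
positive multiple of m fixes the left side and strictly increases the norm. Infinitely many bounded
translates are thus disjoint, so each half is null. -/
theorem volume_tangent_eq_zero (hn : 2 ≤ n) (a v : Space n) {r : ℝ} (hr : 0 < r) :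
    volume {x | inner ℝ a (x - v) = r * ‖x - v‖} = 0 := by
  obtain ⟨m, hm, ham⟩ := exists_unit_orthogonal hn a
  have key : ∀ m : Space n, ‖m‖ = 1 → inner ℝ a m = 0 →
      volume {x | inner ℝ a (x - v) = r * ‖x - v‖ ∧ 0 ≤ inner ℝ m (x - v)} = 0 := by
    intro m hm ham
    refine Measure.addHaar_eq_zero_of_disjoint_translates volume
      (fun k : ℕ => (1 / ((k : ℝ) + 1)) • m) ?_ ?_ ?_
    · refine (Metric.isBounded_closedBall (x := (0 : Space n)) (r := 1)).subset ?_
      rintro _ ⟨k, rfl⟩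
      rw [mem_closedBall_zero_iff, norm_smul, hm, mul_one, Real.norm_of_nonneg (by positivity)]
      exact div_le_one_of_le₀ (by linarith [k.cast_nonneg (α := ℝ)]) (by positivity)
    · have hlt : ∀ s t : ℝ, s < t → ∀ x y : Space n,
          (inner ℝ a (x - v) = r * ‖x - v‖ ∧ 0 ≤ inner ℝ m (x - v)) →
          (inner ℝ a (y - v) = r * ‖y - v‖ ∧ 0 ≤ inner ℝ m (y - v)) →
          s • m + x ≠ t • m + y := by
        intro s t hst x y hx hy h
        have h1 : x - v = (y - v) + (t - s) • m := by
          rw [sub_smul, eq_sub_of_add_eq' h]; abel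
        have h2 := hx.1
        rw [h1, inner_add_right, inner_smul_right, ham, mul_zero, add_zero, hy.1, ← h1] at h2
        have h3 : ‖y - v‖ = ‖x - v‖ := mul_left_cancel₀ hr.ne' h2
        have h4 : ‖x - v‖ ^ 2 = _ := congrArg (fun z => ‖z‖ ^ 2) h1
        rw [norm_add_sq_real, norm_smul, hm, inner_smul_right, real_inner_comm, h3,
          Real.norm_eq_abs, mul_one, sq_abs] at h4
        nlinarith [hy.2, mul_nonneg (sub_pos.2 hst).le hy.2, sq_pos_of_pos (sub_pos.2 hst)]
      intro i j hij
      rw [Function.onFun, Set.disjoint_left]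
      rintro z ⟨_, rfl, x, hx, rfl⟩ ⟨_, rfl, y, hy, hxy⟩
      rcases lt_or_gt_of_ne hij with h | h
      · exact hlt _ _ (one_div_lt_one_div_of_lt (by positivity) (by
          have : (i : ℝ) < j := by exact_mod_cast h
          linarith)) y x hy hx hxy
      · exact hlt _ _ (one_div_lt_one_div_of_lt (by positivity) (by
          have : (j : ℝ) < i := by exact_mod_cast h
          linarith)) x y hx hy hxy.symm
    · have h1 : IsClosed {x : Space n | inner ℝ a (x - v) = r * ‖x - v‖} :=
        isClosed_eq (by fun_prop) (by fun_prop)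
      have h2 : IsClosed {x : Space n | 0 ≤ inner ℝ m (x - v)} :=
        isClosed_le (by fun_prop) (by fun_prop)
      exact (h1.inter h2).measurableSet
  refine measure_mono_null (fun x hx => ?_) (measure_union_null (key m hm ham)
    (key (-m) (by rwa [norm_neg]) (by rw [inner_neg_right, ham, neg_zero])))
  rcases le_total 0 (inner ℝ m (x - v)) with h | h
  · exact Or.inl ⟨hx, h⟩
  · exact Or.inr ⟨hx, by rw [inner_neg_left]; linarith⟩

/-- One of the two samples that are steered onto the line through `v` and `z`. -/
noncomputable def unsteer (v₀ v : Space n) (r ε σ : ℝ) (z : Space n) : Space n :=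
  -- t solves ‖t (z - v) + (v - v₀)‖ = r; the signs σ belong to the two intersections of the line
  -- with the sphere. The distance of the sample from `v₀` is then ε t.
  let t := (-inner ℝ (z - v) (v - v₀) + σ * √(inner ℝ (z - v) (v - v₀) ^ 2 -
    ‖z - v‖ ^ 2 * (‖v - v₀‖ ^ 2 - r ^ 2))) / ‖z - v‖ ^ 2
  v₀ + (ε * t / r) • (t • (z - v) + (v - v₀))

theorem differentiableOn_unsteer (v₀ v : Space n) (r ε σ : ℝ) :
    DifferentiableOn ℝ (unsteer v₀ v r ε σ) {z | inner ℝ (z - v) (v - v₀) ^ 2 -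
      ‖z - v‖ ^ 2 * (‖v - v₀‖ ^ 2 - r ^ 2) ≠ 0 ∧ z - v ≠ 0} := by
  have h1 : Differentiable ℝ fun z : Space n => ‖z - v‖ ^ 2 := by
    have : (fun z : Space n => ‖z - v‖ ^ 2) = fun z => inner ℝ (z - v) (z - v) := by
      ext z; rw [real_inner_self_eq_norm_sq]
    rw [this]
    exact (differentiable_id.sub_const v).inner ℝ (differentiable_id.sub_const v)
  have h2 : Differentiable ℝ fun z : Space n => inner ℝ (z - v) (v - v₀) :=
    (differentiable_id.sub_const v).inner ℝ (differentiable_const _)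
  have ht : DifferentiableOn ℝ (fun z => (-inner ℝ (z - v) (v - v₀) + σ * √(inner ℝ (z - v) (v - v₀) ^ 2 -
      ‖z - v‖ ^ 2 * (‖v - v₀‖ ^ 2 - r ^ 2))) / ‖z - v‖ ^ 2) {z | inner ℝ (z - v) (v - v₀) ^ 2 -
      ‖z - v‖ ^ 2 * (‖v - v₀‖ ^ 2 - r ^ 2) ≠ 0 ∧ z - v ≠ 0} := by
    have h3 := ((h2.pow 2).sub (h1.mul_const (‖v - v₀‖ ^ 2 - r ^ 2))).differentiableOn (s :=
      {z | inner ℝ (z - v) (v - v₀) ^ 2 - ‖z - v‖ ^ 2 * (‖v - v₀‖ ^ 2 - r ^ 2) ≠ 0 ∧ z - v ≠ 0})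
    have h4 := h2.fun_neg.differentiableOn.fun_add ((h3.sqrt fun z hz => hz.1).const_mul σ)
    simp only [div_eq_mul_inv]
    refine h4.fun_mul (h1.differentiableOn.fun_inv fun z hz => ?_)
    · exact pow_ne_zero _ (norm_ne_zero_iff.2 hz.2)
  unfold unsteer
  simp only
  have h5 : Differentiable ℝ fun z : Space n => z - v := differentiable_id.sub_const v
  exact (differentiableOn_const _).fun_add ((show DifferentiableOn ℝ _ _ by
    simpa only [div_eq_mul_inv] using (ht.const_mul ε).mul_const r⁻¹).fun_smul
    ((ht.fun_smul h5.differentiableOn).fun_add (differentiableOn_const _)))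

/-- If steering from `v₀` ends on the sphere of radius `r`, almost every sample can be recovered from
a point of the connection to `v`. -/
theorem eq_unsteer {v₀ v x : Space n} {r ε : ℝ} (hr : 0 < r) (hε : 0 < ε) (hx : x ≠ v₀)
    (htan : inner ℝ (v - v₀) (x - v₀) ≠ r * ‖x - v₀‖) {z : Space n}
    (hz : z = v + (ε / ‖x - v₀‖) • (v₀ + (r / ‖x - v₀‖) • (x - v₀) - v)) :
    (inner ℝ (z - v) (v - v₀) ^ 2 - ‖z - v‖ ^ 2 * (‖v - v₀‖ ^ 2 - r ^ 2) ≠ 0 ∧ z - v ≠ 0) ∧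
      ∃ σ : ℝ, (σ = 1 ∨ σ = -1) ∧ unsteer v₀ v r ε σ z = x := by
  set ρ := ‖x - v₀‖ with hρ
  have hρ0 : 0 < ρ := norm_pos_iff.2 (sub_ne_zero.2 hx)
  set a := v - v₀ with ha
  set y := (r / ρ) • (x - v₀) with hy
  set q := z - v with hq
  set t := ρ / ε with ht
  have ht0 : 0 < t := by positivity
  have hq1 : q = t⁻¹ • (y - a) := by
    rw [hq, hz, ha, ht, inv_div]; abel_nf
  have hy1 : y = t • q + a := by
    rw [hq1, smul_smul, mul_inv_cancel₀ ht0.ne', one_smul]; abel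
  have hny : ‖y‖ = r := by
    rw [hy, norm_smul, Real.norm_of_nonneg (by positivity), ← hρ, div_mul_cancel₀ _ hρ0.ne']
  have hyy : ‖t • q + a‖ ^ 2 = r ^ 2 := by rw [← hy1, hny]
  rw [norm_add_sq_real, norm_smul, inner_smul_left, mul_pow, Real.norm_eq_abs, sq_abs] at hyy
  simp only [conj_trivial] at hyy
  have hqy : inner ℝ q y = t * ‖q‖ ^ 2 + inner ℝ q a := by
    rw [hy1, inner_add_right, inner_smul_right, real_inner_self_eq_norm_sq]
  -- The discriminant is ⟨q, y⟩², which vanishes only if the line is tangent to the sphere at the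
  -- steered point; `htan` excludes this.
  have hD : inner ℝ q a ^ 2 - ‖q‖ ^ 2 * (‖a‖ ^ 2 - r ^ 2) = inner ℝ q y ^ 2 := by
    rw [hqy]; linear_combination -‖q‖ ^ 2 * hyy
  have hne : inner ℝ q y ≠ 0 := by
    intro h
    rw [hq1, inner_smul_left, mul_eq_zero] at h
    rcases h with h | h
    · exact (inv_pos.2 ht0).ne' (by simpa using h)
    · rw [inner_sub_left, real_inner_self_eq_norm_sq, hny, hy, inner_smul_right] at h
      apply htan
      field_simp at h
      have := mul_left_cancel₀ hr.ne' (h.trans ((mul_zero ρ).trans (mul_zero r).symm))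
      linarith
  have hq0 : q ≠ 0 := by rintro h; rw [h, inner_zero_left] at hne; exact hne rfl
  refine ⟨⟨by rw [hD]; exact pow_ne_zero _ hne, hq0⟩, ?_⟩
  have key : ∀ σ : ℝ, σ * √(inner ℝ q y ^ 2) = inner ℝ q y → unsteer v₀ v r ε σ z = x := by
    intro σ hσ
    have hqn : ‖q‖ ^ 2 ≠ 0 := pow_ne_zero _ (norm_ne_zero_iff.2 hq0)
    simp only [unsteer]
    rw [← hq, ← ha, hD, hσ, hqy, show (-inner ℝ q a + (t * ‖q‖ ^ 2 + inner ℝ q a)) / ‖q‖ ^ 2 = t by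
      field_simp; ring, ← hy1, hy, smul_smul, ht,
      show ε * (ρ / ε) / r * (r / ρ) = 1 by field_simp, one_smul, add_sub_cancel]
  rcases lt_or_gt_of_ne hne with h | h
  · exact ⟨-1, Or.inr rfl, key _ (by rw [Real.sqrt_sq_eq_abs, abs_of_neg h]; ring)⟩
  · exact ⟨1, Or.inl rfl, key _ (by rw [Real.sqrt_sq_eq_abs, abs_of_pos h]; ring)⟩

theorem steer_eq_add_smul {η : ℝ≥0∞} (hη : 0 < η) (v x : Space n) :
    ∃ σ : ℝ, 0 < σ ∧ steer η v x = v + σ • (x - v) := by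
  unfold steer
  split_ifs with h
  · exact ⟨1, one_pos, by simp⟩
  · have ht : η ≠ ⊤ := (not_le.1 h).ne_top
    have hne : x ≠ v := by rintro rfl; simp at h
    exact ⟨_, div_pos (ENNReal.toReal_pos hη.ne' ht) (norm_pos_iff.2 (sub_ne_zero.2 hne)), rfl⟩

namespace Problem

variable {P : Problem n} {c : ℝ} (h0 : volume (P.informedSet c) = 0)
include h0

/-- If the informed set of cost `c` is null, a new edge almost surely avoids its interior. -/
theorem volume_isFree_steer_eq_zero {η : ℝ≥0∞} (hη : 0 < η) (v : Space n) :
    volume {x | P.IsFree v (steer η v x) ∧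
      (P.heuristic v < c ∨ P.heuristic (steer η v x) < c)} = 0 := by
  refine measure_mono_null ?_ (volume_rays_eq_zero h0 v)
  rintro x ⟨hfree, hx⟩
  obtain ⟨σ, hσ, hst⟩ := steer_eq_add_smul hη v x
  rw [hst] at hfree hx
  have hcont : Continuous fun l : ℝ => P.heuristic (v + l • (x - v)) :=
    P.continuous_heuristic.comp (by fun_prop)
  refine ⟨Set.Ioo 0 σ ∩ {l | P.heuristic (v + l • (x - v)) < c},
    isOpen_Ioo.inter (isOpen_lt hcont continuous_const), ?_, ?_⟩
  -- The inequality holds at an endpoint of the edge, and being open it also holds at interior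
  -- points nearby.
  · have hcl : closure (Set.Ioo 0 σ) = Set.Icc 0 σ := closure_Ioo hσ.ne
    have : ∃ l ∈ Set.Icc 0 σ, P.heuristic (v + l • (x - v)) < c := by
      rcases hx with hx | hx
      · exact ⟨0, ⟨le_rfl, hσ.le⟩, by simpa using hx⟩
      · exact ⟨σ, ⟨hσ.le, le_rfl⟩, hx⟩
    obtain ⟨l, hl, hlc⟩ := this
    rw [← hcl] at hl
    rw [Set.inter_comm]
    exact mem_closure_iff.1 hl _ (isOpen_lt hcont continuous_const) hlc
  · rintro l ⟨hl, hlc⟩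
    refine ⟨hl.1.ne', hfree ?_, hlc⟩
    rw [segment_eq_image']
    refine ⟨l / σ, ⟨by have := hl.1; positivity, (div_le_one hσ).2 hl.2.le⟩, ?_⟩
    simp only [add_sub_cancel_left, smul_smul, div_mul_cancel₀ _ hσ.ne']

/-- If the informed set of cost `c` is null, a vertex in it is almost surely not connected to a new
state. -/
theorem volume_isFree_connect_eq_zero (hn : 2 ≤ n) {η : ℝ≥0∞} (hη : 0 < η) (v₀ : Space n)
    {v : Space n} (hv : P.heuristic v < c) : volume {x | P.IsFree v (steer η v₀ x)} = 0 := by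
  have h1 := P.volume_isFree_steer_eq_zero h0 (η := ⊤) ENNReal.zero_lt_top v
  simp only [steer_top] at h1
  set r := η.toReal with hr
  -- Steering forgets the distance of the sample. The point of the connection at the fraction ε / ‖x
  -- - v₀‖ records it again, so that the sample is a differentiable image of a point of a null set.
  -- The sequence ε = 1/(k + 1) brings this point close enough to v to lie in the informed set.
  set S : ℕ → Set (Space n) := fun k => P.informedSet c ∩ {z | inner ℝ (z - v) (v - v₀) ^ 2 -
      ‖z - v‖ ^ 2 * (‖v - v₀‖ ^ 2 - r ^ 2) ≠ 0 ∧ z - v ≠ 0} with hS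
  have hnull : ∀ k : ℕ, ∀ σ : ℝ, volume (unsteer v₀ v r (1 / ((k : ℝ) + 1)) σ '' S k) = 0 :=
    fun k σ => addHaar_image_eq_zero_of_differentiableOn_of_addHaar_eq_zero volume
      ((differentiableOn_unsteer v₀ v r _ σ).mono Set.inter_subset_right)
      (measure_mono_null Set.inter_subset_left h0)
  by_cases htop : η = ⊤
  · simp only [htop, steer_top]
    refine measure_mono_null ?_ h1
    exact fun x hx => ⟨hx, Or.inl hv⟩
  have hr0 : 0 < r := ENNReal.toReal_pos hη.ne' htop
  refine measure_mono_null ?_ (measure_union_null h1 (measure_union_null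
    (volume_tangent_eq_zero hn (v - v₀) v₀ hr0)
    (measure_iUnion_null fun k => measure_union_null (hnull k 1) (hnull k (-1)))))
  intro x hx
  have hx : P.IsFree v (steer η v₀ x) := hx
  by_cases hle : edist v₀ x ≤ η
  · rw [steer, if_pos hle] at hx
    exact Or.inl ⟨hx, Or.inl hv⟩
  rw [steer, if_neg hle] at hx
  by_cases htan : inner ℝ (v - v₀) (x - v₀) = r * ‖x - v₀‖
  · exact Or.inr (Or.inl htan)
  refine Or.inr (Or.inr (Set.mem_iUnion.2 ?_))
  have hne : x ≠ v₀ := by rintro rfl; simp at hle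
  have hρ : 0 < ‖x - v₀‖ := norm_pos_iff.2 (sub_ne_zero.2 hne)
  set y := v₀ + (r / ‖x - v₀‖) • (x - v₀) with hy
  have hlim : Tendsto (fun k : ℕ => 1 / ((k : ℝ) + 1) / ‖x - v₀‖) atTop (𝓝 0) := by
    simpa using tendsto_one_div_add_atTop_nhds_zero_nat.div_const (‖x - v₀‖)
  have hcont : Tendsto (fun k : ℕ => P.heuristic (v + (1 / ((k : ℝ) + 1) / ‖x - v₀‖) • (y - v)))
      atTop (𝓝 (P.heuristic v)) := by
    have h2 : Continuous fun l : ℝ => P.heuristic (v + l • (y - v)) :=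
      P.continuous_heuristic.comp (by fun_prop)
    have h3 := (h2.tendsto 0).comp hlim
    rwa [zero_smul, add_zero] at h3
  obtain ⟨k, hk1, hk2⟩ := ((hcont.eventually (gt_mem_nhds hv)).and
    (hlim.eventually (ge_mem_nhds one_pos))).exists
  refine ⟨k, ?_⟩
  set z := v + (1 / ((k : ℝ) + 1) / ‖x - v₀‖) • (y - v) with hz
  have hzN : z ∈ P.informedSet c := by
    refine ⟨hx ?_, hk1⟩
    rw [segment_eq_image']
    exact ⟨_, ⟨by positivity, hk2⟩, rfl⟩
  obtain ⟨hw, σ, hσ, he⟩ := eq_unsteer (ε := 1 / ((k : ℝ) + 1)) hr0 (by positivity) hne htan hz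
  rcases hσ with rfl | rfl
  · exact Or.inl ⟨z, ⟨hzN, hw⟩, he⟩
  · exact Or.inr ⟨z, ⟨hzN, hw⟩, he⟩

end Problem

end InformedRRT

/-! ### Lower bound when the optimal informed set is null -/

namespace InformedRRT

variable {n : ℕ} {P : Problem n} {cfg : Config} {T₀ T : Tree n} {c : ℝ}

/-- `T` arises from `T₀` by adding edges whose endpoints have heuristic cost at least `c`. -/
structure Tree.GrowsOutside (P : Problem n) (c : ℝ) (T₀ T : Tree n) : Prop where
  next_le : T₀.next ≤ T.next
  pos_eq : ∀ v < T₀.next, T.pos v = T₀.pos v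
  mem : ∀ v ∈ T.verts, v < T₀.next → v ∈ T₀.verts
  par_eq : ∀ v ∈ T.verts, v < T₀.next → T.par v < T₀.next → T.par v = T₀.par v
  new_edge : ∀ v ∈ T.verts, T₀.next ≤ v ∨ T₀.next ≤ T.par v →
    c ≤ P.heuristic (T.pos v) ∧ c ≤ P.heuristic (T.pos (T.par v))

/-- The new state connects to a state of heuristic cost below `c`, or is one. -/
def ConnectsInside (P : Problem n) (cfg : Config) (c : ℝ) (T : Tree n) (x : Space n) : Prop :=
  P.IsFree (T.pos (T.nearest x)) (newState cfg T x) ∧ (P.heuristic (newState cfg T x) < c ∨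
    ∃ v, v ∈ T.verts ∧ P.heuristic (T.pos v) < c ∧ P.IsFree (T.pos v) (newState cfg T x))

theorem measTreeFun_connectsInside : MeasTreeFun.{u} (ConnectsInside P cfg c (n := n)) := by
  intro α _ f y hf hy
  have hnew := hf.newState (cfg := cfg) hy
  refine measurableSet_setOfPred.1 ((P.measurableSet_isFree (hf.pos_index (hf.nearest hy)) hnew).inter
    ((measurableSet_lt (P.continuous_heuristic.measurable.comp hnew) measurable_const).union
      (measurableSet_exists_nat fun v => (hf.verts v).inter
        ((measurableSet_lt (P.continuous_heuristic.measurable.comp (hf.pos v)) measurable_const).inter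
          (P.measurableSet_isFree (hf.pos v) hnew)))))

/-- The nearest vertex depends on the sample, hence the union over all labels `v₀`. -/
theorem volume_connectsInside (T : Tree n) (hn : 2 ≤ n)
    (h0 : volume (P.informedSet c) = 0) : volume {x | ConnectsInside P cfg c T x} = 0 := by
  have h1 : volume (⋃ v₀ : ℕ, {x | P.IsFree (T.pos v₀) (steer cfg.η (T.pos v₀) x) ∧
      (P.heuristic (T.pos v₀) < c ∨ P.heuristic (steer cfg.η (T.pos v₀) x) < c)}) = 0 :=
    measure_iUnion_null fun v₀ => P.volume_isFree_steer_eq_zero h0 cfg.η_pos _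
  have h2 : volume (⋃ v₀ : ℕ, ⋃ v : {v : ℕ // P.heuristic (T.pos v) < c},
      {x | P.IsFree (T.pos v) (steer cfg.η (T.pos v₀) x)}) = 0 :=
    measure_iUnion_null fun v₀ => measure_iUnion_null fun v =>
      P.volume_isFree_connect_eq_zero h0 hn cfg.η_pos _ v.2
  refine measure_mono_null ?_ (measure_union_null h1 h2)
  rintro x ⟨hfree, hx | ⟨v, -, hv, hx⟩⟩
  · exact Or.inl (Set.mem_iUnion.2 ⟨T.nearest x, hfree, Or.inr hx⟩)
  · exact Or.inr (Set.mem_iUnion.2 ⟨T.nearest x, Set.mem_iUnion.2 ⟨⟨v, hv⟩, hx⟩⟩)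

namespace Tree.GrowsOutside

theorem refl (hT : T.IsTree) : GrowsOutside P c T T where
  next_le := le_rfl
  pos_eq _ _ := rfl
  mem _ hv _ := hv
  par_eq _ _ _ _ := rfl
  new_edge v hv h := by
    have h1 := hT.lt_next v hv
    have h2 := hT.lt_next _ (hT.par_mem v hv)
    omega

theorem step (hG : GrowsOutside P c T₀ T) (hT : T.Inv P cfg) {x : Space n}
    (hx : ¬ ConnectsInside P cfg c T x) : GrowsOutside P c T₀ (InformedRRT.step P cfg T x) := by
  classical
  by_cases h : P.IsFree (T.pos (T.nearest x)) (newState cfg T x)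
  swap
  · rwa [cost_step_of_not_free h]
  rw [ConnectsInside, not_and] at hx
  have hx := hx h
  push Not at hx
  obtain ⟨hy, hx⟩ := hx
  set y := newState cfg T x with hydef
  have hv₀ := hT.nearest_mem x
  have hfree : ∀ v ∈ T.verts, P.IsFree (T.pos v) y → c ≤ P.heuristic (T.pos v) := fun v hv h1 => by
    by_contra h2
    exact hx v hv (not_le.1 h2) h1
  have hstep : InformedRRT.step P cfg T x =
    (T.extend P cfg (T.nearest x) y).prune P (T.cost P) := if_pos h
  have hpr : IsPruned P (T.cost P) (T.extend P cfg (T.nearest x) y)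
    (InformedRRT.step P cfg T x) := hstep ▸ isPruned_prune _
  have hmin := bestParent_mem (P := P) (cfg := cfg) (y := y) hv₀
  have hE : GrowsOutside P c T₀ (T.extend P cfg (T.nearest x) y) :=
    { next_le := hG.next_le.trans (Nat.le_succ _)
      pos_eq := fun v hv => by
        rw [extend_pos, Function.update_of_ne (hv.trans_le hG.next_le).ne]
        exact hG.pos_eq v hv
      mem := fun v hv hlt => by
        rcases Finset.mem_insert.1 hv with h1 | h1
        · exact absurd (h1 ▸ hG.next_le) (not_le.2 hlt)
        · exact hG.mem v h1 hlt
      par_eq := fun v hv hlt hpar => by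
        rcases Finset.mem_insert.1 hv with h1 | h1
        · exact absurd (h1 ▸ hG.next_le) (not_le.2 hlt)
        · rw [extend_par, if_neg (hT.lt_next v h1).ne] at hpar ⊢
          split_ifs at hpar ⊢ with h2
          · exact absurd hG.next_le (not_le.2 hpar)
          · exact hG.par_eq v h1 hlt hpar
      new_edge := fun v hv hnew => by
        rcases Finset.mem_insert.1 hv with h1 | h1
        · rw [extend_par, if_pos h1, hT.extend_pos_old hmin, h1, extend_pos_new]
          exact ⟨hy, hfree _ hmin (bestParent_free h)⟩
        · by_cases h2 : v ∈ T.rewired P cfg (T.nearest x) y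
          · rw [hT.extend_par_rewired h2, extend_pos_new, hT.extend_pos_old h1]
            refine ⟨hfree v h1 ?_, hy⟩
            have h3 := (mem_rewired.1 h2).2.2
            rwa [Problem.IsFree, segment_symm] at h3
          · rw [hT.extend_par_old h1 h2] at hnew ⊢
            rw [hT.extend_pos_old h1, hT.extend_pos_old (hT.par_mem v h1)]
            exact hG.new_edge v h1 hnew }
  exact
    { next_le := hpr.next_eq ▸ hE.next_le
      pos_eq := hpr.pos_eq ▸ hE.pos_eq
      mem := fun v hv => hE.mem v (hpr.subset hv)
      par_eq := fun v hv => hpr.par_eq ▸ hE.par_eq v (hpr.subset hv)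
      new_edge := fun v hv => by
        rw [hpr.par_eq, hpr.pos_eq]
        exact hE.new_edge v (hpr.subset hv) }

theorem _root_.InformedRRT.Tree.IsTree.iterate_ne (hT : T.IsTree) {v k : ℕ} (hk : k ≠ 0)
    (hv : v ∈ T.verts) (h0 : v ≠ 0) : T.par^[k] v ≠ v := by
  intro h
  obtain ⟨m, hm⟩ := hT.reaches_root v hv
  have h1 : (T.par^[k])^[m] v = v := Function.iterate_fixed h m
  rw [← Function.iterate_mul] at h1
  rw [hT.iterate_of_le hm (Nat.le_mul_of_pos_left m (Nat.pos_of_ne_zero hk))] at h1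
  exact h0 h1.symm

/-- A solution either was one in `T₀`, or it passes two vertices of `T₀` of large heuristic cost. -/
theorem cost_cases (hG : GrowsOutside P c T₀ T) (hT : T.Inv P cfg)
    (hc : P.focal < c) {γ : ℕ} (hγ : γ ∈ T.verts) (hg : T.pos γ = P.goal) :
    T₀.cost P ≤ T.costToCome γ ∨ ∃ o ∈ T₀.verts, ∃ o' ∈ T₀.verts, o ≠ o' ∧
      c ≤ P.heuristic (T₀.pos o) ∧ c ≤ P.heuristic (T₀.pos o') ∧
      ‖T₀.pos o - P.start‖ + ‖T₀.pos o' - T₀.pos o‖ + ‖P.goal - T₀.pos o'‖ ≤ T.costToCome γ := by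
  classical
  -- A new vertex has heuristic cost at least c, whereas the goal has d < c.
  have hγ0 : γ < T₀.next := by
    by_contra h
    have := (hG.new_edge γ hγ (Or.inl (not_lt.1 h))).1
    rw [hg, Problem.heuristic, sub_self, norm_zero, add_zero] at this
    exact absurd hc (not_lt.2 this)
  by_cases hall : ∀ k, T.par^[k] γ < T₀.next
  · left
    have heq : ∀ k, T.par^[k] γ = T₀.par^[k] γ := by
      intro k
      induction k with
      | zero => rfl
      | succ k ih =>
        have h1 := hall (k + 1)
        rw [Function.iterate_succ_apply'] at h1 ⊢
        rw [hG.par_eq _ (hT.iterate_mem hγ k) (hall k) h1, Function.iterate_succ_apply', ih]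
    have h1 : T₀.costToCome γ ≤ T.costToCome γ := by
      unfold Tree.costToCome
      refine (le_of_eq (Finset.sum_congr rfl fun k _ => ?_)).trans
        (Finset.sum_le_sum_of_subset_of_nonneg (Finset.range_subset_range.2 hG.next_le)
          fun _ _ _ => norm_nonneg _)
      rw [hG.pos_eq _ (hall k), hG.pos_eq _ (hall (k + 1)), heq, heq]
    exact (Tree.cost_le (hG.mem γ hγ hγ0) (by rw [← hG.pos_eq γ hγ0, hg])).trans h1
  · right
    push Not at hall
    -- On the way from the goal to the root, o' is the last vertex before the first new one, and o
    -- the first old vertex after it. The path leaves o' and enters o by new edges, so both have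
    -- heuristic cost at least c.
    obtain ⟨j, hj⟩ : ∃ j, Nat.find hall = j + 1 := by
      refine Nat.exists_eq_succ_of_ne_zero fun h => ?_
      have := Nat.find_spec hall
      rw [h] at this
      exact absurd hγ0 (not_lt.2 this)
    have hj1 : T₀.next ≤ T.par^[j + 1] γ := hj ▸ Nat.find_spec hall
    have hj0 : T.par^[j] γ < T₀.next := not_le.1 (Nat.find_min hall (hj ▸ Nat.lt_succ_self j))
    have hback : ∃ k, T.par^[j + 1 + k] γ < T₀.next := by
      refine ⟨T.next, ?_⟩
      rw [hT.iterate_of_le (hT.iterate_next hγ) (Nat.le_add_left _ _)]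
      exact (Nat.zero_le γ).trans_lt hγ0
    obtain ⟨m, hm⟩ : ∃ m, Nat.find hback = m + 1 := by
      refine Nat.exists_eq_succ_of_ne_zero fun h => ?_
      have := Nat.find_spec hback
      rw [h, add_zero] at this
      exact absurd this (not_lt.2 hj1)
    have hm1 : T.par^[j + 1 + (m + 1)] γ < T₀.next := hm ▸ Nat.find_spec hback
    have hm0 : T₀.next ≤ T.par^[j + 1 + m] γ :=
      not_lt.1 (Nat.find_min hback (hm ▸ Nat.lt_succ_self m))
    set o' := T.par^[j] γ with ho'
    set o := T.par^[j + 1 + (m + 1)] γ with ho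
    have ho'm := hT.iterate_mem hγ j
    have hom := hT.iterate_mem hγ (j + 1 + (m + 1))
    have hc' : c ≤ P.heuristic (T.pos o') := (hG.new_edge o' ho'm (Or.inr (by
      rw [ho', ← Function.iterate_succ_apply' T.par]; exact hj1))).1
    have hco : c ≤ P.heuristic (T.pos o) := by
      have := (hG.new_edge _ (hT.iterate_mem hγ (j + 1 + m)) (Or.inl hm0)).2
      rwa [← Function.iterate_succ_apply' T.par] at this
    have hoo : o = T.par^[m + 2] o' := by
      rw [ho, ho', ← Function.iterate_add_apply, show j + 1 + (m + 1) = m + 2 + j by omega]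
    have hne : o' ≠ 0 := by
      intro h
      rw [h, hT.root_pos, P.heuristic_start] at hc'
      exact absurd hc (not_lt.2 hc')
    refine ⟨o, hG.mem o hom hm1, o', hG.mem o' ho'm hj0,
      hoo ▸ hT.iterate_ne (by omega) ho'm hne, ?_, ?_, ?_⟩
    · rwa [← hG.pos_eq o hm1]
    · rwa [← hG.pos_eq o' hj0]
    · rw [← hG.pos_eq o hm1, ← hG.pos_eq o' hj0]
      have h1 := hT.costToCome_add_le hγ j
      have h2 := hT.costToCome_add_le ho'm (m + 2)
      have h3 := hT.norm_start_le hom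
      rw [← hoo] at h2
      rw [hg] at h1
      linarith

end Tree.GrowsOutside

/-- Otherwise two triangle inequalities are equalities and start, o, o', goal lie in this order on a
line. Then o has heuristic cost d < c. -/
theorem Problem.lt_detour {o o' : Space n} (hoo : o ≠ o') (hc : P.focal < c)
    (h : c ≤ P.heuristic o) (h' : c ≤ P.heuristic o') :
    c < ‖o - P.start‖ + ‖o' - o‖ + ‖P.goal - o'‖ := by
  by_contra hle
  push Not at hle
  have h1 := norm_add_le (P.goal - o') (o' - o)
  have h2 := norm_add_le (o' - o) (o - P.start)
  rw [sub_add_sub_cancel] at h1 h2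
  have hd : P.heuristic o = ‖o - P.start‖ + ‖P.goal - o‖ := rfl
  have hd' : P.heuristic o' = ‖o' - P.start‖ + ‖P.goal - o'‖ := rfl
  have w1 : Wbtw ℝ o o' P.goal := by
    rw [← dist_add_dist_eq_iff, dist_eq_norm, dist_eq_norm, dist_eq_norm, norm_sub_rev o o',
      norm_sub_rev o' P.goal, norm_sub_rev o P.goal]
    linarith
  have w2 : Wbtw ℝ P.start o o' := by
    rw [← dist_add_dist_eq_iff, dist_eq_norm, dist_eq_norm, dist_eq_norm, norm_sub_rev P.start o,
      norm_sub_rev o o', norm_sub_rev P.start o']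
    linarith
  have w3 := dist_add_dist_eq_iff.2 (w2.trans_expand_left w1 hoo)
  rw [dist_eq_norm, dist_eq_norm, dist_eq_norm, norm_sub_rev P.start o, norm_sub_rev o P.goal,
    norm_sub_rev P.start P.goal] at w3
  rw [Problem.focal] at hc
  linarith

theorem Tree.exists_detour (hinj : Set.InjOn T.pos (T.verts : Set ℕ)) (hc : P.focal < c) :
    ∃ g > c, ∀ o ∈ T.verts, ∀ o' ∈ T.verts, o ≠ o' → c ≤ P.heuristic (T.pos o) →
      c ≤ P.heuristic (T.pos o') →
      g ≤ ‖T.pos o - P.start‖ + ‖T.pos o' - T.pos o‖ + ‖P.goal - T.pos o'‖ := by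
  have h : ∀ᶠ g in 𝓝[>] c, ∀ o ∈ T.verts, ∀ o' ∈ T.verts, o ≠ o' → c ≤ P.heuristic (T.pos o) →
      c ≤ P.heuristic (T.pos o') →
      g ≤ ‖T.pos o - P.start‖ + ‖T.pos o' - T.pos o‖ + ‖P.goal - T.pos o'‖ := by
    refine (eventually_all_finset _).2 fun o ho => (eventually_all_finset _).2 fun o' ho' => ?_
    by_cases hp : o ≠ o' ∧ c ≤ P.heuristic (T.pos o) ∧ c ≤ P.heuristic (T.pos o')
    · have := P.lt_detour (fun h => hp.1 (hinj ho ho' h)) hc hp.2.1 hp.2.2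
      filter_upwards [nhdsWithin_le_nhds (Iic_mem_nhds this)] with g hg _ _ _
      exact hg
    · exact Eventually.of_forall fun g h1 h2 h3 => absurd ⟨h1, h2, h3⟩ hp
  obtain ⟨g, hg, hgc⟩ := (h.and self_mem_nhdsWithin).exists
  exact ⟨g, hgc, hg⟩

universe u

variable {Ω : Type u} {x : ℕ → Ω → Space n} [MeasurableSpace Ω] {μ : Measure Ω}
  [IsProbabilityMeasure μ]

/-- Solutions of the initial tree and detours over pairs of its vertices are finite in number, and
all of them cost more than the optimum. -/
theorem IsRun.ae_exists_lt_costAt (hx : IsRun P cfg T₀ μ x) (hT₀ : T₀.Valid P cfg) (hn : 2 ≤ n)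
    (hc : P.focal < P.optCost) (h0 : volume (P.informedSet P.optCost) = 0)
    (hT : P.optCost < T₀.cost P) :
    ∀ᵐ ω ∂μ, ∃ g > P.optCost, ∀ i, g ≤ costAt P cfg T₀ (fun j => x j ω) i := by
  obtain ⟨g, hg, hdet⟩ := Tree.exists_detour hT₀.pos_inj hc
  have h1 := hx.ae_not_mem (p := ConnectsInside P cfg P.optCost) measTreeFun_connectsInside
    fun i ω => P.sampleLaw_absolutelyContinuous _
      (volume_connectsInside _ hn h0)
  filter_upwards [h1] with ω hω
  refine ⟨min g (T₀.cost P), lt_min hg hT, fun i => ?_⟩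
  have hG : ∀ i, Tree.GrowsOutside P P.optCost T₀ (treeAt P cfg T₀ (fun j => x j ω) i) := by
    intro i
    induction i with
    | zero => exact .refl hT₀.inv.toIsTree
    | succ i ih => exact ih.step (inv_treeAt hT₀.inv _ i) (hω i)
  have hTi := inv_treeAt hT₀.inv (fun j => x j ω) i
  obtain ⟨γ, hγ, hgoal, hcost⟩ := Tree.exists_cost_eq (P := P) hTi.has_solution
  have hcost : (treeAt P cfg T₀ (fun j => x j ω) i).costToCome γ =
    costAt P cfg T₀ (fun j => x j ω) i := hcost
  rw [← hcost]
  rcases (hG i).cost_cases hTi hc hγ hgoal with h | ⟨o, ho, o', ho', hne, h, h', hle⟩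
  · exact (min_le_right _ _).trans h
  · exact (min_le_left _ _).trans ((hdet o ho o' ho' hne h h').trans hle)

end InformedRRT

/-! ### Small values of trigonometric polynomials -/

namespace InformedRRT

section TrigonometricPolynomial

/-- Points within t of r are within 2t of each other, and a chord is 2|sin((φ - φ₀)/2)|. Hence φ
lies within πt of φ₀ or of φ₀ ± 2π: three intervals of length 2πt. -/
theorem volume_arc_le (r : ℂ) {t : ℝ} (ht : 0 ≤ t) :
    volume {φ : ℝ | φ ∈ Set.Ioc (-Real.pi) Real.pi ∧ ‖Complex.exp (Complex.I * φ) - r‖ ≤ t} ≤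
      ENNReal.ofReal (6 * Real.pi * t) := by
  rcases Set.eq_empty_or_nonempty
    {φ : ℝ | φ ∈ Set.Ioc (-Real.pi) Real.pi ∧ ‖Complex.exp (Complex.I * φ) - r‖ ≤ t} with h | ⟨φ₀, h₀, h₀'⟩
  · rw [h]; simp
  have hπ := Real.pi_pos
  have hsub : {φ : ℝ | φ ∈ Set.Ioc (-Real.pi) Real.pi ∧ ‖Complex.exp (Complex.I * φ) - r‖ ≤ t} ⊆
      Set.Icc (φ₀ - Real.pi * t) (φ₀ + Real.pi * t) ∪
      (Set.Icc (φ₀ + 2 * Real.pi - Real.pi * t) (φ₀ + 2 * Real.pi + Real.pi * t) ∪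
      Set.Icc (φ₀ - 2 * Real.pi - Real.pi * t) (φ₀ - 2 * Real.pi + Real.pi * t)) := by
    rintro φ ⟨h, h'⟩
    have h1 : |Real.sin ((φ - φ₀) / 2)| ≤ t := by
      have h2 : ‖Complex.exp (Complex.I * φ) - Complex.exp (Complex.I * φ₀)‖ ≤ 2 * t := by
        have := norm_sub_le_norm_sub_add_norm_sub (Complex.exp (Complex.I * φ)) r
          (Complex.exp (Complex.I * φ₀))
        rw [norm_sub_rev r] at this
        linarith
      have h3 : Complex.exp (Complex.I * φ) - Complex.exp (Complex.I * φ₀) =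
          Complex.exp (Complex.I * φ₀) * (Complex.exp (Complex.I * (φ - φ₀ : ℝ)) - 1) := by
        rw [mul_sub, ← Complex.exp_add, mul_one]; push_cast; ring_nf
      rw [h3, norm_mul, mul_comm Complex.I (φ₀ : ℂ), Complex.norm_exp_ofReal_mul_I, one_mul,
        Complex.norm_exp_I_mul_ofReal_sub_one, norm_mul, Real.norm_eq_abs, Real.norm_eq_abs,
        abs_two] at h2
      linarith
    have hbd : ∀ ψ : ℝ, |ψ| ≤ Real.pi / 2 → |Real.sin ψ| ≤ t → |ψ| ≤ Real.pi * t / 2 := by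
      intro ψ hψ hs
      have h4 := Real.mul_abs_le_abs_sin hψ
      have h5 : 2 / Real.pi * |ψ| ≤ t := h4.trans hs
      rw [div_mul_eq_mul_div, div_le_iff₀ hπ] at h5
      linarith
    set ψ := (φ - φ₀) / 2 with hψ
    have hψ1 : -Real.pi < ψ := by have := h.1; have := h₀.2; rw [hψ]; linarith
    have hψ2 : ψ < Real.pi := by have := h.2; have := h₀.1; rw [hψ]; linarith
    rcases le_or_gt |ψ| (Real.pi / 2) with h4 | h4
    · have := abs_le.1 (hbd ψ h4 h1)
      exact Or.inl ⟨by linarith, by linarith⟩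
    · refine Or.inr ?_
      rcases lt_abs.1 h4 with h5 | h5
      · have h6 := hbd (ψ - Real.pi) (by rw [abs_le]; constructor <;> linarith)
          (by rwa [Real.sin_sub_pi, abs_neg])
        rw [abs_le] at h6
        exact Or.inl ⟨by linarith, by linarith⟩
      · have h6 := hbd (ψ + Real.pi) (by rw [abs_le]; constructor <;> linarith)
          (by rwa [Real.sin_add_pi, abs_neg])
        rw [abs_le] at h6
        exact Or.inr ⟨by linarith, by linarith⟩
  have hvol : ∀ a : ℝ, volume (Set.Icc (a - Real.pi * t) (a + Real.pi * t)) =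
      ENNReal.ofReal (2 * Real.pi * t) := fun a => by rw [Real.volume_Icc]; congr 1; ring
  refine (measure_mono hsub).trans ((measure_union_le _ _).trans
    ((add_le_add le_rfl (measure_union_le _ _)).trans_eq ?_))
  rw [hvol, hvol, hvol, ← ENNReal.ofReal_add (by positivity) (by positivity),
    ← ENNReal.ofReal_add (by positivity) (by positivity)]
  congr 1; ring

/-- Where a quartic polynomial is small, one of four linear factors is. -/
theorem exists_roots_quartic {c₄ : ℂ} (c₀ c₁ c₂ c₃ : ℂ) (h : c₄ ≠ 0) : ∃ r₁ r₂ r₃ r₄ : ℂ, ∀ z,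
    c₄ * z ^ 4 + c₃ * z ^ 3 + c₂ * z ^ 2 + c₁ * z + c₀ =
      c₄ * ((z - r₁) * ((z - r₂) * ((z - r₃) * (z - r₄)))) := by
  open Polynomial in
  set p : ℂ[X] := C c₄ * X ^ 4 + C c₃ * X ^ 3 + C c₂ * X ^ 2 + C c₁ * X + C c₀ with hp
  have hdeg : p.natDegree = 4 := by rw [hp]; compute_degree!
  have hlead : p.leadingCoeff = c₄ := by
    rw [Polynomial.leadingCoeff, hdeg, hp]; simp
  have hsp := IsAlgClosed.splits p
  have hcard := hsp.natDegree_eq_card_roots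
  rw [hdeg] at hcard
  obtain ⟨r₁, hr₁⟩ := Multiset.card_pos_iff_exists_mem.1 
    (by rw [← hcard]; norm_num : 0 < p.roots.card)
  obtain ⟨s, hs⟩ := Multiset.exists_cons_of_mem hr₁
  rw [hs, Multiset.card_cons] at hcard
  obtain ⟨r₂, r₃, r₄, rfl⟩ := Multiset.card_eq_three.1 (Nat.succ.inj hcard).symm
  refine ⟨r₁, r₂, r₃, r₄, fun z => ?_⟩
  have h1 := hsp.eval_eq_prod_roots z
  rw [hlead, hs, hp] at h1
  simpa using h1

/-- If all four distances to the roots exceeded t, the modulus would exceed ‖c₄‖ t⁴. -/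
theorem volume_quartic_le {c₄ : ℂ} (c₀ c₁ c₂ c₃ : ℂ) (h : c₄ ≠ 0) {ε t : ℝ} (ht : 0 ≤ t)
    (hε : ε ≤ ‖c₄‖ * t ^ 4) : volume {φ : ℝ | φ ∈ Set.Ioc (-Real.pi) Real.pi ∧
      ‖c₄ * Complex.exp (Complex.I * φ) ^ 4 + c₃ * Complex.exp (Complex.I * φ) ^ 3 +
        c₂ * Complex.exp (Complex.I * φ) ^ 2 + c₁ * Complex.exp (Complex.I * φ) + c₀‖ ≤ ε} ≤
      ENNReal.ofReal (24 * Real.pi * t) := by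
  obtain ⟨r₁, r₂, r₃, r₄, hr⟩ := exists_roots_quartic c₀ c₁ c₂ c₃ h
  set A : ℂ → Set ℝ := fun r =>
    {φ : ℝ | φ ∈ Set.Ioc (-Real.pi) Real.pi ∧ ‖Complex.exp (Complex.I * φ) - r‖ ≤ t} with hA
  have hsub : {φ : ℝ | φ ∈ Set.Ioc (-Real.pi) Real.pi ∧
      ‖c₄ * Complex.exp (Complex.I * φ) ^ 4 + c₃ * Complex.exp (Complex.I * φ) ^ 3 +
        c₂ * Complex.exp (Complex.I * φ) ^ 2 + c₁ * Complex.exp (Complex.I * φ) + c₀‖ ≤ ε} ⊆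
      (A r₁ ∪ A r₂) ∪ (A r₃ ∪ A r₄) := by
    rintro φ ⟨h1, h2⟩
    rw [hr, norm_mul, norm_mul, norm_mul, norm_mul] at h2
    have h3 := le_of_mul_le_mul_left (h2.trans hε) (norm_pos_iff.2 h)
    by_contra hc
    simp only [hA, Set.mem_union, Set.mem_ofPred_eq, h1, true_and, not_or, not_le] at hc
    have h5 := mul_lt_mul'' hc.1.1 (mul_lt_mul'' hc.1.2 (mul_lt_mul'' hc.2.1 hc.2.2 ht ht)
      ht (by positivity)) ht (by positivity)
    have h6 : t * (t * (t * t)) = t ^ 4 := by ring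
    linarith
  have hAr : ∀ r, volume (A r) ≤ ENNReal.ofReal (6 * Real.pi * t) := fun r => volume_arc_le r ht
  have hπ := Real.pi_pos
  calc _ ≤ (volume (A r₁) + volume (A r₂)) + (volume (A r₃) + volume (A r₄)) :=
        (measure_mono hsub).trans ((measure_union_le _ _).trans
          (add_le_add (measure_union_le _ _) (measure_union_le _ _)))
    _ ≤ (ENNReal.ofReal (6 * Real.pi * t) + ENNReal.ofReal (6 * Real.pi * t)) +
        (ENNReal.ofReal (6 * Real.pi * t) + ENNReal.ofReal (6 * Real.pi * t)) :=
        add_le_add (add_le_add (hAr _) (hAr _)) (add_le_add (hAr _) (hAr _))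
    _ = _ := by
      rw [← ENNReal.ofReal_add (by positivity) (by positivity),
        ← ENNReal.ofReal_add (by positivity) (by positivity)]
      congr 1; ring

/-- A quadratic trigonometric polynomial with a nondegenerate square is rarely small. -/
theorem volume_quadratic_trig_le (A B C D : ℝ) {N : ℝ} (hN : N ≠ 0) {ζ : ℂ} (hζ : ζ ≠ 0) {ε t : ℝ}
    (ht : 0 ≤ t) (hε : ε ≤ N ^ 2 * ‖ζ‖ ^ 2 * t ^ 4) :
    volume {φ : ℝ | φ ∈ Set.Ioc (-Real.pi) Real.pi ∧
      |A + B * (ζ * Complex.exp (Complex.I * φ)).re + C * (ζ * Complex.exp (Complex.I * φ)).im -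
        (D + 2 * N * (ζ * Complex.exp (Complex.I * φ)).re) ^ 2| ≤ ε} ≤
      ENNReal.ofReal (24 * Real.pi * t) := by
  have hc : -(N : ℂ) ^ 2 * ζ ^ 2 ≠ 0 :=
    mul_ne_zero (neg_ne_zero.2 (pow_ne_zero _ (by exact_mod_cast hN))) (pow_ne_zero _ hζ)
  refine (measure_mono ?_).trans (volume_quartic_le (-(N : ℂ) ^ 2 * (starRingEnd ℂ ζ) ^ 2)
    ((B / 2 + C * Complex.I / 2 - 2 * D * N) * starRingEnd ℂ ζ)
    (A - D ^ 2 - 2 * N ^ 2 * (ζ * starRingEnd ℂ ζ))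
    ((B / 2 - C * Complex.I / 2 - 2 * D * N) * ζ) hc ht (hε.trans_eq ?_))
  · rintro φ ⟨h1, h2⟩
    refine ⟨h1, le_trans (le_of_eq ?_) h2⟩
    set z := Complex.exp (Complex.I * φ) with hz
    have hz1 : ‖z‖ = 1 := by rw [hz, mul_comm, Complex.norm_exp_ofReal_mul_I]
    have hzz : z * starRingEnd ℂ z = 1 := by
      rw [Complex.mul_conj, Complex.normSq_eq_norm_sq, hz1]; simp
    -- On the unit circle conjugation is inversion, so multiplication by z² turns the trigonometric
    -- polynomial into a quartic in z, with leading coefficient -N²ζ².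
    have h3 : ((A + B * (ζ * z).re + C * (ζ * z).im - (D + 2 * N * (ζ * z).re) ^ 2 : ℝ) : ℂ) * z ^ 2 =
        -(N : ℂ) ^ 2 * ζ ^ 2 * z ^ 4 + ((B / 2 - C * Complex.I / 2 - 2 * D * N) * ζ) * z ^ 3 +
        (A - D ^ 2 - 2 * N ^ 2 * (ζ * starRingEnd ℂ ζ)) * z ^ 2 +
        ((B / 2 + C * Complex.I / 2 - 2 * D * N) * starRingEnd ℂ ζ) * z +
        (-(N : ℂ) ^ 2 * (starRingEnd ℂ ζ) ^ 2) := by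
      push_cast
      have him : ∀ u : ℂ, ((u.im : ℝ) : ℂ) = -(Complex.I / 2) * (u - starRingEnd ℂ u) := fun u => by
        rw [Complex.im_eq_sub_conj, div_eq_iff (mul_ne_zero two_ne_zero Complex.I_ne_zero)]
        linear_combination (u - starRingEnd ℂ u) * Complex.I_mul_I
      rw [Complex.re_eq_add_conj, him, map_mul]
      linear_combination ((B / 2 + C * Complex.I / 2 - 2 * D * N) * starRingEnd ℂ ζ * z -
        2 * N ^ 2 * ζ * starRingEnd ℂ ζ * z ^ 2 -
        N ^ 2 * starRingEnd ℂ ζ ^ 2 * (z * starRingEnd ℂ z + 1)) * hzz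
    rw [← h3, norm_mul, norm_pow, hz1, one_pow, mul_one, Complex.norm_real, Real.norm_eq_abs]
  · rw [norm_mul, norm_neg, norm_pow, norm_pow, Complex.norm_real, Real.norm_eq_abs, sq_abs]

end TrigonometricPolynomial

end InformedRRT

/-! ### Slabs and averaging over rotations -/

namespace InformedRRT

variable {n : ℕ}

/-- The part of a ball within a thin slab through its centre is small. -/
theorem volume_slab_le (v : Space n) {m : Space n} (hm : ‖m‖ = 1) {R s : ℝ} (hR : 0 < R) (hs : 0 < s) :
    volume {x | ‖x - v‖ ≤ R ∧ |inner ℝ m (x - v)| ≤ s} ≤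
      ENNReal.ofReal (s / R) * volume (Metric.closedBall (0 : Space n) (3 * R)) := by
  -- `f` compresses the direction m by the factor s/R, which is its determinant. Undoing the
  -- compression keeps the slab within radius 3R.
  set f : Space n →ₗ[ℝ] Space n := LinearMap.transvection (innerₛₗ ℝ m) ((s / R - 1) • m) with hf
  have hdet : LinearMap.det f = s / R := by
    rw [hf, LinearMap.transvection.det]
    simp [hm]
  have hfx : ∀ x, f x = x + ((s / R - 1) * inner ℝ m x) • m := fun x => by
    simp only [hf, LinearMap.transvection.apply, innerₛₗ_apply_apply, smul_smul, mul_comm]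
  have hsub : {x | ‖x - v‖ ≤ R ∧ |inner ℝ m (x - v)| ≤ s} ⊆
      (fun z => v + z) '' (f '' Metric.closedBall 0 (3 * R)) := by
    rintro x ⟨h1, h2⟩
    refine ⟨x - v, ⟨x - v + ((R / s - 1) * inner ℝ m (x - v)) • m, ?_, ?_⟩, add_sub_cancel _ _⟩
    · rw [mem_closedBall_zero_iff]
      have h3 : |inner ℝ m (x - v)| ≤ R := (abs_real_inner_le_norm _ _).trans (by rwa [hm, one_mul])
      have h4 : |R / s * inner ℝ m (x - v)| ≤ R := by
        rw [abs_mul, abs_of_pos (by positivity)]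
        calc R / s * _ ≤ R / s * s := by gcongr
          _ = R := by field_simp
      calc _ ≤ ‖x - v‖ + |(R / s - 1) * inner ℝ m (x - v)| := by
            refine (norm_add_le _ _).trans ?_
            rw [norm_smul, hm, mul_one, Real.norm_eq_abs]
        _ ≤ R + (R + R) := by
          refine add_le_add h1 ?_
          rw [sub_mul, one_mul]
          exact (abs_sub _ _).trans (add_le_add h4 h3)
        _ = 3 * R := by ring
    · rw [hfx, inner_add_right, inner_smul_right, real_inner_self_eq_norm_sq, hm, add_assoc, ← add_smul]
      convert add_zero _
      rw [show (R / s - 1) * inner ℝ m (x - v) + (s / R - 1) *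
        (inner ℝ m (x - v) + (R / s - 1) * inner ℝ m (x - v) * 1 ^ 2) = 0 by field_simp; ring, zero_smul]
  refine (measure_mono hsub).trans_eq ?_
  rw [Set.image_add_left, measure_preimage_add, Measure.addHaar_image_linearMap, hdet,
    abs_of_pos (by positivity)]

section Rotation

variable {k m : Space n}

/-- The rotation by `φ` in the plane of `k` and `m`. -/
noncomputable def rotation (k m : Space n) (φ : ℝ) (x : Space n) : Space n :=
  (x - inner ℝ k x • k - inner ℝ m x • m) +
    ((inner ℝ k x * Real.cos φ - inner ℝ m x * Real.sin φ) • k +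
      (inner ℝ k x * Real.sin φ + inner ℝ m x * Real.cos φ) • m)

theorem continuous_rotation (k m : Space n) :
    Continuous fun p : ℝ × Space n => rotation k m p.1 p.2 := by
  unfold rotation
  fun_prop

variable (hk : ‖k‖ = 1) (hm : ‖m‖ = 1) (hkm : inner ℝ k m = 0)

include hk hkm in
theorem inner_rotation_left (φ : ℝ) (x : Space n) : inner ℝ k (rotation k m φ x) =
    inner ℝ k x * Real.cos φ - inner ℝ m x * Real.sin φ := by
  simp only [rotation, inner_add_right, inner_sub_right, inner_smul_right,
    real_inner_self_eq_norm_sq, hk, hkm]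
  ring

include hm hkm in
theorem inner_rotation_right (φ : ℝ) (x : Space n) : inner ℝ m (rotation k m φ x) =
    inner ℝ k x * Real.sin φ + inner ℝ m x * Real.cos φ := by
  have hmk : inner ℝ m k = 0 := by rw [real_inner_comm, hkm]
  simp only [rotation, inner_add_right, inner_sub_right, inner_smul_right,
    real_inner_self_eq_norm_sq, hm, hmk]
  ring

theorem inner_rotation (φ : ℝ) (x w : Space n) : inner ℝ (rotation k m φ x) w =
    (inner ℝ x w - inner ℝ k x * inner ℝ k w - inner ℝ m x * inner ℝ m w) +
      ((inner ℝ k x * Real.cos φ - inner ℝ m x * Real.sin φ) * inner ℝ k w +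
        (inner ℝ k x * Real.sin φ + inner ℝ m x * Real.cos φ) * inner ℝ m w) := by
  simp only [rotation, inner_add_left, inner_sub_left, inner_smul_left, conj_trivial]

include hk hm hkm

theorem norm_rotation (φ : ℝ) (x : Space n) : ‖rotation k m φ x‖ = ‖x‖ := by
  have h : ‖rotation k m φ x‖ ^ 2 = ‖x‖ ^ 2 := by
    rw [← real_inner_self_eq_norm_sq, inner_rotation, inner_rotation_left hk hkm,
      inner_rotation_right hm hkm, real_inner_comm, inner_rotation,
      real_inner_self_eq_norm_sq]
    linear_combination (inner ℝ k x ^ 2 + inner ℝ m x ^ 2) * Real.sin_sq_add_cos_sq φ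
  exact (sq_eq_sq₀ (norm_nonneg _) (norm_nonneg _)).1 h

theorem measurePreserving_rotation (φ : ℝ) : MeasurePreserving (rotation k m φ) := by
  let f : Space n →ₗ[ℝ] Space n :=
    { toFun := rotation k m φ
      map_add' := fun x y => by simp only [rotation, inner_add_right]; module
      map_smul' := fun c x => by
        simp only [rotation, inner_smul_right, RingHom.id_apply]; module }
  let g : Space n →ₗᵢ[ℝ] Space n := ⟨f, norm_rotation hk hm hkm φ⟩
  exact (g.toLinearIsometryEquiv rfl).measurePreserving

/-- A set that meets all circles in parallel planes in small arcs is small. -/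
theorem volume_le_of_rotation {S : Set (Space n)} (hS : MeasurableSet S) {R b : ℝ} (v : Space n)
    (hSR : ∀ x ∈ S, ‖x - v‖ ≤ R)
    (h : ∀ x, ‖x‖ ≤ R → volume {φ : ℝ | φ ∈ Set.Ioc (-Real.pi) Real.pi ∧
      v + rotation k m φ x ∈ S} ≤ ENNReal.ofReal (2 * Real.pi * b)) :
    volume S ≤ ENNReal.ofReal b * volume (Metric.closedBall (0 : Space n) R) := by
  have hπ := Real.pi_pos
  have hcont : Continuous fun p : ℝ × Space n => v + rotation k m p.1 p.2 :=
    continuous_const.add (continuous_rotation k m)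
  have hmeas : Measurable (Function.uncurry fun (φ : ℝ) (x : Space n) =>
      S.indicator (fun _ => (1 : ℝ≥0∞)) (v + rotation k m φ x)) :=
    (measurable_const.indicator hS).comp hcont.measurable
  have h1 : ∀ φ, ∫⁻ x, S.indicator (fun _ => (1 : ℝ≥0∞)) (v + rotation k m φ x) = volume S := by
    intro φ
    have hmp : MeasurePreserving fun x => v + rotation k m φ x :=
      (measurePreserving_add_left volume v).comp (measurePreserving_rotation hk hm hkm φ)
    rw [hmp.lintegral_comp (measurable_const.indicator hS), lintegral_indicator hS]
    simp
  have h2 : ∫⁻ _ in Set.Ioc (-Real.pi) Real.pi, volume S = ENNReal.ofReal (2 * Real.pi) * volume S := by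
    rw [lintegral_const, Measure.restrict_apply_univ, Real.volume_Ioc, mul_comm]
    congr 2; ring
  have h3 : ∀ x : Space n, ∫⁻ φ in Set.Ioc (-Real.pi) Real.pi,
      S.indicator (fun _ => (1 : ℝ≥0∞)) (v + rotation k m φ x) ≤
      (Metric.closedBall (0 : Space n) R).indicator (fun _ => ENNReal.ofReal (2 * Real.pi * b)) x := by
    intro x
    have hset : MeasurableSet {φ : ℝ | v + rotation k m φ x ∈ S} :=
      (hcont.measurable.comp (measurable_id.prodMk measurable_const)) hS
    have h4 : ∫⁻ φ in Set.Ioc (-Real.pi) Real.pi,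
        S.indicator (fun _ => (1 : ℝ≥0∞)) (v + rotation k m φ x) =
        volume {φ : ℝ | φ ∈ Set.Ioc (-Real.pi) Real.pi ∧ v + rotation k m φ x ∈ S} := by
      have : (fun φ => S.indicator (fun _ => (1 : ℝ≥0∞)) (v + rotation k m φ x)) =
          {φ : ℝ | v + rotation k m φ x ∈ S}.indicator 1 := rfl
      rw [this, lintegral_indicator_one hset, Measure.restrict_apply hset, Set.inter_comm]
      rfl
    rw [h4]
    by_cases hx : ‖x‖ ≤ R
    · rw [Set.indicator_of_mem (mem_closedBall_zero_iff.2 hx)]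
      exact h x hx
    · rw [Set.indicator_of_notMem (fun h => hx (mem_closedBall_zero_iff.1 h)), nonpos_iff_eq_zero]
      convert measure_empty (μ := volume)
      ext φ
      simp only [Set.mem_ofPred_eq, Set.mem_empty_iff_false, iff_false, not_and]
      intro _ hmem
      have := hSR _ hmem
      rw [add_sub_cancel_left, norm_rotation hk hm hkm] at this
      exact hx this
  -- Rotations about v preserve volume, so the volume of S is its average over φ. By Tonelli this is
  -- an integral over x of the angles at which the orbit meets S.
  have h5 : ENNReal.ofReal (2 * Real.pi) * volume S ≤
      ENNReal.ofReal (2 * Real.pi * b) * volume (Metric.closedBall (0 : Space n) R) := by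
    calc _ = ∫⁻ φ in Set.Ioc (-Real.pi) Real.pi, ∫⁻ x,
          S.indicator (fun _ => (1 : ℝ≥0∞)) (v + rotation k m φ x) := by
          rw [← h2]; exact lintegral_congr fun φ => (h1 φ).symm
      _ = ∫⁻ x, ∫⁻ φ in Set.Ioc (-Real.pi) Real.pi,
          S.indicator (fun _ => (1 : ℝ≥0∞)) (v + rotation k m φ x) :=
        lintegral_lintegral_swap hmeas.aemeasurable
      _ ≤ ∫⁻ x, (Metric.closedBall (0 : Space n) R).indicator
          (fun _ => ENNReal.ofReal (2 * Real.pi * b)) x := lintegral_mono h3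
      _ = _ := lintegral_indicator_const Metric.isClosed_closedBall.measurableSet _
  rw [ENNReal.ofReal_mul (p := 2 * Real.pi) (by positivity), mul_assoc] at h5
  exact (ENNReal.mul_le_mul_iff_right (by simpa using hπ) ENNReal.ofReal_ne_top).1 h5

end Rotation

end InformedRRT

/-! ### New states rarely fall near a point or an ellipsoid -/

namespace InformedRRT

variable {n : ℕ}

/-- The fraction of the way to a sample at distance `ρ` that is covered by steering. -/
noncomputable def steerScale (η : ℝ≥0∞) (ρ : ℝ) : ℝ :=
  if ENNReal.ofReal ρ ≤ η then 1 else η.toReal / ρ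

theorem steer_eq_add_steerScale (η : ℝ≥0∞) (v x : Space n) :
    steer η v x = v + steerScale η ‖x - v‖ • (x - v) := by
  have h : edist v x = ENNReal.ofReal ‖x - v‖ := by rw [edist_comm, edist_dist, dist_eq_norm]
  unfold steer steerScale
  rw [h]
  split_ifs <;> simp

theorem steerScale_nonneg (η : ℝ≥0∞) {ρ : ℝ} (hρ : 0 ≤ ρ) : 0 ≤ steerScale η ρ := by
  unfold steerScale
  split_ifs <;> positivity

theorem steerScale_le_one (η : ℝ≥0∞) {ρ : ℝ} (hρ : 0 ≤ ρ) : steerScale η ρ ≤ 1 := by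
  unfold steerScale
  split_ifs with h
  · exact le_rfl
  · exact div_le_one_of_le₀ (ENNReal.toReal_le_of_le_ofReal hρ (not_le.1 h).le) hρ

theorem exists_le_steerScale {η : ℝ≥0∞} (hη : 0 < η) {R : ℝ} (hR : 0 < R) :
    ∃ l : ℝ, 0 < l ∧ ∀ ρ ≤ R, l ≤ steerScale η ρ := by
  by_cases htop : η = ⊤
  · exact ⟨1, one_pos, fun ρ _ => by simp [steerScale, htop]⟩
  have h0 : 0 < η.toReal := ENNReal.toReal_pos hη.ne' htop
  refine ⟨min 1 (η.toReal / R), by positivity, fun ρ hρ => ?_⟩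
  unfold steerScale
  split_ifs with h
  · exact min_le_left _ _
  · have : 0 < ρ := by
      by_contra h'
      rw [ENNReal.ofReal_of_nonpos (not_lt.1 h')] at h
      exact h zero_le
    exact (min_le_right _ _).trans (div_le_div_of_nonneg_left h0.le this hρ)

theorem norm_steer_sub_le (η : ℝ≥0∞) (v x : Space n) : ‖steer η v x - v‖ ≤ ‖x - v‖ := by
  rw [steer_eq_add_steerScale, add_sub_cancel_left, norm_smul,
    Real.norm_of_nonneg (steerScale_nonneg η (norm_nonneg _))]
  exact mul_le_of_le_one_left (norm_nonneg _) (steerScale_le_one η (norm_nonneg _))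

/-- New states rarely come close to a given point. -/
theorem exists_volume_close_le (hn : 2 ≤ n) {η : ℝ≥0∞} (hη : 0 < η) {R : ℝ} (hR : 0 < R) :
    ∃ C : ℝ, 0 < C ∧ ∀ (v₀ p : Space n) (δ : ℝ), 0 < δ →
      volume {x | ‖x - v₀‖ ≤ R ∧ ‖steer η v₀ x - p‖ ≤ δ} ≤ ENNReal.ofReal (C * δ) := by
  obtain ⟨l, hl, hls⟩ := exists_le_steerScale hη hR
  set V := volume.real (Metric.closedBall (0 : Space n) (3 * R))
  refine ⟨V / (l * R) + 1, by positivity, fun v₀ p δ hδ => ?_⟩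
  -- Along a direction m orthogonal to p - v₀, the steered displacement is at least l times that of
  -- the sample. Closeness to p thus confines the sample to a slab.
  obtain ⟨m, hm, hpm⟩ := exists_unit_orthogonal hn (p - v₀)
  have hsub : {x | ‖x - v₀‖ ≤ R ∧ ‖steer η v₀ x - p‖ ≤ δ} ⊆
      {x | ‖x - v₀‖ ≤ R ∧ |inner ℝ m (x - v₀)| ≤ δ / l} := by
    rintro x ⟨h1, h2⟩
    refine ⟨h1, ?_⟩
    have h3 : inner ℝ m (steer η v₀ x - p) = steerScale η ‖x - v₀‖ * inner ℝ m (x - v₀) := by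
      rw [steer_eq_add_steerScale, show v₀ + steerScale η ‖x - v₀‖ • (x - v₀) - p =
        steerScale η ‖x - v₀‖ • (x - v₀) - (p - v₀) by abel, inner_sub_right, inner_smul_right,
        real_inner_comm (p - v₀) m, hpm, sub_zero]
    have h4 := (abs_real_inner_le_norm m (steer η v₀ x - p)).trans_eq (by rw [hm, one_mul])
    rw [h3, abs_mul, abs_of_nonneg (steerScale_nonneg η (norm_nonneg _))] at h4
    rw [le_div_iff₀ hl]
    calc |inner ℝ m (x - v₀)| * l ≤ |inner ℝ m (x - v₀)| * steerScale η ‖x - v₀‖ :=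
          mul_le_mul_of_nonneg_left (hls _ h1) (abs_nonneg _)
      _ ≤ δ := by rw [mul_comm]; exact h4.trans h2
  refine (measure_mono hsub).trans ((volume_slab_le v₀ hm hR (by positivity)).trans ?_)
  rw [← ENNReal.ofReal_toReal (measure_closedBall_lt_top (μ := volume) (x := (0 : Space n))).ne,
    ← ENNReal.ofReal_mul (by positivity)]
  refine ENNReal.ofReal_le_ofReal ?_
  change δ / l / R * V ≤ _
  calc δ / l / R * V = V / (l * R) * δ := by field_simp
    _ ≤ _ := by gcongr; linarith

/-- Heron's factorization replaces the ellipsoid equation a + b = κ by a polynomial in a² and b²,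
which is free of square roots. -/
theorem abs_heron_le {a b κ e M : ℝ} (ha : 0 ≤ a) (hb : 0 ≤ b) (haM : a ≤ M) (hbM : b ≤ M)
    (hκ : 0 ≤ κ) (h1 : κ ≤ a + b) (h2 : a + b ≤ κ + e) :
    |4 * κ ^ 2 * a ^ 2 - (κ ^ 2 + (a ^ 2 - b ^ 2)) ^ 2| ≤ 36 * M ^ 3 * e := by
  have h3 : 4 * κ ^ 2 * a ^ 2 - (κ ^ 2 + (a ^ 2 - b ^ 2)) ^ 2 =
      (b + κ - a) * (κ + a - b) * (κ + a + b) * (a + b - κ) := by ring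
  rw [h3, abs_mul, abs_mul, abs_mul]
  have h4 : |b + κ - a| ≤ 3 * M := by rw [abs_le]; constructor <;> linarith
  have h5 : |κ + a - b| ≤ 3 * M := by rw [abs_le]; constructor <;> linarith
  have h6 : |κ + a + b| ≤ 4 * M := by rw [abs_le]; constructor <;> linarith
  have h7 : |a + b - κ| ≤ e := by rw [abs_le]; constructor <;> linarith
  have hM : 0 ≤ M := ha.trans haM
  calc _ ≤ 3 * M * (3 * M) * (4 * M) * e := by gcongr
    _ = _ := by ring

/-- New states rarely come close to a given ellipsoid. -/
theorem exists_volume_band_le (hn : 2 ≤ n) {η : ℝ≥0∞} (hη : 0 < η) {R : ℝ} (hR : 0 < R) :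
    ∃ C : ℝ, 0 < C ∧ ∀ v₀ v w : Space n, v ≠ w → ‖v - v₀‖ ≤ R → ‖w - v₀‖ ≤ R →
      ∀ κ e s t : ℝ, 0 ≤ κ → 0 ≤ e → 0 < s → 0 < t → C * e ≤ ‖w - v‖ ^ 2 * s ^ 2 * t ^ 4 →
      volume {x | ‖x - v₀‖ ≤ R ∧ κ ≤ ‖steer η v₀ x - v‖ + ‖steer η v₀ x - w‖ ∧
        ‖steer η v₀ x - v‖ + ‖steer η v₀ x - w‖ ≤ κ + e} ≤ ENNReal.ofReal (C * (s + t)) := by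
  obtain ⟨l, hl, hls⟩ := exists_le_steerScale hη hR
  set V := volume.real (Metric.closedBall (0 : Space n) (3 * R)) with hV
  set V' := volume.real (Metric.closedBall (0 : Space n) R) with hV'
  set C₁ := 36 * (2 * R) ^ 3 with hC₁
  have hV0 : 0 ≤ V := measureReal_nonneg
  have hV0' : 0 ≤ V' := measureReal_nonneg
  have hC0 : 0 < C₁ := by positivity
  have hπ := Real.pi_pos
  -- The three summands pay for the lower bound of the leading coefficient, for the slab, and for
  -- the angles: 24πt of 2π makes 12t.
  refine ⟨C₁ / l ^ 2 + V / R + 12 * V', by positivity, ?_⟩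
  intro v₀ v w hvw hv hw κ e s t hκ he hs ht hCe
  set C := C₁ / l ^ 2 + V / R + 12 * V' with hC
  have hC1 : C₁ / l ^ 2 ≤ C := by have : 0 ≤ V / R := by positivity
                                  linarith
  set N := ‖w - v‖ with hN
  have hN0 : 0 < N := norm_pos_iff.2 (sub_ne_zero.2 hvw.symm)
  set k := N⁻¹ • (w - v) with hkdef
  have hk : ‖k‖ = 1 := norm_smul_inv_norm (sub_ne_zero.2 hvw.symm)
  have hNk : w - v = N • k := by rw [hkdef, smul_smul, mul_inv_cancel₀ hN0.ne', one_smul]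
  obtain ⟨m, hm, hkm⟩ := exists_unit_orthogonal hn k
  set S := {x | ‖x - v₀‖ ≤ R ∧ κ ≤ ‖steer η v₀ x - v‖ + ‖steer η v₀ x - w‖ ∧
        ‖steer η v₀ x - v‖ + ‖steer η v₀ x - w‖ ≤ κ + e} with hS
  have hSm : MeasurableSet S := by
    have hst : Measurable fun x : Space n => steer η v₀ x := measurable_steer η measurable_const measurable_id
    have hsum : Measurable fun x : Space n => ‖steer η v₀ x - v‖ + ‖steer η v₀ x - w‖ :=
      (hst.sub_const v).norm.add (hst.sub_const w).norm
    exact (measurableSet_le (measurable_id.sub_const v₀).norm measurable_const).inter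
      ((measurableSet_le measurable_const hsum).inter (measurableSet_le hsum measurable_const))
  -- Off the slab the planar component of the orbit has length at least s, which keeps the leading
  -- coefficient away from 0.
  set S₂ := S ∩ {x | s < |inner ℝ k (x - v₀)|} with hS₂
  have hS₂m : MeasurableSet S₂ := by
    refine hSm.inter (measurableSet_lt measurable_const ?_)
    have : Continuous fun x : Space n => |inner ℝ k (x - v₀)| := by fun_prop
    exact this.measurable
  have hsub : S ⊆ {x | ‖x - v₀‖ ≤ R ∧ |inner ℝ k (x - v₀)| ≤ s} ∪ S₂ := by
    intro x hx
    rcases le_or_gt |inner ℝ k (x - v₀)| s with h | h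
    · exact Or.inl ⟨hx.1, h⟩
    · exact Or.inr ⟨hx, h⟩
  have hrot : volume S₂ ≤ ENNReal.ofReal (12 * t) * volume (Metric.closedBall (0 : Space n) R) := by
    refine volume_le_of_rotation hk hm hkm hS₂m v₀ (fun x hx => hx.1.1) fun x hx => ?_
    by_cases hemp : ∃ φ : ℝ, v₀ + rotation k m φ x ∈ S₂
    swap
    · push Not at hemp
      simp [hemp]
    obtain ⟨φ₀, -, hφ₀⟩ := hemp
    set x₁ := inner ℝ k x with hx₁
    set x₂ := inner ℝ m x with hx₂
    set σ := steerScale η ‖x‖ with hσ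
    have hσl : l ≤ σ := hls _ hx
    have hA : s ^ 2 ≤ x₁ ^ 2 + x₂ ^ 2 := by
      have h1 : s < |inner ℝ k (v₀ + rotation k m φ₀ x - v₀)| := hφ₀
      rw [add_sub_cancel_left, inner_rotation_left hk hkm] at h1
      have h2 := pow_lt_pow_left₀ h1 hs.le two_ne_zero
      rw [sq_abs] at h2
      have h3 := Real.sin_sq_add_cos_sq φ₀
      nlinarith [sq_nonneg (x₁ * Real.sin φ₀ + x₂ * Real.cos φ₀)]
    -- The steering scale depends only on the distance from `v₀`, hence is constant along the orbit.
    -- In the plane, the steered orbit is the circle ζ e^(iφ).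
    set ζ : ℂ := ⟨σ * x₁, σ * x₂⟩ with hζ
    have hζn : ‖ζ‖ ^ 2 = σ ^ 2 * (x₁ ^ 2 + x₂ ^ 2) := by
      rw [← Complex.normSq_eq_norm_sq, Complex.normSq_mk]; ring
    have hζ2 : l ^ 2 * s ^ 2 ≤ ‖ζ‖ ^ 2 := by rw [hζn]; gcongr
    have hζ0 : ζ ≠ 0 := by
      rintro h
      rw [h, norm_zero] at hζ2
      have : 0 < l ^ 2 * s ^ 2 := by positivity
      norm_num at hζ2
      linarith
    set v' := v - v₀ with hv'
    set w' := w - v₀ with hw'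
    have hε : C₁ * e ≤ N ^ 2 * ‖ζ‖ ^ 2 * t ^ 4 := by
      calc C₁ * e = l ^ 2 * (C₁ / l ^ 2 * e) := by field_simp
        _ ≤ l ^ 2 * (N ^ 2 * s ^ 2 * t ^ 4) := by
          exact mul_le_mul_of_nonneg_left ((mul_le_mul_of_nonneg_right hC1 he).trans hCe)
            (by positivity)
        _ = N ^ 2 * (l ^ 2 * s ^ 2) * t ^ 4 := by ring
        _ ≤ _ := by gcongr
    have htrig := volume_quadratic_trig_le
      (4 * κ ^ 2 * (σ ^ 2 * ‖x‖ ^ 2 + ‖v'‖ ^ 2 -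
        2 * σ * (inner ℝ x v' - x₁ * inner ℝ k v' - x₂ * inner ℝ m v')))
      (-8 * κ ^ 2 * inner ℝ k v') (-8 * κ ^ 2 * inner ℝ m v') (κ ^ 2 + ‖v'‖ ^ 2 - ‖w'‖ ^ 2)
      hN0.ne' hζ0 ht.le hε
    refine (measure_mono ?_).trans (htrig.trans_eq (by congr 1; ring))
    rintro φ ⟨hφ, ⟨-, h1, h2⟩, -⟩
    refine ⟨hφ, ?_⟩
    set y := rotation k m φ x with hy
    have hst : steer η v₀ (v₀ + y) = v₀ + σ • y := by
      rw [steer_eq_add_steerScale, add_sub_cancel_left, norm_rotation hk hm hkm]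
    have hyR : ‖σ • y‖ ≤ R := by
      have := norm_steer_sub_le η v₀ (v₀ + y)
      rw [hst, add_sub_cancel_left, add_sub_cancel_left, norm_rotation hk hm hkm] at this
      exact this.trans hx
    have hav : v₀ + σ • y - v = σ • y - v' := by rw [hv']; abel
    have haw : v₀ + σ • y - w = σ • y - w' := by rw [hw']; abel
    rw [hst, hav, haw] at h1 h2
    have hre : (ζ * Complex.exp (Complex.I * φ)).re = σ * (x₁ * Real.cos φ - x₂ * Real.sin φ) := by
      rw [mul_comm Complex.I, Complex.mul_re, Complex.exp_ofReal_mul_I_re, Complex.exp_ofReal_mul_I_im]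
      ring
    have him : (ζ * Complex.exp (Complex.I * φ)).im = σ * (x₁ * Real.sin φ + x₂ * Real.cos φ) := by
      rw [mul_comm Complex.I, Complex.mul_im, Complex.exp_ofReal_mul_I_re, Complex.exp_ofReal_mul_I_im]
      ring
    have hsq : ∀ u : Space n, ‖σ • y - u‖ ^ 2 = σ ^ 2 * ‖x‖ ^ 2 - 2 * σ * inner ℝ y u + ‖u‖ ^ 2 := by
      intro u
      rw [norm_sub_sq_real, norm_smul, inner_smul_left, hy, norm_rotation hk hm hkm, mul_pow,
        Real.norm_eq_abs, sq_abs]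
      simp only [conj_trivial]; ring
    have hdiff : inner ℝ y w' - inner ℝ y v' = N * (x₁ * Real.cos φ - x₂ * Real.sin φ) := by
      rw [← inner_sub_right, show w' - v' = N • k by rw [← hNk, hv', hw']; abel, inner_smul_right,
        real_inner_comm, hy, inner_rotation_left hk hkm]
    have hheron := abs_heron_le (M := 2 * R) (norm_nonneg (σ • y - v')) (norm_nonneg (σ • y - w'))
      ((norm_sub_le _ _).trans (by linarith)) ((norm_sub_le _ _).trans (by linarith)) hκ h1 h2
    refine le_trans (le_of_eq ?_) hheron
    congr 1
    rw [hre, him, hsq, hsq, show σ ^ 2 * ‖x‖ ^ 2 - 2 * σ * inner ℝ y v' + ‖v'‖ ^ 2 -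
      (σ ^ 2 * ‖x‖ ^ 2 - 2 * σ * inner ℝ y w' + ‖w'‖ ^ 2) = ‖v'‖ ^ 2 - ‖w'‖ ^ 2 +
        2 * σ * (inner ℝ y w' - inner ℝ y v') by ring, hdiff, hy, inner_rotation]
    ring
  refine (measure_mono hsub).trans ((measure_union_le _ _).trans ((add_le_add
    (volume_slab_le v₀ hk hR hs) hrot).trans ?_))
  rw [← ENNReal.ofReal_toReal (measure_closedBall_lt_top (μ := volume) (x := (0 : Space n))
    (r := 3 * R)).ne, ← ENNReal.ofReal_toReal (measure_closedBall_lt_top (μ := volume)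
    (x := (0 : Space n)) (r := R)).ne, ← ENNReal.ofReal_mul (by positivity),
    ← ENNReal.ofReal_mul (by positivity), ← ENNReal.ofReal_add (by positivity) (by positivity)]
  refine ENNReal.ofReal_le_ofReal ?_
  change s / R * V + 12 * t * V' ≤ _
  have h1 : 0 ≤ C₁ / l ^ 2 := by positivity
  have h2 : 0 ≤ V / R := by positivity
  calc s / R * V + 12 * t * V' = (V / R) * s + (12 * V') * t := by ring
    _ ≤ C * s + C * t := by gcongr <;> linarith
    _ = _ := by ring

end InformedRRT

/-! ### Polynomial separation of the vertices -/

namespace InformedRRT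

variable {n : ℕ} {P : Problem n} {cfg : Config} {T T₀ : Tree n}

theorem Tree.Inv.mem_verts_step (hT : T.Inv P cfg) {x : Space n} {v : ℕ}
    (hv : v ∈ (InformedRRT.step P cfg T x).verts) :
    (v ∈ T.verts ∧ (InformedRRT.step P cfg T x).pos v = T.pos v) ∨
      (v = T.next ∧ (InformedRRT.step P cfg T x).pos v = newState cfg T x) := by
  classical
  by_cases h : P.IsFree (T.pos (T.nearest x)) (newState cfg T x)
  · have hs : InformedRRT.step P cfg T x =
      (T.extend P cfg (T.nearest x) (newState cfg T x)).prune P (T.cost P) := if_pos h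
    rw [hs] at hv ⊢
    have hp := Tree.isPruned_prune (P := P) (c := T.cost P)
      (T.extend P cfg (T.nearest x) (newState cfg T x))
    rw [hp.pos_eq]
    rcases Finset.mem_insert.1 (hp.subset hv) with rfl | hv'
    · exact Or.inr ⟨rfl, Tree.extend_pos_new⟩
    · exact Or.inl ⟨hv', hT.extend_pos_old hv'⟩
  · rw [cost_step_of_not_free h] at hv ⊢
    exact Or.inl ⟨hv, rfl⟩

theorem card_verts_treeAt_le (hT₀ : T₀.Inv P cfg) (x : ℕ → Space n) (i : ℕ) :
    (treeAt P cfg T₀ x i).verts.card ≤ T₀.verts.card + i := by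
  induction i with
  | zero => exact le_rfl
  | succ i ih =>
    have hsub : (treeAt P cfg T₀ x (i + 1)).verts ⊆
        insert (treeAt P cfg T₀ x i).next (treeAt P cfg T₀ x i).verts := fun v hv =>
      ((inv_treeAt hT₀ x i).mem_verts_step hv).elim (fun h => Finset.mem_insert_of_mem h.1)
        fun h => by rw [h.1]; exact Finset.mem_insert_self _ _
    have := (Finset.card_le_card hsub).trans (Finset.card_insert_le _ _)
    omega

theorem Tree.Inv.norm_sub_nearest_le (hT : T.Inv P cfg) {x : Space n} {c : ℝ}
    (hx : x ∈ P.informedSet c) : ‖x - T.pos (T.nearest x)‖ ≤ c := by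
  have h := (Tree.nearest_spec ⟨0, hT.root_mem⟩ x).2 0 hT.root_mem
  rw [hT.root_pos] at h
  exact h.trans (mem_ball_iff_norm.1 (P.hyperspheroid_subset_ball c hx.2)).le

/-- The new state comes within `δ` of a vertex. -/
def IsClose (cfg : Config) (δ : ℝ) (T : Tree n) (x : Space n) : Prop :=
  ∃ p, p ∈ T.verts ∧ ‖newState cfg T x - T.pos p‖ ≤ δ

theorem measTreeFun_isClose (δ : ℝ) : MeasTreeFun.{u} (IsClose cfg δ (n := n)) :=
  fun _ _ _ _ hf hy => measurableSet_setOfPred.1 (measurableSet_exists_nat fun v =>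
    (hf.verts v).inter (measurableSet_le ((hf.newState hy).sub (hf.pos v)).norm measurable_const))

theorem Tree.Inv.volume_isClose_le (hT : T.Inv P cfg) {R δ C : ℝ} (hR : T.cost P ≤ R) (hδ : 0 < δ)
    (hC : ∀ (v₀ p : Space n) (δ : ℝ), 0 < δ →
      volume {x | ‖x - v₀‖ ≤ R ∧ ‖steer cfg.η v₀ x - p‖ ≤ δ} ≤ ENNReal.ofReal (C * δ)) :
    volume (P.informedSet (T.cost P) ∩ {x | IsClose cfg δ T x}) ≤
      (T.verts.card : ℝ≥0∞) ^ 2 * ENNReal.ofReal (C * δ) := by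
  have hsub : P.informedSet (T.cost P) ∩ {x | IsClose cfg δ T x} ⊆
      ⋃ q ∈ T.verts ×ˢ T.verts,
        {x | ‖x - T.pos q.1‖ ≤ R ∧ ‖steer cfg.η (T.pos q.1) x - T.pos q.2‖ ≤ δ} := by
    rintro x ⟨hx, p, hp, h⟩
    exact Set.mem_biUnion (x := (T.nearest x, p))
      (Finset.mem_coe.2 (Finset.mk_mem_product (hT.nearest_mem x) hp))
      ⟨(hT.norm_sub_nearest_le hx).trans hR, h⟩
  refine (measure_mono hsub).trans ((measure_biUnion_finset_le _ _).trans
    ((Finset.sum_le_card_nsmul _ _ _ fun q _ => hC _ _ δ hδ).trans_eq ?_))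
  rw [Finset.card_product, nsmul_eq_mul]
  push_cast
  ring

/-- All sampling densities are bounded by a common constant once the smallest informed set has
positive volume. -/
theorem Problem.sampleLaw_le {c c' : ℝ} (hc : c' ≤ c) (B : Set (Space n)) :
    P.sampleLaw c B ≤ (volume (P.informedSet c'))⁻¹ * volume (P.informedSet c ∩ B) := by
  rw [P.sampleLaw_apply]
  exact mul_le_mul_left (ENNReal.inv_le_inv.2 (measure_mono (P.informedSet_mono hc))) _

universe u

variable {Ω : Type u} {x : ℕ → Ω → Space n} [MeasurableSpace Ω] {μ : Measure Ω}
  [IsProbabilityMeasure μ]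

theorem IsRun.measure_le_of_sampleLaw_le (hx : IsRun P cfg T₀ μ x) {p : Tree n → Space n → Prop}
    (hp : MeasTreeFun.{u} p) (i : ℕ) {b : ℝ≥0∞}
    (h : ∀ ω, P.sampleLaw (costAt P cfg T₀ (fun j => x j ω) i)
      {y | p (treeAt P cfg T₀ (fun j => x j ω) i) y} ≤ b) :
    μ {ω | p (treeAt P cfg T₀ (fun j => x j ω) i) (x i ω)} ≤ b := by
  classical
  have hΨ : MeasTreeFun.{u} (fun T y => if p T y then (1 : ℝ≥0∞) else 0) := fun α _ f y hf hy =>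
    Measurable.ite (measurableSet_setOfPred.2 (hp α f y hf hy)) measurable_const measurable_const
  have h1 := hx.lintegral_mul_tree i (g := fun _ => 1) measurable_const hΨ
  simp only [one_mul] at h1
  have h2 : μ {ω | p (treeAt P cfg T₀ (fun j => x j ω) i) (x i ω)} =
      ∫⁻ ω, (if p (treeAt P cfg T₀ (fun j => x j ω) i) (x i ω) then 1 else 0) ∂μ := by
    rw [← lintegral_indicator_one
      (measurableSet_setOfPred.2 (hp Ω _ _ (hx.measTree i) (hx.measurable i)))]
    rfl
  rw [h2, h1]
  calc _ ≤ ∫⁻ _, b ∂μ := lintegral_mono fun ω => by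
        refine le_trans (le_of_eq ?_) (h ω)
        rw [← lintegral_indicator_one (measurableSet_setOfPred.2 (hp.measurable_right _))]
        rfl
    _ = b := by simp

/-- Almost surely the new states keep a polynomially small distance from the tree. -/
theorem IsRun.ae_exists_not_isClose (hx : IsRun P cfg T₀ μ x) (hT₀ : T₀.Inv P cfg) (hn : 2 ≤ n)
    (h0 : volume (P.informedSet P.optCost) ≠ 0) :
    ∀ᵐ ω ∂μ, ∃ ε > 0, ∀ i : ℕ, ¬ IsClose cfg (ε / ((i : ℝ) + 1) ^ 4)
      (treeAt P cfg T₀ (fun j => x j ω) i) (x i ω) := by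
  have hR : 0 < T₀.cost P := P.focal_pos.trans_le hT₀.dist_le_cost
  obtain ⟨C, hC, hCv⟩ := exists_volume_close_le hn cfg.η_pos hR
  set m := (volume (P.informedSet P.optCost))⁻¹ with hm
  have hmt : m ≠ ⊤ := ENNReal.inv_ne_top.2 h0
  set N : ℝ := T₀.verts.card + 1 with hN
  have hN1 : 1 ≤ N := by rw [hN]; linarith [(T₀.verts.card.cast_nonneg : (0 : ℝ) ≤ _)]
  -- At time i there are at most (N(i + 1))² pairs of a nearest vertex and another vertex. The
  -- exponent 4 of the distance leaves a summable i^(-2).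
  set f : ℕ → ℝ := fun i => N ^ 2 * C / ((i : ℝ) + 1) ^ 2 with hf
  have hf0 : ∀ i, 0 ≤ f i := fun i => by positivity
  have hfs : Summable f := by
    have h1 := (summable_nat_add_iff 1).2 (Real.summable_one_div_nat_pow.2 one_lt_two)
    refine (h1.mul_left (N ^ 2 * C)).congr fun i => ?_
    rw [hf]
    push_cast
    ring
  have hμ : ∀ ε > 0, μ {ω | ∃ i : ℕ, IsClose cfg (ε / ((i : ℝ) + 1) ^ 4)
      (treeAt P cfg T₀ (fun j => x j ω) i) (x i ω)} ≤ ENNReal.ofReal ε * (m * ∑' i, ENNReal.ofReal (f i)) := by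
    intro ε hε
    simp only [Set.ofPred_exists]
    refine (measure_iUnion_le _).trans ?_
    rw [← ENNReal.tsum_mul_left, ← ENNReal.tsum_mul_left]
    refine ENNReal.tsum_le_tsum fun i => ?_
    refine hx.measure_le_of_sampleLaw_le (measTreeFun_isClose _) i fun ω => ?_
    have hT := inv_treeAt hT₀ (fun j => x j ω) i
    have hδ : 0 < ε / ((i : ℝ) + 1) ^ 4 := by positivity
    refine (P.sampleLaw_le hT.optCost_le_cost _).trans ?_
    rw [mul_left_comm]
    refine mul_le_mul_right ((hT.volume_isClose_le (antitone_costAt hT₀ _ (Nat.zero_le i)) hδ hCv).trans ?_) _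
    rw [← ENNReal.ofReal_natCast, ← ENNReal.ofReal_pow (Nat.cast_nonneg _),
      ← ENNReal.ofReal_mul (by positivity), ← ENNReal.ofReal_mul hε.le]
    refine ENNReal.ofReal_le_ofReal ?_
    have hcard : ((treeAt P cfg T₀ (fun j => x j ω) i).verts.card : ℝ) ≤ N * (i + 1) := by
      have h1 : ((treeAt P cfg T₀ (fun j => x j ω) i).verts.card : ℝ) ≤ T₀.verts.card + i := by
        exact_mod_cast card_verts_treeAt_le hT₀ _ i
      have h2 : (0 : ℝ) ≤ T₀.verts.card * i := by positivity
      rw [hN]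
      linarith
    calc _ ≤ (N * (i + 1)) ^ 2 * (C * (ε / ((i : ℝ) + 1) ^ 4)) := by gcongr
      _ = ε * f i := by rw [hf]; field_simp
  have hK : m * ∑' i, ENNReal.ofReal (f i) ≠ ⊤ :=
    ENNReal.mul_ne_top hmt (by rw [← ENNReal.ofReal_tsum_of_nonneg hf0 hfs]; exact ENNReal.ofReal_ne_top)
  -- The probability of ever coming too close is at most a multiple of ε, so almost surely some ε
  -- works.
  have hlim : Tendsto (fun ε : ℝ => ENNReal.ofReal ε * (m * ∑' i, ENNReal.ofReal (f i))) (𝓝[>] 0) (𝓝 0) := by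
    have h1 : Tendsto ENNReal.ofReal (𝓝[>] 0) (𝓝 0) := by
      have := (ENNReal.continuous_ofReal.tendsto 0).mono_left (nhdsWithin_le_nhds (s := Set.Ioi (0 : ℝ)))
      rwa [ENNReal.ofReal_zero] at this
    have := ENNReal.Tendsto.mul_const h1 (Or.inr hK)
    rwa [zero_mul] at this
  rw [ae_iff]
  refine le_antisymm (ge_of_tendsto hlim ?_) zero_le
  filter_upwards [self_mem_nhdsWithin] with ε hε
  refine (measure_mono fun ω hω => ?_).trans (hμ ε hε)
  by_contra h
  refine hω ⟨ε, hε, fun i hi => h ⟨i, hi⟩⟩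

/-- Almost surely the vertices are polynomially separated. -/
theorem IsRun.ae_exists_separated (hx : IsRun P cfg T₀ μ x) (hT₀ : T₀.Valid P cfg) (hn : 2 ≤ n)
    (h0 : volume (P.informedSet P.optCost) ≠ 0) :
    ∀ᵐ ω ∂μ, ∃ ε > 0, ∀ i : ℕ, ∀ v ∈ (treeAt P cfg T₀ (fun j => x j ω) i).verts,
      ∀ w ∈ (treeAt P cfg T₀ (fun j => x j ω) i).verts, v ≠ w →
      ε / ((i : ℝ) + 1) ^ 4 ≤ ‖(treeAt P cfg T₀ (fun j => x j ω) i).pos w -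
        (treeAt P cfg T₀ (fun j => x j ω) i).pos v‖ := by
  have hinit : ∃ ε > 0, ∀ v ∈ T₀.verts, ∀ w ∈ T₀.verts, v ≠ w → ε ≤ ‖T₀.pos w - T₀.pos v‖ := by
    have h : ∀ᶠ ε in 𝓝[>] (0 : ℝ), ∀ v ∈ T₀.verts, ∀ w ∈ T₀.verts, v ≠ w →
        ε ≤ ‖T₀.pos w - T₀.pos v‖ := by
      refine (eventually_all_finset _).2 fun v hv => (eventually_all_finset _).2 fun w hw => ?_
      by_cases hvw : v = w
      · exact Eventually.of_forall fun _ h => absurd hvw h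
      · have : 0 < ‖T₀.pos w - T₀.pos v‖ :=
          norm_pos_iff.2 (sub_ne_zero.2 fun h => hvw (hT₀.pos_inj hw hv h).symm)
        filter_upwards [nhdsWithin_le_nhds (Iic_mem_nhds this)] with ε hε _
        exact hε
    obtain ⟨ε, hε, h⟩ := (h.and self_mem_nhdsWithin).exists
    exact ⟨ε, h, hε⟩
  obtain ⟨ε₀, hε₀, hsep₀⟩ := hinit
  filter_upwards [hx.ae_exists_not_isClose hT₀.inv hn h0] with ω ⟨ε₁, hε₁, hω⟩
  have hnew : ∀ (i : ℕ), ∀ p ∈ (treeAt P cfg T₀ (fun j => x j ω) i).verts,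
      min ε₀ ε₁ / (((i + 1 : ℕ) : ℝ) + 1) ^ 4 ≤ ‖newState cfg (treeAt P cfg T₀ (fun j => x j ω) i) (x i ω) -
        (treeAt P cfg T₀ (fun j => x j ω) i).pos p‖ := by
    intro i p hp
    refine le_trans ?_ (not_le.1 fun h => hω i ⟨p, hp, h⟩).le
    push_cast
    gcongr
    · exact min_le_right _ _
    · linarith
  refine ⟨min ε₀ ε₁, lt_min hε₀ hε₁, fun i => ?_⟩
  induction i with
  | zero =>
    intro v hv w hw hvw
    refine le_trans ?_ (hsep₀ v hv w hw hvw)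
    simp
  | succ i ih =>
    intro v hv w hw hvw
    have hT := inv_treeAt hT₀.inv (fun j => x j ω) i
    have hpos : ∀ u, (treeAt P cfg T₀ (fun j => x j ω) (i + 1)).pos u =
      (step P cfg (treeAt P cfg T₀ (fun j => x j ω) i) (x i ω)).pos u := fun _ => rfl
    rw [hpos, hpos]
    rcases hT.mem_verts_step hv with ⟨hv1, hv2⟩ | ⟨hv1, hv2⟩ <;>
    rcases hT.mem_verts_step hw with ⟨hw1, hw2⟩ | ⟨hw1, hw2⟩ <;> rw [hv2, hw2]
    · refine le_trans ?_ (ih v hv1 w hw1 hvw)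
      have : 0 ≤ min ε₀ ε₁ := (lt_min hε₀ hε₁).le
      push_cast
      gcongr
      linarith
    · exact hnew i v hv1
    · rw [norm_sub_rev]; exact hnew i w hw1
    · exact absurd (hv1.trans hw1.symm) hvw

end InformedRRT

/-! ### Lower bound when the optimal informed set has positive volume -/

namespace InformedRRT

variable {n : ℕ} {P : Problem n} {cfg : Config} {T T₀ : Tree n}

theorem volume_steer_eq_zero (hn : 2 ≤ n) {η : ℝ≥0∞} (hη : 0 < η) {R : ℝ} (hR : 0 < R)
    (v₀ p : Space n) : volume {x | ‖x - v₀‖ ≤ R ∧ steer η v₀ x = p} = 0 := by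
  obtain ⟨C, -, hCv⟩ := exists_volume_close_le hn hη hR
  have hlim : Tendsto (fun δ : ℝ => ENNReal.ofReal (C * δ)) (𝓝[>] 0) (𝓝 0) := by
    have h : Continuous fun δ : ℝ => ENNReal.ofReal (C * δ) :=
      ENNReal.continuous_ofReal.comp (continuous_const.mul continuous_id)
    have := (h.tendsto 0).mono_left (nhdsWithin_le_nhds (s := Set.Ioi (0 : ℝ)))
    simpa using this
  refine le_antisymm (ge_of_tendsto hlim ?_) zero_le
  filter_upwards [self_mem_nhdsWithin] with δ hδ
  refine (measure_mono fun x hx => ?_).trans (hCv v₀ p δ hδ)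
  have hδ : 0 < δ := hδ
  exact ⟨hx.1, by rw [hx.2, sub_self, norm_zero]; exact hδ.le⟩

/-- Improvements are rare when the solution is almost optimal and the vertices are separated. -/
theorem Tree.Inv.volume_cost_step_lt_le (hT : T.Inv P cfg) (hn : 2 ≤ n) {c C δ s t : ℝ}
    (hc : T.cost P ≤ c)
    (hC : ∀ v₀ v w : Space n, v ≠ w → ‖v - v₀‖ ≤ 4 * c → ‖w - v₀‖ ≤ 4 * c →
      ∀ κ e s t : ℝ, 0 ≤ κ → 0 ≤ e → 0 < s → 0 < t → C * e ≤ ‖w - v‖ ^ 2 * s ^ 2 * t ^ 4 →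
      volume {x | ‖x - v₀‖ ≤ 4 * c ∧ κ ≤ ‖steer cfg.η v₀ x - v‖ + ‖steer cfg.η v₀ x - w‖ ∧
        ‖steer cfg.η v₀ x - v‖ + ‖steer cfg.η v₀ x - w‖ ≤ κ + e} ≤ ENNReal.ofReal (C * (s + t)))
    (hδ : 0 < δ) (hsep : ∀ v ∈ T.verts, ∀ w ∈ T.verts, v ≠ w → δ ≤ ‖T.pos w - T.pos v‖)
    (hs : 0 < s) (ht : 0 < t) (he : C * (T.cost P - P.optCost) ≤ δ ^ 2 * s ^ 2 * t ^ 4) :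
    volume (P.informedSet (T.cost P) ∩ {x | (InformedRRT.step P cfg T x).cost P < T.cost P}) ≤
      (T.verts.card : ℝ≥0∞) ^ 4 * ENNReal.ofReal (C * (s + t)) := by
  have hc0 : 0 < c := P.focal_pos.trans_le (hT.dist_le_cost.trans hc)
  have hfoc : ‖P.goal - P.start‖ ≤ c := hT.dist_le_cost.trans hc
  have he0 : 0 ≤ T.cost P - P.optCost := sub_nonneg.2 hT.optCost_le_cost
  -- An improved cost is `a γ v w` plus the distances of the new state from v and w. It lies between
  -- the optimal and the current cost, so the new state lies in one of the bands `B`, as wide as the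
  -- error.
  set a : ℕ → ℕ → ℕ → ℝ := fun γ v w => T.costToCome γ - T.costToCome w + T.costToCome v with ha
  set B : ℕ × ℕ × ℕ × ℕ → Set (Space n) := fun q =>
    {x | q.2.2.1 ≠ q.2.2.2 ∧ ‖T.pos q.2.2.1 - T.pos q.1‖ ≤ 4 * c ∧
      ‖T.pos q.2.2.2 - T.pos q.1‖ ≤ 4 * c ∧ ‖x - T.pos q.1‖ ≤ 4 * c ∧
      max 0 (P.optCost - a q.2.1 q.2.2.1 q.2.2.2) ≤
        ‖steer cfg.η (T.pos q.1) x - T.pos q.2.2.1‖ + ‖steer cfg.η (T.pos q.1) x - T.pos q.2.2.2‖ ∧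
      ‖steer cfg.η (T.pos q.1) x - T.pos q.2.2.1‖ + ‖steer cfg.η (T.pos q.1) x - T.pos q.2.2.2‖ ≤
        max 0 (P.optCost - a q.2.1 q.2.2.1 q.2.2.2) + (T.cost P - P.optCost)} with hB
  -- The remaining way to improve is a new state at the goal itself, which is a null event.
  set A : Set (Space n) := ⋃ v₀ ∈ T.verts, {x | ‖x - T.pos v₀‖ ≤ c ∧ steer cfg.η (T.pos v₀) x = P.goal}
    with hA
  have hA0 : volume A = 0 := (measure_biUnion_null_iff (T.verts.finite_toSet.countable)).2
    fun v₀ _ => volume_steer_eq_zero hn cfg.η_pos hc0 _ _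
  have hBv : ∀ q ∈ T.verts ×ˢ T.verts ×ˢ T.verts ×ˢ T.verts,
      volume (B q) ≤ ENNReal.ofReal (C * (s + t)) := by
    rintro ⟨v₀, γ, v, w⟩ hq
    simp only [Finset.mem_product] at hq
    by_cases h : v ≠ w ∧ ‖T.pos v - T.pos v₀‖ ≤ 4 * c ∧ ‖T.pos w - T.pos v₀‖ ≤ 4 * c
    · have hd := hsep v hq.2.2.1 w hq.2.2.2 h.1
      have hne : T.pos v ≠ T.pos w := fun h' => by
        rw [h', sub_self, norm_zero] at hd
        exact absurd hδ hd.not_gt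
      refine (measure_mono fun x hx => hx.2.2.2).trans (hC (T.pos v₀) (T.pos v) (T.pos w) hne h.2.1 h.2.2
        _ _ s t (le_max_left _ _) he0 hs ht (he.trans ?_))
      gcongr
    · refine le_trans (le_of_eq ?_) zero_le
      convert measure_empty (μ := (volume : Measure (Space n)))
      exact Set.eq_empty_of_forall_notMem fun x hx => h ⟨hx.1, hx.2.1, hx.2.2.1⟩
  have hsub : P.informedSet (T.cost P) ∩ {x | (InformedRRT.step P cfg T x).cost P < T.cost P} ⊆
      A ∪ ⋃ q ∈ T.verts ×ˢ T.verts ×ˢ T.verts ×ˢ T.verts, B q := by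
    rintro x ⟨hx, hlt⟩
    have hlt : (InformedRRT.step P cfg T x).cost P < T.cost P := hlt
    have hv₀ := hT.nearest_mem x
    have hxv := hT.norm_sub_nearest_le hx
    obtain ⟨-, v, hv, -, ⟨h, -⟩ | ⟨γ, hγ, w, hw, hvw, -, h1, h2⟩⟩ := hT.cost_step_lt hlt
    · exact Or.inl (Set.mem_biUnion (Finset.mem_coe.2 hv₀) ⟨hxv.trans hc, h⟩)
    · right
      have hopt := (hT.step x).optCost_le_cost
      have h3 := norm_nonneg (newState cfg T x - T.pos v)
      have h4 := norm_nonneg (newState cfg T x - T.pos w)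
      have h5 := norm_nonneg (P.goal - T.pos w)
      have h6 := hT.norm_start_le hv
      have h7 : ‖x - P.start‖ ≤ T.cost P :=
        (mem_ball_iff_norm.1 (P.hyperspheroid_subset_ball _ hx.2)).le
      have h8 : ‖T.pos (T.nearest x) - P.start‖ ≤ 2 * c := by
        have := norm_sub_le (x - P.start) (x - T.pos (T.nearest x))
        rw [sub_sub_sub_cancel_left] at this
        linarith
      have h9 : ‖T.pos v - T.pos (T.nearest x)‖ ≤ 4 * c := by
        have := norm_sub_le (T.pos v - P.start) (T.pos (T.nearest x) - P.start)
        rw [sub_sub_sub_cancel_right] at this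
        linarith
      have h10 : ‖T.pos w - T.pos (T.nearest x)‖ ≤ 4 * c := by
        have i1 := norm_sub_le (T.pos w - P.start) (T.pos (T.nearest x) - P.start)
        rw [sub_sub_sub_cancel_right] at i1
        have i2 := norm_sub_le (P.goal - P.start) (P.goal - T.pos w)
        rw [sub_sub_sub_cancel_left] at i2
        have := T.costToCome_nonneg v
        linarith
      refine Set.mem_biUnion (x := (T.nearest x, γ, v, w)) (Finset.mem_coe.2
        (Finset.mk_mem_product hv₀ (Finset.mk_mem_product hγ (Finset.mk_mem_product hv hw))))
        ⟨hvw, h9, h10, by linarith, ?_, ?_⟩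
      · refine max_le (add_nonneg h3 h4) ?_
        change P.optCost - (T.costToCome γ - T.costToCome w + T.costToCome v) ≤
          ‖newState cfg T x - T.pos v‖ + ‖newState cfg T x - T.pos w‖
        linarith
      · have := le_max_right 0 (P.optCost - (T.costToCome γ - T.costToCome w + T.costToCome v))
        change ‖newState cfg T x - T.pos v‖ + ‖newState cfg T x - T.pos w‖ ≤
          max 0 (P.optCost - (T.costToCome γ - T.costToCome w + T.costToCome v)) + _
        linarith
  refine (measure_mono hsub).trans ((measure_union_le _ _).trans ?_)
  rw [hA0, zero_add]
  refine (measure_biUnion_finset_le _ _).trans ((Finset.sum_le_card_nsmul _ _ _ hBv).trans_eq ?_)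
  simp only [Finset.card_product, nsmul_eq_mul]
  push_cast
  ring

/-- The expected ratio is at least the probability of no improvement. -/
theorem Tree.Inv.one_sub_le_expectedRatio (hT : T.Inv P cfg) (hc : P.optCost < T.cost P)
    [IsProbabilityMeasure (P.sampleLaw (T.cost P))] :
    1 - (P.sampleLaw (T.cost P)).real {y | (InformedRRT.step P cfg T y).cost P < T.cost P} ≤
      expectedRatio P cfg T := by
  have hm : MeasurableSet {y | (InformedRRT.step P cfg T y).cost P < T.cost P} :=
    measurableSet_lt (measurable_cost_step T) measurable_const
  rw [← probReal_compl_eq_one_sub hm, ← integral_indicator_one hm.compl]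
  refine integral_mono ((integrable_const 1).indicator hm.compl) hT.integrable_ratio fun y => ?_
  refine Set.indicator_le' (fun y hy => ?_) (fun y _ => (hT.ratio_mem_Icc y).1) y
  have : (InformedRRT.step P cfg T y).cost P = T.cost P :=
    le_antisymm (hT.cost_step_le y) (not_lt.1 hy)
  rw [this, div_self (sub_pos.2 hc).ne', Pi.one_apply]

theorem Tree.Inv.one_sub_expectedRatio_mul_le (hT : T.Inv P cfg) (hc : P.optCost < T.cost P)
    [IsProbabilityMeasure (P.sampleLaw (T.cost P))] (h0 : volume (P.informedSet P.optCost) ≠ 0)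
    {N : ℕ} {b : ℝ} (h : volume (P.informedSet (T.cost P) ∩
      {x | (InformedRRT.step P cfg T x).cost P < T.cost P}) ≤ (N : ℝ≥0∞) ^ 4 * ENNReal.ofReal b)
    (hb : 0 ≤ b) :
    (1 - expectedRatio P cfg T) * volume.real (P.informedSet P.optCost) ≤ (N : ℝ) ^ 4 * b := by
  have hm0 : 0 < volume.real (P.informedSet P.optCost) :=
    ENNReal.toReal_pos h0 (P.volume_informedSet_lt_top P.optCost).ne
  have hlaw := (P.sampleLaw_le hc.le _).trans (mul_le_mul_right h _)
  have hreal := ENNReal.toReal_mono (ENNReal.mul_ne_top (ENNReal.inv_ne_top.2 h0)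
    (ENNReal.mul_ne_top (ENNReal.pow_ne_top (ENNReal.natCast_ne_top N)) ENNReal.ofReal_ne_top)) hlaw
  rw [ENNReal.toReal_mul, ENNReal.toReal_inv, ENNReal.toReal_mul, ENNReal.toReal_pow,
    ENNReal.toReal_natCast, ENNReal.toReal_ofReal hb, inv_mul_eq_div] at hreal
  rw [← le_div_iff₀ hm0]
  exact (sub_le_comm.1 (hT.one_sub_le_expectedRatio hc)).trans hreal

/-- A geometric decay outweighs polynomial losses. -/
theorem exists_scales {N C ε K q b : ℝ} (hC : 0 < C) (hε : 0 < ε)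
    (hq : 0 < q) (hq1 : q < 1) (hb : 0 < b) (I : ℕ) :
    ∃ i ≥ I, ∃ s > 0, ∃ t > 0,
      C * (K * (q ^ (i + 1)) ^ 4) ≤ (ε / ((i : ℝ) + 1) ^ 4) ^ 2 * s ^ 2 * t ^ 4 ∧
      (N * ((i : ℝ) + 1)) ^ 4 * (C * (s + t)) < b := by
  set D := max 1 (C * K / ε ^ 2) with hD
  have hD1 : 1 ≤ D := le_max_left _ _
  have hDK : C * K ≤ ε ^ 2 * D ^ 4 := by
    have h1 : C * K / ε ^ 2 ≤ D ^ 4 := (le_max_right _ _).trans (le_self_pow₀ hD1 (by norm_num))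
    rwa [div_le_iff₀ (by positivity), mul_comm (D ^ 4)] at h1
  have hlim : Tendsto (fun m : ℕ => N ^ 4 * C * ((m : ℝ)⁻¹ + D * ((m : ℝ) ^ 9 * q ^ m))) atTop
      (𝓝 (N ^ 4 * C * (0 + D * 0))) :=
    (tendsto_natCast_atTop_atTop.inv_tendsto_atTop.add ((tendsto_pow_const_mul_const_pow_of_abs_lt_one 9
      (by rwa [abs_of_pos hq])).const_mul D)).const_mul _
  rw [mul_zero, add_zero, mul_zero] at hlim
  obtain ⟨i, hi, hiI⟩ := ((((tendsto_add_atTop_iff_nat 1).2 hlim).eventually (gt_mem_nhds hb)).and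
    (eventually_ge_atTop I)).exists
  set M : ℝ := (i : ℝ) + 1 with hM
  have hM1 : 1 ≤ M := by rw [hM]; linarith [(i.cast_nonneg : (0 : ℝ) ≤ _)]
  have hM0 : 0 < M := by linarith
  push_cast at hi
  rw [← hM] at hi
  -- M^(-5) beats the M⁴ bands. Then t has to compensate s² and the separation M^(-8), at the cost
  -- of M⁵, which the factor q^(i + 1) outweighs in the end.
  refine ⟨i, hiI, (M ^ 5)⁻¹, by positivity, D * q ^ (i + 1) * M ^ 5, by positivity, ?_, ?_⟩ <;>
    rw [← hM] <;> clear_value M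
  · calc C * (K * (q ^ (i + 1)) ^ 4) = C * K * (q ^ (i + 1)) ^ 4 * 1 := by ring
      _ ≤ ε ^ 2 * D ^ 4 * (q ^ (i + 1)) ^ 4 * M ^ 2 := by
        gcongr
        exact one_le_pow₀ hM1
      _ = _ := by field_simp
  · refine lt_of_eq_of_lt ?_ hi
    field_simp

universe u

variable {Ω : Type u} {x : ℕ → Ω → Space n} [MeasurableSpace Ω] {μ : Measure Ω}
  [IsProbabilityMeasure μ]

theorem IsRun.ae_not_ratioAt_le_of_volume_ne_zero (hx : IsRun P cfg T₀ μ x) (hT₀ : T₀.Valid P cfg)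
    (hn : 2 ≤ n) (h0 : volume (P.informedSet P.optCost) ≠ 0) {ρ : ℝ} (hρ : 0 ≤ ρ) (hρ1 : ρ < 1)
    (I : ℕ) :
    ∀ᵐ ω ∂μ, (∀ i, P.optCost < costAt P cfg T₀ (fun j => x j ω) i) →
      ¬ ∀ i, I ≤ i → ratioAt P cfg T₀ (fun j => x j ω) i ≤ ρ := by
  obtain ⟨ρ', hρ', hρ'1⟩ := exists_between hρ1
  have hρ'0 : 0 < ρ' := hρ.trans_lt hρ'
  -- The scale t enters the band estimate with the power 4, so the fourth root of the decay rate is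
  -- needed.
  obtain ⟨q, hq, hq1, hqρ⟩ : ∃ q : ℝ, 0 < q ∧ q < 1 ∧ ρ' = q ^ 4 :=
    ⟨√(√ρ'), by positivity, by
      rw [Real.sqrt_lt' one_pos, one_pow, Real.sqrt_lt' one_pos, one_pow]; exact hρ'1, by
      rw [show 4 = 2 * 2 from rfl, pow_mul, Real.sq_sqrt (Real.sqrt_nonneg _), Real.sq_sqrt hρ'0.le]⟩
  have hc0 : 0 < T₀.cost P := P.focal_pos.trans_le hT₀.inv.dist_le_cost
  obtain ⟨C, hC, hCv⟩ := exists_volume_band_le hn cfg.η_pos (by positivity : 0 < 4 * T₀.cost P)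
  set m := volume.real (P.informedSet P.optCost) with hm
  have hmt := (P.volume_informedSet_lt_top P.optCost).ne
  have hm0 : 0 < m := ENNReal.toReal_pos h0 hmt
  set N : ℝ := T₀.verts.card + 1 with hN
  filter_upwards [hx.ae_exists_separated hT₀ hn h0, hx.ae_excess_le hT₀.inv hρ hρ' I,
    hx.ae_isProbabilityMeasure] with ω ⟨ε, hε, hsep⟩ hexc hprob hopt hr
  obtain ⟨K, hK, hKi⟩ := hexc hr
  obtain ⟨i, hi, s, hs, t, ht, h1, h2⟩ := exists_scales (N := N)
    (K := K.toReal / (q ^ (I + 1)) ^ 4) (b := (1 - ρ) * m) hC hε hq hq1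
    (mul_pos (sub_pos.2 hρ1) hm0) I
  set T := treeAt P cfg T₀ (fun j => x j ω) i with hTdef
  have hT : T.Inv P cfg := inv_treeAt hT₀.inv (fun j => x j ω) i
  have hle : T.cost P ≤ T₀.cost P := costAt_le_cost hT₀.inv (fun j => x j ω) i
  have he : T.cost P - P.optCost ≤ K.toReal / (q ^ (I + 1)) ^ 4 * (q ^ (i + 1)) ^ 4 := by
    have h3 := hKi (i - I)
    rw [Nat.add_sub_cancel' hi] at h3
    rw [← ENNReal.ofReal_toReal hK, ← ENNReal.ofReal_pow hρ'0.le,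
      ← ENNReal.ofReal_mul ENNReal.toReal_nonneg] at h3
    have h4 := (ENNReal.ofReal_le_ofReal_iff (by positivity)).1 h3
    refine h4.trans_eq ?_
    rw [hqρ, show i + 1 = (i - I) + (I + 1) by omega, pow_add q (i - I), mul_pow, pow_right_comm]
    field_simp
  have hvol := hT.volume_cost_step_lt_le hn hle hCv (by positivity) (hsep i) hs ht
    ((mul_le_mul_of_nonneg_left he hC.le).trans h1)
  have hprob : IsProbabilityMeasure (P.sampleLaw (T.cost P)) := hprob i
  have h5 := hT.one_sub_expectedRatio_mul_le (hopt i) h0 hvol (by positivity)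
  have hcard : (T.verts.card : ℝ) ≤ N * (i + 1) := by
    have h3 : (T.verts.card : ℝ) ≤ T₀.verts.card + i := by
      exact_mod_cast card_verts_treeAt_le hT₀.inv (fun j => x j ω) i
    have h4 : (0 : ℝ) ≤ T₀.verts.card * i := by positivity
    rw [hN]
    linarith
  have hratio : expectedRatio P cfg T ≤ ρ := hr i hi
  refine absurd ?_ (not_le.2 h2)
  calc (1 - ρ) * m ≤ (1 - expectedRatio P cfg T) * m := by gcongr
    _ ≤ (T.verts.card : ℝ) ^ 4 * (C * (s + t)) := h5
    _ ≤ _ := by gcongr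

end InformedRRT

/-! ### The lower bound in general -/

namespace InformedRRT

variable {n : ℕ} {P : Problem n} {cfg : Config} {T₀ : Tree n} {Ω : Type*} [MeasurableSpace Ω]
  {μ : Measure Ω} [IsProbabilityMeasure μ] {x : ℕ → Ω → Space n}

/-- The three cases: optimal cost d, null optimal informed set, and optimal informed set of positive
volume. In the second, an initial tree that is already optimal contradicts the assumption on the
costs at time 0. -/
theorem IsRun.ae_not_ratioAt_le (hx : IsRun P cfg T₀ μ x) (hT₀ : T₀.Valid P cfg) (hn : 2 ≤ n)
    {ρ : ℝ} (hρ : 0 < ρ) (hρ' : ρ < ((n : ℝ) - 1) / ((n : ℝ) + 1)) (I : ℕ) :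
    ∀ᵐ ω ∂μ, (∀ i, P.optCost < costAt P cfg T₀ (fun j => x j ω) i) →
      ¬ ∀ i, I ≤ i → ratioAt P cfg T₀ (fun j => x j ω) i ≤ ρ := by
  have hn' : (2 : ℝ) ≤ n := by exact_mod_cast hn
  have hρ1 : ρ < 1 := hρ'.trans (by rw [div_lt_one (by linarith)]; linarith)
  rcases hT₀.inv.dist_le_optCost.eq_or_lt with hd | hd
  · filter_upwards [hx.ae_not_ratioAt_le_of_optCost_eq_focal hT₀.inv hn hd.symm hρ hρ' I] with ω h _
    exact h
  by_cases h0 : volume (P.informedSet P.optCost) = 0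
  · by_cases hT : P.optCost < T₀.cost P
    · filter_upwards [hx.ae_exists_lt_costAt hT₀ hn hd h0 hT,
        hx.ae_exists_costAt_lt hT₀.inv hρ.le hρ1 I] with ω ⟨g, hg, h1⟩ h2 _ hr
      obtain ⟨i, -, hi⟩ := h2 hr g hg
      exact (h1 i).not_gt hi
    · exact ae_of_all _ fun ω h => absurd (h 0) hT
  · exact hx.ae_not_ratioAt_le_of_volume_ne_zero hT₀ hn h0 hρ.le hρ1 I

theorem IsRun.ae_le_expectedRate (hx : IsRun P cfg T₀ μ x) (hT₀ : T₀.Valid P cfg) (hn : 2 ≤ n) :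
    ∀ᵐ ω ∂μ, (∀ i, P.optCost < costAt P cfg T₀ (fun j => x j ω) i) →
      ((n : ℝ) - 1) / ((n : ℝ) + 1) ≤ expectedRate P cfg T₀ (fun j => x j ω) ∧
      expectedRate P cfg T₀ (fun j => x j ω) ≤ 1 := by
  have hn' : (2 : ℝ) ≤ n := by exact_mod_cast hn
  have h0 : (0 : ℝ) < ((n : ℝ) - 1) / ((n : ℝ) + 1) := by apply div_pos <;> linarith
  -- Rational levels and starting times leave only countably many null sets. An upper limit below
  -- the bound would produce such a pair.
  have h : ∀ᵐ ω ∂μ, ∀ (q : ℚ) (I : ℕ), (0 : ℝ) < q → (q : ℝ) < ((n : ℝ) - 1) / ((n : ℝ) + 1) →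
      (∀ i, P.optCost < costAt P cfg T₀ (fun j => x j ω) i) →
      ¬ ∀ i, I ≤ i → ratioAt P cfg T₀ (fun j => x j ω) i ≤ q := by
    refine ae_all_iff.2 fun q => ae_all_iff.2 fun I => ?_
    by_cases hq : (0 : ℝ) < q ∧ (q : ℝ) < ((n : ℝ) - 1) / ((n : ℝ) + 1)
    · filter_upwards [hx.ae_not_ratioAt_le hT₀ hn hq.1 hq.2 I] with ω h _ _
      exact h
    · exact ae_of_all _ fun ω h1 h2 => absurd ⟨h1, h2⟩ hq
  filter_upwards [h] with ω hω hc
  refine ⟨?_, expectedRate_le_one hT₀.inv _⟩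
  by_contra! hlt
  obtain ⟨q, hq1, hq2⟩ := exists_rat_btwn (max_lt hlt h0)
  obtain ⟨hq1, hq0⟩ := max_lt_iff.1 hq1
  obtain ⟨I, hI⟩ := eventually_atTop.1 (eventually_lt_of_limsup_lt hq1
    (isBoundedUnder_ratioAt hT₀.inv _))
  exact hω q I hq0 hq2 hc fun i hi => (hI i hi).le

end InformedRRT

theorem theorem6 {n : ℕ} (hn : 2 ≤ n) (P : InformedRRT.Problem n) (cfg : InformedRRT.Config)
    (T₀ : InformedRRT.Tree n) (hT₀ : T₀.Valid P cfg)
    {Ω : Type*} [MeasurableSpace Ω] (μ : Measure Ω) [IsProbabilityMeasure μ]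
    (x : ℕ → Ω → InformedRRT.Space n) (hx : InformedRRT.IsRun P cfg T₀ μ x) :
    (∀ᵐ ω ∂μ, (∀ i, P.optCost < InformedRRT.costAt P cfg T₀ (fun j => x j ω) i) →
      ((n : ℝ) - 1) / ((n : ℝ) + 1) ≤ InformedRRT.expectedRate P cfg T₀ (fun j => x j ω) ∧
      InformedRRT.expectedRate P cfg T₀ (fun j => x j ω) ≤ 1) ∧
    (P.IsUnobstructed → cfg.IsInfinite → P.optCost < T₀.cost P →
      InformedRRT.IsLinearRate (((n : ℝ) - 1) / ((n : ℝ) + 1)) ∧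
      ∀ᵐ ω ∂μ, (∀ i, P.optCost < InformedRRT.costAt P cfg T₀ (fun j => x j ω) i) ∧
        Tendsto (InformedRRT.costAt P cfg T₀ (fun j => x j ω)) atTop (𝓝 P.optCost) ∧
        Tendsto (InformedRRT.ratioAt P cfg T₀ (fun j => x j ω)) atTop
          (𝓝 (((n : ℝ) - 1) / ((n : ℝ) + 1))) ∧
        InformedRRT.expectedRate P cfg T₀ (fun j => x j ω) = ((n : ℝ) - 1) / ((n : ℝ) + 1)) := by
  have hn' : (2 : ℝ) ≤ n := by exact_mod_cast hn
  refine ⟨?_, fun hP hcfg hc => ⟨⟨?_, ?_⟩, hx.ae_rate_of_isUnobstructed hT₀.inv hP hcfg hn hc⟩⟩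
  · exact hx.ae_le_expectedRate hT₀ hn
  · apply div_pos <;> linarith
  · rw [div_lt_one (by linarith)]
    linarith
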